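/- Setting. Let $d\ge 0$ and let $\Theta=\mathrm{BW}(\mathbb R^d)=\{(m,\Sigma): m\in\mathbb R^d,\ \Sigma\in\mathbb R^{d\times d}\text{ symmetric positive definite}\}$ be the Bures–Wasserstein space of non-degenerate Gaussians $p_\theta=\mathcal N(m,\Sigma)$, $\theta=(m,\Sigma)$. A tangent vector at $\theta$ is a pair $(a,S)$ with $a\in\mathbb R^d$ and $S$ symmetric (a curve with tangent vector $(a,S)$ has $\dot m=a$, $\dot\Sigma=S\Sigma+\Sigma S$), the Riemannian metric is $\mathfrak g_\theta((a,S),(a',S'))=\langle a,a'\rangle+\operatorname{tr}(S\Sigma S')$, the gradient of a function $\varphi$ is $\nabla\varphi=(\nabla_m\varphi,2\nabla_\Sigma\varphi)$, and the distance is $\mathsf d^2(\theta_0,\theta_1)=\|m_0-m_1\|^2+\operatorname{tr}\bigl(\Sigma_0+\Sigma_1-2(\Sigma_0^{1/2}\Sigma_1\Sigma_0^{1/2})^{1/2}\bigr)$. Let $\mathcal P_2(\Theta)$ be the probability measures $\mu$ on $\Theta$ with $\int \mathsf d^2(\theta_0,\cdot)\,d\mu<\infty$ for some $\theta_0$. For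 an interval $I$, a curve $(\mu_t)_{t\in I}$ and vector fields $(v_t)_{t\in I}$ satisfy the continuity equation if for all $\varphi\in C_c^\infty(\Theta)$ and $t\in I$, $\mathfrak g(\nabla\varphi,v_t)$ is $\mu_t$-integrable and $\partial_t\int\varphi\,d\mu_t=\int\mathfrak g(\nabla\varphi,v_t)\,d\mu_t$ (a one-sided derivative at an endpoint of $I$). The tangent space $T_\mu\mathcal P_2(\Theta)$ is the closure of $\{\nabla\psi:\psi\in C_c^\infty(\Theta)\}$ in $L^2(\mu;\mathfrak g)$. The Wasserstein gradient of $F:\mathcal P_2(\Theta)\to[0,\infty]$ at a $\mu$ with $F(\mu)<\infty$ is the element $G\in T_\mu\mathcal P_2(\Theta)$ such that, for every $\varepsilon>0$ and every curve $(\nu_t)_{|t|<\varepsilon}$ in $\mathcal P_2(\Theta)$ with $\nu_0=\mu$ that solves the continuity equation with a continuous velocity field $(w_t)$ supported in one compact subset of $\Theta$ and with $w_0\in T_\mu\mathcal P_2(\Theta)$, $F(\nu_t)$ is finite for $t$ near $0$ and $\partial_t|_{t=0}F(\nu_t)=\int\mathfrak g(G,w_0)\,d\mu$. A gradient flow of $F$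 is a curve $(\mu_t)_{t\ge0}$ in $\mathcal P_2(\Theta)$ such that $F$ has a Wasserstein gradient $\nabla_{W_2}F(\mu_t)$ at $\mu_t$ for every $t\ge 0$ and the continuity equation holds on $[0,\infty)$ with $v_t=-\nabla_{W_2}F(\mu_t)$. Let $\pi=e^{-V}/\int e^{-V}$, where $V\in C^2(\mathbb R^d)$, $e^{-V}$ is integrable, and $V$, $\nabla V$, $\nabla^2V$ are integrable with respect to every non-degenerate Gaussian. Let $\mathsf p_\mu=\int p_\theta\,d\mu(\theta)$ and $F(\mu)=\mathrm{KL}(\mathsf p_\mu\,\|\,\pi)$. For $\theta=(m,\Sigma)$ and $Y\sim\mathcal N(m,\Sigma)$ put $g_\mu(\theta)=\mathbb E\,\nabla\ln\frac{\mathsf p_\mu}{\pi}(Y)$ and $H_\mu(\theta)=\mathbb E\,\nabla^2\ln\frac{\mathsf p_\mu}{\pi}(Y)$. Given $(\mu_t)$, the particle equations for $\theta_t=(m_t,\Sigma_t)$ are, for all $t\ge0$, $$\dot m_t=-g_{\mu_t}(\theta_t),\qquad \dot\Sigma_t=-H_{\mu_t}(\theta_t)\,\Sigma_t-\Sigma_t\,H_{\mu_t}(\theta_t).\tag{1}$$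 Call $\mu$ regular if the density $\mathsf p_\mu$ is finite everywhere and $\ln\mathsf p_\mu$ is $C^2$ with gradient and Hessian integrable with respect to every non-degenerate Gaussian. Theorem. (i) Let $(\mu_t)_{t\ge0}$ be a gradient flow of $F$ with every $\mu_t$ regular. Let $(\theta_t)_{t\ge0}$ be $\Theta$-valued random variables on a probability space with $\theta_0\sim\mu_0$ whose paths almost surely solve (1). Then $\theta_t\sim\mu_t$ for all $t\ge0$. (ii) Conversely, let $(\mu_t)_{t\ge0}$ be a curve in $\mathcal P_2(\Theta)$ such that, for every $t\ge 0$, $\mu_t$ is regular, $F(\mu_t)<\infty$ and $\int\mathfrak g\bigl((g_{\mu_t},H_{\mu_t}),(g_{\mu_t},H_{\mu_t})\bigr)\,d\mu_t<\infty$. If there are random variables $\theta_t\sim\mu_t$, $t\ge0$, on one probability space whose paths almost surely solve (1), then $(\mu_t)$ is a gradient flow of $F$. (iii) Let $\mu_0=\sum_{i=1}^Nw_i\delta_{\theta_0^{(i)}}$ with $w_i>0$, $\sum_iw_i=1$. A curve $(\mu_t)_{t\ge0}$ starting at $\mu_0$ is a gradient flow of $F$ if and only if there are trajectories $\theta^{(i)}:[0,\infty)\to\Theta$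 starting at $\theta_0^{(i)}$, $i=1,\dots,N$, such that $\mu_t=\sum_iw_i\delta_{\theta_t^{(i)}}$ for all $t\ge0$ and every $\theta^{(i)}$ solves (1), that is, if and only if $(\mu_t)$ is given by the interacting particle system $\dot m^{(i)}_t=-\mathbb E\nabla\ln\frac{\mathsf p_{\mu_t}}{\pi}(Y_t^{(i)})$, $\dot\Sigma_t^{(i)}=-\mathbb E\nabla^2\ln\frac{\mathsf p_{\mu_t}}{\pi}(Y_t^{(i)})\,\Sigma_t^{(i)}-\Sigma_t^{(i)}\,\mathbb E\nabla^2\ln\frac{\mathsf p_{\mu_t}}{\pi}(Y_t^{(i)})$, $Y_t^{(i)}\sim\mathcal N(m_t^{(i)},\Sigma_t^{(i)})$. -/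

import Mathlib

open MeasureTheory ProbabilityTheory Set Filter Topology
open scoped ENNReal NNReal ContDiff Gradient Matrix

attribute [local instance] Matrix.normedAddCommGroup Matrix.normedSpace

noncomputable section

namespace GaussianMixtureFlow

/-- The Borel σ-algebra on real square matrices. -/
instance matrixMeasurableSpace (d : ℕ) : MeasurableSpace (Matrix (Fin d) (Fin d) ℝ) :=
  inferInstanceAs (MeasurableSpace (Fin d → Fin d → ℝ))

instance matrixBorelSpace (d : ℕ) : BorelSpace (Matrix (Fin d) (Fin d) ℝ) :=
  inferInstanceAs (BorelSpace (Fin d → Fin d → ℝ))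

/-! ### The Bures-Wasserstein manifold -/

/-- The ambient space of pairs (vector, square matrix). It contains the parameter space of the
Gaussians as well as all tangent vectors. -/
abbrev Ambient (d : ℕ) := EuclideanSpace ℝ (Fin d) × Matrix (Fin d) (Fin d) ℝ

/-- The Bures-Wasserstein space of non-degenerate Gaussians `N(m, Σ)` on `ℝ^d`, identified with
the pairs `(m, Σ)` of a mean and a (symmetric) positive definite covariance matrix. -/
abbrev BW (d : ℕ) := {θ : Ambient d // θ.2.PosDef}

variable {d : ℕ}

/-- The mean of the Gaussian `θ`. -/
abbrev mean (θ : BW d) : EuclideanSpace ℝ (Fin d) := θ.1.1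

/-- The covariance matrix of the Gaussian `θ`. -/
abbrev cov (θ : BW d) : Matrix (Fin d) (Fin d) ℝ := θ.1.2

/-- The Gaussian measure `N(m, Σ)`. -/
abbrev gaussian (θ : BW d) : Measure (EuclideanSpace ℝ (Fin d)) :=
  multivariateGaussian (mean θ) (cov θ)

/-- The Lebesgue density `p_θ` of `N(m, Σ)`. -/
def gaussianDensity (θ : BW d) (x : EuclideanSpace ℝ (Fin d)) : ℝ :=
  (√((2 * Real.pi) ^ d * (cov θ).det))⁻¹ *
    Real.exp (-(1 / 2) * (WithLp.ofLp (x - mean θ) ⬝ᵥ ((cov θ)⁻¹ *ᵥ WithLp.ofLp (x - mean θ))))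

open scoped MatrixOrder in
/-- The squared Bures-Wasserstein distance
`‖m₀ - m₁‖² + tr (Σ₀ + Σ₁ - 2 (Σ₀^{1/2} Σ₁ Σ₀^{1/2})^{1/2})`. -/
def bwDistSq (θ₀ θ₁ : BW d) : ℝ :=
  ‖mean θ₀ - mean θ₁‖ ^ 2 +
    (cov θ₀ + cov θ₁ -
      (2 : ℝ) • CFC.sqrt (CFC.sqrt (cov θ₀) * cov θ₁ * CFC.sqrt (cov θ₀))).trace

/-- The Bures-Wasserstein Riemannian metric. A tangent vector at `θ = (m, Σ)` is a pair `(a, S)`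
with `S` symmetric, standing for the affine map `x ↦ a + S (x - m)`; a curve with this tangent
vector has `ṁ = a` and `Σ̇ = S Σ + Σ S`. The metric is `⟨a, a'⟩ + tr (S Σ S')`. -/
def bwInner (θ : BW d) (u v : Ambient d) : ℝ :=
  inner ℝ u.1 v.1 + (u.2 * cov θ * v.2).trace

/-- Smooth compactly supported functions on the Bures-Wasserstein manifold, represented by a
smooth function of all pairs (vector, matrix), of which only the restriction to the manifold
matters. -/
def IsTestFunction (φ : Ambient d → ℝ) : Prop :=
  ContDiff ℝ ∞ φ ∧ ∃ K : Set (BW d), IsCompact K ∧ ∀ θ : BW d, θ ∉ K → φ θ.1 = 0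

/-- The Euclidean gradient in the covariance variable, within symmetric matrices. -/
def covGrad (φ : Ambient d → ℝ) (θ : BW d) : Matrix (Fin d) (Fin d) ℝ :=
  Matrix.of fun i j =>
    (fderiv ℝ φ θ.1 (0, Matrix.single i j 1) + fderiv ℝ φ θ.1 (0, Matrix.single j i 1)) / 2

/-- The Bures-Wasserstein gradient `(∇_m φ, 2 ∇_Σ φ)`. -/
def bwGrad (φ : Ambient d → ℝ) (θ : BW d) : Ambient d :=
  (∇ (fun m => φ (m, cov θ)) (mean θ), (2 : ℝ) • covGrad φ θ)

/-! ### The Wasserstein space over the Bures-Wasserstein manifold -/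

/-- Probability measures on the Bures-Wasserstein manifold with finite second moment. -/
def IsP2 (μ : Measure (BW d)) : Prop :=
  IsProbabilityMeasure μ ∧ ∃ θ₀ : BW d, ∫⁻ θ, ENNReal.ofReal (bwDistSq θ₀ θ) ∂μ < ⊤

/-- Vector fields on the Bures-Wasserstein manifold. -/
def IsVectorField (v : BW d → Ambient d) : Prop := ∀ θ, (v θ).2.IsSymm

/-- The tangent space at `μ`: the closure in `L²(μ)` of the gradients of smooth compactly
supported functions. -/
def InTangentSpace (μ : Measure (BW d)) (v : BW d → Ambient d) : Prop :=
  IsVectorField v ∧ AEMeasurable v μ ∧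
    ∀ ε : ℝ, 0 < ε → ∃ ψ : Ambient d → ℝ, IsTestFunction ψ ∧
      ∫⁻ θ, ENNReal.ofReal (bwInner θ (v θ - bwGrad ψ θ) (v θ - bwGrad ψ θ)) ∂μ
        < ENNReal.ofReal ε

/-- The continuity equation `∂ₜ μₜ + div (μₜ vₜ) = 0` for times in `I`, in the weak sense:
`∂ₜ ∫ φ dμₜ = ∫ g(∇φ, vₜ) dμₜ` for every test function `φ` and every `t ∈ I`. -/
def ContinuityEquation (I : Set ℝ) (μ : ℝ → Measure (BW d)) (v : ℝ → BW d → Ambient d) : Prop :=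
  ∀ φ : Ambient d → ℝ, IsTestFunction φ → ∀ t ∈ I,
    Integrable (fun θ => bwInner θ (bwGrad φ θ) (v t θ)) (μ t) ∧
    HasDerivWithinAt (fun s => ∫ θ, φ θ.1 ∂(μ s))
      (∫ θ, bwInner θ (bwGrad φ θ) (v t θ) ∂(μ t)) I t

/-- Regular curves through `μ` in the Wasserstein space, along which functionals are
differentiated: solutions `(ν, w)` of the continuity equation on `(-ε, ε)` with `ν₀ = μ`, whose
velocity is a continuous time-dependent vector field with compact support (uniformly in time) and
is tangent at time `0`. -/
structure IsRegularCurve (μ : Measure (BW d)) (ε : ℝ) (ν : ℝ → Measure (BW d))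
    (w : ℝ → BW d → Ambient d) : Prop where
  pos : 0 < ε
  isP2 : ∀ t ∈ Ioo (-ε) ε, IsP2 (ν t)
  start : ν 0 = μ
  continuityEquation : ContinuityEquation (Ioo (-ε) ε) ν w
  vectorField : ∀ t ∈ Ioo (-ε) ε, IsVectorField (w t)
  continuous : ContinuousOn (fun p : ℝ × BW d => w p.1 p.2) (Ioo (-ε) ε ×ˢ univ)
  compactSupport : ∃ K : Set (BW d), IsCompact K ∧ ∀ t ∈ Ioo (-ε) ε, ∀ θ ∉ K, w t θ = 0
  tangent : InTangentSpace μ (w 0)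

/-- `G` is the Wasserstein gradient of `F` at `μ`: it lies in the tangent space at `μ`, and
`∂ₜ F(νₜ) = ⟨G, w₀⟩_μ` at `t = 0` along all regular curves `(ν, w)` through `μ`. -/
def IsWassersteinGradient (F : Measure (BW d) → ℝ≥0∞) (μ : Measure (BW d))
    (G : BW d → Ambient d) : Prop :=
  F μ ≠ ⊤ ∧ InTangentSpace μ G ∧
    ∀ (ε : ℝ) (ν : ℝ → Measure (BW d)) (w : ℝ → BW d → Ambient d), IsRegularCurve μ ε ν w →
      (∀ᶠ t in 𝓝 0, F (ν t) ≠ ⊤) ∧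
      HasDerivAt (fun t => (F (ν t)).toReal) (∫ θ, bwInner θ (G θ) (w 0 θ) ∂μ) 0

/-- `(μₜ)_{t ≥ 0}` is a Wasserstein gradient flow of `F`: a curve of measures with finite second
moment that solves the continuity equation with velocity minus the Wasserstein gradient of `F`. -/
def IsGradientFlow (F : Measure (BW d) → ℝ≥0∞) (μ : ℝ → Measure (BW d)) : Prop :=
  (∀ t, 0 ≤ t → IsP2 (μ t)) ∧
    ∃ G : ℝ → BW d → Ambient d,
      (∀ t, 0 ≤ t → IsWassersteinGradient F (μ t) (G t)) ∧
      ContinuityEquation (Ici 0) μ (fun t θ => -G t θ)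

/-! ### The Kullback-Leibler functional -/

/-- The density `p_μ(x) = ∫ p_θ(x) dμ(θ)` of the Gaussian mixture with mixing measure `μ`. -/
def mixtureDensity (μ : Measure (BW d)) (x : EuclideanSpace ℝ (Fin d)) : ℝ :=
  ∫ θ, gaussianDensity θ x ∂μ

/-- The Gaussian mixture with mixing measure `μ`, as a measure. -/
def mixture (μ : Measure (BW d)) : Measure (EuclideanSpace ℝ (Fin d)) :=
  volume.withDensity fun x => ∫⁻ θ, ENNReal.ofReal (gaussianDensity θ x) ∂μ

/-- The target density `π ∝ exp (-V)`. -/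
def targetDensity (V : EuclideanSpace ℝ (Fin d) → ℝ) (x : EuclideanSpace ℝ (Fin d)) : ℝ :=
  Real.exp (-V x) / ∫ y, Real.exp (-V y)

/-- The target probability measure. -/
def target (V : EuclideanSpace ℝ (Fin d) → ℝ) : Measure (EuclideanSpace ℝ (Fin d)) :=
  volume.withDensity fun x => ENNReal.ofReal (targetDensity V x)

/-- The functional `μ ↦ KL (p_μ ‖ π)`. -/
def klFunctional (V : EuclideanSpace ℝ (Fin d) → ℝ) (μ : Measure (BW d)) : ℝ≥0∞ :=
  InformationTheory.klDiv (mixture μ) (target V)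

/-! ### The Gaussian particle dynamics -/

/-- The Hessian matrix of a function on `ℝ^d`. -/
def hessian (f : EuclideanSpace ℝ (Fin d) → ℝ) (x : EuclideanSpace ℝ (Fin d)) :
    Matrix (Fin d) (Fin d) ℝ :=
  Matrix.of fun i j =>
    iteratedFDeriv ℝ 2 f x ![EuclideanSpace.single i 1, EuclideanSpace.single j 1]

/-- The function `ln (p_μ / π)`. -/
def logRatio (V : EuclideanSpace ℝ (Fin d) → ℝ) (μ : Measure (BW d))
    (x : EuclideanSpace ℝ (Fin d)) : ℝ :=
  Real.log (mixtureDensity μ x / targetDensity V x)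

/-- `E ∇ ln (p_μ / π) (Y)` for `Y ∼ N(m, Σ)`, where `θ = (m, Σ)`. -/
def expectedGrad (V : EuclideanSpace ℝ (Fin d) → ℝ) (μ : Measure (BW d)) (θ : BW d) :
    EuclideanSpace ℝ (Fin d) :=
  ∫ y, ∇ (logRatio V μ) y ∂(gaussian θ)

/-- `E ∇² ln (p_μ / π) (Y)` for `Y ∼ N(m, Σ)`, where `θ = (m, Σ)`. -/
def expectedHess (V : EuclideanSpace ℝ (Fin d) → ℝ) (μ : Measure (BW d)) (θ : BW d) :
    Matrix (Fin d) (Fin d) ℝ :=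
  Matrix.of fun i j => ∫ y, hessian (logRatio V μ) y i j ∂(gaussian θ)

/-- The function `t ↦ θₜ = (mₜ, Σₜ)` solves, for `t ≥ 0`, the Gaussian particle equations driven
by the curve `(μₜ)`:
`ṁ = - E ∇ ln (p_{μₜ}/π)(Yₜ)` and
`Σ̇ = - E ∇² ln (p_{μₜ}/π)(Yₜ) Σ - Σ E ∇² ln (p_{μₜ}/π)(Yₜ)` with `Yₜ ∼ N(mₜ, Σₜ)`. -/
def SolvesParticleODE (V : EuclideanSpace ℝ (Fin d) → ℝ) (μ : ℝ → Measure (BW d))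
    (θ : ℝ → BW d) : Prop :=
  ∀ t, 0 ≤ t →
    HasDerivWithinAt (fun s => mean (θ s)) (-expectedGrad V (μ t) (θ t)) (Ici 0) t ∧
    HasDerivWithinAt (fun s => cov (θ s))
      (-(expectedHess V (μ t) (θ t) * cov (θ t)) - cov (θ t) * expectedHess V (μ t) (θ t))
      (Ici 0) t

/-- A real function is twice continuously differentiable, and its gradient and Hessian have
expectations under every non-degenerate Gaussian. -/
structure HasGaussianDerivatives (f : EuclideanSpace ℝ (Fin d) → ℝ) : Prop where
  contDiff : ContDiff ℝ 2 f
  integrable_grad : ∀ θ : BW d, Integrable (fun y => ∇ f y) (gaussian θ)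
  integrable_hess : ∀ (θ : BW d) (i j : Fin d), Integrable (fun y => hessian f y i j) (gaussian θ)

/-- The regularity of a mixing measure `μ` that makes the particle equations meaningful: the
mixture density `p_μ` is finite everywhere, and `ln p_μ` is twice continuously differentiable with
gradient and Hessian that have expectations under every non-degenerate Gaussian. -/
structure IsRegularMixing (μ : Measure (BW d)) : Prop where
  integrable_density : ∀ x, Integrable (fun θ => gaussianDensity θ x) μ
  log_density : HasGaussianDerivatives fun x => Real.log (mixtureDensity μ x)

/-- The velocity field `θ ↦ (E ∇ ln (p_μ/π)(Y), E ∇² ln (p_μ/π)(Y))` has finite energy, that is,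
it is square-integrable with respect to the Bures-Wasserstein metric and `μ`. -/
def HasFiniteEnergy (V : EuclideanSpace ℝ (Fin d) → ℝ) (μ : Measure (BW d)) : Prop :=
  ∫⁻ θ, ENNReal.ofReal (bwInner θ (expectedGrad V μ θ, expectedHess V μ θ)
    (expectedGrad V μ θ, expectedHess V μ θ)) ∂μ < ⊤

/-- The finitely supported mixing measure `∑ wᵢ δ_{θᵢ}`. -/
def finiteMixing {N : ℕ} (w : Fin N → ℝ≥0) (θ : Fin N → BW d) : Measure (BW d) :=
  ∑ i, w i • Measure.dirac (θ i)

end GaussianMixtureFlow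

end

open GaussianMixtureFlow

/-!
Everything rests on replacing the Wasserstein gradient by a field that makes sense for every mixing
measure `μ`: the Bures-Wasserstein gradient `velocity V μ` of the first variation
`θ ↦ ∫ ln (p_μ / π) p_θ`, obtained by differentiating the Gaussian kernel `p_θ` in its parameter.
For regular `μ`, Gaussian integration by parts (Stein's identities, `gradOf_integral_kernelDeriv`)
identifies it with the pair of the expected gradient and Hessian of `ln (p_μ / π)`, see
`velocity_eq`. The particle equations are then the characteristic equations of this field
(`solvesParticleODE_iff`).

*Gradient flows are solutions of a continuity equation.* Along regular curves, the derivative of the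
divergence is the pairing of the initial velocity with `velocity V μ`
(`IsRegularCurve.hasDerivAt_klFunctional`). Every gradient of a test function is the velocity of a
regular curve, namely of the transport by its flow (`IsTestFunction.exists_isRegularCurve`).
Hence the Wasserstein gradient and `velocity V μ` have the same pairing with gradients of test
functions, and a gradient flow solves the continuity equation with velocity `-velocity V (μ t)`
(`IsGradientFlow.continuityEquation`). Conversely, if the velocity has finite energy, its orthogonal
projection onto the tangent space (`exists_projection`) is the Wasserstein gradient, and solutions
of the continuity equation are gradient flows (`isGradientFlow_of_continuityEquation`). So the laws
of particles form a gradient flow (`isGradientFlow_of_isCharacteristic`).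

*Uniqueness.* Given the curve `μ`, the continuity equation is linear. Its field is smooth in the
parameter and continuous in time: near a compact set of parameters, `θ ↦ exp (c ‖·‖²) p_θ` is a
smooth map into the bounded continuous functions for some `c > 0`, and the log-ratios depend
continuously on time in the `L¹` space with weight `exp (-c ‖·‖²)`
(`TestContinuousOn.tendsto_logRatio`). The field is, however, only locally bounded and the manifold
is incomplete, so there is no global flow to compare with. Instead, two solutions that agree near
the initial point of a characteristic are shown to agree near its final point
(`exists_local_uniqueness`): a test function concentrated near the characteristic is transported
backwards by explicit Euler steps. When the characteristics of almost all initial points exist for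
all times, this determines the solution (`map_eq_of_isCharacteristic`).

*Finitely supported initial data.* Here the existence of the particles has to be derived from the
existence of the flow. The characteristic through an atom of `μ 0` carries the mass of the atom as
long as it exists, by local uniqueness. Since `(μ t)` is tight on bounded time intervals, this mass,
and with it the characteristic, stays in a compact set, and the characteristic cannot cease to exist
(`exists_isCharacteristic`). Finite Gaussian mixtures are regular, since the derivatives of their
log-densities have at most quadratic growth (`isRegularMixing_finiteMixing`), and have finite
divergence and energy, so that the other parts of the argument apply to them.
-/

noncomputable section

namespace GaussianMixtureFlow

variable {d : ℕ}

/-! ### Gaussian densities -/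

/-- The Gaussian density as a function of an arbitrary pair (vector, matrix), which extends
`gaussianDensity` smoothly to a neighbourhood of the Bures-Wasserstein manifold. -/
def gaussKernel (θ : Ambient d) (x : EuclideanSpace ℝ (Fin d)) : ℝ :=
  (√((2 * Real.pi) ^ d * θ.2.det))⁻¹ *
    Real.exp (-(1 / 2) * (WithLp.ofLp (x - θ.1) ⬝ᵥ (θ.2⁻¹ *ᵥ WithLp.ofLp (x - θ.1))))

lemma gaussianDensity_eq_gaussKernel (θ : BW d) : gaussianDensity θ = gaussKernel θ.1 := rfl

lemma continuous_dotProduct_mulVec (A : Matrix (Fin d) (Fin d) ℝ) :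
    Continuous fun x : EuclideanSpace ℝ (Fin d) => WithLp.ofLp x ⬝ᵥ (A *ᵥ WithLp.ofLp x) := by
  simp only [dotProduct, Matrix.mulVec]
  fun_prop

lemma continuous_gaussKernel (θ : Ambient d) : Continuous (gaussKernel θ) := by
  have := (continuous_dotProduct_mulVec θ.2⁻¹).comp
    (continuous_id.sub (continuous_const (y := θ.1)))
  unfold gaussKernel
  exact continuous_const.mul (Real.continuous_exp.comp (continuous_const.mul this))

lemma stdGaussian_eq_withDensity :
    stdGaussian (EuclideanSpace ℝ (Fin d)) = volume.withDensity fun x =>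
      ENNReal.ofReal ((√((2 * Real.pi) ^ d))⁻¹ * Real.exp (-(1 / 2) * ‖x‖ ^ 2)) := by
  have hint : Integrable (fun x : EuclideanSpace ℝ (Fin d) =>
      (√((2 * Real.pi) ^ d))⁻¹ * Real.exp (-(1 / 2) * ‖x‖ ^ 2)) := by
    have := (GaussianFourier.integrable_cexp_neg_mul_sq_norm_add (b := (1 / 2 : ℂ)) (by norm_num) 0
      (0 : EuclideanSpace ℝ (Fin d))).re
    refine Integrable.const_mul (this.congr (ae_of_all _ fun x => ?_)) _
    simp only [zero_mul, add_zero]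
    rw [show (-(1 / 2) * (‖x‖ : ℂ) ^ 2) = ((-(1 / 2) * ‖x‖ ^ 2 : ℝ) : ℂ) by push_cast; ring]
    exact Complex.exp_ofReal_re _
  have hfin : IsFiniteMeasure (volume.withDensity fun x : EuclideanSpace ℝ (Fin d) =>
      ENNReal.ofReal ((√((2 * Real.pi) ^ d))⁻¹ * Real.exp (-(1 / 2) * ‖x‖ ^ 2))) :=
    isFiniteMeasure_withDensity_ofReal hint.2
  refine Measure.ext_of_charFun ?_
  ext t
  rw [charFun_stdGaussian, charFun_apply,
    integral_withDensity_eq_integral_toReal_smul (by fun_prop)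
      (ae_of_all _ fun _ => ENNReal.ofReal_lt_top)]
  have h1 := GaussianFourier.integral_cexp_neg_mul_sq_norm_add (b := (1 / 2 : ℂ)) (by norm_num)
    Complex.I t
  have h2 : ∀ x : EuclideanSpace ℝ (Fin d),
      (ENNReal.ofReal ((√((2 * Real.pi) ^ d))⁻¹ * Real.exp (-(1 / 2) * ‖x‖ ^ 2))).toReal •
        Complex.exp ((inner ℝ x t : ℝ) * Complex.I)
      = (((√((2 * Real.pi) ^ d))⁻¹ : ℝ) : ℂ) *
        Complex.exp (-(1 / 2) * ‖x‖ ^ 2 + Complex.I * (inner ℝ t x : ℝ)) := by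
    intro x
    rw [ENNReal.toReal_ofReal (by positivity), Complex.real_smul, Complex.ofReal_mul,
      Complex.ofReal_exp, mul_assoc, ← Complex.exp_add, real_inner_comm]
    congr 2
    push_cast
    ring
  simp_rw [h2]
  rw [integral_const_mul, h1]
  have h3 : ((Real.pi : ℂ) / (1 / 2)) ^ ((Module.finrank ℝ (EuclideanSpace ℝ (Fin d)) : ℂ) / 2)
      = ((√((2 * Real.pi) ^ d) : ℝ) : ℂ) := by
    rw [finrank_euclideanSpace_fin, Real.sqrt_eq_rpow, ← Real.rpow_natCast,
      ← Real.rpow_mul (by positivity), Complex.ofReal_cpow (by positivity)]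
    congr 1
    · push_cast; ring
    · push_cast; ring
  rw [h3, ← mul_assoc, ← Complex.ofReal_mul, inv_mul_cancel₀ (by positivity)]
  simp
  ring_nf

open scoped MatrixOrder in
/-- The density of `N(m, Σ)`, by the change of variables `x = m + Σ^{1/2} z`. -/
lemma gaussian_eq_withDensity (θ : BW d) :
    gaussian θ = volume.withDensity fun x => ENNReal.ofReal (gaussianDensity θ x) := by
  set R : Matrix (Fin d) (Fin d) ℝ := CFC.sqrt (cov θ) with hR
  have hRR : R * R = cov θ :=
    CFC.sqrt_mul_sqrt_self _ (Matrix.nonneg_iff_posSemidef.2 θ.2.posSemidef)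
  have hRT : Rᵀ = R := by
    have : IsSelfAdjoint R := IsSelfAdjoint.of_nonneg (CFC.sqrt_nonneg _)
    simpa [IsSelfAdjoint, Matrix.star_eq_conjTranspose] using this
  have hdet : R.det * R.det = (cov θ).det := by rw [← Matrix.det_mul, hRR]
  have hdetpos : 0 < (cov θ).det := θ.2.det_pos
  have hRdet : R.det ≠ 0 := by
    intro h; rw [h] at hdet; simp at hdet; exact hdetpos.ne hdet
  set L := Matrix.toEuclideanCLM (n := Fin d) (𝕜 := ℝ) R with hL
  have hLdet : L.det = R.det := by
    rw [ContinuousLinearMap.det, hL]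
    exact LinearMap.det_toLpLin 2 R
  have hLapply : ∀ x, WithLp.ofLp (L x) = R *ᵥ WithLp.ofLp x := fun x => rfl
  have hinj : Function.Injective fun x => mean θ + L x := by
    intro x y hxy
    have h1 : WithLp.ofLp (L x) = WithLp.ofLp (L y) :=
      congrArg WithLp.ofLp (add_left_cancel hxy)
    rw [hLapply, hLapply] at h1
    have := Matrix.mulVec_injective_of_isUnit
      ((Matrix.isUnit_iff_isUnit_det _).2 (isUnit_iff_ne_zero.2 hRdet)) h1
    exact (WithLp.ofLp_injective 2) this
  have hsurj : (fun x => mean θ + L x) '' univ = univ := by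
    rw [image_univ, range_eq_univ]
    intro y
    refine ⟨WithLp.toLp 2 (R⁻¹ *ᵥ WithLp.ofLp (y - mean θ)), ?_⟩
    have : L (WithLp.toLp 2 (R⁻¹ *ᵥ WithLp.ofLp (y - mean θ))) = y - mean θ := by
      apply WithLp.ofLp_injective 2
      rw [hLapply, Matrix.mulVec_mulVec, Matrix.mul_nonsing_inv _ (isUnit_iff_ne_zero.2 hRdet),
        Matrix.one_mulVec]
    simp only [this, add_sub_cancel]
  have hmeas : Measurable fun x => ENNReal.ofReal (gaussianDensity θ x) :=
    (continuous_gaussKernel θ.1).measurable.ennreal_ofReal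
  have hkey : ∀ x, |L.det| * gaussianDensity θ (mean θ + L x)
      = (√((2 * Real.pi) ^ d))⁻¹ * Real.exp (-(1 / 2) * ‖x‖ ^ 2) := by
    intro x
    have h1 : WithLp.ofLp (mean θ + L x - mean θ) = R *ᵥ WithLp.ofLp x := by simp [hLapply]
    unfold gaussianDensity
    rw [h1, hLdet]
    have h2 : (R *ᵥ WithLp.ofLp x) ⬝ᵥ ((cov θ)⁻¹ *ᵥ (R *ᵥ WithLp.ofLp x)) = ‖x‖ ^ 2 := by
      have h3 : R * ((cov θ)⁻¹ * R) = 1 := by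
        rw [← hRR, Matrix.mul_inv_rev, Matrix.mul_assoc,
          Matrix.nonsing_inv_mul _ (isUnit_iff_ne_zero.2 hRdet), Matrix.mul_one,
          Matrix.mul_nonsing_inv _ (isUnit_iff_ne_zero.2 hRdet)]
      rw [Matrix.mulVec_mulVec]
      nth_rewrite 1 [← hRT]
      rw [Matrix.mulVec_transpose, ← Matrix.dotProduct_mulVec, Matrix.mulVec_mulVec, h3,
        Matrix.one_mulVec, EuclideanSpace.real_norm_sq_eq]
      simp [dotProduct, sq]
    rw [h2, ← hdet, Real.sqrt_mul (by positivity), Real.sqrt_mul_self_eq_abs]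
    have : |R.det| ≠ 0 := abs_ne_zero.2 hRdet
    field_simp
  refine Measure.ext fun s hs => ?_
  rw [gaussian, multivariateGaussian, stdGaussian_eq_withDensity, withDensity_apply _ hs,
    Measure.map_apply (by fun_prop) hs,
    withDensity_apply _ ((by fun_prop : Measurable fun x => mean θ + L x) hs),
    ← lintegral_indicator hs,
    ← lintegral_indicator ((by fun_prop : Measurable fun x => mean θ + L x) hs)]
  have h := lintegral_image_eq_lintegral_abs_det_fderiv_mul
    (volume : Measure (EuclideanSpace ℝ (Fin d))) MeasurableSet.univ
    (f := fun x => mean θ + L x) (f' := fun _ => L)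
    (fun x _ => (L.hasFDerivAt.const_add _).hasFDerivWithinAt) hinj.injOn
    (s.indicator fun x => ENNReal.ofReal (gaussianDensity θ x))
  rw [hsurj, Measure.restrict_univ] at h
  rw [h]
  refine lintegral_congr fun x => ?_
  by_cases hx : mean θ + L x ∈ s
  · rw [indicator_of_mem hx, indicator_of_mem (show x ∈ (fun x => mean θ + L x) ⁻¹' s from hx),
      ← ENNReal.ofReal_mul (abs_nonneg _), hkey]
  · rw [indicator_of_notMem hx,
      indicator_of_notMem (show x ∉ (fun x => mean θ + L x) ⁻¹' s from hx), mul_zero]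

lemma gaussianDensity_pos (θ : BW d) (x : EuclideanSpace ℝ (Fin d)) : 0 < gaussianDensity θ x := by
  have := θ.2.det_pos
  unfold gaussianDensity
  positivity

lemma continuous_gaussianDensity (θ : BW d) : Continuous (gaussianDensity θ) :=
  continuous_gaussKernel θ.1

lemma lintegral_gaussianDensity (θ : BW d) :
    ∫⁻ x, ENNReal.ofReal (gaussianDensity θ x) = 1 := by
  have : gaussian θ univ = 1 := measure_univ
  rwa [gaussian_eq_withDensity, withDensity_apply _ MeasurableSet.univ, Measure.restrict_univ]
    at this

lemma integral_gaussian {F : Type*} [NormedAddCommGroup F] [NormedSpace ℝ F] (θ : BW d)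
    (f : EuclideanSpace ℝ (Fin d) → F) :
    ∫ x, f x ∂(gaussian θ) = ∫ x, gaussianDensity θ x • f x := by
  rw [gaussian_eq_withDensity, integral_withDensity_eq_integral_toReal_smul
    (continuous_gaussianDensity θ).measurable.ennreal_ofReal (by simp)]
  simp_rw [ENNReal.toReal_ofReal (gaussianDensity_pos θ _).le]

lemma integrable_gaussian_iff {F : Type*} [NormedAddCommGroup F] [NormedSpace ℝ F] (θ : BW d)
    (f : EuclideanSpace ℝ (Fin d) → F) :
    Integrable f (gaussian θ) ↔ Integrable fun x => gaussianDensity θ x • f x := by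
  rw [gaussian_eq_withDensity, integrable_withDensity_iff_integrable_smul'
    (continuous_gaussianDensity θ).measurable.ennreal_ofReal (by simp)]
  simp_rw [ENNReal.toReal_ofReal (gaussianDensity_pos θ _).le]

open scoped MatrixOrder in
/-- The Bures-Wasserstein distance is controlled by the second moments. -/
lemma bwDistSq_le (θ₀ θ₁ : BW d) :
    bwDistSq θ₀ θ₁ ≤ ‖mean θ₀ - mean θ₁‖ ^ 2 + (cov θ₀).trace + (cov θ₁).trace := by
  have h : 0 ≤ (CFC.sqrt (CFC.sqrt (cov θ₀) * cov θ₁ * CFC.sqrt (cov θ₀))).trace :=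
    (Matrix.nonneg_iff_posSemidef.1 (CFC.sqrt_nonneg _)).trace_nonneg
  unfold bwDistSq
  rw [Matrix.trace_sub, Matrix.trace_add, Matrix.trace_smul, smul_eq_mul]
  linarith

/-- The topology of the entrywise norm on matrices. It is the product topology, but instance search
does not see this by itself; making it a local instance keeps topology and norm in step. -/
abbrev matrixTopology (d : ℕ) : TopologicalSpace (Matrix (Fin d) (Fin d) ℝ) :=
  Matrix.normedAddCommGroup.toMetricSpace.toPseudoMetricSpace.toUniformSpace.toTopologicalSpace

attribute [local instance] matrixTopology

lemma borelSpace_matrixTopology (d : ℕ) : BorelSpace (Matrix (Fin d) (Fin d) ℝ) :=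
  matrixBorelSpace d

lemma secondCountable_matrixTopology (d : ℕ) :
    SecondCountableTopology (Matrix (Fin d) (Fin d) ℝ) :=
  inferInstanceAs (SecondCountableTopology (Fin d → Fin d → ℝ))

attribute [local instance] borelSpace_matrixTopology secondCountable_matrixTopology

/-! ### The Gaussian kernel as a smooth curve of weighted bounded functions -/

open BoundedContinuousFunction in
/-- A one-parameter exponential family `h ↦ exp (h τ - w)` with `|τ| ≤ w` is, for `|h| < 1`, a
smooth curve in the Banach space of bounded continuous functions: it is the sum of the power series
with coefficients `τⁿ exp (-w) / n!`, which are bounded by `1`. -/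
lemma exists_contDiffOn_exp_family {X : Type*} [TopologicalSpace X] {τ w : X → ℝ}
    (hτ : Continuous τ) (hw : Continuous w) (h : ∀ x, |τ x| ≤ w x) :
    ∃ W : ℝ → X →ᵇ ℝ, ContDiffOn ℝ ∞ W (Metric.ball 0 1) ∧
      ∀ s ∈ Metric.ball (0 : ℝ) 1, ∀ x, W s x = Real.exp (s * τ x - w x) := by
  have hb : ∀ (n : ℕ) x, ‖τ x ^ n * Real.exp (-w x) / n.factorial‖ ≤ 1 := by
    intro n x
    have hw0 : 0 ≤ w x := (abs_nonneg _).trans (h x)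
    have h1 : |τ x| ^ n / n.factorial ≤ Real.exp (w x) :=
      (div_le_div_of_nonneg_right (pow_le_pow_left₀ (abs_nonneg _) (h x) n)
        (by positivity)).trans (Real.pow_div_factorial_le_exp _ hw0 n)
    rw [Real.norm_eq_abs, abs_div, abs_mul, abs_pow, Real.abs_exp, Nat.abs_cast]
    calc |τ x| ^ n * Real.exp (-w x) / n.factorial
        = (|τ x| ^ n / n.factorial) * Real.exp (-w x) := by ring
      _ ≤ Real.exp (w x) * Real.exp (-w x) := by gcongr
      _ = 1 := by rw [← Real.exp_add]; simp
  set a : ℕ → X →ᵇ ℝ := fun n => BoundedContinuousFunction.ofNormedAddCommGroup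
    (fun x => τ x ^ n * Real.exp (-w x) / n.factorial) (by fun_prop) 1 (hb n) with ha
  have hna : ∀ n, ‖a n‖ ≤ 1 := fun n =>
    (BoundedContinuousFunction.norm_le zero_le_one).2 (hb n)
  have hbd : ∀ s : ℝ, ‖s‖ < 1 → Summable fun n => s ^ n • a n := by
    intro s hs
    refine Summable.of_norm_bounded (g := fun n => ‖s‖ ^ n)
      (summable_geometric_of_lt_one (norm_nonneg _) hs) fun n => ?_
    rw [norm_smul, norm_pow]
    exact mul_le_of_le_one_right (by positivity) (hna n)
  set p : FormalMultilinearSeries ℝ ℝ (X →ᵇ ℝ) := fun n =>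
    ContinuousMultilinearMap.mkPiRing ℝ (Fin n) (a n) with hp
  refine ⟨fun s => ∑' n, s ^ n • a n, ?_, ?_⟩
  · have hps : HasFPowerSeriesOnBall (fun s : ℝ => ∑' n, s ^ n • a n) p 0 1 := by
      refine ⟨?_, one_pos, ?_⟩
      · have := p.le_radius_of_bound (r := 1) 1 (fun n => by
          simp only [hp, ContinuousMultilinearMap.norm_mkPiRing]
          simpa using hna n)
        simpa using this
      · intro y hy
        have hy' : ‖y‖ < 1 := by
          rw [← ENNReal.ofReal_one, Metric.eball_ofReal] at hy
          simpa using hy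
        simpa [hp] using (hbd y hy').hasSum
    have := hps.analyticOnNhd
    rw [← ENNReal.ofReal_one, Metric.eball_ofReal] at this
    exact this.contDiffOn Metric.isOpen_ball.uniqueDiffOn
  · intro s hs x
    have hs' : ‖s‖ < 1 := by simpa using hs
    have h1 : HasSum (fun n => (s ^ n • a n) x) ((∑' n, s ^ n • a n) x) :=
      (hbd s hs').hasSum.map (BoundedContinuousFunction.evalCLM ℝ x)
        (BoundedContinuousFunction.evalCLM ℝ x).continuous
    refine h1.unique ?_
    have h2 := (NormedSpace.expSeries_div_hasSum_exp (𝔸 := ℝ) (s * τ x)).mul_right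
      (Real.exp (-w x))
    rw [← Real.exp_eq_exp_ℝ, ← Real.exp_add] at h2
    have h3 : (fun n => (s ^ n • a n) x)
        = fun n => (s * τ x) ^ n / n.factorial * Real.exp (-w x) := by
      funext n
      change s ^ n * (τ x ^ n * Real.exp (-w x) / n.factorial) = _
      ring
    change HasSum (fun n => (s ^ n • a n) x) _
    rw [h3, sub_eq_add_neg]
    exact h2

open BoundedContinuousFunction in
/-- Multi-parameter version of `exists_contDiffOn_exp_family`: the family
`η ↦ exp (B + ∑ ηᵢ τᵢ)` is smooth for `|ηᵢ| < ε` as soon as `B + (#ι) ε w` is bounded above,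
where `w` dominates all `|τᵢ|`. -/
lemma exists_contDiffOn_exp_family_pi {X ι : Type*} [TopologicalSpace X] [Fintype ι]
    {τ : ι → X → ℝ} {w B : X → ℝ} {ε C : ℝ} (hε : 0 < ε)
    (hτ : ∀ i, Continuous (τ i)) (hw : Continuous w) (hB : Continuous B)
    (h : ∀ i x, |τ i x| ≤ w x) (hC : ∀ x, B x + Fintype.card ι * ε * w x ≤ C) :
    ∃ W : (ι → ℝ) → X →ᵇ ℝ, ContDiffOn ℝ ∞ W {η | ∀ i, |η i| < ε} ∧
      ∀ η : ι → ℝ, (∀ i, |η i| < ε) → ∀ x, W η x = Real.exp (B x + ∑ i, η i * τ i x) := by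
  have key : ∀ i, ∃ W : ℝ → X →ᵇ ℝ, ContDiffOn ℝ ∞ W (Metric.ball 0 1) ∧
      ∀ s ∈ Metric.ball (0 : ℝ) 1, ∀ x, W s x = Real.exp (s * (ε * τ i x) - ε * w x) := fun i =>
    exists_contDiffOn_exp_family (by have := hτ i; fun_prop) (by fun_prop) fun x => by
      rw [abs_mul, abs_of_pos hε]; exact mul_le_mul_of_nonneg_left (h i x) hε.le
  choose W hW1 hW2 using key
  set b : X →ᵇ ℝ := BoundedContinuousFunction.ofNormedAddCommGroup
    (fun x => Real.exp (B x + Fintype.card ι * ε * w x)) (by fun_prop) (Real.exp C)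
    (fun x => by rw [Real.norm_eq_abs, Real.abs_exp]; exact Real.exp_le_exp.2 (hC x)) with hb
  have hmem : ∀ (η : ι → ℝ), (∀ i, |η i| < ε) → ∀ i, η i / ε ∈ Metric.ball (0 : ℝ) 1 := by
    intro η hη i
    rw [mem_ball_zero_iff, Real.norm_eq_abs, abs_div, abs_of_pos hε, div_lt_one hε]
    exact hη i
  refine ⟨fun η => b * ∏ i, W i (η i / ε), ?_, ?_⟩
  · refine contDiffOn_const.mul (contDiffOn_prod fun i _ => ?_)
    exact (hW1 i).comp (by fun_prop) fun η hη => hmem η hη i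
  · intro η hη x
    have hprod : (∏ i, W i (η i / ε)) x = ∏ i, W i (η i / ε) x := by
      simp
    rw [BoundedContinuousFunction.mul_apply, hprod,
      Finset.prod_congr rfl fun i _ => hW2 i _ (hmem η hη i) x, ← Real.exp_sum]
    simp only [hb, BoundedContinuousFunction.coe_ofNormedAddCommGroup]
    rw [← Real.exp_add]
    congr 1
    have : ∀ i, η i / ε * (ε * τ i x) - ε * w x = η i * τ i x - ε * w x := by
      intro i; field_simp
    simp only [this, Finset.sum_sub_distrib, Finset.sum_const, Finset.card_univ, nsmul_eq_mul]
    ring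

lemma contDiff_matrix_entry (i j : Fin d) : ContDiff ℝ ∞ fun θ : Ambient d => θ.2 i j :=
  ((LinearMap.toContinuousLinearMap
    { toFun := fun θ : Ambient d => θ.2 i j
      map_add' := fun _ _ => rfl
      map_smul' := fun _ _ => rfl } : Ambient d →L[ℝ] ℝ)).contDiff

lemma contDiff_mean_entry (i : Fin d) : ContDiff ℝ ∞ fun θ : Ambient d => θ.1 i :=
  (EuclideanSpace.proj i : EuclideanSpace ℝ (Fin d) →L[ℝ] ℝ).contDiff.comp contDiff_fst

lemma contDiff_det_of_entries {E : Type*} [NormedAddCommGroup E] [NormedSpace ℝ E]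
    {M : E → Matrix (Fin d) (Fin d) ℝ} (h : ∀ i j, ContDiff ℝ ∞ fun e => M e i j) :
    ContDiff ℝ ∞ fun e => (M e).det := by
  simp only [Matrix.det_apply]
  exact ContDiff.sum fun σ _ => (contDiff_prod fun i _ => h _ _).const_smul _

lemma contDiff_det : ContDiff ℝ ∞ fun θ : Ambient d => θ.2.det :=
  contDiff_det_of_entries contDiff_matrix_entry

lemma contDiffOn_inv_entry (i j : Fin d) :
    ContDiffOn ℝ ∞ (fun θ : Ambient d => θ.2⁻¹ i j) {θ | θ.2.det ≠ 0} := by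
  have h : ContDiff ℝ ∞ fun θ : Ambient d => θ.2.adjugate i j := by
    simp only [Matrix.adjugate_apply]
    refine contDiff_det_of_entries fun k l => ?_
    by_cases hk : k = j
    · subst hk; simpa [Matrix.updateRow_self] using contDiff_const
    · simpa [Matrix.updateRow_ne hk] using contDiff_matrix_entry k l
  have : (fun θ : Ambient d => θ.2⁻¹ i j) = fun θ => (θ.2.det)⁻¹ * θ.2.adjugate i j := by
    ext θ; simp [Matrix.inv_def, Ring.inverse_eq_inv']
  rw [this]
  exact (contDiff_det.contDiffOn.inv fun θ hθ => hθ).mul h.contDiffOn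

/-- A positive definite quadratic form is bounded below by a multiple of the squared norm. -/
lemma exists_mul_norm_sq_le_of_posDef {A : Matrix (Fin d) (Fin d) ℝ} (hA : A.PosDef) :
    ∃ δ > 0, ∀ x : EuclideanSpace ℝ (Fin d),
      δ * ‖x‖ ^ 2 ≤ WithLp.ofLp x ⬝ᵥ (A *ᵥ WithLp.ofLp x) := by
  by_cases hne : (Metric.sphere (0 : EuclideanSpace ℝ (Fin d)) 1).Nonempty
  · obtain ⟨y, hy, hmin⟩ := (isCompact_sphere (0 : EuclideanSpace ℝ (Fin d)) 1).exists_isMinOn hne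
      (continuous_dotProduct_mulVec A).continuousOn
    have hy0 : y ≠ 0 := by rintro rfl; simp at hy
    refine ⟨WithLp.ofLp y ⬝ᵥ (A *ᵥ WithLp.ofLp y), ?_, fun x => ?_⟩
    · have := hA.dotProduct_mulVec_pos (x := WithLp.ofLp y) (by simpa using hy0)
      simpa using this
    · by_cases hx : x = 0
      · simp [hx]
      have hx' : 0 < ‖x‖ := norm_pos_iff.2 hx
      have h1 := hmin (show (‖x‖⁻¹ • x) ∈ Metric.sphere (0 : EuclideanSpace ℝ (Fin d)) 1 by
        simp [norm_smul, hx'.ne'])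
      simp only [mem_ofPred_eq, WithLp.ofLp_smul, Matrix.mulVec_smul, smul_dotProduct,
        dotProduct_smul, smul_eq_mul] at h1
      calc _ ≤ (‖x‖⁻¹ * (‖x‖⁻¹ * (WithLp.ofLp x ⬝ᵥ A *ᵥ WithLp.ofLp x))) * ‖x‖ ^ 2 := by gcongr
        _ = _ := by field_simp
  · refine ⟨1, one_pos, fun x => ?_⟩
    have hx : x = 0 := by
      by_contra hx
      exact hne ⟨‖x‖⁻¹ • x, by simp [norm_smul, norm_ne_zero_iff.2 hx]⟩
    simp [hx]

lemma abs_coord_le_norm (x : EuclideanSpace ℝ (Fin d)) (i : Fin d) : |x i| ≤ ‖x‖ := by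
  simpa using PiLp.norm_apply_le x i

lemma abs_coord_mul_le (x : EuclideanSpace ℝ (Fin d)) (i j : Fin d) : |x i * x j| ≤ ‖x‖ ^ 2 := by
  rw [abs_mul, sq]
  exact mul_le_mul (abs_coord_le_norm x i) (abs_coord_le_norm x j) (abs_nonneg _) (norm_nonneg _)

/-- The linear coefficient `½ (A + Aᵀ) m`, `A = Σ⁻¹`, of the exponent of the Gaussian kernel. -/
def kernelLin (θ : Ambient d) (i : Fin d) : ℝ :=
  ∑ j, (1 / 2) * ((θ.2⁻¹ i j + θ.2⁻¹ j i) * θ.1 j)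

/-- The constant coefficient of the Gaussian kernel, including the normalisation. -/
def kernelConst (θ : Ambient d) : ℝ :=
  (√((2 * Real.pi) ^ d * θ.2.det))⁻¹ *
    Real.exp (∑ i, ∑ j, -(1 / 2) * (θ.1 i * (θ.2⁻¹ i j * θ.1 j)))

lemma gaussKernel_eq_expand (θ : Ambient d) (x : EuclideanSpace ℝ (Fin d)) :
    gaussKernel θ x = kernelConst θ *
      Real.exp (∑ i, ∑ j, θ.2⁻¹ i j * (-(1 / 2) * (x i * x j)) + ∑ i, kernelLin θ i * x i) := by
  unfold gaussKernel kernelConst kernelLin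
  rw [mul_assoc, ← Real.exp_add]
  congr 2
  simp only [dotProduct, Matrix.mulVec, Finset.mul_sum, Finset.sum_mul, WithLp.ofLp_sub,
    Pi.sub_apply]
  have hs : ∑ i, ∑ j, (1 / 2) * ((θ.2⁻¹ i j + θ.2⁻¹ j i) * θ.1 j) * x i
      = ∑ i, ∑ j, ((1 / 2) * (θ.2⁻¹ i j * θ.1 j * x i + θ.2⁻¹ i j * θ.1 i * x j)) := by
    have h1 : ∑ i, ∑ j, (1 / 2) * (θ.2⁻¹ j i * θ.1 j * x i)
        = ∑ i, ∑ j, (1 / 2) * (θ.2⁻¹ i j * θ.1 i * x j) := Finset.sum_comm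
    simp only [add_mul, mul_add, Finset.sum_add_distrib] at h1 ⊢
    rw [← h1]
    congr 1 <;> exact Finset.sum_congr rfl fun i _ => Finset.sum_congr rfl fun j _ => by ring
  rw [hs]
  simp only [← Finset.sum_add_distrib]
  exact Finset.sum_congr rfl fun i _ => Finset.sum_congr rfl fun j _ => by ring

lemma contDiffOn_kernelLin (i : Fin d) :
    ContDiffOn ℝ ∞ (fun θ : Ambient d => kernelLin θ i) {θ | 0 < θ.2.det} := by
  unfold kernelLin
  have h : ∀ i j, ContDiffOn ℝ ∞ (fun θ : Ambient d => θ.2⁻¹ i j) {θ | 0 < θ.2.det} := fun i j =>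
    (contDiffOn_inv_entry i j).mono fun θ hθ => ne_of_gt hθ
  exact ContDiffOn.sum fun j _ => contDiffOn_const.mul
    (((h i j).add (h j i)).mul (contDiff_mean_entry j).contDiffOn)

lemma contDiffOn_kernelConst :
    ContDiffOn ℝ ∞ (kernelConst : Ambient d → ℝ) {θ | 0 < θ.2.det} := by
  have h : ∀ i j, ContDiffOn ℝ ∞ (fun θ : Ambient d => θ.2⁻¹ i j) {θ | 0 < θ.2.det} := fun i j =>
    (contDiffOn_inv_entry i j).mono fun θ hθ => ne_of_gt hθ
  have hpos : ∀ θ ∈ {θ : Ambient d | 0 < θ.2.det}, 0 < (2 * Real.pi) ^ d * θ.2.det := fun θ hθ =>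
    mul_pos (by positivity) hθ
  refine ContDiffOn.mul (ContDiffOn.inv ?_ fun θ hθ => (Real.sqrt_pos.2 (hpos θ hθ)).ne') ?_
  · exact (contDiffOn_const.mul contDiff_det.contDiffOn).sqrt fun θ hθ => (hpos θ hθ).ne'
  · exact (ContDiffOn.sum fun i _ => ContDiffOn.sum fun j _ => contDiffOn_const.mul
      ((contDiff_mean_entry i).contDiffOn.mul ((h i j).mul
        (contDiff_mean_entry j).contDiffOn))).exp

open scoped BoundedContinuousFunction in
/-- Near a point of the Bures-Wasserstein manifold the Gaussian kernel, multiplied by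
`exp (c |x|²)` with `c` small, is a smooth map into the bounded continuous functions. -/
lemma exists_weightedKernel_nhds (θ₀ : BW d) :
    ∃ c₀ > 0, ∃ N : Set (Ambient d), IsOpen N ∧ θ₀.1 ∈ N ∧ ∀ c ∈ Ioc 0 c₀,
      ∃ W : Ambient d → (EuclideanSpace ℝ (Fin d) →ᵇ ℝ), ContDiffOn ℝ ∞ W N ∧
        ∀ θ ∈ N, ∀ x, W θ x = gaussKernel θ x * Real.exp (c * ‖x‖ ^ 2) := by
  obtain ⟨δ, hδ, hA⟩ := exists_mul_norm_sq_le_of_posDef θ₀.2.inv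
  -- The family is parametrized by the increments of the coefficients of the quadratic exponent.
  -- The accuracy `ε` keeps the perturbation, and `c` the weight, below the decay rate `δ / 2`.
  set n : ℝ := (Fintype.card ((Fin d × Fin d) ⊕ Fin d) : ℝ) with hn
  set ε : ℝ := δ / (8 * (n + 1)) with hε
  have hn0 : 0 ≤ n := Nat.cast_nonneg _
  have hεpos : 0 < ε := by positivity
  have hnε : n * ε ≤ δ / 8 := by
    rw [hε, mul_div_assoc', div_le_div_iff₀ (by positivity) (by norm_num)]
    nlinarith
  set η : Ambient d → ((Fin d × Fin d) ⊕ Fin d) → ℝ := fun θ =>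
    Sum.elim (fun p => θ.2⁻¹ p.1 p.2 - θ₀.1.2⁻¹ p.1 p.2)
      (fun i => kernelLin θ i - kernelLin θ₀.1 i) with hη
  set D : Set (Ambient d) := {θ | 0 < θ.2.det}
  have hDo : IsOpen D := isOpen_lt continuous_const contDiff_det.continuous
  have hηD : ContDiffOn ℝ ∞ η D := by
    rw [contDiffOn_pi]
    rintro (p | i)
    · exact ((contDiffOn_inv_entry p.1 p.2).mono fun θ hθ => ne_of_gt hθ).sub contDiffOn_const
    · exact (contDiffOn_kernelLin i).sub contDiffOn_const
  set N : Set (Ambient d) := D ∩ η ⁻¹' {v | ∀ i, |v i| < ε} with hN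
  have hVo : IsOpen {v : ((Fin d × Fin d) ⊕ Fin d) → ℝ | ∀ i, |v i| < ε} := by
    simp only [ofPred_forall]
    exact isOpen_iInter_of_finite fun i =>
      isOpen_lt (continuous_abs.comp (continuous_apply i)) continuous_const
  refine ⟨δ / 8, by positivity, N, hηD.continuousOn.isOpen_inter_preimage hDo hVo, ?_, ?_⟩
  · refine ⟨θ₀.2.det_pos, ?_⟩
    rintro (p | i) <;> simpa [hη] using hεpos
  intro c hc
  set τ : ((Fin d × Fin d) ⊕ Fin d) → EuclideanSpace ℝ (Fin d) → ℝ :=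
    Sum.elim (fun p x => -(1 / 2) * (x p.1 * x p.2)) (fun i x => x i) with hτ
  set u : EuclideanSpace ℝ (Fin d) := WithLp.toLp 2 (kernelLin θ₀.1) with hu
  set B : EuclideanSpace ℝ (Fin d) → ℝ := fun x => c * ‖x‖ ^ 2 +
    (∑ i, ∑ j, θ₀.1.2⁻¹ i j * (-(1 / 2) * (x i * x j)) + ∑ i, kernelLin θ₀.1 i * x i) with hB
  have hBle : ∀ x, B x + n * ε * (1 + ‖x‖ ^ 2) ≤ δ / 8 + ‖u‖ ^ 2 / δ := by
    intro x
    have h1 : ∑ i, ∑ j, θ₀.1.2⁻¹ i j * (-(1 / 2) * (x i * x j)) ≤ -(δ / 2) * ‖x‖ ^ 2 := by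
      have h2 : ∑ i, ∑ j, θ₀.1.2⁻¹ i j * (-(1 / 2) * (x i * x j))
          = -(1 / 2) * (WithLp.ofLp x ⬝ᵥ (θ₀.1.2⁻¹ *ᵥ WithLp.ofLp x)) := by
        simp only [dotProduct, Matrix.mulVec, Finset.mul_sum]
        exact Finset.sum_congr rfl fun i _ => Finset.sum_congr rfl fun j _ => by ring
      rw [h2]
      linarith [hA x]
    have h3 : ∑ i, kernelLin θ₀.1 i * x i ≤ ‖u‖ * ‖x‖ := by
      have := real_inner_le_norm x u
      rw [mul_comm]
      simpa [hu, PiLp.inner_apply] using this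
    have h4 : ‖u‖ * ‖x‖ ≤ ‖u‖ ^ 2 / δ + δ / 4 * ‖x‖ ^ 2 := by
      have : ‖u‖ ^ 2 / δ + δ / 4 * ‖x‖ ^ 2 - ‖u‖ * ‖x‖ = (‖u‖ - δ / 2 * ‖x‖) ^ 2 / δ := by
        field_simp; ring
      have h5 : 0 ≤ (‖u‖ - δ / 2 * ‖x‖) ^ 2 / δ := by positivity
      linarith
    have h6 : c * ‖x‖ ^ 2 ≤ δ / 8 * ‖x‖ ^ 2 := by gcongr; exact hc.2
    have h7 : n * ε * (1 + ‖x‖ ^ 2) ≤ δ / 8 * (1 + ‖x‖ ^ 2) := by gcongr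
    simp only [hB]
    linarith
  obtain ⟨W, hW1, hW2⟩ := exists_contDiffOn_exp_family_pi (τ := τ) (w := fun x => 1 + ‖x‖ ^ 2)
    (B := B) (ε := ε) hεpos (by rintro (p | i) <;> simp only [hτ, Sum.elim_inl, Sum.elim_inr] <;>
      fun_prop) (by fun_prop) (by simp only [hB]; fun_prop) (by
      rintro (p | i) x
      · simp only [hτ, Sum.elim_inl]
        have h1 := abs_coord_mul_le x p.1 p.2
        have h2 : |(-(1 / 2) : ℝ)| = 1 / 2 := by rw [abs_neg]; norm_num
        rw [abs_mul, h2]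
        nlinarith [abs_nonneg (x p.1 * x p.2)]
      · simp only [hτ, Sum.elim_inr]
        have := abs_coord_le_norm x i
        nlinarith [sq_nonneg (‖x‖ - 1)]) hBle
  refine ⟨fun θ => kernelConst θ • W (η θ), ?_, ?_⟩
  · exact (contDiffOn_kernelConst.mono inter_subset_left).smul
      (hW1.comp (hηD.mono inter_subset_left) fun θ hθ => hθ.2)
  · intro θ hθ x
    change kernelConst θ * W (η θ) x = _
    rw [hW2 _ hθ.2, gaussKernel_eq_expand, mul_assoc, ← Real.exp_add]
    congr 2
    simp only [hB, hη, hτ, Fintype.sum_sum_type, Sum.elim_inl, Sum.elim_inr, sub_mul,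
      Finset.sum_sub_distrib, Fintype.sum_prod_type]
    ring

open scoped BoundedContinuousFunction in
/-- The function `x ↦ p_θ(x) exp (c |x|²)` as an element of the Banach space of bounded continuous
functions, with junk value `0` where it is unbounded. -/
def weightedKernel (c : ℝ) (θ : Ambient d) : EuclideanSpace ℝ (Fin d) →ᵇ ℝ :=
  open Classical in
  if h : ∃ C, ∀ x, ‖gaussKernel θ x * Real.exp (c * ‖x‖ ^ 2)‖ ≤ C then
    BoundedContinuousFunction.ofNormedAddCommGroup
      (fun x => gaussKernel θ x * Real.exp (c * ‖x‖ ^ 2))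
      ((continuous_gaussKernel θ).mul (by fun_prop)) h.choose h.choose_spec
  else 0

open scoped BoundedContinuousFunction in
lemma weightedKernel_eq {c : ℝ} {θ : Ambient d} {W : EuclideanSpace ℝ (Fin d) →ᵇ ℝ}
    (h : ∀ x, W x = gaussKernel θ x * Real.exp (c * ‖x‖ ^ 2)) : weightedKernel c θ = W := by
  have hb : ∃ C, ∀ x, ‖gaussKernel θ x * Real.exp (c * ‖x‖ ^ 2)‖ ≤ C :=
    ⟨‖W‖, fun x => by rw [← h]; exact W.norm_coe_le_norm x⟩
  rw [weightedKernel, dif_pos hb]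
  ext x
  simp [h]

/-- Smoothness of the weighted kernel near a compact set of Gaussians, for some small weight. -/
lemma exists_contDiffOn_weightedKernel {K : Set (BW d)} (hK : IsCompact K) :
    ∃ c > 0, ∃ N : Set (Ambient d), IsOpen N ∧ (∀ θ ∈ K, θ.1 ∈ N) ∧
      ContDiffOn ℝ ∞ (weightedKernel c) N ∧
      ∀ θ ∈ N, ∀ x, weightedKernel c θ x = gaussKernel θ x * Real.exp (c * ‖x‖ ^ 2) := by
  suffices h : ∃ c₀ > 0, ∃ N : Set (Ambient d), IsOpen N ∧ (∀ θ ∈ K, θ.1 ∈ N) ∧ ∀ c ∈ Ioc 0 c₀,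
      ContDiffOn ℝ ∞ (weightedKernel c) N ∧
      ∀ θ ∈ N, ∀ x, weightedKernel c θ x = gaussKernel θ x * Real.exp (c * ‖x‖ ^ 2) by
    obtain ⟨c₀, h0, N, hN, hKN, h⟩ := h
    exact ⟨c₀, h0, N, hN, hKN, h c₀ ⟨h0, le_rfl⟩⟩
  -- The statement for all small weights is stable under unions, unlike that for a single weight.
  refine IsCompact.induction_on (p := fun K : Set (BW d) => ∃ c₀ > 0, ∃ N : Set (Ambient d),
      IsOpen N ∧ (∀ θ ∈ K, θ.1 ∈ N) ∧ ∀ c ∈ Ioc 0 c₀, ContDiffOn ℝ ∞ (weightedKernel c) N ∧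
      ∀ θ ∈ N, ∀ x, weightedKernel c θ x = gaussKernel θ x * Real.exp (c * ‖x‖ ^ 2))
    hK ?_ ?_ ?_ ?_
  · exact ⟨1, one_pos, ∅, isOpen_empty, by simp, by simp⟩
  · intro s t hst h
    obtain ⟨c₀, h0, N, hN, hKN, h⟩ := h
    exact ⟨c₀, h0, N, hN, fun θ hθ => hKN θ (hst hθ), h⟩
  · intro s t h1 h2
    obtain ⟨c₁, h1, N₁, hN₁, hKN₁, h₁⟩ := h1
    obtain ⟨c₂, h2, N₂, hN₂, hKN₂, h₂⟩ := h2
    refine ⟨min c₁ c₂, lt_min h1 h2, N₁ ∪ N₂, hN₁.union hN₂,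
      fun θ hθ => hθ.imp (hKN₁ θ) (hKN₂ θ), fun c hc => ?_⟩
    have H1 := h₁ c ⟨hc.1, hc.2.trans (min_le_left _ _)⟩
    have H2 := h₂ c ⟨hc.1, hc.2.trans (min_le_right _ _)⟩
    exact ⟨H1.1.union_of_isOpen H2.1 hN₁ hN₂, fun θ hθ => hθ.elim (H1.2 θ) (H2.2 θ)⟩
  · intro θ₀ hθ₀
    obtain ⟨c₀, h0, N, hN, hθN, h⟩ := exists_weightedKernel_nhds θ₀
    refine ⟨Subtype.val ⁻¹' N, mem_nhdsWithin_of_mem_nhds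
      ((hN.preimage continuous_subtype_val).mem_nhds hθN), c₀, h0, N, hN, fun θ hθ => hθ,
      fun c hc => ?_⟩
    obtain ⟨W, hW1, hW2⟩ := h c hc
    have heq : ∀ θ ∈ N, weightedKernel c θ = W θ := fun θ hθ => weightedKernel_eq (hW2 θ hθ)
    exact ⟨hW1.congr heq, fun θ hθ x => by rw [heq θ hθ, hW2 θ hθ]⟩

lemma contDiffOn_gaussKernel_uncurry :
    ContDiffOn ℝ ∞ (fun p : Ambient d × EuclideanSpace ℝ (Fin d) => gaussKernel p.1 p.2)
      {p | 0 < p.1.2.det} := by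
  have hA : ∀ i j, ContDiffOn ℝ ∞
      (fun p : Ambient d × EuclideanSpace ℝ (Fin d) => p.1.2⁻¹ i j) {p | 0 < p.1.2.det} :=
    fun i j => (contDiffOn_inv_entry i j).comp contDiff_fst.contDiffOn fun p hp => ne_of_gt hp
  have hl : ∀ i, ContDiffOn ℝ ∞
      (fun p : Ambient d × EuclideanSpace ℝ (Fin d) => kernelLin p.1 i) {p | 0 < p.1.2.det} :=
    fun i => (contDiffOn_kernelLin i).comp contDiff_fst.contDiffOn fun p hp => hp
  have hk : ContDiffOn ℝ ∞
      (fun p : Ambient d × EuclideanSpace ℝ (Fin d) => kernelConst p.1) {p | 0 < p.1.2.det} :=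
    contDiffOn_kernelConst.comp contDiff_fst.contDiffOn fun p hp => hp
  have hx : ∀ i, ContDiffOn ℝ ∞
      (fun p : Ambient d × EuclideanSpace ℝ (Fin d) => p.2 i) {p | 0 < p.1.2.det} := fun i =>
    ((EuclideanSpace.proj i : EuclideanSpace ℝ (Fin d) →L[ℝ] ℝ).contDiff.comp
      contDiff_snd).contDiffOn
  simp_rw [gaussKernel_eq_expand]
  refine hk.mul (ContDiffOn.exp (ContDiffOn.add ?_ ?_))
  · exact ContDiffOn.sum fun i _ => ContDiffOn.sum fun j _ =>
      (hA i j).mul (contDiffOn_const.mul ((hx i).mul (hx j)))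
  · exact ContDiffOn.sum fun i _ => (hl i).mul (hx i)

lemma isOpen_det_pos : IsOpen {θ : Ambient d | 0 < θ.2.det} :=
  isOpen_lt continuous_const contDiff_det.continuous

lemma contDiffOn_gaussKernel (x : EuclideanSpace ℝ (Fin d)) :
    ContDiffOn ℝ ∞ (fun θ : Ambient d => gaussKernel θ x) {θ | 0 < θ.2.det} :=
  contDiffOn_gaussKernel_uncurry.comp (t := {p | 0 < p.1.2.det})
    (f := fun θ : Ambient d => (θ, x)) (by fun_prop) fun θ hθ => hθ

/-- The differential of the Gaussian kernel in its parameter. -/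
def kernelDeriv (θ : Ambient d) (x : EuclideanSpace ℝ (Fin d)) : Ambient d →L[ℝ] ℝ :=
  fderiv ℝ (fun θ' => gaussKernel θ' x) θ

lemma hasFDerivAt_gaussKernel {θ : Ambient d} (hθ : 0 < θ.2.det) (x : EuclideanSpace ℝ (Fin d)) :
    HasFDerivAt (fun θ' => gaussKernel θ' x) (kernelDeriv θ x) θ :=
  (((contDiffOn_gaussKernel x).contDiffAt (isOpen_det_pos.mem_nhds hθ)).differentiableAt
    (by simp)).hasFDerivAt

lemma continuousOn_kernelDeriv : ContinuousOn
    (fun p : Ambient d × EuclideanSpace ℝ (Fin d) => kernelDeriv p.1 p.2) {p | 0 < p.1.2.det} := by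
  have ho : IsOpen {p : Ambient d × EuclideanSpace ℝ (Fin d) | 0 < p.1.2.det} :=
    isOpen_det_pos.preimage continuous_fst
  have h := contDiffOn_gaussKernel_uncurry (d := d).continuousOn_fderiv_of_isOpen ho (by simp)
  have h2 := h.clm_comp (continuousOn_const
    (c := ContinuousLinearMap.inl ℝ (Ambient d) (EuclideanSpace ℝ (Fin d))))
  refine h2.congr fun p hp => ?_
  have h3 : HasFDerivAt (fun p : Ambient d × EuclideanSpace ℝ (Fin d) => gaussKernel p.1 p.2)
      (fderiv ℝ (fun p : Ambient d × EuclideanSpace ℝ (Fin d) => gaussKernel p.1 p.2) p) p :=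
    ((contDiffOn_gaussKernel_uncurry.contDiffAt (ho.mem_nhds hp)).differentiableAt
      (by simp)).hasFDerivAt
  exact (HasFDerivAt.comp (x := p.1) (f := fun θ => (θ, p.2)) h3
    (hasFDerivAt_prodMk_left p.1 p.2)).fderiv

/-- The differential of the weighted kernel is the weighted differential of the kernel. -/
lemma fderiv_weightedKernel_apply {c : ℝ} {N : Set (Ambient d)} (hN : IsOpen N)
    (hs : ContDiffOn ℝ ∞ (weightedKernel c) N)
    (hv : ∀ θ ∈ N, ∀ x, weightedKernel c θ x = gaussKernel θ x * Real.exp (c * ‖x‖ ^ 2))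
    {θ : Ambient d} (hθ : θ ∈ N) (u : Ambient d)
    (x : EuclideanSpace ℝ (Fin d)) :
    kernelDeriv θ x u = fderiv ℝ (weightedKernel c) θ u x * Real.exp (-(c * ‖x‖ ^ 2)) := by
  have h1 : HasFDerivAt (weightedKernel c) (fderiv ℝ (weightedKernel c) θ) θ :=
    ((hs.contDiffAt (hN.mem_nhds hθ)).differentiableAt (by simp)).hasFDerivAt
  have h2 := ((BoundedContinuousFunction.evalCLM ℝ x).hasFDerivAt.comp θ h1).mul_const
    (Real.exp (-(c * ‖x‖ ^ 2)))
  have h3 : (fun θ' => gaussKernel θ' x) =ᶠ[𝓝 θ]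
      fun θ' => (BoundedContinuousFunction.evalCLM ℝ x ∘ weightedKernel c) θ' *
        Real.exp (-(c * ‖x‖ ^ 2)) := by
    filter_upwards [hN.mem_nhds hθ] with θ' hθ'
    change _ = weightedKernel c θ' x * _
    rw [hv θ' hθ', mul_assoc, ← Real.exp_add]
    simp
  have h4 := (h2.congr_of_eventuallyEq h3).fderiv
  rw [kernelDeriv, h4]
  exact mul_comm _ _

/-- Uniform Gaussian upper bounds for the kernel and its differential over a compact set. -/
lemma exists_kernel_bounds {K : Set (BW d)} (hK : IsCompact K) :
    ∃ c > 0, ∃ C > 0, ∀ θ ∈ K, ∀ x : EuclideanSpace ℝ (Fin d),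
      gaussianDensity θ x ≤ C * Real.exp (-(c * ‖x‖ ^ 2)) ∧
      ‖kernelDeriv θ.1 x‖ ≤ C * Real.exp (-(c * ‖x‖ ^ 2)) := by
  obtain ⟨c, hc, N, hN, hKN, hs, hv⟩ := exists_contDiffOn_weightedKernel hK
  have hKc : IsCompact (Subtype.val '' K : Set (Ambient d)) := hK.image continuous_subtype_val
  have hKN' : (Subtype.val '' K : Set (Ambient d)) ⊆ N := by rintro _ ⟨θ, hθ, rfl⟩; exact hKN θ hθ
  obtain ⟨C1, hC1⟩ := hKc.exists_bound_of_continuousOn (hs.continuousOn.mono hKN')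
  obtain ⟨C2, hC2⟩ := hKc.exists_bound_of_continuousOn
    ((hs.continuousOn_fderiv_of_isOpen hN (by simp)).mono hKN')
  refine ⟨c, hc, max (max C1 C2) 1, by positivity, fun θ hθ x => ⟨?_, ?_⟩⟩
  · have h1 := (le_abs_self _).trans
      (((weightedKernel c θ.1).norm_coe_le_norm x).trans (hC1 _ ⟨θ, hθ, rfl⟩))
    rw [hv _ (hKN θ hθ)] at h1
    have h2 : gaussianDensity θ x
        = (gaussKernel θ.1 x * Real.exp (c * ‖x‖ ^ 2)) * Real.exp (-(c * ‖x‖ ^ 2)) := by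
      rw [mul_assoc, ← Real.exp_add]; simp [gaussianDensity_eq_gaussKernel]
    rw [h2]
    gcongr
    exact h1.trans ((le_max_left _ _).trans (le_max_left _ _))
  · refine ContinuousLinearMap.opNorm_le_bound _ (by positivity) fun u => ?_
    rw [fderiv_weightedKernel_apply hN hs hv (hKN θ hθ), norm_mul, Real.norm_eq_abs (Real.exp _),
      Real.abs_exp]
    have h1 := (((fderiv ℝ (weightedKernel c) θ.1 u).norm_coe_le_norm x).trans
      ((fderiv ℝ (weightedKernel c) θ.1).le_opNorm u))
    have h2 : ‖fderiv ℝ (weightedKernel c) θ.1‖ ≤ max (max C1 C2) 1 :=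
      (hC2 _ ⟨θ, hθ, rfl⟩).trans ((le_max_right _ _).trans (le_max_left _ _))
    calc _ ≤ (max (max C1 C2) 1 * ‖u‖) * Real.exp (-(c * ‖x‖ ^ 2)) := by
          gcongr; exact h1.trans (by gcongr)
      _ = _ := by ring

/-- Uniform Gaussian lower bounds for the kernel over a compact set. -/
lemma exists_kernel_lower_bound {K : Set (BW d)} (hK : IsCompact K) :
    ∃ C > 0, ∀ θ ∈ K, ∀ x : EuclideanSpace ℝ (Fin d),
      Real.exp (-(C * (1 + ‖x‖ ^ 2))) ≤ gaussianDensity θ x := by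
  have hKc : IsCompact (Subtype.val '' K : Set (Ambient d)) := hK.image continuous_subtype_val
  have hKD : (Subtype.val '' K : Set (Ambient d)) ⊆ {θ | 0 < θ.2.det} := by
    rintro _ ⟨θ, hθ, rfl⟩; exact θ.2.det_pos
  have hkc : ∀ θ ∈ {θ : Ambient d | 0 < θ.2.det}, 0 < kernelConst θ := fun θ hθ => by
    have : 0 < θ.2.det := hθ
    unfold kernelConst; positivity
  have hcont : ContinuousOn (fun θ : Ambient d => (∑ i, ∑ j, |θ.2⁻¹ i j|) +
      (∑ i, |kernelLin θ i|) + |Real.log (kernelConst θ)|) {θ | 0 < θ.2.det} := by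
    refine ((continuousOn_finsetSum _ fun i _ => continuousOn_finsetSum _ fun j _ => ?_).add
      (continuousOn_finsetSum _ fun i _ => (contDiffOn_kernelLin i).continuousOn.abs)).add
      (contDiffOn_kernelConst.continuousOn.log fun θ hθ => (hkc θ hθ).ne').abs
    exact ((contDiffOn_inv_entry i j).continuousOn.mono fun θ hθ => ne_of_gt hθ).abs
  obtain ⟨C, hC⟩ := hKc.exists_bound_of_continuousOn (hcont.mono hKD)
  refine ⟨max C 1, by positivity, fun θ hθ x => ?_⟩
  have hdet : θ.1 ∈ {θ : Ambient d | 0 < θ.2.det} := θ.2.det_pos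
  have hC' := (le_abs_self _).trans (hC _ ⟨θ, hθ, rfl⟩)
  rw [gaussianDensity_eq_gaussKernel, gaussKernel_eq_expand, ← Real.exp_log (hkc _ hdet),
    ← Real.exp_add]
  refine Real.exp_le_exp.2 ?_
  have h1 : -((∑ i, ∑ j, |θ.1.2⁻¹ i j|) * ‖x‖ ^ 2)
      ≤ ∑ i, ∑ j, θ.1.2⁻¹ i j * (-(1 / 2) * (x i * x j)) := by
    rw [Finset.sum_mul, ← Finset.sum_neg_distrib]
    refine Finset.sum_le_sum fun i _ => ?_
    rw [Finset.sum_mul, ← Finset.sum_neg_distrib]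
    refine Finset.sum_le_sum fun j _ => ?_
    refine neg_le_of_abs_le ?_
    rw [abs_mul]
    refine mul_le_mul_of_nonneg_left ?_ (abs_nonneg _)
    have h2 : |(-(1 / 2) : ℝ)| = 1 / 2 := by rw [abs_neg]; norm_num
    rw [abs_mul, h2]
    nlinarith [abs_coord_mul_le x i j, abs_nonneg (x i * x j)]
  have h2 : -((∑ i, |kernelLin θ.1 i|) * (1 + ‖x‖ ^ 2)) ≤ ∑ i, kernelLin θ.1 i * x i := by
    rw [Finset.sum_mul, ← Finset.sum_neg_distrib]
    refine Finset.sum_le_sum fun i _ => neg_le_of_abs_le ?_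
    rw [abs_mul]
    refine mul_le_mul_of_nonneg_left ?_ (abs_nonneg _)
    nlinarith [abs_coord_le_norm x i, sq_nonneg (‖x‖ - 1)]
  have h3 := neg_abs_le (Real.log (kernelConst θ.1))
  have h4 : 0 ≤ ∑ i, ∑ j, |θ.1.2⁻¹ i j| :=
    Finset.sum_nonneg fun i _ => Finset.sum_nonneg fun j _ => abs_nonneg _
  have h5 : 0 ≤ ‖x‖ ^ 2 := by positivity
  have h6 := (hC'.trans (le_max_left C 1))
  have h7 := mul_le_mul_of_nonneg_right h6 (by positivity : (0 : ℝ) ≤ 1 + ‖x‖ ^ 2)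
  nlinarith [mul_nonneg (abs_nonneg (Real.log (kernelConst θ.1))) h5]

/-! ### Tangent vectors and gradients -/

/-- The velocity `(a, S Σ + Σ S)` in the ambient space of the tangent vector `(a, S)`. -/
def tangentMap (θ u : Ambient d) : Ambient d := (u.1, u.2 * θ.2 + θ.2 * u.2)

/-- The Bures-Wasserstein gradient `(∇_m φ, 2 ∇_Σ φ)` as a function of the differential of `φ`. -/
def gradOf : (Ambient d →L[ℝ] ℝ) →L[ℝ] Ambient d :=
  LinearMap.toContinuousLinearMap
    { toFun := fun L => ((InnerProductSpace.toDual ℝ _).symm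
          (L.comp (ContinuousLinearMap.inl ℝ (EuclideanSpace ℝ (Fin d))
            (Matrix (Fin d) (Fin d) ℝ))),
        Matrix.of fun i j => L (0, Matrix.single i j 1) + L (0, Matrix.single j i 1))
      map_add' := fun L L' => by
        refine Prod.ext ?_ ?_
        · simp
        · ext i j; simp; ring
      map_smul' := fun r L => by
        refine Prod.ext ?_ ?_
        · simp [ContinuousLinearMap.smul_comp]
        · ext i j; simp; ring }

lemma gradOf_fst (L : Ambient d →L[ℝ] ℝ) : (gradOf L).1 = (InnerProductSpace.toDual ℝ _).symm
    (L.comp (ContinuousLinearMap.inl ℝ (EuclideanSpace ℝ (Fin d)) (Matrix (Fin d) (Fin d) ℝ))) :=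
  rfl

lemma gradOf_snd (L : Ambient d →L[ℝ] ℝ) (i j : Fin d) :
    (gradOf L).2 i j = L (0, Matrix.single i j 1) + L (0, Matrix.single j i 1) := rfl

lemma gradOf_isSymm (L : Ambient d →L[ℝ] ℝ) : (gradOf L).2.IsSymm := by
  ext i j; simp [gradOf_snd, add_comm]

lemma bwGrad_eq_gradOf {φ : Ambient d → ℝ} (hφ : Differentiable ℝ φ) (θ : BW d) :
    bwGrad φ θ = gradOf (fderiv ℝ φ θ.1) := by
  refine Prod.ext ?_ ?_
  · rw [gradOf_fst]
    change (InnerProductSpace.toDual ℝ _).symm (fderiv ℝ (fun m => φ (m, cov θ)) (mean θ)) = _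
    congr 1
    exact (HasFDerivAt.comp (x := mean θ) (f := fun m => (m, cov θ))
      ((hφ θ.1).hasFDerivAt) (hasFDerivAt_prodMk_left (mean θ) (cov θ))).fderiv
  · ext i j
    rw [gradOf_snd]
    change (2 : ℝ) * ((fderiv ℝ φ θ.1 (0, Matrix.single i j 1) +
      fderiv ℝ φ θ.1 (0, Matrix.single j i 1)) / 2) = _
    ring

/-- The Riemannian pairing with a gradient is the differential along the tangent vector. -/
lemma bwInner_gradOf (θ : BW d) (L : Ambient d →L[ℝ] ℝ) {u : Ambient d} (hu : u.2.IsSymm) :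
    bwInner θ (gradOf L) u = L (tangentMap θ.1 u) := by
  have hcov : (cov θ)ᵀ = cov θ := by simpa using θ.2.isHermitian.eq
  have h1 : tangentMap θ.1 u = (u.1, 0) + (0, u.2 * cov θ + cov θ * u.2) := by simp [tangentMap]
  have h2 : ∀ M : Matrix (Fin d) (Fin d) ℝ,
      L (0, M) = ∑ i, ∑ j, M i j * L (0, Matrix.single i j 1) := by
    intro M
    have h3 : ((0, M) : Ambient d) = ∑ i, ∑ j, M i j • (0, Matrix.single i j (1 : ℝ)) := by
      refine Prod.ext ?_ ?_
      · simp [Prod.fst_sum]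
      · simp only [Prod.snd_sum, Prod.smul_snd, Matrix.smul_single, smul_eq_mul, mul_one]
        exact Matrix.matrix_eq_sum_single M
    rw [h3, map_sum]
    refine Finset.sum_congr rfl fun i _ => ?_
    rw [map_sum]
    exact Finset.sum_congr rfl fun j _ => by rw [map_smul, smul_eq_mul]
  have h4 : ∀ i j, (u.2 * cov θ) i j = (cov θ * u.2) j i := fun i j => by
    rw [← Matrix.transpose_apply (cov θ * u.2), Matrix.transpose_mul, hcov, hu.eq]
  rw [h1, map_add, h2]
  unfold bwInner
  congr 1
  · rw [gradOf_fst, InnerProductSpace.toDual_symm_apply]; rfl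
  · rw [Matrix.mul_assoc, Matrix.trace]
    simp only [Matrix.diag_apply, Matrix.mul_apply (M := (gradOf L).2), gradOf_snd,
      Matrix.add_apply, h4, add_mul, Finset.sum_add_distrib]
    congr 1
    · exact Finset.sum_congr rfl fun i _ => Finset.sum_congr rfl fun j _ => mul_comm _ _
    · rw [Finset.sum_comm]
      exact Finset.sum_congr rfl fun i _ => Finset.sum_congr rfl fun j _ => mul_comm _ _

lemma bwInner_bwGrad {φ : Ambient d → ℝ} (hφ : Differentiable ℝ φ) (θ : BW d) {u : Ambient d}
    (hu : u.2.IsSymm) : bwInner θ (bwGrad φ θ) u = fderiv ℝ φ θ.1 (tangentMap θ.1 u) := by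
  rw [bwGrad_eq_gradOf hφ, bwInner_gradOf θ _ hu]

/-! ### The explicit differential of the Gaussian kernel -/

/-- The score `Σ⁻¹ (x - m)`. -/
def score (θ : BW d) (x : EuclideanSpace ℝ (Fin d)) : EuclideanSpace ℝ (Fin d) :=
  WithLp.toLp 2 ((cov θ)⁻¹ *ᵥ WithLp.ofLp (x - mean θ))

lemma cov_inv_isSymm (θ : BW d) : ((cov θ)⁻¹).IsSymm := by
  rw [Matrix.IsSymm, ← Matrix.conjTranspose_eq_transpose_of_trivial]
  exact θ.2.inv.isHermitian.eq

lemma isUnit_det_cov (θ : BW d) : IsUnit (cov θ).det := isUnit_iff_ne_zero.2 θ.2.det_pos.ne'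

lemma hasDerivAt_det_line (θ : BW d) (H : Matrix (Fin d) (Fin d) ℝ) :
    HasDerivAt (fun t : ℝ => (cov θ + t • H).det)
      ((cov θ).det * ((cov θ)⁻¹ * H).trace) 0 := by
  have h1 : (fun t : ℝ => (cov θ + t • H).det) =
      fun t => (cov θ).det * (1 + ((cov θ)⁻¹ * H).trace * t +
        ((Matrix.det (1 + (Polynomial.X : Polynomial ℝ) •
          ((cov θ)⁻¹ * H).map Polynomial.C)).divX.divX).eval t * t ^ 2) := by
    funext t
    rw [← Matrix.det_one_add_smul, ← Matrix.det_mul, Matrix.mul_add, Matrix.mul_smul,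
      Matrix.mul_nonsing_inv_cancel_left _ _ (isUnit_det_cov θ), Matrix.mul_one]
  rw [h1]
  have h2 := (((Matrix.det (1 + (Polynomial.X : Polynomial ℝ) •
          ((cov θ)⁻¹ * H).map Polynomial.C)).divX.divX).hasDerivAt 0).mul
    ((hasDerivAt_id (0 : ℝ)).pow 2)
  have h3 := ((((hasDerivAt_id (0 : ℝ)).const_mul ((cov θ)⁻¹ * H).trace).const_add 1).add
    h2).const_mul (cov θ).det
  refine h3.congr_deriv ?_
  simp

lemma hasDerivAt_inv_line (θ : BW d) (H : Matrix (Fin d) (Fin d) ℝ) (i j : Fin d) :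
    HasDerivAt (fun t : ℝ => (cov θ + t • H)⁻¹ i j)
      (-((cov θ)⁻¹ * H * (cov θ)⁻¹) i j) 0 := by
  have hline : ∀ i j, HasDerivAt (fun t : ℝ => (cov θ + t • H) i j) (H i j) 0 := fun i j => by
    simpa using ((hasDerivAt_id (0 : ℝ)).mul_const (H i j)).const_add (cov θ i j)
  have hdiff : ∀ i j, DifferentiableAt ℝ (fun t : ℝ => (cov θ + t • H)⁻¹ i j) 0 := by
    intro i j
    have h1 : DifferentiableAt ℝ (fun η : Ambient d => η.2⁻¹ i j) (θ.1 + (0 : ℝ) • (0, H)) :=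
      ((contDiffOn_inv_entry i j).contDiffAt ((isOpen_ne_fun contDiff_det.continuous
        continuous_const).mem_nhds (by simpa using θ.2.det_pos.ne'))).differentiableAt (by simp)
    have h2 : DifferentiableAt ℝ (fun t : ℝ => θ.1 + t • ((0, H) : Ambient d)) 0 := by fun_prop
    exact DifferentiableAt.comp (0 : ℝ) h1 h2
  set B : Matrix (Fin d) (Fin d) ℝ := Matrix.of fun i j =>
    deriv (fun t : ℝ => (cov θ + t • H)⁻¹ i j) 0 with hB
  have hBd : ∀ i j, HasDerivAt (fun t : ℝ => (cov θ + t • H)⁻¹ i j) (B i j) 0 :=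
    fun i j => (hdiff i j).hasDerivAt
  have hzero : H * (cov θ)⁻¹ + cov θ * B = 0 := by
    ext i k
    have h1 : HasDerivAt (fun t : ℝ => ∑ j, (cov θ + t • H) i j * (cov θ + t • H)⁻¹ j k)
        (∑ j, (H i j * (cov θ)⁻¹ j k + cov θ i j * B j k)) 0 := by
      refine HasDerivAt.fun_sum fun j _ => ((hline i j).mul (hBd j k)).congr_deriv ?_
      simp
    have h2 : (fun t : ℝ => ∑ j, (cov θ + t • H) i j * (cov θ + t • H)⁻¹ j k)
        =ᶠ[𝓝 0] fun _ => (1 : Matrix (Fin d) (Fin d) ℝ) i k := by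
      have h3 : ∀ᶠ t : ℝ in 𝓝 0, (cov θ + t • H).det ≠ 0 :=
        (hasDerivAt_det_line θ H).continuousAt.eventually_ne (by simpa using θ.2.det_pos.ne')
      filter_upwards [h3] with t ht
      rw [← Matrix.mul_apply, Matrix.mul_nonsing_inv _ (isUnit_iff_ne_zero.2 ht)]
    have h4 := h1.unique ((hasDerivAt_const (0 : ℝ) _).congr_of_eventuallyEq h2)
    rw [Finset.sum_add_distrib] at h4
    simpa [Matrix.mul_apply] using h4
  have hBeq : B = -((cov θ)⁻¹ * H * (cov θ)⁻¹) := by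
    have h5 : cov θ * B = -(H * (cov θ)⁻¹) := by rw [eq_neg_iff_add_eq_zero, add_comm, hzero]
    rw [← Matrix.nonsing_inv_mul_cancel_left (cov θ) B (isUnit_det_cov θ), h5, Matrix.mul_neg,
      Matrix.mul_assoc]
  have := hBd i j
  rw [hBeq] at this
  exact this

/-- The differential of the Gaussian density with respect to its mean and covariance. -/
lemma kernelDeriv_apply (θ : BW d) (x : EuclideanSpace ℝ (Fin d)) (u : Ambient d) :
    kernelDeriv θ.1 x u = (inner ℝ (score θ x) u.1 +
      (1 / 2) * (WithLp.ofLp (score θ x) ⬝ᵥ (u.2 *ᵥ WithLp.ofLp (score θ x)) -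
        ((cov θ)⁻¹ * u.2).trace)) * gaussianDensity θ x := by
  obtain ⟨a, H⟩ := u
  set A := (cov θ)⁻¹ with hA
  set y := WithLp.ofLp (x - mean θ) with hy
  have hdet := θ.2.det_pos
  have hl : HasDerivAt (fun t : ℝ => θ.1 + t • ((a, H) : Ambient d)) (a, H) 0 := by
    simpa using ((hasDerivAt_id (0 : ℝ)).smul_const ((a, H) : Ambient d)).const_add θ.1
  have h1 : HasDerivAt (fun t : ℝ => gaussKernel (θ.1 + t • ((a, H) : Ambient d)) x)
      (kernelDeriv θ.1 x (a, H)) 0 := by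
    have h2 : HasFDerivAt (fun θ' => gaussKernel θ' x) (kernelDeriv θ.1 x)
        (θ.1 + (0 : ℝ) • ((a, H) : Ambient d)) := by
      simpa using hasFDerivAt_gaussKernel (θ := θ.1) hdet x
    exact h2.comp_hasDerivAt (0 : ℝ) hl
  -- the quadratic form along the line
  have hq : HasDerivAt (fun t : ℝ => WithLp.ofLp (x - (mean θ + t • a)) ⬝ᵥ
      ((cov θ + t • H)⁻¹ *ᵥ WithLp.ofLp (x - (mean θ + t • a))))
      (-(2 * inner ℝ (score θ x) a) -
        WithLp.ofLp (score θ x) ⬝ᵥ (H *ᵥ WithLp.ofLp (score θ x))) 0 := by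
    have hyd : ∀ i, HasDerivAt (fun t : ℝ => (x - (mean θ + t • a)) i) (-(a i)) 0 := fun i => by
      simpa using (((hasDerivAt_id (0 : ℝ)).mul_const (a i)).const_add (mean θ i)).const_sub (x i)
    have h2 : HasDerivAt (fun t : ℝ => ∑ i, (x - (mean θ + t • a)) i *
        ∑ j, (cov θ + t • H)⁻¹ i j * (x - (mean θ + t • a)) j)
        (∑ i, (-(a i) * (∑ j, A i j * y j) +
          y i * ∑ j, (-((A * H * A) i j) * y j + A i j * -(a j)))) 0 := by
      refine HasDerivAt.fun_sum fun i _ => ?_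
      refine ((hyd i).mul (HasDerivAt.fun_sum fun j _ =>
        (hasDerivAt_inv_line θ H i j).mul (hyd j))).congr_deriv ?_
      simp [hA, hy]
    refine h2.congr_deriv ?_
    have h3 : ∑ i, (-(a i) * (∑ j, A i j * y j) +
          y i * ∑ j, (-((A * H * A) i j) * y j + A i j * -(a j)))
        = -(WithLp.ofLp a ⬝ᵥ (A *ᵥ y)) - y ⬝ᵥ ((A * H * A) *ᵥ y) - y ⬝ᵥ (A *ᵥ WithLp.ofLp a) := by
      simp only [dotProduct, Matrix.mulVec, Finset.sum_add_distrib, mul_add, neg_mul, mul_neg,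
        Finset.sum_neg_distrib]
      ring
    have h4 : ∀ v w : Fin d → ℝ, v ⬝ᵥ (A *ᵥ w) = (A *ᵥ v) ⬝ᵥ w := fun v w => by
      rw [Matrix.dotProduct_mulVec, ← Matrix.mulVec_transpose, (cov_inv_isSymm θ).eq]
    have h5 : inner ℝ (score θ x) a = (A *ᵥ y) ⬝ᵥ WithLp.ofLp a := by
      rw [PiLp.inner_apply]
      simp [score, dotProduct, hA, hy, mul_comm]
    rw [h3, h5, ← Matrix.mulVec_mulVec, ← Matrix.mulVec_mulVec, h4 y, h4 y,
      dotProduct_comm (WithLp.ofLp a)]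
    change _ = -(2 * (A *ᵥ y) ⬝ᵥ WithLp.ofLp a) - (A *ᵥ y) ⬝ᵥ (H *ᵥ (A *ᵥ y))
    ring
  have hpos : 0 < (2 * Real.pi) ^ d * (cov θ).det := mul_pos (by positivity) hdet
  have hs : HasDerivAt (fun t : ℝ => (√((2 * Real.pi) ^ d * (cov θ + t • H).det))⁻¹)
      (-(1 / 2) * (A * H).trace * (√((2 * Real.pi) ^ d * (cov θ).det))⁻¹) 0 := by
    have h2 := ((hasDerivAt_det_line θ H).const_mul ((2 * Real.pi) ^ d)).sqrt
      (by simpa using hpos.ne')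
    have h3 := h2.inv (by simpa using (Real.sqrt_pos.2 hpos).ne')
    refine h3.congr_deriv ?_
    simp only [zero_smul, add_zero]
    have h4 := Real.sq_sqrt hpos.le
    have h5 : √((2 * Real.pi) ^ d * (cov θ).det) ≠ 0 := (Real.sqrt_pos.2 hpos).ne'
    have h6 : (2 * Real.pi) ^ d * ((cov θ).det * (A * H).trace)
        = √((2 * Real.pi) ^ d * (cov θ).det) ^ 2 * (A * H).trace := by rw [h4]; ring
    rw [h6]
    field_simp
  have h7 := hs.mul (hq.const_mul (-(1 / 2))).exp
  refine (h1.unique h7).trans ?_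
  simp only [zero_smul, add_zero]
  unfold gaussianDensity
  ring

/-! ### Gaussian weights -/

/-- The centred isotropic Gaussian whose density is proportional to `exp (-c |x|²)`. -/
def isoGaussian (d : ℕ) {c : ℝ} (hc : 0 < c) : BW d :=
  ⟨(0, (2 * c)⁻¹ • (1 : Matrix (Fin d) (Fin d) ℝ)), Matrix.PosDef.one.smul (by positivity)⟩

lemma gaussianDensity_isoGaussian {c : ℝ} (hc : 0 < c) :
    ∃ k > 0, ∀ x : EuclideanSpace ℝ (Fin d),
      gaussianDensity (isoGaussian d hc) x = k * Real.exp (-(c * ‖x‖ ^ 2)) := by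
  have hinv : ((2 * c)⁻¹ • (1 : Matrix (Fin d) (Fin d) ℝ))⁻¹ = (2 * c) • 1 := by
    refine Matrix.inv_eq_right_inv ?_
    rw [Matrix.smul_mul, Matrix.one_mul, smul_smul, inv_mul_cancel₀ (by positivity), one_smul]
  refine ⟨(√((2 * Real.pi) ^ d * (cov (isoGaussian d hc)).det))⁻¹, ?_, fun x => ?_⟩
  · have := (isoGaussian d hc).2.det_pos
    positivity
  · unfold gaussianDensity
    congr 2
    change -(1 / 2) * (WithLp.ofLp (x - 0) ⬝ᵥ
      (((2 * c)⁻¹ • (1 : Matrix (Fin d) (Fin d) ℝ))⁻¹ *ᵥ WithLp.ofLp (x - 0))) = _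
    rw [hinv, sub_zero, Matrix.smul_mulVec, Matrix.one_mulVec, dotProduct_smul,
      EuclideanSpace.real_norm_sq_eq]
    simp only [dotProduct, smul_eq_mul, sq]
    ring

/-- Integrability under all Gaussians gives integrability against all weights `exp (-c |x|²)`. -/
lemma integrable_exp_smul_of_gaussian {F : Type*} [NormedAddCommGroup F] [NormedSpace ℝ F]
    {f : EuclideanSpace ℝ (Fin d) → F} (hf : ∀ θ : BW d, Integrable f (gaussian θ)) {c : ℝ}
    (hc : 0 < c) : Integrable fun x => Real.exp (-(c * ‖x‖ ^ 2)) • f x := by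
  obtain ⟨k, hk, h⟩ := gaussianDensity_isoGaussian (d := d) hc
  have h1 := ((integrable_gaussian_iff _ _).1 (hf (isoGaussian d hc))).smul k⁻¹
  refine h1.congr (ae_of_all _ fun x => ?_)
  simp only [Pi.smul_apply, h, smul_smul, ← mul_assoc]
  rw [inv_mul_cancel₀ hk.ne', one_mul]

lemma integrable_exp_neg_mul_sq {c : ℝ} (hc : 0 < c) :
    Integrable fun x : EuclideanSpace ℝ (Fin d) => Real.exp (-(c * ‖x‖ ^ 2)) := by
  simpa using integrable_exp_smul_of_gaussian (d := d) (f := fun _ => (1 : ℝ))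
    (fun θ => integrable_const _) hc

lemma one_add_mul_exp_le {c : ℝ} (hc : 0 < c) {s : ℝ} (hs : 0 ≤ s) :
    (1 + s) * Real.exp (-(c * s)) ≤ (1 + 2 / c) * Real.exp (-(c / 2 * s)) := by
  have h1 : c / 2 * s + 1 ≤ Real.exp (c / 2 * s) := Real.add_one_le_exp _
  have h2 : 1 ≤ Real.exp (c / 2 * s) := Real.one_le_exp (by positivity)
  have h3 : 1 + s ≤ (1 + 2 / c) * Real.exp (c / 2 * s) := by
    have h4 : s ≤ 2 / c * Real.exp (c / 2 * s) := by
      rw [div_mul_eq_mul_div, le_div_iff₀ hc]; nlinarith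
    nlinarith
  calc (1 + s) * Real.exp (-(c * s))
      ≤ ((1 + 2 / c) * Real.exp (c / 2 * s)) * Real.exp (-(c * s)) := by gcongr
    _ = (1 + 2 / c) * Real.exp (-(c / 2 * s)) := by
      rw [mul_assoc, ← Real.exp_add]; congr 2; ring

lemma integrable_one_add_sq_mul_exp {c : ℝ} (hc : 0 < c) :
    Integrable fun x : EuclideanSpace ℝ (Fin d) =>
      (1 + ‖x‖ ^ 2) * Real.exp (-(c * ‖x‖ ^ 2)) := by
  refine ((integrable_exp_neg_mul_sq (d := d) (half_pos hc)).const_mul (1 + 2 / c)).mono'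
    (by fun_prop) (ae_of_all _ fun x => ?_)
  rw [Real.norm_of_nonneg (by positivity)]
  exact one_add_mul_exp_le hc (by positivity)

/-! ### Mixture densities and the Kullback-Leibler functional -/

lemma continuous_gaussianDensity_uncurry :
    Continuous fun p : BW d × EuclideanSpace ℝ (Fin d) => gaussianDensity p.1 p.2 :=
  contDiffOn_gaussKernel_uncurry.continuousOn.comp_continuous
    (f := fun p : BW d × EuclideanSpace ℝ (Fin d) => (p.1.1, p.2)) (by fun_prop)
    fun p => p.1.2.det_pos

lemma measurable_gaussianDensity_uncurry :
    Measurable fun p : BW d × EuclideanSpace ℝ (Fin d) => gaussianDensity p.1 p.2 :=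
  continuous_gaussianDensity_uncurry.measurable

lemma measurable_gaussianDensity_left (x : EuclideanSpace ℝ (Fin d)) :
    Measurable fun θ : BW d => gaussianDensity θ x :=
  measurable_gaussianDensity_uncurry.comp (by fun_prop : Measurable fun θ : BW d => (θ, x))

lemma mixtureDensity_eq_toReal (μ : Measure (BW d)) (x : EuclideanSpace ℝ (Fin d)) :
    mixtureDensity μ x = (∫⁻ θ, ENNReal.ofReal (gaussianDensity θ x) ∂μ).toReal :=
  integral_eq_lintegral_of_nonneg_ae (ae_of_all _ fun θ => (gaussianDensity_pos θ x).le)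
    (measurable_gaussianDensity_left x).aestronglyMeasurable

lemma measurable_lintegral_gaussianDensity (μ : Measure (BW d)) [SFinite μ] :
    Measurable fun x => ∫⁻ θ, ENNReal.ofReal (gaussianDensity θ x) ∂μ :=
  Measurable.lintegral_prod_left' measurable_gaussianDensity_uncurry.ennreal_ofReal

lemma measurable_mixtureDensity (μ : Measure (BW d)) [SFinite μ] :
    Measurable (mixtureDensity μ) := by
  have := (measurable_lintegral_gaussianDensity μ).ennreal_toReal
  simpa only [← mixtureDensity_eq_toReal] using this

lemma mixtureDensity_nonneg (μ : Measure (BW d)) (x : EuclideanSpace ℝ (Fin d)) :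
    0 ≤ mixtureDensity μ x := by rw [mixtureDensity_eq_toReal]; positivity

lemma lintegral_lintegral_gaussianDensity (μ : Measure (BW d)) [SFinite μ] :
    ∫⁻ x, ∫⁻ θ, ENNReal.ofReal (gaussianDensity θ x) ∂μ = μ univ := by
  rw [lintegral_lintegral_swap]
  · simp [lintegral_gaussianDensity]
  · exact (measurable_gaussianDensity_uncurry.comp measurable_swap).ennreal_ofReal.aemeasurable

lemma ae_integrable_gaussianDensity (μ : Measure (BW d)) [IsFiniteMeasure μ] :
    ∀ᵐ x : EuclideanSpace ℝ (Fin d), Integrable (fun θ => gaussianDensity θ x) μ := by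
  have h := ae_lt_top (measurable_lintegral_gaussianDensity μ)
    (by rw [lintegral_lintegral_gaussianDensity]; exact measure_ne_top μ univ)
  filter_upwards [h] with x hx
  refine ⟨(measurable_gaussianDensity_left x).aestronglyMeasurable, ?_⟩
  rw [hasFiniteIntegral_iff_ofReal (ae_of_all _ fun θ => (gaussianDensity_pos θ x).le)]
  exact hx

lemma lintegral_ofReal_gaussianDensity {μ : Measure (BW d)} {x : EuclideanSpace ℝ (Fin d)}
    (h : Integrable (fun θ => gaussianDensity θ x) μ) :
    ∫⁻ θ, ENNReal.ofReal (gaussianDensity θ x) ∂μ = ENNReal.ofReal (mixtureDensity μ x) :=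
  (ofReal_integral_eq_lintegral_ofReal h
    (ae_of_all _ fun θ => (gaussianDensity_pos θ x).le)).symm

lemma lintegral_ofReal_mixtureDensity (μ : Measure (BW d)) [IsFiniteMeasure μ] :
    ∫⁻ x, ENNReal.ofReal (mixtureDensity μ x) = μ univ := by
  rw [← lintegral_lintegral_gaussianDensity]
  refine lintegral_congr_ae ?_
  filter_upwards [ae_integrable_gaussianDensity μ] with x hx
  exact (lintegral_ofReal_gaussianDensity hx).symm

lemma integrable_mixtureDensity (μ : Measure (BW d)) [IsFiniteMeasure μ] :
    Integrable (mixtureDensity μ) := by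
  refine ⟨(measurable_mixtureDensity μ).aestronglyMeasurable, ?_⟩
  rw [hasFiniteIntegral_iff_ofReal (ae_of_all _ fun θ => mixtureDensity_nonneg μ θ),
    lintegral_ofReal_mixtureDensity]
  exact measure_lt_top μ univ

/-- A mixture density has a Gaussian lower bound, governed by a compact set of parameters. -/
lemma le_mixtureDensity {μ : Measure (BW d)} [IsFiniteMeasure μ] {K : Set (BW d)}
    (hK : MeasurableSet K) {x : EuclideanSpace ℝ (Fin d)} {b : ℝ}
    (hb : ∀ θ ∈ K, b ≤ gaussianDensity θ x)
    (hx : Integrable (fun θ => gaussianDensity θ x) μ) :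
    μ.real K * b ≤ mixtureDensity μ x := by
  have h1 : ∫ θ in K, b ∂μ ≤ ∫ θ in K, gaussianDensity θ x ∂μ :=
    setIntegral_mono_on (integrable_const _) hx.integrableOn hK hb
  have h2 : ∫ θ in K, gaussianDensity θ x ∂μ ≤ mixtureDensity μ x :=
    setIntegral_le_integral hx (ae_of_all _ fun θ => (gaussianDensity_pos θ x).le)
  simpa using h1.trans h2

lemma mixtureDensity_pos {μ : Measure (BW d)} [IsProbabilityMeasure μ]
    {x : EuclideanSpace ℝ (Fin d)} (hx : Integrable (fun θ => gaussianDensity θ x) μ) :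
    0 < mixtureDensity μ x := by
  unfold mixtureDensity
  rw [integral_pos_iff_support_of_nonneg (fun θ => (gaussianDensity_pos θ x).le) hx]
  have : Function.support (fun θ : BW d => gaussianDensity θ x) = univ := by
    ext θ; simp [(gaussianDensity_pos θ x).ne']
  simp [this]

section Target

variable {V : EuclideanSpace ℝ (Fin d) → ℝ}

lemma integral_exp_neg_pos (hexp : Integrable (fun x => Real.exp (-V x)) volume) :
    0 < ∫ y, Real.exp (-V y) := integral_exp_pos hexp

lemma targetDensity_pos (hexp : Integrable (fun x => Real.exp (-V x)) volume)
    (x : EuclideanSpace ℝ (Fin d)) : 0 < targetDensity V x :=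
  div_pos (Real.exp_pos _) (integral_exp_neg_pos hexp)

lemma integrable_targetDensity (hexp : Integrable (fun x => Real.exp (-V x)) volume) :
    Integrable (targetDensity V) := hexp.div_const _

lemma measurable_targetDensity (hV : Continuous V) : Measurable (targetDensity V) :=
  ((Real.continuous_exp.comp hV.neg).div_const _).measurable

lemma logRatio_eq (hexp : Integrable (fun x => Real.exp (-V x)) volume) {μ : Measure (BW d)}
    {x : EuclideanSpace ℝ (Fin d)} (hx : 0 < mixtureDensity μ x) :
    logRatio V μ x = Real.log (mixtureDensity μ x) + V x + Real.log (∫ y, Real.exp (-V y)) := by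
  unfold logRatio
  rw [Real.log_div hx.ne' (targetDensity_pos hexp x).ne', targetDensity,
    Real.log_div (Real.exp_pos _).ne' (integral_exp_neg_pos hexp).ne', Real.log_exp]
  ring

/-- The integrand `π klFun (p / π) = p log (p / π) + π - p` of the Kullback-Leibler divergence. -/
def klIntegrand (V : EuclideanSpace ℝ (Fin d) → ℝ) (μ : Measure (BW d))
    (x : EuclideanSpace ℝ (Fin d)) : ℝ :=
  targetDensity V x * InformationTheory.klFun (mixtureDensity μ x / targetDensity V x)

lemma klIntegrand_nonneg (hexp : Integrable (fun x => Real.exp (-V x)) volume)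
    (μ : Measure (BW d)) (x : EuclideanSpace ℝ (Fin d)) : 0 ≤ klIntegrand V μ x :=
  mul_nonneg (targetDensity_pos hexp x).le (InformationTheory.klFun_nonneg
    (div_nonneg (mixtureDensity_nonneg μ x) (targetDensity_pos hexp x).le))

lemma klIntegrand_eq (hexp : Integrable (fun x => Real.exp (-V x)) volume)
    (μ : Measure (BW d)) (x : EuclideanSpace ℝ (Fin d)) :
    klIntegrand V μ x
      = mixtureDensity μ x * logRatio V μ x + targetDensity V x - mixtureDensity μ x := by
  have := (targetDensity_pos hexp x).ne'
  unfold klIntegrand InformationTheory.klFun logRatio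
  field_simp

lemma measurable_logRatio (hV : Continuous V) (μ : Measure (BW d)) [SFinite μ] :
    Measurable (logRatio V μ) :=
  ((measurable_mixtureDensity μ).div (measurable_targetDensity hV)).log

lemma measurable_klIntegrand (hV : Continuous V) (μ : Measure (BW d)) [SFinite μ] :
    Measurable (klIntegrand V μ) :=
  (measurable_targetDensity hV).mul (InformationTheory.measurable_klFun.comp
    ((measurable_mixtureDensity μ).div (measurable_targetDensity hV)))

lemma klFunctional_eq (hV : Continuous V) (hexp : Integrable (fun x => Real.exp (-V x)) volume)
    (μ : Measure (BW d)) [IsFiniteMeasure μ] :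
    klFunctional V μ = ∫⁻ x, ENNReal.ofReal (klIntegrand V μ x) := by
  set m : EuclideanSpace ℝ (Fin d) → ℝ≥0∞ :=
    fun x => ∫⁻ θ, ENNReal.ofReal (gaussianDensity θ x) ∂μ with hm
  have hmm : Measurable m := measurable_lintegral_gaussianDensity μ
  set q : EuclideanSpace ℝ (Fin d) → ℝ≥0∞ := fun x => ENNReal.ofReal (targetDensity V x) with hq
  have hqm : Measurable q := (measurable_targetDensity hV).ennreal_ofReal
  have hq0 : ∀ x, q x ≠ 0 := fun x => by simpa [hq] using targetDensity_pos hexp x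
  have hqt : ∀ x, q x ≠ ⊤ := fun x => ENNReal.ofReal_ne_top
  have hmix : mixture μ = (target V).withDensity (fun x => m x / q x) := by
    refine Eq.trans ?_ (withDensity_mul volume hqm (hmm.div hqm))
    unfold mixture
    congr 1
    ext x
    exact (ENNReal.mul_div_cancel (hq0 x) (hqt x)).symm
  have : IsFiniteMeasure (target V) :=
    isFiniteMeasure_withDensity_ofReal (integrable_targetDensity hexp).2
  have : IsFiniteMeasure (mixture μ) := isFiniteMeasure_withDensity (by
    rw [lintegral_lintegral_gaussianDensity]; exact measure_ne_top μ univ)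
  unfold klFunctional
  rw [InformationTheory.klDiv_eq_lintegral_klFun_of_ac
    (hmix ▸ withDensity_absolutelyContinuous _ _)]
  have h1 : (mixture μ).rnDeriv (target V) =ᵐ[target V] fun x => m x / q x := by
    rw [hmix]; exact Measure.rnDeriv_withDensity _ (hmm.div hqm)
  rw [lintegral_congr_ae (g := fun x =>
    ENNReal.ofReal (InformationTheory.klFun ((m x / q x).toReal)))
    (h1.mono fun x hx => by simp only [hx])]
  refine (lintegral_withDensity_eq_lintegral_mul volume hqm
    (InformationTheory.measurable_klFun.comp
      (hmm.div hqm).ennreal_toReal).ennreal_ofReal).trans ?_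
  refine lintegral_congr fun x => ?_
  have hx : (m x / q x).toReal = mixtureDensity μ x / targetDensity V x := by
    rw [ENNReal.toReal_div, mixtureDensity_eq_toReal,
      ENNReal.toReal_ofReal (targetDensity_pos hexp x).le]
  change q x * ENNReal.ofReal (InformationTheory.klFun ((m x / q x).toReal)) = _
  rw [hx, klIntegrand, ENNReal.ofReal_mul (targetDensity_pos hexp x).le]

lemma klFunctional_ne_top_iff (hV : Continuous V)
    (hexp : Integrable (fun x => Real.exp (-V x)) volume)
    (μ : Measure (BW d)) [IsFiniteMeasure μ] :
    klFunctional V μ ≠ ⊤ ↔ Integrable (klIntegrand V μ) := by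
  rw [klFunctional_eq hV hexp]
  exact lintegral_ofReal_ne_top_iff_integrable (measurable_klIntegrand hV μ).aestronglyMeasurable
    (ae_of_all _ fun x => klIntegrand_nonneg hexp μ x)

lemma toReal_klFunctional (hV : Continuous V)
    (hexp : Integrable (fun x => Real.exp (-V x)) volume)
    (μ : Measure (BW d)) [IsFiniteMeasure μ] :
    (klFunctional V μ).toReal = ∫ x, klIntegrand V μ x := by
  rw [klFunctional_eq hV hexp]
  exact (integral_eq_lintegral_of_nonneg_ae (ae_of_all _ fun x => klIntegrand_nonneg hexp μ x)
    (measurable_klIntegrand hV μ).aestronglyMeasurable).symm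

end Target

/-! ### Compact exhaustion and weighted integrability of the log-ratio -/

lemma isClosed_posSemidef : IsClosed {M : Matrix (Fin d) (Fin d) ℝ | M.PosSemidef} := by
  have : {M : Matrix (Fin d) (Fin d) ℝ | M.PosSemidef} = {M | Mᴴ = M} ∩
      ⋂ x : Fin d → ℝ, {M | 0 ≤ star x ⬝ᵥ (M *ᵥ x)} := by
    ext M
    simp only [mem_ofPred_eq, Matrix.posSemidef_iff_dotProduct_mulVec, mem_inter_iff, mem_iInter]
    rfl
  rw [this]
  have h : ∀ x y : Fin d → ℝ, Continuous fun M : Matrix (Fin d) (Fin d) ℝ => x ⬝ᵥ (M *ᵥ y) := by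
    intro x y
    simp only [dotProduct, Matrix.mulVec]
    refine continuous_finsetSum _ fun i _ => continuous_const.mul (continuous_finsetSum _ fun j _ =>
      (Continuous.mul ?_ continuous_const))
    exact (continuous_apply j).comp (continuous_apply (A := fun _ : Fin d => Fin d → ℝ) i)
  refine IsClosed.inter ?_ (isClosed_iInter fun x => isClosed_le continuous_const (h _ _))
  have h2 : ∀ i j, Continuous fun M : Matrix (Fin d) (Fin d) ℝ => M i j := fun i j =>
    (continuous_apply j).comp (continuous_apply (A := fun _ : Fin d => Fin d → ℝ) i)
  have : {M : Matrix (Fin d) (Fin d) ℝ | Mᴴ = M} = ⋂ i, ⋂ j, {M | M j i = M i j} := by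
    ext M
    simp only [mem_ofPred_eq, mem_iInter]
    constructor
    · intro h i j
      simpa using congrFun (congrFun h i) j
    · intro h
      ext i j
      simpa using h i j
  rw [this]
  exact isClosed_iInter fun i => isClosed_iInter fun j => isClosed_eq (h2 j i) (h2 i j)

/-- The parameters with determinant at least `δ` and norm at most `R`. -/
def paramBox (d : ℕ) (δ R : ℝ) : Set (BW d) := {θ | δ ≤ (cov θ).det ∧ ‖θ.1‖ ≤ R}

lemma isCompact_paramBox {δ : ℝ} (hδ : 0 < δ) (R : ℝ) : IsCompact (paramBox d δ R) := by
  have hdet : Continuous fun θ : Ambient d => θ.2.det := contDiff_det.continuous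
  have h : (Subtype.val '' paramBox d δ R : Set (Ambient d)) =
      {θ | θ.2.PosSemidef} ∩ {θ | δ ≤ θ.2.det} ∩ Metric.closedBall 0 R := by
    ext θ
    simp only [mem_image, mem_inter_iff, mem_ofPred_eq, mem_closedBall_zero_iff, paramBox]
    constructor
    · rintro ⟨θ, ⟨h1, h2⟩, rfl⟩
      exact ⟨⟨θ.2.posSemidef, h1⟩, h2⟩
    · rintro ⟨⟨h1, h2⟩, h3⟩
      refine ⟨⟨θ, ?_⟩, ⟨h2, h3⟩, rfl⟩
      refine h1.posDef_iff_isUnit.2 ?_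
      exact (Matrix.isUnit_iff_isUnit_det _).2 (isUnit_iff_ne_zero.2 (hδ.trans_le h2).ne')
  rw [Subtype.isCompact_iff, h]
  exact (isCompact_closedBall _ _).inter_left
    ((isClosed_posSemidef.preimage continuous_snd).inter (isClosed_le continuous_const hdet))

lemma exists_subset_paramBox {K : Set (BW d)} (hK : IsCompact K) :
    ∃ δ > 0, ∃ R > 0, ∀ θ ∈ K, δ < (cov θ).det ∧ ‖θ.1‖ < R := by
  have hdet : Continuous fun θ : BW d => ((cov θ).det)⁻¹ :=
    (contDiff_det.continuous.comp continuous_subtype_val).inv₀ fun θ => θ.2.det_pos.ne'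
  obtain ⟨C, hC⟩ := hK.exists_bound_of_continuousOn hdet.continuousOn
  obtain ⟨R, hR⟩ := hK.exists_bound_of_continuousOn
    (continuous_subtype_val (p := fun θ : Ambient d => θ.2.PosDef)).continuousOn
  refine ⟨(|C| + 1)⁻¹, by positivity, |R| + 1, by positivity, fun θ hθ => ⟨?_, ?_⟩⟩
  · have h := θ.2.det_pos
    rw [inv_lt_comm₀ (by positivity) h]
    calc ((cov θ).det)⁻¹ ≤ C := (le_abs_self _).trans (hC θ hθ)
      _ < |C| + 1 := by linarith [le_abs_self C]
  · linarith [hR θ hθ, le_abs_self R]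

lemma iUnion_paramBox : ⋃ n : ℕ, paramBox d ((n : ℝ) + 1)⁻¹ n = univ := by
  refine eq_univ_of_forall fun θ => mem_iUnion.2 ?_
  obtain ⟨δ, hδ, R, hR, h⟩ := exists_subset_paramBox (isCompact_singleton (x := θ))
  obtain ⟨h1, h2⟩ := h θ rfl
  obtain ⟨n, hn⟩ := exists_nat_ge (max R δ⁻¹)
  refine ⟨n, ?_, h2.le.trans ((le_max_left _ _).trans hn)⟩
  refine le_trans ?_ h1.le
  rw [inv_le_comm₀ (by positivity) hδ]
  linarith [(le_max_right R δ⁻¹).trans hn]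

lemma monotone_paramBox : Monotone fun n : ℕ => paramBox d ((n : ℝ) + 1)⁻¹ n := by
  intro m n hmn θ hθ
  have : (m : ℝ) ≤ n := by exact_mod_cast hmn
  refine ⟨le_trans ?_ hθ.1, hθ.2.trans this⟩
  exact inv_anti₀ (by positivity) (by linarith)

lemma exists_isCompact_lt_real (μ : Measure (BW d)) [IsFiniteMeasure μ] {a : ℝ}
    (ha : a < μ.real univ) : ∃ K : Set (BW d), IsCompact K ∧ a < μ.real K := by
  have h := tendsto_measure_iUnion_atTop (μ := μ) (monotone_paramBox (d := d))
  rw [iUnion_paramBox] at h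
  have h2 := (ENNReal.tendsto_toReal (measure_ne_top μ univ)).comp h
  obtain ⟨n, hn⟩ := (h2.eventually (lt_mem_nhds ha)).exists
  exact ⟨_, isCompact_paramBox (by positivity) _, hn⟩

/-- A Gaussian lower bound for all mixtures with half of their mass in a compact set. -/
lemma exists_mixtureDensity_lower_bound {K : Set (BW d)} (hK : IsCompact K) :
    ∃ C > 0, ∀ (μ : Measure (BW d)) [IsFiniteMeasure μ], 1 / 2 ≤ μ.real K →
      ∀ x, Integrable (fun θ => gaussianDensity θ x) μ →
        Real.exp (-(C * (1 + ‖x‖ ^ 2))) ≤ mixtureDensity μ x := by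
  obtain ⟨C, hC, h⟩ := exists_kernel_lower_bound hK
  refine ⟨C + Real.log 2, by positivity, fun μ _ hμ x hx => ?_⟩
  refine le_trans ?_ (le_mixtureDensity hK.measurableSet (fun θ hθ => h θ hθ x) hx)
  have h1 : Real.exp (-((C + Real.log 2) * (1 + ‖x‖ ^ 2)))
      ≤ 1 / 2 * Real.exp (-(C * (1 + ‖x‖ ^ 2))) := by
    rw [one_div, ← Real.exp_log (show (0 : ℝ) < 2 by norm_num), ← Real.exp_neg, ← Real.exp_add,
      Real.exp_log (by norm_num)]
    refine Real.exp_le_exp.2 ?_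
    have : 0 ≤ Real.log 2 * ‖x‖ ^ 2 := by positivity
    nlinarith
  exact h1.trans (by gcongr)

section Target

variable {V : EuclideanSpace ℝ (Fin d) → ℝ}

lemma abs_logRatio_le (hexp : Integrable (fun x => Real.exp (-V x)) volume) {μ : Measure (BW d)}
    {C : ℝ} {x : EuclideanSpace ℝ (Fin d)}
    (hx : Real.exp (-(C * (1 + ‖x‖ ^ 2))) ≤ mixtureDensity μ x) :
    |logRatio V μ x| ≤ mixtureDensity μ x + |C| * (1 + ‖x‖ ^ 2) + |V x|
      + |Real.log (∫ y, Real.exp (-V y))| := by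
  have hp := (Real.exp_pos _).trans_le hx
  rw [logRatio_eq hexp hp]
  have h1 : |Real.log (mixtureDensity μ x)| ≤ mixtureDensity μ x + |C| * (1 + ‖x‖ ^ 2) := by
    have h2 := Real.log_le_sub_one_of_pos hp
    have h3 : -(C * (1 + ‖x‖ ^ 2)) ≤ Real.log (mixtureDensity μ x) := by
      rw [← Real.log_exp (-(C * (1 + ‖x‖ ^ 2)))]; exact Real.log_le_log (Real.exp_pos _) hx
    have h4 : C * (1 + ‖x‖ ^ 2) ≤ |C| * (1 + ‖x‖ ^ 2) := by gcongr; exact le_abs_self C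
    have h5 : 0 ≤ |C| * (1 + ‖x‖ ^ 2) := by positivity
    exact abs_le.2 ⟨by linarith, by linarith⟩
  exact (abs_add_three _ _ _).trans (by linarith)

lemma exists_mixtureDensity_ge (μ : Measure (BW d)) [IsProbabilityMeasure μ] :
    ∃ C > 0, ∀ x, Integrable (fun θ => gaussianDensity θ x) μ →
        Real.exp (-(C * (1 + ‖x‖ ^ 2))) ≤ mixtureDensity μ x := by
  obtain ⟨K, hK, h⟩ := exists_isCompact_lt_real μ (a := 1 / 2) (by simp; norm_num)
  obtain ⟨C, hC, h2⟩ := exists_mixtureDensity_lower_bound hK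
  exact ⟨C, hC, h2 μ h.le⟩

/-- The log-ratio is integrable against all Gaussian weights. -/
lemma integrable_exp_mul_logRatio (hV : Continuous V)
    (hVint : ∀ θ : BW d, Integrable V (gaussian θ))
    (hexp : Integrable (fun x => Real.exp (-V x)) volume) (μ : Measure (BW d))
    [IsProbabilityMeasure μ] {c : ℝ} (hc : 0 < c) :
    Integrable fun x => Real.exp (-(c * ‖x‖ ^ 2)) * logRatio V μ x := by
  obtain ⟨C, -, h⟩ := exists_mixtureDensity_ge μ
  have hbound : Integrable fun x => mixtureDensity μ x
      + |C| * ((1 + ‖x‖ ^ 2) * Real.exp (-(c * ‖x‖ ^ 2)))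
      + ‖Real.exp (-(c * ‖x‖ ^ 2)) • V x‖
      + |Real.log (∫ y, Real.exp (-V y))| * Real.exp (-(c * ‖x‖ ^ 2)) :=
    (((integrable_mixtureDensity μ).add ((integrable_one_add_sq_mul_exp hc).const_mul _)).add
      (integrable_exp_smul_of_gaussian hVint hc).norm).add
      ((integrable_exp_neg_mul_sq hc).const_mul _)
  refine hbound.mono' ?_ ?_
  · exact ((by fun_prop : Continuous fun x : EuclideanSpace ℝ (Fin d) =>
      Real.exp (-(c * ‖x‖ ^ 2))).measurable.mul (measurable_logRatio hV μ)).aestronglyMeasurable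
  filter_upwards [ae_integrable_gaussianDensity μ] with x hx
  have h1 := abs_logRatio_le hexp (h x hx)
  rw [norm_mul, norm_smul, Real.norm_eq_abs, Real.abs_exp, Real.norm_eq_abs, Real.norm_eq_abs]
  have h2 : Real.exp (-(c * ‖x‖ ^ 2)) ≤ 1 := Real.exp_le_one_iff.2 (by
    have : 0 ≤ c * ‖x‖ ^ 2 := by positivity
    linarith)
  have h3 := mul_le_mul_of_nonneg_left h1 (Real.exp_pos (-(c * ‖x‖ ^ 2))).le
  have h4 := mul_le_mul_of_nonneg_right h2 (mixtureDensity_nonneg μ x)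
  nlinarith

end Target

/-! ### Gaussian integration by parts -/

section Stein

lemma integrable_smul_kernelDeriv {f : EuclideanSpace ℝ (Fin d) → ℝ}
    (hf : ∀ c : ℝ, 0 < c → Integrable fun x => Real.exp (-(c * ‖x‖ ^ 2)) * f x) (θ : BW d) :
    Integrable fun x => f x • kernelDeriv θ.1 x := by
  obtain ⟨c, hc, C, hC, h⟩ := exists_kernel_bounds (isCompact_singleton (x := θ))
  have hm : AEStronglyMeasurable f volume := by
    have h1 := (hf 1 one_pos).aestronglyMeasurable
    have h2 : Continuous fun x : EuclideanSpace ℝ (Fin d) => Real.exp (1 * ‖x‖ ^ 2) := by fun_prop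
    refine (h2.aestronglyMeasurable.mul h1).congr (ae_of_all _ fun x => ?_)
    change Real.exp (1 * ‖x‖ ^ 2) * (Real.exp (-(1 * ‖x‖ ^ 2)) * f x) = f x
    rw [← mul_assoc, ← Real.exp_add]; simp
  have hk : Continuous fun x => kernelDeriv θ.1 x :=
    continuousOn_kernelDeriv.comp_continuous (f := fun x => (θ.1, x)) (by fun_prop)
      fun x => θ.2.det_pos
  refine ((hf c hc).norm.const_mul C).mono' (hm.smul hk.aestronglyMeasurable)
    (ae_of_all _ fun x => ?_)
  rw [norm_smul, norm_mul, Real.norm_eq_abs (Real.exp _), Real.abs_exp]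
  have := mul_le_mul_of_nonneg_left (h θ rfl x).2 (norm_nonneg (f x))
  linarith

/-- Integrability survives multiplication with a function of quadratic growth and a Gaussian. -/
lemma integrable_mul_quadratic_mul_gaussianDensity {f : EuclideanSpace ℝ (Fin d) → ℝ}
    (hf : ∀ c : ℝ, 0 < c → Integrable fun x => Real.exp (-(c * ‖x‖ ^ 2)) * f x) (θ : BW d)
    {g : EuclideanSpace ℝ (Fin d) → ℝ} (hg : Continuous g) {B : ℝ}
    (hB : ∀ x, |g x| ≤ B * (1 + ‖x‖ ^ 2)) :
    Integrable fun x => f x * (g x * gaussianDensity θ x) := by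
  obtain ⟨c, hc, C, hC, h⟩ := exists_kernel_bounds (isCompact_singleton (x := θ))
  have hB0 : 0 ≤ B := by simpa using (abs_nonneg _).trans (hB 0)
  have hq : Continuous fun x => g x * gaussianDensity θ x * Real.exp (c / 2 * ‖x‖ ^ 2) :=
    (hg.mul (continuous_gaussianDensity θ)).mul (by fun_prop)
  refine ((hf (c / 2) (half_pos hc)).mul_bdd (c := B * C * (1 + 2 / c))
    hq.aestronglyMeasurable (ae_of_all _ fun x => ?_)).congr (ae_of_all _ fun x => ?_)
  · rw [norm_mul, norm_mul, Real.norm_eq_abs, Real.norm_of_nonneg (gaussianDensity_pos θ x).le,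
      Real.norm_of_nonneg (Real.exp_pos _).le]
    have h1 : gaussianDensity θ x ≤ C * Real.exp (-(c * ‖x‖ ^ 2)) := (h θ rfl x).1
    calc |g x| * gaussianDensity θ x * Real.exp (c / 2 * ‖x‖ ^ 2)
        ≤ (B * (1 + ‖x‖ ^ 2)) * (C * Real.exp (-(c * ‖x‖ ^ 2))) * Real.exp (c / 2 * ‖x‖ ^ 2) := by
          have := (gaussianDensity_pos θ x).le
          gcongr
          exact hB x
      _ = B * C * ((1 + ‖x‖ ^ 2) * Real.exp (-(c * ‖x‖ ^ 2))) * Real.exp (c / 2 * ‖x‖ ^ 2) := by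
          ring
      _ ≤ B * C * ((1 + 2 / c) * Real.exp (-(c / 2 * ‖x‖ ^ 2))) * Real.exp (c / 2 * ‖x‖ ^ 2) := by
          have := one_add_mul_exp_le hc (sq_nonneg ‖x‖)
          gcongr
      _ = B * C * (1 + 2 / c) *
          (Real.exp (-(c / 2 * ‖x‖ ^ 2)) * Real.exp (c / 2 * ‖x‖ ^ 2)) := by ring
      _ = B * C * (1 + 2 / c) := by rw [← Real.exp_add]; simp
  · change Real.exp (-(c / 2 * ‖x‖ ^ 2)) * f x *
      (g x * gaussianDensity θ x * Real.exp (c / 2 * ‖x‖ ^ 2)) = _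
    have : Real.exp (-(c / 2 * ‖x‖ ^ 2)) * Real.exp (c / 2 * ‖x‖ ^ 2) = 1 := by
      rw [← Real.exp_add]; simp
    linear_combination (f x * (g x * gaussianDensity θ x)) * this

lemma hasLineDerivAt_gaussianDensity (θ : BW d) (x a : EuclideanSpace ℝ (Fin d)) :
    HasLineDerivAt ℝ (gaussianDensity θ) (-(inner ℝ (score θ x) a * gaussianDensity θ x)) x a := by
  have h1 : HasDerivAt (fun t : ℝ => θ.1 + t • ((-a, 0) : Ambient d)) (-a, 0) 0 := by
    simpa using ((hasDerivAt_id (0 : ℝ)).smul_const ((-a, 0) : Ambient d)).const_add θ.1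
  have h2 : HasFDerivAt (fun θ' => gaussKernel θ' x) (kernelDeriv θ.1 x)
      (θ.1 + (0 : ℝ) • ((-a, 0) : Ambient d)) := by
    simpa using hasFDerivAt_gaussKernel (θ := θ.1) θ.2.det_pos x
  have h3 := h2.comp_hasDerivAt (0 : ℝ) h1
  rw [kernelDeriv_apply] at h3
  refine (h3.congr_deriv ?_).congr_of_eventuallyEq (Eventually.of_forall fun t => ?_)
  · simp
  · change gaussKernel θ.1 (x + t • a) = gaussKernel (θ.1 + t • ((-a, 0) : Ambient d)) x
    unfold gaussKernel
    have e1 : (θ.1 + t • ((-a, 0) : Ambient d)).2 = θ.1.2 := by simp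
    have e2 : x - (θ.1 + t • ((-a, 0) : Ambient d)).1 = x + t • a - θ.1.1 := by
      simp only [Prod.fst_add, Prod.smul_fst]
      module
    rw [e1, e2]

lemma score_apply (θ : BW d) (x : EuclideanSpace ℝ (Fin d)) (i : Fin d) :
    score θ x i = ∑ j, (cov θ)⁻¹ i j * (x j - mean θ j) := rfl

lemma inner_single (x : EuclideanSpace ℝ (Fin d)) (i : Fin d) :
    inner ℝ x (EuclideanSpace.single i 1) = x i := by
  simp [EuclideanSpace.inner_single_right]

lemma hasLineDerivAt_score (θ : BW d) (x : EuclideanSpace ℝ (Fin d)) (i j : Fin d) :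
    HasLineDerivAt ℝ (fun y => score θ y i) ((cov θ)⁻¹ i j) x (EuclideanSpace.single j 1) := by
  have h : HasDerivAt (fun t : ℝ => ∑ k, (cov θ)⁻¹ i k *
      ((x + t • EuclideanSpace.single j (1 : ℝ)) k - mean θ k))
      (∑ k, (cov θ)⁻¹ i k * (EuclideanSpace.single j (1 : ℝ)) k) 0 := by
    refine HasDerivAt.fun_sum fun k _ => HasDerivAt.const_mul _ ?_
    simpa using (((hasDerivAt_id (0 : ℝ)).mul_const
      ((EuclideanSpace.single j (1 : ℝ)) k)).const_add (x k)).sub_const (mean θ k)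
  refine h.congr_deriv ?_
  simp

lemma exists_abs_score_le (θ : BW d) : ∃ B, 0 ≤ B ∧ ∀ x i, |score θ x i| ≤ B * (1 + ‖x‖) := by
  refine ⟨(∑ i, ∑ j, |(cov θ)⁻¹ i j|) * (1 + ‖mean θ‖), by positivity, fun x i => ?_⟩
  rw [score_apply]
  have h2 : ∀ j, |x j - mean θ j| ≤ (1 + ‖mean θ‖) * (1 + ‖x‖) := fun j => by
    have h3 := abs_coord_le_norm x j
    have h4 := abs_coord_le_norm (mean θ) j
    have h5 := abs_sub (x j) (mean θ j)
    nlinarith [norm_nonneg x, norm_nonneg (mean θ)]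
  calc |∑ j, (cov θ)⁻¹ i j * (x j - mean θ j)|
      ≤ ∑ j, |(cov θ)⁻¹ i j| * ((1 + ‖mean θ‖) * (1 + ‖x‖)) := by
        refine (Finset.abs_sum_le_sum_abs _ _).trans (Finset.sum_le_sum fun j _ => ?_)
        rw [abs_mul]
        exact mul_le_mul_of_nonneg_left (h2 j) (abs_nonneg _)
    _ = (∑ j, |(cov θ)⁻¹ i j|) * ((1 + ‖mean θ‖) * (1 + ‖x‖)) := by rw [Finset.sum_mul]
    _ ≤ (∑ i, ∑ j, |(cov θ)⁻¹ i j|) * ((1 + ‖mean θ‖) * (1 + ‖x‖)) := by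
        refine mul_le_mul_of_nonneg_right ?_ (by positivity)
        exact Finset.single_le_sum (f := fun i => ∑ j, |(cov θ)⁻¹ i j|)
          (fun i _ => Finset.sum_nonneg fun j _ => abs_nonneg _) (Finset.mem_univ i)
    _ = _ := by ring

lemma continuous_score (θ : BW d) (i : Fin d) : Continuous fun x => score θ x i := by
  simp only [score_apply]
  fun_prop

lemma gradient_apply (f : EuclideanSpace ℝ (Fin d) → ℝ) (x : EuclideanSpace ℝ (Fin d))
    (i : Fin d) : (∇ f x) i = fderiv ℝ f x (EuclideanSpace.single i 1) := by
  rw [← inner_single, gradient, InnerProductSpace.toDual_symm_apply]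

lemma hessian_apply (f : EuclideanSpace ℝ (Fin d) → ℝ) (x : EuclideanSpace ℝ (Fin d))
    (i j : Fin d) : hessian f x i j
      = fderiv ℝ (fderiv ℝ f) x (EuclideanSpace.single i 1) (EuclideanSpace.single j 1) := by
  rw [hessian, Matrix.of_apply, iteratedFDeriv_two_apply]
  rfl

/-- Stein's identities: the Bures-Wasserstein gradient of `θ ↦ E f (Y)`, `Y ∼ N(m, Σ)`, is
`(E ∇ f (Y), E ∇² f (Y))`. -/
theorem gradOf_integral_kernelDeriv {f : EuclideanSpace ℝ (Fin d) → ℝ}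
    (hf : HasGaussianDerivatives f)
    (h0 : ∀ c : ℝ, 0 < c → Integrable fun x => Real.exp (-(c * ‖x‖ ^ 2)) * f x) (θ : BW d) :
    gradOf (∫ x, f x • kernelDeriv θ.1 x) = (∫ y, ∇ f y ∂(gaussian θ),
      Matrix.of fun i j => ∫ y, hessian f y i j ∂(gaussian θ)) := by
  obtain ⟨B, hB0, hB⟩ := exists_abs_score_le θ
  set e : Fin d → EuclideanSpace ℝ (Fin d) := fun i => EuclideanSpace.single i 1 with he
  set A := (cov θ)⁻¹ with hA
  set p := gaussianDensity θ with hp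
  have hdf : Differentiable ℝ f := hf.contDiff.differentiable (by norm_num)
  have hddf : Differentiable ℝ (fderiv ℝ f) :=
    (hf.contDiff.fderiv_right (m := 1) (by norm_num)).differentiable (by norm_num)
  have h1 : ∀ i (c : ℝ), 0 < c →
      Integrable fun x => Real.exp (-(c * ‖x‖ ^ 2)) * fderiv ℝ f x (e i) := by
    intro i c hc
    have h := integrable_exp_smul_of_gaussian hf.integrable_grad hc
    have h' := (EuclideanSpace.proj (𝕜 := ℝ) i).integrable_comp h
    refine h'.congr (ae_of_all _ fun x => ?_)
    simp [gradient_apply, he]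
  have h2 : ∀ i j (c : ℝ), 0 < c →
      Integrable fun x => Real.exp (-(c * ‖x‖ ^ 2)) * hessian f x i j := fun i j c hc =>
    integrable_exp_smul_of_gaussian (fun θ => hf.integrable_hess θ i j) hc
  have quad : ∀ x : EuclideanSpace ℝ (Fin d), (1 + ‖x‖) ^ 2 ≤ 2 * (1 + ‖x‖ ^ 2) := fun x => by
    nlinarith [sq_nonneg (1 - ‖x‖)]
  have b1 : ∀ x : EuclideanSpace ℝ (Fin d), |(1 : ℝ)| ≤ 1 * (1 + ‖x‖ ^ 2) := fun x => by
    rw [abs_one]; nlinarith [sq_nonneg ‖x‖]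
  have bz : ∀ i x, |score θ x i| ≤ (2 * B) * (1 + ‖x‖ ^ 2) := fun i x => by
    have h5 : (1 + ‖x‖) ≤ 2 * (1 + ‖x‖ ^ 2) := by nlinarith [sq_nonneg (1 - ‖x‖)]
    have := mul_le_mul_of_nonneg_left h5 hB0
    linarith [hB x i]
  have bzz : ∀ i j x, |score θ x i * score θ x j| ≤ (2 * B ^ 2) * (1 + ‖x‖ ^ 2) := fun i j x => by
    rw [abs_mul]
    calc |score θ x i| * |score θ x j| ≤ (B * (1 + ‖x‖)) * (B * (1 + ‖x‖)) := by
          gcongr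
          · exact hB x i
          · exact hB x j
      _ = B ^ 2 * (1 + ‖x‖) ^ 2 := by ring
      _ ≤ B ^ 2 * (2 * (1 + ‖x‖ ^ 2)) := by gcongr; exact quad x
      _ = _ := by ring
  have I0 : ∀ {q : EuclideanSpace ℝ (Fin d) → ℝ}, (∀ c : ℝ, 0 < c →
      Integrable fun x => Real.exp (-(c * ‖x‖ ^ 2)) * q x) → Integrable fun x => q x * p x :=
    fun hq => by simpa using integrable_mul_quadratic_mul_gaussianDensity hq θ continuous_const b1
  have Iz : ∀ {q : EuclideanSpace ℝ (Fin d) → ℝ} (i : Fin d), (∀ c : ℝ, 0 < c →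
      Integrable fun x => Real.exp (-(c * ‖x‖ ^ 2)) * q x) →
      Integrable fun x => q x * (score θ x i * p x) :=
    fun i hq => integrable_mul_quadratic_mul_gaussianDensity hq θ (continuous_score θ i) (bz i)
  have Izz : ∀ i j : Fin d, Integrable fun x => f x * (score θ x i * score θ x j * p x) :=
    fun i j => integrable_mul_quadratic_mul_gaussianDensity h0 θ
      ((continuous_score θ i).mul (continuous_score θ j)) (bzz i j)
  have dp : ∀ i x, HasLineDerivAt ℝ p (-(score θ x i * p x)) x (e i) := fun i x => by
    have := hasLineDerivAt_gaussianDensity θ x (e i)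
    rwa [he, inner_single] at this
  have dzp : ∀ i j x, HasLineDerivAt ℝ (fun y => score θ y i * p y)
      ((A i j - score θ x i * score θ x j) * p x) x (e j) := fun i j x => by
    have h3 := HasDerivAt.mul (hasLineDerivAt_score θ x i j) (dp j x)
    refine h3.congr_deriv ?_
    simp only [zero_smul, add_zero]
    ring
  have df : ∀ i x, HasLineDerivAt ℝ f (fderiv ℝ f x (e i)) x (e i) := fun i x =>
    (hdf x).hasFDerivAt.hasLineDerivAt (e i)
  have ddf : ∀ i j x, HasLineDerivAt ℝ (fun y => fderiv ℝ f y (e j)) (hessian f x i j) x (e i) := by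
    intro i j x
    have h3 := ((hddf x).hasFDerivAt.clm_apply (hasFDerivAt_const (e j) x)).hasLineDerivAt (e i)
    rw [hessian_apply]
    simpa using h3
  have hsum : Integrable fun x => f x • kernelDeriv θ.1 x := integrable_smul_kernelDeriv h0 θ
  have happ : ∀ u, (∫ x, f x • kernelDeriv θ.1 x) u = ∫ x, f x * kernelDeriv θ.1 x u := fun u => by
    rw [ContinuousLinearMap.integral_apply hsum]; rfl
  -- one integration by parts
  have s1 : ∀ i, ∫ x, f x * (score θ x i * p x) = ∫ x, fderiv ℝ f x (e i) * p x := by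
    intro i
    have h := integral_bilinear_hasLineDerivAt_right_eq_neg_left_of_integrable
      (μ := volume) (B := ContinuousLinearMap.mul ℝ ℝ) (f := f) (g := p) (v := e i)
      (f' := fun x => fderiv ℝ f x (e i)) (g' := fun x => -(score θ x i * p x))
      (I0 (h1 i)) ((Iz i h0).neg.congr (ae_of_all _ fun x => by simp)) (I0 h0)
      (fun x _ => df i x) (fun x _ => dp i x)
    simp only [ContinuousLinearMap.mul_apply', mul_neg, integral_neg, neg_inj] at h
    exact h
  -- two integrations by parts
  have s2 : ∀ i j, ∫ x, f x * ((score θ x i * score θ x j - A i j) * p x)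
      = ∫ x, hessian f x i j * p x := by
    intro i j
    have h := integral_bilinear_hasLineDerivAt_right_eq_neg_left_of_integrable
      (μ := volume) (B := ContinuousLinearMap.mul ℝ ℝ) (f := f) (g := fun x => score θ x i * p x)
      (v := e j) (f' := fun x => fderiv ℝ f x (e j))
      (g' := fun x => (A i j - score θ x i * score θ x j) * p x)
      (Iz i (h1 j)) ((((I0 h0).const_mul (A i j)).sub (Izz i j)).congr (ae_of_all _ fun x => by
        simp only [Pi.sub_apply, ContinuousLinearMap.mul_apply']; ring)) (Iz i h0)
      (fun x _ => df j x) (fun x _ => dzp i j x)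
    have h' := integral_bilinear_hasLineDerivAt_right_eq_neg_left_of_integrable
      (μ := volume) (B := ContinuousLinearMap.mul ℝ ℝ) (f := fun x => fderiv ℝ f x (e j)) (g := p)
      (v := e i) (f' := fun x => hessian f x i j) (g' := fun x => -(score θ x i * p x))
      (I0 (h2 i j)) ((Iz i (h1 j)).neg.congr (ae_of_all _ fun x => by simp)) (I0 (h1 j))
      (fun x _ => ddf i j x) (fun x _ => dp i x)
    simp only [ContinuousLinearMap.mul_apply', mul_neg, integral_neg, neg_inj] at h h'
    rw [← h', ← neg_eq_iff_eq_neg.2 h, ← integral_neg]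
    exact integral_congr_ae (ae_of_all _ fun x => by ring)
  refine Prod.ext ?_ ?_
  · ext i
    rw [gradOf_fst, ← inner_single, InnerProductSpace.toDual_symm_apply]
    change (∫ x, f x • kernelDeriv θ.1 x) (e i, 0) = (∫ y, ∇ f y ∂(gaussian θ)) i
    have h3 : (∫ y, ∇ f y ∂(gaussian θ)) i = ∫ y, (∇ f y) i ∂(gaussian θ) :=
      ((EuclideanSpace.proj (𝕜 := ℝ) i).integral_comp_comm (hf.integrable_grad θ)).symm
    rw [h3, happ, integral_gaussian]
    refine (integral_congr_ae (ae_of_all _ fun x => ?_)).trans ((s1 i).trans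
      (integral_congr_ae (ae_of_all _ fun x => ?_)))
    · simp only [kernelDeriv_apply, he, inner_single, Matrix.zero_mulVec, dotProduct_zero,
        Matrix.mul_zero, Matrix.trace_zero]
      ring
    · simp only [gradient_apply, smul_eq_mul]
      exact mul_comm _ _
  · ext i j
    rw [gradOf_snd, happ, happ]
    change _ = ∫ y, hessian f y i j ∂(gaussian θ)
    rw [integral_gaussian]
    have hk : ∀ i j x, kernelDeriv θ.1 x (0, Matrix.single i j 1)
        = (1 / 2) * (score θ x i * score θ x j - A i j) * p x := fun i j x => by
      rw [kernelDeriv_apply]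
      have h4 : (A * Matrix.single i j (1 : ℝ)).trace = A i j := by
        rw [Matrix.trace_mul_single]
        simp [hA, (cov_inv_isSymm θ).apply]
      have h5 : WithLp.ofLp (score θ x) ⬝ᵥ (Matrix.single i j (1 : ℝ) *ᵥ WithLp.ofLp (score θ x))
          = score θ x i * score θ x j := by
        simp [dotProduct, Matrix.single_mulVec, Function.update_apply]
      rw [h4, h5, inner_zero_right, zero_add]
    have hint : ∀ i j, Integrable fun x => f x * kernelDeriv θ.1 x (0, Matrix.single i j 1) :=
      fun i j => by
        have := ((ContinuousLinearMap.apply ℝ ℝ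
          ((0, Matrix.single i j 1) : Ambient d))).integrable_comp hsum
        simpa using this
    rw [← integral_add (hint i j) (hint j i)]
    refine (integral_congr_ae (ae_of_all _ fun x => ?_)).trans ((s2 i j).trans
      (integral_congr_ae (ae_of_all _ fun x => ?_)))
    · have h6 : A j i = A i j := (cov_inv_isSymm θ).apply _ _
      simp only [hk, h6]
      ring
    · simp only [smul_eq_mul]
      exact mul_comm _ _

lemma HasGaussianDerivatives.add {f g : EuclideanSpace ℝ (Fin d) → ℝ}
    (hf : HasGaussianDerivatives f) (hg : HasGaussianDerivatives g) :
    HasGaussianDerivatives fun x => f x + g x := by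
  have hdf : Differentiable ℝ f := hf.contDiff.differentiable (by norm_num)
  have hdg : Differentiable ℝ g := hg.contDiff.differentiable (by norm_num)
  have h1 : fderiv ℝ (fun x => f x + g x) = fun x => fderiv ℝ f x + fderiv ℝ g x :=
    funext fun x => fderiv_fun_add (hdf x) (hdg x)
  refine ⟨hf.contDiff.add hg.contDiff, fun θ => ?_, fun θ i j => ?_⟩
  · refine ((hf.integrable_grad θ).add (hg.integrable_grad θ)).congr (ae_of_all _ fun x => ?_)
    simp [gradient, h1]
  · refine ((hf.integrable_hess θ i j).add (hg.integrable_hess θ i j)).congr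
      (ae_of_all _ fun x => ?_)
    change hessian f x i j + hessian g x i j = hessian (fun x => f x + g x) x i j
    rw [hessian_apply, hessian_apply, hessian_apply, h1, fderiv_fun_add]
    · rfl
    · exact (hf.contDiff.fderiv_right (m := 1) (by norm_num)).differentiable (by norm_num) x
    · exact (hg.contDiff.fderiv_right (m := 1) (by norm_num)).differentiable (by norm_num) x

lemma hasGaussianDerivatives_const (a : ℝ) :
    HasGaussianDerivatives fun _ : EuclideanSpace ℝ (Fin d) => a := by
  refine ⟨contDiff_const, fun θ => ?_, fun θ i j => ?_⟩
  · simp [gradient]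
  · simp [hessian_apply]

end Stein

section Velocity

variable {V : EuclideanSpace ℝ (Fin d) → ℝ}

lemma hasGaussianDerivatives_logRatio (hV : HasGaussianDerivatives V)
    (hexp : Integrable (fun x => Real.exp (-V x)) volume) {μ : Measure (BW d)}
    [IsProbabilityMeasure μ] (hμ : IsRegularMixing μ) : HasGaussianDerivatives (logRatio V μ) := by
  have h : logRatio V μ = fun x => (Real.log (mixtureDensity μ x) + V x)
      + Real.log (∫ y, Real.exp (-V y)) :=
    funext fun x => logRatio_eq hexp (mixtureDensity_pos (hμ.integrable_density x))
  rw [h]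
  exact (hμ.log_density.add hV).add (hasGaussianDerivatives_const _)

/-- The differential at `θ` of `θ ↦ ∫ ln (p_μ / π) p_θ` for fixed `μ`, that is, of the first
variation of `μ ↦ KL (p_μ ‖ π)`. It makes sense for all mixing measures, whereas the expectations
of the gradient and Hessian of `ln p_μ` need regularity of `μ`. -/
def firstVariationDeriv (V : EuclideanSpace ℝ (Fin d) → ℝ) (μ : Measure (BW d)) (θ : Ambient d) :
    Ambient d →L[ℝ] ℝ :=
  ∫ x, logRatio V μ x • kernelDeriv θ x

/-- The Bures-Wasserstein gradient of the first variation of `μ ↦ KL (p_μ ‖ π)`. -/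
def velocity (V : EuclideanSpace ℝ (Fin d) → ℝ) (μ : Measure (BW d)) (θ : BW d) : Ambient d :=
  gradOf (firstVariationDeriv V μ θ.1)

lemma velocity_isSymm (μ : Measure (BW d)) (θ : BW d) : (velocity V μ θ).2.IsSymm :=
  gradOf_isSymm _

lemma velocity_eq (hV : HasGaussianDerivatives V) (hVint : ∀ θ : BW d, Integrable V (gaussian θ))
    (hexp : Integrable (fun x => Real.exp (-V x)) volume) {μ : Measure (BW d)}
    [IsProbabilityMeasure μ] (hμ : IsRegularMixing μ) (θ : BW d) :
    velocity V μ θ = (expectedGrad V μ θ, expectedHess V μ θ) :=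
  gradOf_integral_kernelDeriv (hasGaussianDerivatives_logRatio hV hexp hμ)
    (fun _ hc => integrable_exp_mul_logRatio hV.contDiff.continuous hVint hexp μ hc) θ

end Velocity

/-! ### Smooth cutoffs and measures tested by smooth functions -/

section FiniteDimensional

variable {E : Type*} [NormedAddCommGroup E] [NormedSpace ℝ E] [FiniteDimensional ℝ E]

lemma exists_smooth_cutoff {K U : Set E} (hK : IsCompact K) (hU : IsOpen U) (hKU : K ⊆ U) :
    ∃ χ : E → ℝ, ContDiff ℝ ∞ χ ∧ HasCompactSupport χ ∧ tsupport χ ⊆ U ∧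
      (∃ W, IsOpen W ∧ K ⊆ W ∧ ∀ x ∈ W, χ x = 1) ∧ ∀ x, χ x ∈ Icc (0 : ℝ) 1 := by
  obtain ⟨L, hL, hKL, hLU⟩ := exists_compact_between hK hU hKU
  obtain ⟨f, hf1, hf0, hf⟩ := exists_contMDiffMap_one_nhds_of_subset_interior (n := (⊤ : ℕ∞))
    (modelWithCornersSelf ℝ E) hK.isClosed hKL
  have hs : tsupport f ⊆ L := closure_minimal (fun x hx => by
    by_contra h; exact hx (hf0 x h)) hL.isClosed
  obtain ⟨W, hW, hKW, hW1⟩ := eventually_nhdsSet_iff_exists.1 hf1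
  exact ⟨f, f.contMDiff.contDiff, hL.of_isClosed_subset (isClosed_tsupport _) hs, hs.trans hLU,
    ⟨W, hW, hKW, hW1⟩, hf⟩

variable [MeasurableSpace E] [BorelSpace E]

lemma integrable_of_hasCompactSupport {φ : E → ℝ} (hφ : Continuous φ) (hc : HasCompactSupport φ)
    (μ : Measure E) [IsFiniteMeasure μ] : Integrable φ μ :=
  hφ.integrable_of_hasCompactSupport hc

lemma measure_le_of_forall_integral_eq {μ ν : Measure E} [IsFiniteMeasure μ] [IsFiniteMeasure ν]
    {U : Set E} (hU : IsOpen U)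
    (h : ∀ φ : E → ℝ, ContDiff ℝ ∞ φ → HasCompactSupport φ → tsupport φ ⊆ U →
      ∫ x, φ x ∂μ = ∫ x, φ x ∂ν) {A : Set E} (hA : MeasurableSet A) (hAU : A ⊆ U) :
    μ A ≤ ν A := by
  have hcomp : ∀ K ⊆ U, IsCompact K → μ K ≤ ν K := by
    intro K hKU hK
    refine ENNReal.le_of_forall_pos_le_add fun ε hε _ => ?_
    obtain ⟨W, hKW, hW, hWlt⟩ := K.exists_isOpen_lt_add (measure_ne_top ν K)
      (ENNReal.coe_ne_zero.2 hε.ne')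
    obtain ⟨χ, hχ, hχc, hχs, ⟨W', -, hKW', hW'⟩, hχ01⟩ :=
      exists_smooth_cutoff hK (hU.inter hW) (subset_inter hKU hKW)
    have hint : ∀ (ρ : Measure E) [IsFiniteMeasure ρ], Integrable χ ρ :=
      fun ρ _ => integrable_of_hasCompactSupport hχ.continuous hχc ρ
    have h1 : μ.real K ≤ ∫ x, χ x ∂μ := by
      rw [← integral_indicator_one hK.measurableSet]
      refine integral_mono ((integrable_const 1).indicator hK.measurableSet) (hint μ) fun x => ?_
      by_cases hx : x ∈ K
      · simp [hx, hW' x (hKW' hx)]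
      · simpa [hx] using (hχ01 x).1
    have h2 : ∫ x, χ x ∂ν ≤ ν.real W := by
      rw [← integral_indicator_one hW.measurableSet]
      refine integral_mono (hint ν) ((integrable_const 1).indicator hW.measurableSet) fun x => ?_
      by_cases hx : x ∈ W
      · simpa [hx] using (hχ01 x).2
      · simp [hx, image_eq_zero_of_notMem_tsupport fun hx' => hx (hχs hx').2]
    rw [h χ hχ hχc (hχs.trans inter_subset_left)] at h1
    exact ((ENNReal.toReal_le_toReal (measure_ne_top _ _) (measure_ne_top _ _)).1
      (h1.trans h2)).trans hWlt.le
  rw [hA.measure_eq_iSup_isCompact μ]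
  exact iSup₂_le fun K hKA => iSup_le fun hK =>
    (hcomp K (hKA.trans hAU) hK).trans (measure_mono hKA)

lemma measure_eq_of_forall_integral_eq {μ ν : Measure E} [IsFiniteMeasure μ] [IsFiniteMeasure ν]
    {U : Set E} (hU : IsOpen U)
    (h : ∀ φ : E → ℝ, ContDiff ℝ ∞ φ → HasCompactSupport φ → tsupport φ ⊆ U →
      ∫ x, φ x ∂μ = ∫ x, φ x ∂ν) {A : Set E} (hA : MeasurableSet A) (hAU : A ⊆ U) :
    μ A = ν A :=
  le_antisymm (measure_le_of_forall_integral_eq hU h hA hAU)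
    (measure_le_of_forall_integral_eq hU (fun φ h1 h2 h3 => (h φ h1 h2 h3).symm) hA hAU)

end FiniteDimensional

/-- The open set of pairs (vector, matrix) with positive determinant; the parameter space is closed
in it. -/
def detPos (d : ℕ) : Set (Ambient d) := {θ | 0 < θ.2.det}

lemma isOpen_detPos : IsOpen (detPos d) := isOpen_det_pos

lemma val_mem_detPos (θ : BW d) : θ.1 ∈ detPos d := θ.2.det_pos

lemma isCompact_val_preimage {L : Set (Ambient d)} (hL : IsCompact L) (hs : L ⊆ detPos d) :
    IsCompact (Subtype.val ⁻¹' L : Set (BW d)) := by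
  obtain ⟨R, hR⟩ := hL.isBounded.exists_norm_le
  have hdet : ContinuousOn (fun θ : Ambient d => (θ.2.det)⁻¹) L :=
    contDiff_det.continuous.continuousOn.inv₀ fun θ hθ => (hs hθ).ne'
  obtain ⟨C, hC⟩ := hL.exists_bound_of_continuousOn hdet
  refine (isCompact_paramBox (d := d) (δ := (|C| + 1)⁻¹) (by positivity) R).of_isClosed_subset
    (hL.isClosed.preimage continuous_subtype_val) fun θ hθ => ⟨?_, hR _ hθ⟩
  have h := θ.2.det_pos
  rw [inv_le_comm₀ (by positivity) h]
  have := (le_abs_self _).trans (hC _ hθ)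
  linarith [le_abs_self C]

lemma isTestFunction_of_hasCompactSupport {φ : Ambient d → ℝ} (hφ : ContDiff ℝ ∞ φ)
    (hc : HasCompactSupport φ) (hs : tsupport φ ⊆ detPos d) : IsTestFunction φ :=
  ⟨hφ, _, isCompact_val_preimage hc hs, fun _ hθ => image_eq_zero_of_notMem_tsupport hθ⟩

/-- Smooth cutoffs on the parameter space. -/
lemma exists_test_cutoff {K : Set (BW d)} (hK : IsCompact K) :
    ∃ χ : Ambient d → ℝ, ContDiff ℝ ∞ χ ∧ HasCompactSupport χ ∧ tsupport χ ⊆ detPos d ∧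
      (∃ W, IsOpen W ∧ (∀ θ ∈ K, θ.1 ∈ W) ∧ ∀ x ∈ W, χ x = 1) ∧ ∀ x, χ x ∈ Icc (0 : ℝ) 1 := by
  obtain ⟨χ, h1, h2, h3, ⟨W, hW, hKW, hW1⟩, h4⟩ := exists_smooth_cutoff
    (hK.image continuous_subtype_val) isOpen_detPos
    (by rintro _ ⟨θ, -, rfl⟩; exact val_mem_detPos θ)
  exact ⟨χ, h1, h2, h3, ⟨W, hW, fun θ hθ => hKW ⟨θ, hθ, rfl⟩, hW1⟩, h4⟩

/-- The product of a cutoff supported in `detPos` and a function that is smooth there. -/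
lemma contDiff_cutoff_mul {E F : Type*} [NormedAddCommGroup E] [NormedSpace ℝ E]
    [NormedAddCommGroup F] [NormedSpace ℝ F] {χ : E → ℝ} {g : E → F} {U : Set E}
    (hχ : ContDiff ℝ ∞ χ) (hU : IsOpen U) (hs : tsupport χ ⊆ U) (hg : ContDiffOn ℝ ∞ g U) :
    ContDiff ℝ ∞ fun x => χ x • g x := by
  rw [contDiff_iff_contDiffAt]
  intro x
  by_cases hx : x ∈ tsupport χ
  · exact hχ.contDiffAt.smul (hg.contDiffAt (hU.mem_nhds (hs hx)))
  · refine (contDiffAt_const (c := (0 : F))).congr_of_eventuallyEq ?_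
    filter_upwards [(isClosed_tsupport χ).isOpen_compl.mem_nhds hx] with y hy
    simp [image_eq_zero_of_notMem_tsupport hy]

lemma exists_ambient_measurableSet {A : Set (BW d)} (hA : MeasurableSet A) :
    ∃ B : Set (Ambient d), MeasurableSet B ∧ Subtype.val ⁻¹' B = A := hA

/-- Finite measures on the parameter space whose integrals agree for test functions supported in an
open set agree in this set. -/
lemma measure_eq_of_forall_test {μ ν : Measure (BW d)} [IsFiniteMeasure μ] [IsFiniteMeasure ν]
    {U : Set (Ambient d)} (hU : IsOpen U)
    (h : ∀ φ : Ambient d → ℝ, ContDiff ℝ ∞ φ → HasCompactSupport φ → tsupport φ ⊆ U ∩ detPos d →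
      ∫ θ, φ θ.1 ∂μ = ∫ θ, φ θ.1 ∂ν) {A : Set (BW d)} (hA : MeasurableSet A)
    (hAU : ∀ θ ∈ A, θ.1 ∈ U) : μ A = ν A := by
  obtain ⟨B, hB, rfl⟩ := exists_ambient_measurableSet hA
  have hm : Measurable (Subtype.val : BW d → Ambient d) := measurable_subtype_coe
  have hUm : MeasurableSet (U ∩ detPos d) := (hU.inter isOpen_detPos).measurableSet
  have h1 := measure_eq_of_forall_integral_eq (μ := μ.map Subtype.val) (ν := ν.map Subtype.val)
    (hU.inter isOpen_detPos) (fun φ h1 h2 h3 => by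
      rw [integral_map hm.aemeasurable h1.continuous.aestronglyMeasurable,
        integral_map hm.aemeasurable h1.continuous.aestronglyMeasurable]
      exact h φ h1 h2 h3) (hB.inter hUm) inter_subset_right
  rw [Measure.map_apply hm (hB.inter hUm), Measure.map_apply hm (hB.inter hUm)] at h1
  have h2 : (Subtype.val ⁻¹' (B ∩ (U ∩ detPos d)) : Set (BW d)) = Subtype.val ⁻¹' B := by
    ext θ
    exact ⟨fun hθ => hθ.1, fun hθ => ⟨hθ, hAU θ hθ, val_mem_detPos θ⟩⟩
  rwa [h2] at h1

lemma cov_isSymm (θ : BW d) : (cov θ).IsSymm := by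
  rw [Matrix.IsSymm, ← Matrix.conjTranspose_eq_transpose_of_trivial]
  exact θ.2.isHermitian.eq

/-- Positive definiteness is an open condition among symmetric matrices. -/
lemma eventually_posDef (θ : BW d) : ∀ᶠ η : Ambient d in 𝓝 θ.1, η.2.IsSymm → η.2.PosDef := by
  obtain ⟨δ, hδ, h⟩ := exists_mul_norm_sq_le_of_posDef θ.2
  have hd : (0 : ℝ) < (d : ℝ) * d + 1 := by positivity
  have hnear : ∀ᶠ η : Ambient d in 𝓝 θ.1, ‖η.2 - cov θ‖ < δ / ((d : ℝ) * d + 1) := by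
    have hc : Continuous fun η : Ambient d => ‖η.2 - cov θ‖ := by fun_prop
    refine hc.continuousAt.eventually (gt_mem_nhds ?_)
    simp only [sub_self, norm_zero]
    positivity
  filter_upwards [hnear] with η hη hsymm
  refine Matrix.PosDef.of_dotProduct_mulVec_pos ?_ fun x hx => ?_
  · rw [Matrix.IsHermitian, Matrix.conjTranspose_eq_transpose_of_trivial]
    exact hsymm
  set y : EuclideanSpace ℝ (Fin d) := WithLp.toLp 2 x with hy
  have hy0 : 0 < ‖y‖ ^ 2 := by
    have : y ≠ 0 := by simpa [hy] using hx
    positivity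
  have h1 : x ⬝ᵥ (η.2 *ᵥ x) = x ⬝ᵥ (cov θ *ᵥ x) + ∑ i, ∑ j, x i * ((η.2 - cov θ) i j * x j) := by
    simp only [dotProduct, Matrix.mulVec, Finset.mul_sum, Matrix.sub_apply,
      ← Finset.sum_add_distrib]
    exact Finset.sum_congr rfl fun i _ => Finset.sum_congr rfl fun j _ => by ring
  have h2 : |∑ i, ∑ j, x i * ((η.2 - cov θ) i j * x j)|
      ≤ ∑ _i : Fin d, ∑ _j : Fin d, ‖η.2 - cov θ‖ * ‖y‖ ^ 2 := by
    refine (Finset.abs_sum_le_sum_abs _ _).trans (Finset.sum_le_sum fun i _ =>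
      (Finset.abs_sum_le_sum_abs _ _).trans (Finset.sum_le_sum fun j _ => ?_))
    have h3 : x i * ((η.2 - cov θ) i j * x j) = (η.2 - cov θ) i j * (x i * x j) := by ring
    rw [h3, abs_mul]
    exact mul_le_mul (Matrix.norm_entry_le_entrywise_sup_norm (η.2 - cov θ))
      (abs_coord_mul_le y i j) (abs_nonneg _) (norm_nonneg _)
  have h3 := h y
  simp only [Finset.sum_const, Finset.card_univ, Fintype.card_fin, nsmul_eq_mul] at h2
  have h4 : (d : ℝ) * (d * (‖η.2 - cov θ‖ * ‖y‖ ^ 2)) < δ * ‖y‖ ^ 2 := by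
    rw [lt_div_iff₀ hd] at hη
    nlinarith [norm_nonneg (η.2 - cov θ)]
  have h5 := neg_abs_le (∑ i, ∑ j, x i * ((η.2 - cov θ) i j * x j))
  change 0 < x ⬝ᵥ (η.2 *ᵥ x)
  change δ * ‖y‖ ^ 2 ≤ x ⬝ᵥ (cov θ *ᵥ x) at h3
  rw [h1]
  linarith

lemma IsTestFunction.continuous {φ : Ambient d → ℝ} (hφ : IsTestFunction φ) : Continuous φ :=
  hφ.1.continuous

lemma IsTestFunction.differentiable {φ : Ambient d → ℝ} (hφ : IsTestFunction φ) :
    Differentiable ℝ φ := hφ.1.differentiable (by simp)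

lemma IsTestFunction.exists_bound {φ : Ambient d → ℝ} (hφ : IsTestFunction φ) :
    ∃ C, ∀ θ : BW d, |φ θ.1| ≤ C := by
  obtain ⟨K, hK, h0⟩ := hφ.2
  obtain ⟨C, hC⟩ := hK.exists_bound_of_continuousOn
    (hφ.continuous.comp continuous_subtype_val).continuousOn
  refine ⟨|C|, fun θ => ?_⟩
  by_cases hθ : θ ∈ K
  · exact (hC θ hθ).trans (le_abs_self C)
  · simp [h0 θ hθ]

lemma IsTestFunction.integrable {φ : Ambient d → ℝ} (hφ : IsTestFunction φ) (μ : Measure (BW d))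
    [IsFiniteMeasure μ] : Integrable (fun θ : BW d => φ θ.1) μ := by
  obtain ⟨C, hC⟩ := hφ.exists_bound
  exact Integrable.of_bound (hφ.continuous.comp continuous_subtype_val).aestronglyMeasurable C
    (ae_of_all _ hC)

lemma IsTestFunction.continuous_bwGrad {φ : Ambient d → ℝ} (hφ : IsTestFunction φ) :
    Continuous fun θ : BW d => bwGrad φ θ := by
  simp only [bwGrad_eq_gradOf hφ.differentiable]
  exact gradOf.continuous.comp
    ((hφ.1.continuous_fderiv (by simp)).comp continuous_subtype_val)

/-- The gradient of a test function vanishes off a compact set: on the boundary of the support this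
uses that the gradient only sees symmetric directions. -/
lemma IsTestFunction.bwGrad_eq_zero {φ : Ambient d → ℝ} (hφ : Differentiable ℝ φ) {K : Set (BW d)}
    (hK : IsClosed K) (h0 : ∀ θ : BW d, θ ∉ K → φ θ.1 = 0) {θ : BW d} (hθ : θ ∉ K) :
    bwGrad φ θ = 0 := by
  have key : ∀ u : Ambient d, u.2.IsSymm → fderiv ℝ φ θ.1 u = 0 := by
    intro u hu
    have hl : HasDerivAt (fun t : ℝ => θ.1 + t • u) u 0 := by
      simpa using ((hasDerivAt_id (0 : ℝ)).smul_const u).const_add θ.1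
    have h1 : HasDerivAt (fun t : ℝ => φ (θ.1 + t • u)) (fderiv ℝ φ θ.1 u) 0 := by
      have h2 : HasFDerivAt φ (fderiv ℝ φ θ.1) (θ.1 + (0 : ℝ) • u) := by
        simpa using (hφ θ.1).hasFDerivAt
      exact h2.comp_hasDerivAt (0 : ℝ) hl
    have h3 : ∀ᶠ t : ℝ in 𝓝 0, φ (θ.1 + t • u) = 0 := by
      obtain ⟨O, hO, hOK⟩ := isOpen_induced_iff.1 hK.isOpen_compl
      have hθO : θ.1 ∈ O := by
        have : θ ∈ (Subtype.val ⁻¹' O : Set (BW d)) := by rw [hOK]; exact hθ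
        exact this
      have hcont : ContinuousAt (fun t : ℝ => θ.1 + t • u) 0 := hl.continuousAt
      have e1 : ∀ᶠ t : ℝ in 𝓝 0, θ.1 + t • u ∈ O :=
        hcont.eventually_mem (hO.mem_nhds (by simpa using hθO))
      have hpd : ∀ᶠ t : ℝ in 𝓝 0, (θ.1 + t • u).2.PosDef := by
        have h4 : ∀ᶠ η in 𝓝 (θ.1 + (0 : ℝ) • u), η.2.IsSymm → η.2.PosDef := by
          simpa using eventually_posDef θ
        filter_upwards [hcont.eventually h4] with t ht
        exact ht ((cov_isSymm θ).add (hu.smul t))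
      filter_upwards [e1, hpd] with t h1 h2
      refine h0 ⟨_, h2⟩ fun h => ?_
      have : (⟨_, h2⟩ : BW d) ∈ (Subtype.val ⁻¹' O : Set (BW d)) := h1
      rw [hOK] at this
      exact this h
    exact h1.unique ((hasDerivAt_const (0 : ℝ) (0 : ℝ)).congr_of_eventuallyEq h3)
  rw [bwGrad_eq_gradOf hφ]
  refine Prod.ext ?_ ?_
  · rw [gradOf_fst]
    have : (fderiv ℝ φ θ.1).comp (ContinuousLinearMap.inl ℝ (EuclideanSpace ℝ (Fin d))
        (Matrix (Fin d) (Fin d) ℝ)) = 0 := by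
      ext a
      exact key (a, 0) (by simp [Matrix.IsSymm])
    rw [this, map_zero]; rfl
  · ext i j
    rw [gradOf_snd, ← map_add, key]
    · rfl
    · simp only [Prod.mk_add_mk, Matrix.IsSymm, Matrix.transpose_add, Matrix.transpose_single]
      exact add_comm _ _

/-! ### The derivative of the Kullback-Leibler functional along regular curves -/

lemma tangentMap_zero (θ : Ambient d) : tangentMap θ 0 = 0 := by
  simp [tangentMap]

lemma continuous_tangentMap :
    Continuous fun p : Ambient d × Ambient d => tangentMap p.1 p.2 := by
  unfold tangentMap
  have h : ∀ f g : Ambient d × Ambient d → Matrix (Fin d) (Fin d) ℝ, Continuous f → Continuous g →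
      Continuous fun p => f p * g p := fun f g hf hg => hf.matrix_mul hg
  exact (continuous_fst.comp continuous_snd).prodMk
    ((h _ _ (by fun_prop) (by fun_prop)).add (h _ _ (by fun_prop) (by fun_prop)))

lemma continuous_kernelDeriv_apply {T : BW d → Ambient d} (hT : Continuous T) :
    Continuous fun p : BW d × EuclideanSpace ℝ (Fin d) => kernelDeriv p.1.1 p.2 (T p.1) := by
  have h : Continuous fun p : BW d × EuclideanSpace ℝ (Fin d) => kernelDeriv p.1.1 p.2 :=
    continuousOn_kernelDeriv.comp_continuous
      (f := fun p : BW d × EuclideanSpace ℝ (Fin d) => (p.1.1, p.2)) (by fun_prop)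
      fun p => p.1.2.det_pos
  exact h.clm_apply (hT.comp continuous_fst)

section RegularCurve

variable {μ : Measure (BW d)} {ε : ℝ} {ν : ℝ → Measure (BW d)} {w : ℝ → BW d → Ambient d}
  {K : Set (BW d)}

/-- Along a regular curve no mass moves outside of the support of the velocity. -/
lemma IsRegularCurve.measure_eq (h : IsRegularCurve μ ε ν w) (hK : IsCompact K)
    (hw : ∀ t ∈ Ioo (-ε) ε, ∀ θ ∉ K, w t θ = 0) {t : ℝ} (ht : t ∈ Ioo (-ε) ε) {A : Set (BW d)}
    (hA : MeasurableSet A) (hAK : ∀ θ ∈ A, θ ∉ K) : ν t A = μ A := by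
  have h0 : (0 : ℝ) ∈ Ioo (-ε) ε := ⟨by linarith [h.pos], h.pos⟩
  have := (h.isP2 t ht).1
  have := (h.isP2 0 h0).1
  rw [← h.start]
  have hKc : IsClosed (Subtype.val '' K : Set (Ambient d)) :=
    (hK.image continuous_subtype_val).isClosed
  refine measure_eq_of_forall_test hKc.isOpen_compl (fun φ h1 h2 h3 => ?_) hA fun θ hθ => ?_
  · have hφ : IsTestFunction φ :=
      isTestFunction_of_hasCompactSupport h1 h2 (h3.trans inter_subset_right)
    have hd : ∀ s ∈ Ioo (-ε) ε, HasDerivAt (fun s => ∫ θ, φ θ.1 ∂(ν s)) 0 s := by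
      intro s hs
      have h4 := ((h.continuityEquation φ hφ s hs).2).hasDerivAt (Ioo_mem_nhds hs.1 hs.2)
      refine h4.congr_deriv ?_
      rw [integral_eq_zero_of_ae]
      refine ae_of_all _ fun θ => ?_
      by_cases hθ : θ ∈ K
      · have h5 : θ.1 ∉ tsupport φ := fun h6 => (h3 h6).1 ⟨θ, hθ, rfl⟩
        have h6 : fderiv ℝ φ θ.1 = 0 := by
          by_contra h7
          exact h5 (support_fderiv_subset ℝ h7)
        simp only [bwInner_bwGrad hφ.differentiable θ (h.vectorField s hs θ), h6,
          _root_.zero_apply, Pi.zero_apply]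
      · simp [bwInner, hw s hs θ hθ]
    exact (convex_Ioo _ _).is_const_of_fderivWithin_eq_zero (𝕜 := ℝ)
      (fun s hs => (hd s hs).differentiableAt.differentiableWithinAt)
      (fun s hs => by
        rw [fderivWithin_of_isOpen isOpen_Ioo hs]
        ext
        simp [(hd s hs).deriv]) ht h0
  · rintro ⟨η, hη, he⟩
    exact hAK θ hθ (Subtype.ext he ▸ hη)

lemma IsRegularCurve.restrict_eq (h : IsRegularCurve μ ε ν w) (hK : IsCompact K)
    (hw : ∀ t ∈ Ioo (-ε) ε, ∀ θ ∉ K, w t θ = 0) {t : ℝ} (ht : t ∈ Ioo (-ε) ε) :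
    (ν t).restrict Kᶜ = μ.restrict Kᶜ := by
  ext A hA
  rw [Measure.restrict_apply hA, Measure.restrict_apply hA]
  exact h.measure_eq hK hw ht (hA.inter hK.measurableSet.compl) fun θ hθ => hθ.2

/-- The mixture density is differentiable along a regular curve: only the part of the mixing
measure in the compact support of the velocity changes, and there a cutoff of the kernel is a test
function. -/
lemma IsRegularCurve.hasDerivAt_mixtureDensity (h : IsRegularCurve μ ε ν w) (hK : IsCompact K)
    (hw : ∀ t ∈ Ioo (-ε) ε, ∀ θ ∉ K, w t θ = 0) {x : EuclideanSpace ℝ (Fin d)}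
    (hx : Integrable (fun θ => gaussianDensity θ x) μ) {t : ℝ} (ht : t ∈ Ioo (-ε) ε) :
    Integrable (fun θ => gaussianDensity θ x) (ν t) ∧
    HasDerivAt (fun s => mixtureDensity (ν s) x)
      (∫ θ, kernelDeriv θ.1 x (tangentMap θ.1 (w t θ)) ∂(ν t)) t := by
  obtain ⟨χ, h1, h2, h3, ⟨W, hW, hKW, hW1⟩, -⟩ := exists_test_cutoff hK
  set φ : Ambient d → ℝ := fun θ => χ θ • gaussKernel θ x with hφd
  have hφ : IsTestFunction φ := isTestFunction_of_hasCompactSupport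
    (contDiff_cutoff_mul h1 isOpen_detPos h3 (contDiffOn_gaussKernel x)) h2.smul_right
    ((tsupport_smul_subset_left _ _).trans h3)
  set g : BW d → ℝ := fun θ => gaussianDensity θ x - φ θ.1 with hg
  have hgK : ∀ θ ∈ K, g θ = 0 := fun θ hθ => by
    simp [hg, hφd, hW1 _ (hKW θ hθ), gaussianDensity_eq_gaussKernel]
  have hsupp : Function.support g ⊆ Kᶜ := fun θ hθ hθK => hθ (hgK θ hθK)
  have hμ : IsProbabilityMeasure μ := h.start ▸ (h.isP2 0 ⟨by linarith [h.pos], h.pos⟩).1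
  have hgμ : Integrable g μ := hx.sub (hφ.integrable μ)
  have hgν : ∀ s ∈ Ioo (-ε) ε, Integrable g (ν s) := fun s hs => by
    rw [← integrableOn_iff_integrable_of_support_subset hsupp, IntegrableOn,
      h.restrict_eq hK hw hs]
    exact hgμ.integrableOn
  have hgi : ∀ s ∈ Ioo (-ε) ε, ∫ θ, g θ ∂(ν s) = ∫ θ, g θ ∂μ := fun s hs => by
    rw [← setIntegral_eq_integral_of_forall_compl_eq_zero (s := Kᶜ) (μ := ν s)
      (fun θ hθ => hgK θ (not_not.1 hθ)), ← setIntegral_eq_integral_of_forall_compl_eq_zero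
      (s := Kᶜ) (μ := μ) (fun θ hθ => hgK θ (not_not.1 hθ)), h.restrict_eq hK hw hs]
  have hpν : ∀ s ∈ Ioo (-ε) ε, Integrable (fun θ => gaussianDensity θ x) (ν s) := fun s hs => by
    have := (h.isP2 s hs).1
    refine ((hgν s hs).add (hφ.integrable (ν s))).congr (ae_of_all _ fun θ => ?_)
    simp [hg]
  refine ⟨hpν t ht, ?_⟩
  have h4 := ((h.continuityEquation φ hφ t ht).2).hasDerivAt (Ioo_mem_nhds ht.1 ht.2)
  have h5 := (h4.add_const (∫ θ, g θ ∂μ)).congr_of_eventuallyEq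
    (f₁ := fun s => mixtureDensity (ν s) x) (by
      filter_upwards [Ioo_mem_nhds ht.1 ht.2] with s hs
      have := (h.isP2 s hs).1
      rw [← hgi s hs, ← integral_add (hφ.integrable (ν s)) (hgν s hs), mixtureDensity]
      simp [hg])
  refine h5.congr_deriv (integral_congr_ae (ae_of_all _ fun θ => ?_))
  by_cases hθ : θ ∈ K
  · simp only [bwInner_bwGrad hφ.differentiable θ (h.vectorField t ht θ)]
    congr 1
    refine Filter.EventuallyEq.fderiv_eq ?_
    filter_upwards [hW.mem_nhds (hKW θ hθ)] with η hη
    simp [hφd, hW1 η hη]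
  · simp [bwInner, hw t ht θ hθ, tangentMap_zero]

end RegularCurve

section Target

variable {V : EuclideanSpace ℝ (Fin d) → ℝ}

lemma integrable_kernelDeriv_mul {K : Set (BW d)} (hK : IsCompact K)
    {T : BW d → Ambient d} (hT : Continuous T) (hTK : ∀ θ ∉ K, T θ = 0) (μ : Measure (BW d))
    [IsFiniteMeasure μ] {f : EuclideanSpace ℝ (Fin d) → ℝ} (hfm : Measurable f)
    (hf : ∀ c : ℝ, 0 < c → Integrable fun x => Real.exp (-(c * ‖x‖ ^ 2)) * f x) :
    Integrable (fun p : BW d × EuclideanSpace ℝ (Fin d) => f p.2 * kernelDeriv p.1.1 p.2 (T p.1))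
      (μ.prod volume) := by
  obtain ⟨c, hc, C, hC, hb⟩ := exists_kernel_bounds hK
  obtain ⟨B, hB⟩ := hK.exists_bound_of_continuousOn hT.continuousOn
  have h1 : Integrable (fun p : BW d × EuclideanSpace ℝ (Fin d) =>
      |C| * |B| * ‖Real.exp (-(c * ‖p.2‖ ^ 2)) * f p.2‖) (μ.prod volume) :=
    (((hf c hc).norm.const_mul (|C| * |B|)).comp_snd μ)
  refine h1.mono' ((hfm.comp measurable_snd).mul
    (continuous_kernelDeriv_apply hT).measurable).aestronglyMeasurable (ae_of_all _ fun p => ?_)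
  by_cases hp : p.1 ∈ K
  · have h2 := ((kernelDeriv p.1.1 p.2).le_opNorm (T p.1)).trans (mul_le_mul
      ((hb _ hp p.2).2) (hB _ hp) (norm_nonneg _) (by positivity))
    rw [norm_mul, norm_mul, Real.norm_of_nonneg (Real.exp_pos _).le]
    have h3 := mul_le_mul_of_nonneg_left h2 (norm_nonneg (f p.2))
    have h4 : C * Real.exp (-(c * ‖p.2‖ ^ 2)) * B ≤ |C| * Real.exp (-(c * ‖p.2‖ ^ 2)) * |B| := by
      rw [abs_of_pos hC]; gcongr; exact le_abs_self B
    have h5 := mul_le_mul_of_nonneg_left h4 (norm_nonneg (f p.2))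
    refine h3.trans (h5.trans (le_of_eq (by ring)))
  · rw [hTK _ hp, map_zero, mul_zero, norm_zero]
    positivity

/-- Interchange of the integrals over parameters and sample space in the first variation. -/
lemma integral_logRatio_mul_integral_kernelDeriv (hV : Continuous V)
    (hVint : ∀ θ : BW d, Integrable V (gaussian θ))
    (hexp : Integrable (fun x => Real.exp (-V x)) volume) (μ : Measure (BW d))
    [IsProbabilityMeasure μ] {K : Set (BW d)} (hK : IsCompact K)
    {T : BW d → Ambient d} (hT : Continuous T) (hTK : ∀ θ ∉ K, T θ = 0) :
    ∫ x, logRatio V μ x * ∫ θ, kernelDeriv θ.1 x (T θ) ∂μ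
      = ∫ θ, firstVariationDeriv V μ θ.1 (T θ) ∂μ := by
  have hf := fun c hc => integrable_exp_mul_logRatio hV hVint hexp μ (c := c) hc
  have h := integrable_kernelDeriv_mul hK hT hTK μ (measurable_logRatio hV μ) hf
  simp only [← integral_const_mul]
  rw [← integral_integral_swap (f := fun θ x => logRatio V μ x * kernelDeriv θ.1 x (T θ)) h]
  refine integral_congr_ae (ae_of_all _ fun θ => ?_)
  simp only [firstVariationDeriv]
  rw [ContinuousLinearMap.integral_apply (integrable_smul_kernelDeriv hf θ)]
  rfl

end Target

section KL

variable {V : EuclideanSpace ℝ (Fin d) → ℝ}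

lemma exp_neg_mul_sq_le_one {c : ℝ} (hc : 0 < c) (x : EuclideanSpace ℝ (Fin d)) :
    Real.exp (-(c * ‖x‖ ^ 2)) ≤ 1 := Real.exp_le_one_iff.2 (by
  have : 0 ≤ c * ‖x‖ ^ 2 := by positivity
  linarith)

/-- The bound used to differentiate under the integral is integrable. -/
lemma integrable_weighted_bound (hVint : ∀ θ : BW d, Integrable V (gaussian θ))
    (μ : Measure (BW d)) [IsFiniteMeasure μ] {c : ℝ} (hc : 0 < c) (a b e : ℝ) :
    Integrable fun x => Real.exp (-(c * ‖x‖ ^ 2)) *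
      (mixtureDensity μ x + a + b * (1 + ‖x‖ ^ 2) + |V x| + e) := by
  have h1 : Integrable fun x => Real.exp (-(c * ‖x‖ ^ 2)) * mixtureDensity μ x := by
    refine (integrable_mixtureDensity μ).bdd_mul (c := 1)
      (by fun_prop : Continuous fun x : EuclideanSpace ℝ (Fin d) =>
        Real.exp (-(c * ‖x‖ ^ 2))).aestronglyMeasurable (ae_of_all _ fun x => ?_)
    rw [Real.norm_of_nonneg (Real.exp_pos _).le]
    exact exp_neg_mul_sq_le_one hc x
  have h2 := (integrable_exp_smul_of_gaussian hVint hc).norm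
  refine ((((h1.add ((integrable_exp_neg_mul_sq hc).const_mul a)).add
    ((integrable_one_add_sq_mul_exp hc).const_mul b)).add h2).add
    ((integrable_exp_neg_mul_sq hc).const_mul e)).congr (ae_of_all _ fun x => ?_)
  simp only [Pi.add_apply, norm_smul, Real.norm_eq_abs, Real.abs_exp]
  ring

/-- Along every regular curve through a mixing measure `μ` of finite divergence, the derivative of
the divergence is the pairing of the initial velocity with the gradient of the first variation. -/
theorem IsRegularCurve.hasDerivAt_klFunctional {μ : Measure (BW d)} {ε : ℝ}
    {ν : ℝ → Measure (BW d)} {w : ℝ → BW d → Ambient d} (h : IsRegularCurve μ ε ν w)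
    (hV : Continuous V) (hVint : ∀ θ : BW d, Integrable V (gaussian θ))
    (hexp : Integrable (fun x => Real.exp (-V x)) volume) (hF : klFunctional V μ ≠ ⊤) :
    (∀ᶠ t in 𝓝 0, klFunctional V (ν t) ≠ ⊤) ∧
      HasDerivAt (fun t => (klFunctional V (ν t)).toReal)
        (∫ θ, bwInner θ (velocity V μ θ) (w 0 θ) ∂μ) 0 := by
  have hε := h.pos
  have h0 : (0 : ℝ) ∈ Ioo (-ε) ε := ⟨by linarith, hε⟩
  have hμ : IsProbabilityMeasure μ := h.start ▸ (h.isP2 0 h0).1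
  obtain ⟨K, hK, hw⟩ := h.compactSupport
  obtain ⟨c, hc, C, hC, hb⟩ := exists_kernel_bounds hK
  -- The velocity is bounded on a smaller, relatively compact time interval.
  have hTcont : ContinuousOn (fun p : ℝ × BW d => tangentMap p.2.1 (w p.1 p.2))
      (Ioo (-ε) ε ×ˢ univ) :=
    continuous_tangentMap.comp_continuousOn
      (((continuous_subtype_val.comp continuous_snd).continuousOn).prodMk h.continuous)
  have hsub : Icc (-(ε / 2)) (ε / 2) ⊆ Ioo (-ε) ε := fun t ht =>
    ⟨by linarith [ht.1], by linarith [ht.2]⟩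
  obtain ⟨B, hB⟩ :=
    ((isCompact_Icc (a := -(ε / 2)) (b := ε / 2)).prod hK).exists_bound_of_continuousOn
      (hTcont.mono (prod_mono hsub (subset_univ K)))
  set J : Set ℝ := Ioo (-(ε / 2)) (ε / 2) with hJ
  have hJ0 : J ∈ 𝓝 (0 : ℝ) := Ioo_mem_nhds (by linarith) (by linarith)
  have hJsub : J ⊆ Ioo (-ε) ε := Ioo_subset_Icc_self.trans hsub
  set q : ℝ → EuclideanSpace ℝ (Fin d) → ℝ := fun t x =>
    ∫ θ, kernelDeriv θ.1 x (tangentMap θ.1 (w t θ)) ∂(ν t) with hq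
  set D := C * |B| with hD
  have hD0 : 0 ≤ D := by positivity
  have hqb : ∀ t ∈ J, ∀ x, |q t x| ≤ D * Real.exp (-(c * ‖x‖ ^ 2)) := by
    intro t ht x
    have := (h.isP2 t (hJsub ht)).1
    have h1 := norm_integral_le_of_norm_le_const (μ := ν t)
      (f := fun θ => kernelDeriv θ.1 x (tangentMap θ.1 (w t θ)))
      (C := D * Real.exp (-(c * ‖x‖ ^ 2))) (ae_of_all _ fun θ => ?_)
    · simpa using h1
    · by_cases hθ : θ ∈ K
      · refine ((kernelDeriv θ.1 x).le_opNorm _).trans ?_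
        have h2 := (hb θ hθ x).2
        have h3 : ‖tangentMap θ.1 (w t θ)‖ ≤ |B| :=
          (hB (t, θ) ⟨Ioo_subset_Icc_self ht, hθ⟩).trans (le_abs_self B)
        calc _ ≤ (C * Real.exp (-(c * ‖x‖ ^ 2))) * |B| := by gcongr
          _ = _ := by rw [hD]; ring
      · rw [hw t (hJsub ht) θ hθ, tangentMap_zero, map_zero, norm_zero]
        positivity
  -- A Gaussian lower bound for all mixtures along the curve: mass outside of `K` does not move, so
  -- `K ∪ K₁` carries half of the mass at all times.
  obtain ⟨K₁, hK₁, hμK₁⟩ := exists_isCompact_lt_real μ (a := 1 / 2) (by simp; norm_num)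
  obtain ⟨C₁, hC₁, hlow⟩ := exists_mixtureDensity_lower_bound (hK.union hK₁)
  have hmass : ∀ t ∈ Ioo (-ε) ε, 1 / 2 ≤ (ν t).real (K ∪ K₁) := by
    intro t ht
    have := (h.isP2 t ht).1
    have hm := (hK.union hK₁).measurableSet
    have h1 : (ν t).real (K ∪ K₁)ᶜ = μ.real (K ∪ K₁)ᶜ := by
      unfold Measure.real
      rw [h.measure_eq hK hw ht hm.compl fun θ hθ hθK => hθ (Or.inl hθK)]
    rw [probReal_compl_eq_one_sub hm, probReal_compl_eq_one_sub hm] at h1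
    have h2 : μ.real K₁ ≤ μ.real (K ∪ K₁) := measureReal_mono subset_union_right
    linarith
  have hgood := ae_integrable_gaussianDensity μ
  have hder : ∀ {x}, Integrable (fun θ => gaussianDensity θ x) μ → ∀ t ∈ Ioo (-ε) ε,
      Integrable (fun θ => gaussianDensity θ x) (ν t) ∧
      HasDerivAt (fun s => mixtureDensity (ν s) x) (q t x) t :=
    fun hx t ht => h.hasDerivAt_mixtureDensity hK hw hx ht
  have hpl : ∀ {x}, Integrable (fun θ => gaussianDensity θ x) μ → ∀ t ∈ Ioo (-ε) ε,
      Real.exp (-(C₁ * (1 + ‖x‖ ^ 2))) ≤ mixtureDensity (ν t) x := fun hx t ht => by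
    have := (h.isP2 t ht).1
    exact hlow (ν t) (hmass t ht) _ (hder hx t ht).1
  have hpu : ∀ {x}, Integrable (fun θ => gaussianDensity θ x) μ → ∀ t ∈ J,
      mixtureDensity (ν t) x ≤ mixtureDensity μ x + D * ε := by
    intro x hx t ht
    have h1 := (convex_Ioo (-(ε / 2)) (ε / 2)).norm_image_sub_le_of_norm_hasDerivWithin_le
      (f := fun s => mixtureDensity (ν s) x) (f' := fun s => q s x) (C := D)
      (fun s hs => ((hder hx s (hJsub hs)).2).hasDerivWithinAt)
      (fun s hs => (hqb s hs x).trans (mul_le_of_le_one_right hD0 (exp_neg_mul_sq_le_one hc x)))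
      (mem_of_mem_nhds hJ0) ht
    have h2 : ‖t - 0‖ ≤ ε := by
      rw [sub_zero, Real.norm_eq_abs]
      exact abs_le.2 ⟨by linarith [ht.1], by linarith [ht.2]⟩
    have h3 := (le_abs_self _).trans (h1.trans (mul_le_mul_of_nonneg_left h2 hD0))
    simp only [h.start] at h3
    linarith
  -- The derivative of the integrand is the log-ratio times `q`; the Gaussian decay of `q` absorbs
  -- the quadratic growth of the log-ratio.
  set bound : EuclideanSpace ℝ (Fin d) → ℝ := fun x => D * (Real.exp (-(c * ‖x‖ ^ 2)) *
    (mixtureDensity μ x + D * ε + |C₁| * (1 + ‖x‖ ^ 2) + |V x|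
      + |Real.log (∫ y, Real.exp (-V y))|)) with hbound
  have hboundint : Integrable bound :=
    (integrable_weighted_bound hVint μ hc (D * ε) |C₁| _).const_mul D
  have hdiff : ∀ᵐ x, ∀ t ∈ J, HasDerivAt (fun s => klIntegrand V (ν s) x)
      (logRatio V (ν t) x * q t x) t := by
    filter_upwards [hgood] with x hx t ht
    have hπ := targetDensity_pos hexp x
    have hpos := (Real.exp_pos _).trans_le (hpl hx t (hJsub ht))
    have h1 := ((InformationTheory.hasDerivAt_klFun (div_pos hpos hπ).ne').comp t
      ((hder hx t (hJsub ht)).2.div_const (targetDensity V x))).const_mul (targetDensity V x)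
    refine h1.congr_deriv ?_
    unfold logRatio
    field_simp
  have hbd : ∀ᵐ x, ∀ t ∈ J, ‖logRatio V (ν t) x * q t x‖ ≤ bound x := by
    filter_upwards [hgood] with x hx t ht
    have h1 := abs_logRatio_le hexp (hpl hx t (hJsub ht))
    have h2 := hpu hx t ht
    have h3 : |logRatio V (ν t) x| ≤ mixtureDensity μ x + D * ε + |C₁| * (1 + ‖x‖ ^ 2) + |V x|
      + |Real.log (∫ y, Real.exp (-V y))| := by linarith
    rw [norm_mul, Real.norm_eq_abs, Real.norm_eq_abs]
    refine (mul_le_mul h3 (hqb t ht x) (abs_nonneg _) ((abs_nonneg _).trans h3)).trans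
      (le_of_eq ?_)
    rw [hbound]
    ring
  have hint0 : Integrable (klIntegrand V (ν 0)) := by
    rw [h.start]; exact (klFunctional_ne_top_iff hV hexp μ).1 hF
  have hmeas : ∀ t ∈ J, AEStronglyMeasurable (klIntegrand V (ν t)) volume := fun t ht => by
    have := (h.isP2 t (hJsub ht)).1
    exact (measurable_klIntegrand hV (ν t)).aestronglyMeasurable
  have hint : ∀ t ∈ J, Integrable (klIntegrand V (ν t)) := by
    intro t ht
    have h1 : Integrable fun x => klIntegrand V (ν t) x - klIntegrand V (ν 0) x := by
      refine (hboundint.mul_const ε).mono' ((hmeas t ht).sub (hmeas 0 (mem_of_mem_nhds hJ0))) ?_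
      filter_upwards [hdiff, hbd] with x hx1 hx2
      have h1 := (convex_Ioo (-(ε / 2)) (ε / 2)).norm_image_sub_le_of_norm_hasDerivWithin_le
        (fun s hs => (hx1 s hs).hasDerivWithinAt) hx2 (mem_of_mem_nhds hJ0) ht
      have h2 : ‖t - 0‖ ≤ ε := by
        rw [sub_zero, Real.norm_eq_abs]
        exact abs_le.2 ⟨by linarith [ht.1], by linarith [ht.2]⟩
      exact h1.trans (mul_le_mul_of_nonneg_left h2
        ((norm_nonneg _).trans (hx2 0 (mem_of_mem_nhds hJ0))))
    refine (h1.add hint0).congr (ae_of_all _ fun x => ?_)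
    simp
  refine ⟨?_, ?_⟩
  · filter_upwards [hJ0] with t ht
    have := (h.isP2 t (hJsub ht)).1
    exact (klFunctional_ne_top_iff hV hexp (ν t)).2 (hint t ht)
  have hw0 : Continuous fun θ => tangentMap θ.1 (w 0 θ) :=
    (hTcont.comp_continuous (f := fun θ : BW d => ((0 : ℝ), θ)) (by fun_prop)
      fun θ => ⟨h0, mem_univ _⟩)
  have hw0K : ∀ θ ∉ K, tangentMap θ.1 (w 0 θ) = 0 := fun θ hθ => by
    rw [hw 0 h0 θ hθ, tangentMap_zero]
  have hqm : AEStronglyMeasurable (fun x => logRatio V (ν 0) x * q 0 x) volume := by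
    simp only [hq, h.start]
    refine (measurable_logRatio hV μ).aestronglyMeasurable.mul ?_
    exact ((continuous_kernelDeriv_apply hw0).comp continuous_swap
      ).stronglyMeasurable.integral_prod_right'.aestronglyMeasurable
  have main := (hasDerivAt_integral_of_dominated_loc_of_deriv_le hJ0
    (by filter_upwards [hJ0] with t ht using hmeas t ht) hint0 hqm hbd hboundint hdiff).2
  have hval : ∫ x, logRatio V (ν 0) x * q 0 x
      = ∫ θ, bwInner θ (velocity V μ θ) (w 0 θ) ∂μ := by
    simp only [hq, h.start]
    rw [integral_logRatio_mul_integral_kernelDeriv hV hVint hexp μ hK hw0 hw0K]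
    refine integral_congr_ae (ae_of_all _ fun θ => ?_)
    simp only [velocity]
    rw [bwInner_gradOf θ _ (h.vectorField 0 h0 θ)]
  rw [hval] at main
  refine main.congr_of_eventuallyEq ?_
  filter_upwards [hJ0] with t ht
  have := (h.isP2 t (hJsub ht)).1
  exact toReal_klFunctional hV hexp (ν t)

end KL

/-! ### Gradients of test functions are velocities of regular curves -/

lemma exists_bound_of_eq_zero {X F : Type*} [TopologicalSpace X] [NormedAddCommGroup F] {f : X → F}
    (hf : Continuous f) {K : Set X} (hK : IsCompact K) (h0 : ∀ x ∉ K, f x = 0) :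
    ∃ C, ∀ x, ‖f x‖ ≤ C := by
  obtain ⟨C, hC⟩ := hK.exists_bound_of_continuousOn hf.continuousOn
  refine ⟨|C|, fun x => ?_⟩
  by_cases hx : x ∈ K
  · exact (hC x hx).trans (le_abs_self C)
  · simp [h0 x hx]

lemma continuous_bwInner : Continuous fun p : BW d × Ambient d × Ambient d =>
    bwInner p.1 p.2.1 p.2.2 := by
  unfold bwInner
  have h1 : Continuous fun p : BW d × Ambient d × Ambient d => p.2.1.2 * cov p.1 * p.2.2.2 := by
    have ha : Continuous fun p : BW d × Ambient d × Ambient d => p.2.1.2 := by fun_prop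
    have hb : Continuous fun p : BW d × Ambient d × Ambient d => cov p.1 := by fun_prop
    have hc : Continuous fun p : BW d × Ambient d × Ambient d => p.2.2.2 := by fun_prop
    exact (ha.matrix_mul hb).matrix_mul hc
  exact (by fun_prop : Continuous fun p : BW d × Ambient d × Ambient d =>
    inner ℝ p.2.1.1 p.2.2.1).add h1.matrix_trace

/-- Symmetrization of the matrix component. -/
def symmPart (d : ℕ) : Ambient d →L[ℝ] Ambient d :=
  LinearMap.toContinuousLinearMap
    { toFun := fun u => (u.1, (1 / 2 : ℝ) • (u.2 + u.2ᵀ))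
      map_add' := fun u v => by
        refine Prod.ext rfl ?_
        simp only [Prod.snd_add, Matrix.transpose_add]
        rw [← smul_add]
        congr 1
        abel
      map_smul' := fun r u => by
        refine Prod.ext rfl ?_
        simp only [Prod.smul_snd, Matrix.transpose_smul, RingHom.id_apply]
        rw [← smul_add, smul_comm] }

lemma symmPart_apply (u : Ambient d) : symmPart d u = (u.1, (1 / 2 : ℝ) • (u.2 + u.2ᵀ)) := rfl

lemma symmPart_isSymm (u : Ambient d) : (symmPart d u).2.IsSymm := by
  rw [symmPart_apply, Matrix.IsSymm]
  simp [add_comm]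

lemma symmPart_of_isSymm {u : Ambient d} (hu : u.2.IsSymm) : symmPart d u = u := by
  refine Prod.ext rfl ?_
  rw [symmPart_apply]
  simp only [hu.eq, ← two_smul ℝ u.2, smul_smul]
  norm_num

lemma symmPart_val (θ : BW d) : symmPart d θ.1 = θ.1 := symmPart_of_isSymm (cov_isSymm θ)

lemma tangentMap_isSymm {θ u : Ambient d} (hθ : θ.2.IsSymm) (hu : u.2.IsSymm) :
    (tangentMap θ u).2.IsSymm := by
  simp only [tangentMap, Matrix.IsSymm, Matrix.transpose_add, Matrix.transpose_mul, hθ.eq, hu.eq]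
  exact add_comm _ _

lemma contDiff_tangentMap :
    ContDiff ℝ ∞ fun p : Ambient d × Ambient d => tangentMap p.1 p.2 := by
  have hb : IsBoundedBilinearMap ℝ fun p : Matrix (Fin d) (Fin d) ℝ × Matrix (Fin d) (Fin d) ℝ =>
      p.1 * p.2 :=
    (LinearMap.toContinuousBilinearMap (LinearMap.mul ℝ (Matrix (Fin d) (Fin d) ℝ))
      ).isBoundedBilinearMap
  unfold tangentMap
  have h1 : ContDiff ℝ ∞ fun p : Ambient d × Ambient d => p.2.2 * p.1.2 :=
    hb.contDiff.comp (contDiff_snd.snd.prodMk contDiff_fst.snd)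
  have h2 : ContDiff ℝ ∞ fun p : Ambient d × Ambient d => p.1.2 * p.2.2 :=
    hb.contDiff.comp (contDiff_fst.snd.prodMk contDiff_snd.snd)
  exact contDiff_snd.fst.prodMk (h1.add h2)

/-- Symmetric matrices are preserved by curves with symmetric velocity. -/
lemma isSymm_of_hasDerivWithinAt {γ γ' : ℝ → Ambient d} {s : Set ℝ} (hs : Convex ℝ s)
    (hγ : ∀ t ∈ s, HasDerivWithinAt γ (γ' t) s t) (hγ' : ∀ t ∈ s, (γ' t).2.IsSymm) {t₀ t : ℝ}
    (ht₀ : t₀ ∈ s) (ht : t ∈ s) (h0 : (γ t₀).2.IsSymm) : (γ t).2.IsSymm := by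
  have h1 : ∀ r ∈ s, HasDerivWithinAt (fun r => γ r - symmPart d (γ r)) 0 s r := fun r hr => by
    have h2 := (hγ r hr).sub
      ((symmPart d).hasFDerivAt.comp_hasDerivWithinAt r (hγ r hr))
    refine h2.congr_deriv ?_
    rw [symmPart_of_isSymm (hγ' r hr), sub_self]
  have h3 := hs.norm_image_sub_le_of_norm_hasDerivWithin_le (C := 0) h1 (by simp) ht₀ ht
  rw [symmPart_of_isSymm h0, sub_self, sub_zero, zero_mul] at h3
  have h4 : γ t = symmPart d (γ t) := by
    rw [← sub_eq_zero]; exact norm_le_zero_iff.1 h3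
  rw [h4]
  exact symmPart_isSymm _

/-- The flow field of a gradient, as a compactly supported field on the ambient space. It is
evaluated at the symmetrization of the base point, so that its matrix component is symmetric. -/
lemma IsTestFunction.exists_field {ψ : Ambient d → ℝ} (hψ : IsTestFunction ψ) :
    ∃ Y : Ambient d → Ambient d, ContDiff ℝ ∞ Y ∧ HasCompactSupport Y ∧
      (∀ η, (Y η).2.IsSymm) ∧ ∀ θ : BW d, Y θ.1 = tangentMap θ.1 (bwGrad ψ θ) := by
  obtain ⟨K, hK, hψK⟩ := hψ.2
  obtain ⟨χ, h1, h2, h3, ⟨W, hW, hKW, hW1⟩, -⟩ := exists_test_cutoff hK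
  refine ⟨fun η => χ η • tangentMap (symmPart d η) (gradOf (fderiv ℝ ψ (symmPart d η))),
    h1.smul ?_, h2.smul_right, fun η => ?_, fun θ => ?_⟩
  · have h4 : ContDiff ℝ ∞ fun η => symmPart d η := (symmPart d).contDiff
    have h5 : ContDiff ℝ ∞ (fderiv ℝ ψ) := hψ.1.fderiv_right (by simp)
    exact contDiff_tangentMap.comp (h4.prodMk (gradOf.contDiff.comp (h5.comp h4)))
  · exact Matrix.IsSymm.smul (tangentMap_isSymm (symmPart_isSymm η) (gradOf_isSymm _)) (χ η)
  · simp only [symmPart_val, ← bwGrad_eq_gradOf hψ.differentiable]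
    by_cases hθ : θ ∈ K
    · rw [hW1 _ (hKW θ hθ), one_smul]
    · rw [IsTestFunction.bwGrad_eq_zero hψ.differentiable hK.isClosed hψK hθ, tangentMap_zero,
        smul_zero]

lemma exists_flow {E : Type*} [NormedAddCommGroup E] [NormedSpace ℝ E] [CompleteSpace E]
    {Y : E → E} {M k : ℝ≥0} (hM : ∀ x, ‖Y x‖ ≤ M) (hk : LipschitzWith k Y) (r : ℝ≥0) :
    ∃ α : E → ℝ → E, (∀ x ∈ Metric.closedBall 0 (r : ℝ), α x 0 = x ∧
      ∀ t ∈ Icc (-1 : ℝ) 1, HasDerivWithinAt (α x) (Y (α x t)) (Icc (-1) 1) t) ∧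
      ∀ t ∈ Icc (-1 : ℝ) 1, ContinuousOn (fun x => α x t) (Metric.closedBall 0 (r : ℝ)) := by
  have h : IsPicardLindelof (fun _ => Y) (tmin := -1) (tmax := 1) ⟨0, by norm_num⟩ 0
      (r + M) r M k :=
    { lipschitzOnWith := fun t _ => hk.lipschitzOnWith
      continuousOn := fun x _ => continuousOn_const
      norm_le := fun t _ x _ => hM x
      mul_max_le := by simp }
  obtain ⟨α, h1, L, h2⟩ := h.exists_forall_mem_closedBall_eq_hasDerivWithinAt_lipschitzOnWith
  exact ⟨α, h1, fun t ht => (h2 t ht).continuousOn⟩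

/-- The flow of the gradient of a test function, for short times. -/
lemma IsTestFunction.exists_flow {ψ : Ambient d → ℝ} (hψ : IsTestFunction ψ) {K : Set (BW d)}
    (hK : IsCompact K) (hψK : ∀ θ : BW d, θ ∉ K → ψ θ.1 = 0) :
    ∃ ε > 0, ∃ Φ : ℝ → BW d → BW d, (∀ θ, Φ 0 θ = θ) ∧ (∀ t, ∀ θ ∉ K, Φ t θ = θ) ∧
      (∃ R, ∀ t ∈ Ioo (-ε) ε, ∀ θ ∈ K, ‖(Φ t θ).1‖ ≤ R) ∧
      (∀ t ∈ Ioo (-ε) ε, Measurable (Φ t)) ∧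
      ∀ t ∈ Ioo (-ε) ε, ∀ θ, HasDerivAt (fun s => (Φ s θ).1)
        (tangentMap (Φ t θ).1 (bwGrad ψ (Φ t θ))) t := by
  classical
  obtain ⟨Y, hY, hYc, hYs, hYθ⟩ := hψ.exists_field
  obtain ⟨M, hM⟩ := hYc.exists_bound_of_continuous hY.continuous
  obtain ⟨k, hk⟩ := ContDiff.lipschitzWith_of_hasCompactSupport hYc hY (by simp)
  obtain ⟨δ', hδ', R, hR, hKR⟩ := exists_subset_paramBox hK
  have hM' : ∀ x, ‖Y x‖ ≤ M.toNNReal := fun x => (hM x).trans (Real.le_coe_toNNReal M)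
  obtain ⟨α, hα, hαc⟩ := GaussianMixtureFlow.exists_flow hM' hk R.toNNReal
  have hKball : ∀ θ ∈ K, θ.1 ∈ Metric.closedBall (0 : Ambient d) (R.toNNReal : ℝ) := fun θ hθ => by
    rw [mem_closedBall_zero_iff, Real.coe_toNNReal _ hR.le]
    exact (hKR θ hθ).2.le
  -- a uniform neighbourhood of `K` in which symmetric matrices are positive definite
  have hKO : (Subtype.val '' K : Set (Ambient d)) ⊆
      interior {η : Ambient d | η.2.IsSymm → η.2.PosDef} := by
    rintro _ ⟨θ, -, rfl⟩
    exact mem_interior_iff_mem_nhds.2 (eventually_posDef θ)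
  obtain ⟨δ, hδ, hδO⟩ := (hK.image continuous_subtype_val).exists_thickening_subset_open
    isOpen_interior hKO
  set ε : ℝ := min 1 (δ / (M.toNNReal + 1)) with hε
  have hεpos : 0 < ε := lt_min one_pos (by positivity)
  have hsub : Ioo (-ε) ε ⊆ Icc (-1 : ℝ) 1 := fun t ht =>
    ⟨by linarith [ht.1, min_le_left 1 (δ / ((M.toNNReal : ℝ) + 1))],
      by linarith [ht.2, min_le_left 1 (δ / ((M.toNNReal : ℝ) + 1))]⟩
  have h01 : (0 : ℝ) ∈ Icc (-1 : ℝ) 1 := by norm_num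
  have hmove : ∀ t ∈ Ioo (-ε) ε, ∀ θ ∈ K, ‖α θ.1 t - θ.1‖ < δ := by
    intro t ht θ hθ
    obtain ⟨h1, h2⟩ := hα _ (hKball θ hθ)
    have h3 := (convex_Icc (-1 : ℝ) 1).norm_image_sub_le_of_norm_hasDerivWithin_le h2
      (fun s _ => hM' _) h01 (hsub ht)
    rw [h1, sub_zero] at h3
    have h4 : ‖t‖ < δ / (M.toNNReal + 1) :=
      (abs_lt.2 ⟨ht.1, ht.2⟩).trans_le (min_le_right _ _)
    rw [lt_div_iff₀ (by positivity)] at h4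
    nlinarith [norm_nonneg t]
  have hposdef : ∀ t ∈ Ioo (-ε) ε, ∀ θ ∈ K, (α θ.1 t).2.PosDef := by
    intro t ht θ hθ
    obtain ⟨h1, h2⟩ := hα _ (hKball θ hθ)
    have h3 : α θ.1 t ∈ Metric.thickening δ (Subtype.val '' K) :=
      Metric.mem_thickening_iff.2 ⟨θ.1, ⟨θ, hθ, rfl⟩, by
        rw [dist_eq_norm]; exact hmove t ht θ hθ⟩
    refine interior_subset (hδO h3) (isSymm_of_hasDerivWithinAt (convex_Icc (-1 : ℝ) 1) h2
      (fun s _ => hYs _) h01 (hsub ht) ?_)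
    rw [h1]; exact cov_isSymm θ
  -- Outside of `K` the field vanishes, and the flow is the identity.
  set Φ : ℝ → BW d → BW d := fun t θ =>
    if h : θ ∈ K ∧ (α θ.1 t).2.PosDef then ⟨α θ.1 t, h.2⟩ else θ with hΦ
  have hΦK : ∀ t ∈ Ioo (-ε) ε, ∀ θ ∈ K, (Φ t θ).1 = α θ.1 t := fun t ht θ hθ => by
    simp only [hΦ]
    rw [dif_pos ⟨hθ, hposdef t ht θ hθ⟩]
  have hΦn : ∀ t, ∀ θ ∉ K, Φ t θ = θ := fun t θ hθ => dif_neg fun h => hθ h.1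
  have h0ε : (0 : ℝ) ∈ Ioo (-ε) ε := ⟨by linarith, hεpos⟩
  refine ⟨ε, hεpos, Φ, fun θ => ?_, hΦn, ⟨R + δ, fun t ht θ hθ => ?_⟩, fun t ht => ?_,
    fun t ht θ => ?_⟩
  · by_cases hθ : θ ∈ K
    · exact Subtype.ext ((hΦK 0 h0ε θ hθ).trans (hα _ (hKball θ hθ)).1)
    · exact hΦn 0 θ hθ
  · rw [hΦK t ht θ hθ]
    have h1 := norm_add_le (α θ.1 t - θ.1) θ.1
    rw [sub_add_cancel] at h1
    linarith [hmove t ht θ hθ, (hKR θ hθ).2]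
  · have h1 : Measurable (K.piecewise (fun θ : BW d => α θ.1 t) Subtype.val) := by
      refine ContinuousOn.measurable_piecewise ?_ continuous_subtype_val.continuousOn
        hK.measurableSet
      exact (hαc t (hsub ht)).comp continuous_subtype_val.continuousOn hKball
    have h2 : ∀ θ, (K.piecewise (fun θ : BW d => α θ.1 t) Subtype.val) θ = (Φ t θ).1 := fun θ => by
      by_cases hθ : θ ∈ K
      · rw [piecewise_eq_of_mem _ _ _ hθ, hΦK t ht θ hθ]
      · rw [piecewise_eq_of_notMem _ _ _ hθ, hΦn t θ hθ]
    have h3 : Φ t = fun θ => ⟨(K.piecewise (fun θ : BW d => α θ.1 t) Subtype.val) θ,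
        (h2 θ) ▸ (Φ t θ).2⟩ := funext fun θ => Subtype.ext (h2 θ).symm
    rw [h3]
    exact h1.subtype_mk
  · by_cases hθ : θ ∈ K
    · have h1 := ((hα _ (hKball θ hθ)).2 t (hsub ht)).mono hsub
      have h2 := h1.hasDerivAt (Ioo_mem_nhds ht.1 ht.2)
      rw [← hΦK t ht θ hθ, hYθ] at h2
      refine h2.congr_of_eventuallyEq ?_
      filter_upwards [Ioo_mem_nhds ht.1 ht.2] with s hs using hΦK s hs θ hθ
    · simp only [hΦn _ θ hθ]
      rw [IsTestFunction.bwGrad_eq_zero hψ.differentiable hK.isClosed hψK hθ, tangentMap_zero]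
      exact hasDerivAt_const _ _

lemma IsTestFunction.exists_bound_bwInner {φ : Ambient d → ℝ} (hφ : IsTestFunction φ)
    {v : BW d → Ambient d} (hv : Continuous v) :
    ∃ C, ∀ θ, |bwInner θ (bwGrad φ θ) (v θ)| ≤ C := by
  obtain ⟨K, hK, hφK⟩ := hφ.2
  refine exists_bound_of_eq_zero (f := fun θ => bwInner θ (bwGrad φ θ) (v θ))
    (continuous_bwInner.comp (continuous_id.prodMk (hφ.continuous_bwGrad.prodMk hv))) hK
    fun θ hθ => ?_
  rw [IsTestFunction.bwGrad_eq_zero hφ.differentiable hK.isClosed hφK hθ]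
  simp [bwInner]

lemma isVectorField_bwGrad {ψ : Ambient d → ℝ} (hψ : IsTestFunction ψ) :
    IsVectorField (bwGrad ψ) := fun θ => by
  rw [bwGrad_eq_gradOf hψ.differentiable]; exact gradOf_isSymm _

/-- Every gradient of a test function is the velocity of a regular curve, the transport of the given
measure by the flow of the gradient. -/
lemma IsTestFunction.exists_isRegularCurve {ψ : Ambient d → ℝ} (hψ : IsTestFunction ψ)
    {μ : Measure (BW d)} (hμ : IsP2 μ) :
    ∃ ε ν, IsRegularCurve μ ε ν (fun _ => bwGrad ψ) := by
  obtain ⟨K, hK, hψK⟩ := hψ.2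
  obtain ⟨ε, hε, Φ, hΦ0, hΦn, ⟨R, hΦR⟩, hΦm, hΦd⟩ := hψ.exists_flow hK hψK
  have hprob := hμ.1
  refine ⟨ε, fun t => μ.map (Φ t), hε, fun t ht => ⟨?_, ?_⟩, ?_, ?_,
    fun t _ => isVectorField_bwGrad hψ, ?_, ⟨K, hK, fun t _ θ hθ =>
      IsTestFunction.bwGrad_eq_zero hψ.differentiable hK.isClosed hψK hθ⟩,
    isVectorField_bwGrad hψ, ?_, fun r hr => ⟨ψ, hψ, ?_⟩⟩
  · exact Measure.isProbabilityMeasure_map (hΦm t ht).aemeasurable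
  · obtain ⟨θ₀, hθ₀⟩ := hμ.2
    refine ⟨θ₀, ?_⟩
    -- on the moving part of the space the distance is bounded
    obtain ⟨C, hC⟩ : ∃ C, ∀ θ : BW d, ‖θ.1‖ ≤ R → bwDistSq θ₀ θ ≤ C := by
      have hcont : Continuous fun η : Ambient d => ‖mean θ₀ - η.1‖ ^ 2 + (cov θ₀).trace
          + η.2.trace := by
        have : Continuous fun η : Ambient d => η.2.trace :=
          Continuous.matrix_trace continuous_snd
        fun_prop
      obtain ⟨C, hC⟩ := (isCompact_closedBall (0 : Ambient d) R).exists_bound_of_continuousOn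
        hcont.continuousOn
      exact ⟨C, fun θ hθ => (bwDistSq_le θ₀ θ).trans
        ((le_abs_self _).trans (hC θ.1 (by simpa using hθ)))⟩
    calc ∫⁻ θ, ENNReal.ofReal (bwDistSq θ₀ θ) ∂(μ.map (Φ t))
        ≤ ∫⁻ θ, ENNReal.ofReal (bwDistSq θ₀ (Φ t θ)) ∂μ := lintegral_map_le _ _
      _ ≤ ∫⁻ θ, (ENNReal.ofReal (bwDistSq θ₀ θ) + ENNReal.ofReal C) ∂μ := by
          refine lintegral_mono fun θ => ?_
          by_cases hθ : θ ∈ K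
          · exact (ENNReal.ofReal_le_ofReal (hC _ (hΦR t ht θ hθ))).trans le_add_self
          · rw [hΦn t θ hθ]; exact le_self_add
      _ = (∫⁻ θ, ENNReal.ofReal (bwDistSq θ₀ θ) ∂μ) + ENNReal.ofReal C := by
          rw [lintegral_add_right _ measurable_const]; simp
      _ < ⊤ := ENNReal.add_lt_top.2 ⟨hθ₀, ENNReal.ofReal_lt_top⟩
  · have : Φ 0 = id := funext hΦ0
    simp only [this, Measure.map_id]
  · intro φ hφ t ht
    obtain ⟨C, hC⟩ := hφ.exists_bound_bwInner hψ.continuous_bwGrad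
    have hc : Continuous fun θ => bwInner θ (bwGrad φ θ) (bwGrad ψ θ) :=
      continuous_bwInner.comp
        (continuous_id.prodMk (hφ.continuous_bwGrad.prodMk hψ.continuous_bwGrad))
    have hφc : Continuous fun θ : BW d => φ θ.1 := hφ.continuous.comp continuous_subtype_val
    have hpt := Measure.isProbabilityMeasure_map (μ := μ) (hΦm t ht).aemeasurable
    refine ⟨Integrable.of_bound hc.aestronglyMeasurable C (ae_of_all _ hC), ?_⟩
    have hmap : ∀ s ∈ Ioo (-ε) ε, ∫ θ, φ θ.1 ∂(μ.map (Φ s)) = ∫ θ, φ (Φ s θ).1 ∂μ :=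
      fun s hs => integral_map (hΦm s hs).aemeasurable hφc.aestronglyMeasurable
    have h1 := (hasDerivAt_integral_of_dominated_loc_of_deriv_le (μ := μ) (𝕜 := ℝ)
      (F := fun s θ => φ (Φ s θ).1) (x₀ := t) (bound := fun _ => C)
      (F' := fun s θ => bwInner (Φ s θ) (bwGrad φ (Φ s θ)) (bwGrad ψ (Φ s θ)))
      (Ioo_mem_nhds ht.1 ht.2)
      (by
        filter_upwards [Ioo_mem_nhds ht.1 ht.2] with s hs
        exact (hφc.measurable.comp (hΦm s hs)).aestronglyMeasurable)
      (by
        obtain ⟨C', hC'⟩ := hφ.exists_bound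
        exact Integrable.of_bound (hφc.measurable.comp (hΦm t ht)).aestronglyMeasurable C'
          (ae_of_all _ fun θ => hC' _))
      (hc.measurable.comp (hΦm t ht)).aestronglyMeasurable
      (ae_of_all _ fun θ s _ => hC _) (integrable_const C)
      (ae_of_all _ fun θ s hs => by
        rw [bwInner_bwGrad hφ.differentiable _ (isVectorField_bwGrad hψ _)]
        exact (hφ.differentiable _).hasFDerivAt.comp_hasDerivAt s (hΦd s hs θ))).2
    rw [integral_map (hΦm t ht).aemeasurable hc.aestronglyMeasurable]
    refine (h1.congr_of_eventuallyEq ?_).hasDerivWithinAt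
    filter_upwards [Ioo_mem_nhds ht.1 ht.2] with s hs using hmap s hs
  · exact (hψ.continuous_bwGrad.comp continuous_snd).continuousOn
  · exact hψ.continuous_bwGrad.measurable.aemeasurable
  · simp [bwInner, hr]

/-! ### Square-integrable vector fields and the projection onto the tangent space -/

lemma bwInner_comm (θ : BW d) {u v : Ambient d} (hu : u.2.IsSymm) (hv : v.2.IsSymm) :
    bwInner θ u v = bwInner θ v u := by
  unfold bwInner
  rw [real_inner_comm, ← Matrix.trace_transpose (u.2 * cov θ * v.2), Matrix.transpose_mul,
    Matrix.transpose_mul, hu.eq, hv.eq, (cov_isSymm θ).eq, Matrix.mul_assoc]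

lemma bwInner_add_left (θ : BW d) (u v w : Ambient d) :
    bwInner θ (u + v) w = bwInner θ u w + bwInner θ v w := by
  simp only [bwInner, Prod.fst_add, Prod.snd_add, inner_add_left, Matrix.add_mul,
    Matrix.trace_add]
  ring

lemma bwInner_add_right (θ : BW d) (u v w : Ambient d) :
    bwInner θ u (v + w) = bwInner θ u v + bwInner θ u w := by
  simp only [bwInner, Prod.fst_add, Prod.snd_add, inner_add_right, Matrix.mul_add,
    Matrix.trace_add]
  ring

lemma bwInner_smul_left (θ : BW d) (r : ℝ) (u v : Ambient d) :
    bwInner θ (r • u) v = r * bwInner θ u v := by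
  simp only [bwInner, Prod.smul_fst, Prod.smul_snd, real_inner_smul_left, Matrix.smul_mul,
    Matrix.trace_smul, smul_eq_mul]
  ring

lemma bwInner_smul_right (θ : BW d) (r : ℝ) (u v : Ambient d) :
    bwInner θ u (r • v) = r * bwInner θ u v := by
  simp only [bwInner, Prod.smul_fst, Prod.smul_snd, real_inner_smul_right, Matrix.mul_smul,
    Matrix.trace_smul, smul_eq_mul]
  ring

lemma bwInner_neg_right (θ : BW d) (u v : Ambient d) : bwInner θ u (-v) = -bwInner θ u v := by
  rw [← neg_one_smul ℝ v, bwInner_smul_right]; ring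

lemma bwInner_neg_left (θ : BW d) (u v : Ambient d) : bwInner θ (-u) v = -bwInner θ u v := by
  rw [← neg_one_smul ℝ u, bwInner_smul_left]; ring

lemma bwInner_sub_left (θ : BW d) (u v w : Ambient d) :
    bwInner θ (u - v) w = bwInner θ u w - bwInner θ v w := by
  rw [sub_eq_add_neg, bwInner_add_left, bwInner_neg_left]; ring

lemma bwInner_sub_right (θ : BW d) (u v w : Ambient d) :
    bwInner θ u (v - w) = bwInner θ u v - bwInner θ u w := by
  rw [sub_eq_add_neg, bwInner_add_right, bwInner_neg_right]; ring

/-- The Riemannian metric dominates the norm, with a constant depending on the base point. -/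
lemma exists_mul_norm_sq_le_bwInner (θ : BW d) :
    ∃ c > 0, ∀ u : Ambient d, u.2.IsSymm → c * ‖u‖ ^ 2 ≤ bwInner θ u u := by
  obtain ⟨δ, hδ, h⟩ := exists_mul_norm_sq_le_of_posDef θ.2
  refine ⟨min 1 δ, lt_min one_pos hδ, fun u hu => ?_⟩
  have htr : (u.2 * cov θ * u.2).trace
        = ∑ j, (fun i => u.2 i j) ⬝ᵥ (cov θ *ᵥ fun i => u.2 i j) := by
    rw [Matrix.mul_assoc, Matrix.trace]
    refine Finset.sum_congr rfl fun j _ => ?_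
    rw [Matrix.diag_apply, Matrix.mul_apply]
    refine Finset.sum_congr rfl fun k _ => ?_
    rw [hu.apply]
    rfl
  have hcol : ∀ j, δ * ∑ i, u.2 i j ^ 2 ≤ (fun i => u.2 i j) ⬝ᵥ (cov θ *ᵥ fun i => u.2 i j) := by
    intro j
    have := h (WithLp.toLp 2 fun i => u.2 i j)
    rwa [EuclideanSpace.real_norm_sq_eq] at this
  have h0 : 0 ≤ (u.2 * cov θ * u.2).trace := by
    rw [htr]
    exact Finset.sum_nonneg fun j _ => le_trans (by positivity) (hcol j)
  have h1 : min 1 δ * ‖u.2‖ ^ 2 ≤ (u.2 * cov θ * u.2).trace := by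
    have h2 : ‖u.2‖ ≤ √((u.2 * cov θ * u.2).trace / min 1 δ) := by
      have hmin : 0 < min 1 δ := lt_min one_pos hδ
      rw [Matrix.norm_le_iff (Real.sqrt_nonneg _)]
      intro i j
      refine Real.le_sqrt_of_sq_le ?_
      rw [le_div_iff₀ hmin, Real.norm_eq_abs, sq_abs]
      calc u.2 i j ^ 2 * min 1 δ ≤ u.2 i j ^ 2 * δ := by gcongr; exact min_le_right _ _
        _ = δ * u.2 i j ^ 2 := mul_comm _ _
        _ ≤ δ * ∑ i, u.2 i j ^ 2 := by
            gcongr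
            exact Finset.single_le_sum (f := fun i => u.2 i j ^ 2) (fun i _ => sq_nonneg _)
              (Finset.mem_univ i)
        _ ≤ _ := hcol j
        _ ≤ _ := by
            rw [htr]
            exact Finset.single_le_sum
              (f := fun j => (fun i => u.2 i j) ⬝ᵥ (cov θ *ᵥ fun i => u.2 i j))
              (fun j _ => le_trans (by positivity) (hcol j)) (Finset.mem_univ j)
    have h3 := pow_le_pow_left₀ (norm_nonneg _) h2 2
    have hmin : 0 < min 1 δ := lt_min one_pos hδ
    rw [Real.sq_sqrt (by positivity), le_div_iff₀ hmin] at h3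
    linarith
  have h4 : min 1 δ * ‖u.1‖ ^ 2 ≤ inner ℝ u.1 u.1 := by
    rw [real_inner_self_eq_norm_sq]
    exact mul_le_of_le_one_left (by positivity) (min_le_left _ _)
  have h5 : 0 ≤ min 1 δ * ‖u.1‖ ^ 2 := by
    have : 0 < min 1 δ := lt_min one_pos hδ
    positivity
  have h6 : 0 ≤ inner ℝ u.1 u.1 := real_inner_self_nonneg
  unfold bwInner
  rw [Prod.norm_def]
  rcases max_choice ‖u.1‖ ‖u.2‖ with h | h <;> rw [h] <;> linarith

lemma bwInner_self_nonneg (θ : BW d) {u : Ambient d} (hu : u.2.IsSymm) : 0 ≤ bwInner θ u u := by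
  obtain ⟨c, hc, h⟩ := exists_mul_norm_sq_le_bwInner θ
  exact le_trans (by positivity) (h u hu)

lemma two_mul_abs_bwInner_le (θ : BW d) {u v : Ambient d} (hu : u.2.IsSymm) (hv : v.2.IsSymm)
    {s : ℝ} (hs : 0 < s) :
    2 * |bwInner θ u v| ≤ s * bwInner θ u u + s⁻¹ * bwInner θ v v := by
  have h1 := bwInner_self_nonneg θ (u := s • u + v) ((hu.smul s).add hv)
  have h2 := bwInner_self_nonneg θ (u := s • u - v) ((hu.smul s).sub hv)
  simp only [bwInner_add_left, bwInner_add_right, bwInner_sub_left, bwInner_sub_right,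
    bwInner_smul_left, bwInner_smul_right, bwInner_comm θ hv hu] at h1 h2
  have h3 : s * (s * bwInner θ u u + s⁻¹ * bwInner θ v v)
      = s * (s * bwInner θ u u) + bwInner θ v v := by field_simp
  have h4 : s * (2 * |bwInner θ u v|) ≤ s * (s * bwInner θ u u + s⁻¹ * bwInner θ v v) := by
    rw [h3]
    rcases abs_choice (bwInner θ u v) with h | h <;> rw [h] <;> linarith
  exact le_of_mul_le_mul_left h4 hs

/-- Square-integrable vector fields. -/
structure FiniteEnergyField (μ : Measure (BW d)) (u : BW d → Ambient d) : Prop where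
  isVectorField : IsVectorField u
  aemeasurable : AEMeasurable u μ
  integrable : Integrable (fun θ => bwInner θ (u θ) (u θ)) μ

section FiniteEnergy

variable {μ : Measure (BW d)} {u v : BW d → Ambient d}

lemma aemeasurable_bwInner (hu : AEMeasurable u μ) (hv : AEMeasurable v μ) :
    AEMeasurable (fun θ => bwInner θ (u θ) (v θ)) μ := by
  have h1 : AEMeasurable (fun θ : BW d => (θ, u θ, v θ)) μ := aemeasurable_id.prodMk (hu.prodMk hv)
  have h2 : Measurable fun p : BW d × Ambient d × Ambient d => bwInner p.1 p.2.1 p.2.2 :=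
    continuous_bwInner.measurable
  simpa only [Function.comp_def] using h2.comp_aemeasurable h1

lemma FiniteEnergyField.integrable_bwInner (hu : FiniteEnergyField μ u)
    (hv : FiniteEnergyField μ v) : Integrable (fun θ => bwInner θ (u θ) (v θ)) μ := by
  refine (hu.integrable.add hv.integrable).mono'
    (aemeasurable_bwInner hu.aemeasurable hv.aemeasurable).aestronglyMeasurable
    (ae_of_all _ fun θ => ?_)
  have h1 := two_mul_abs_bwInner_le θ (hu.isVectorField θ) (hv.isVectorField θ) one_pos
  have h2 := abs_nonneg (bwInner θ (u θ) (v θ))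
  rw [Real.norm_eq_abs, Pi.add_apply]
  linarith

lemma FiniteEnergyField.add (hu : FiniteEnergyField μ u) (hv : FiniteEnergyField μ v) :
    FiniteEnergyField μ (fun θ => u θ + v θ) := by
  refine ⟨fun θ => (hu.isVectorField θ).add (hv.isVectorField θ),
    hu.aemeasurable.add hv.aemeasurable, ?_⟩
  simp only [bwInner_add_left, bwInner_add_right]
  exact (hu.integrable.add (hv.integrable_bwInner hu)).add
    ((hu.integrable_bwInner hv).add hv.integrable)

lemma FiniteEnergyField.const_smul (hu : FiniteEnergyField μ u) (r : ℝ) :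
    FiniteEnergyField μ (fun θ => r • u θ) := by
  refine ⟨fun θ => (hu.isVectorField θ).smul r, hu.aemeasurable.const_smul r, ?_⟩
  simp only [bwInner_smul_left, bwInner_smul_right]
  exact (hu.integrable.const_mul r).const_mul r

lemma FiniteEnergyField.sub (hu : FiniteEnergyField μ u) (hv : FiniteEnergyField μ v) :
    FiniteEnergyField μ (fun θ => u θ - v θ) := by
  have := hu.add (hv.const_smul (-1))
  simpa [← sub_eq_add_neg] using this

lemma FiniteEnergyField.lintegral_eq (hu : FiniteEnergyField μ u) :
    ∫⁻ θ, ENNReal.ofReal (bwInner θ (u θ) (u θ)) ∂μ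
      = ENNReal.ofReal (∫ θ, bwInner θ (u θ) (u θ) ∂μ) :=
  (ofReal_integral_eq_lintegral_ofReal hu.integrable
    (ae_of_all _ fun θ => bwInner_self_nonneg θ (hu.isVectorField θ))).symm

lemma finiteEnergyField_of_lintegral (h1 : IsVectorField u) (h2 : AEMeasurable u μ)
    (h3 : ∫⁻ θ, ENNReal.ofReal (bwInner θ (u θ) (u θ)) ∂μ < ⊤) : FiniteEnergyField μ u := by
  refine ⟨h1, h2, (aemeasurable_bwInner h2 h2).aestronglyMeasurable, ?_⟩
  rw [hasFiniteIntegral_iff_ofReal (ae_of_all _ fun θ => bwInner_self_nonneg θ (h1 θ))]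
  exact h3

lemma FiniteEnergyField.two_mul_abs_integral_le (hu : FiniteEnergyField μ u)
    (hv : FiniteEnergyField μ v) {s : ℝ} (hs : 0 < s) :
    2 * |∫ θ, bwInner θ (u θ) (v θ) ∂μ|
      ≤ s * ∫ θ, bwInner θ (u θ) (u θ) ∂μ + s⁻¹ * ∫ θ, bwInner θ (v θ) (v θ) ∂μ := by
  rw [← integral_const_mul, ← integral_const_mul,
    ← integral_add (hu.integrable.const_mul s) (hv.integrable.const_mul s⁻¹)]
  calc 2 * |∫ θ, bwInner θ (u θ) (v θ) ∂μ| ≤ 2 * ∫ θ, |bwInner θ (u θ) (v θ)| ∂μ := by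
        gcongr; exact abs_integral_le_integral_abs
    _ = ∫ θ, 2 * |bwInner θ (u θ) (v θ)| ∂μ := (integral_const_mul _ _).symm
    _ ≤ _ := integral_mono ((hu.integrable_bwInner hv).abs.const_mul 2)
        ((hu.integrable.const_mul s).add (hv.integrable.const_mul s⁻¹))
        fun θ => two_mul_abs_bwInner_le θ (hu.isVectorField θ) (hv.isVectorField θ) hs

lemma finiteEnergyField_of_continuous [IsFiniteMeasure μ] (hu : IsVectorField u)
    (hc : Continuous u) {K : Set (BW d)} (hK : IsCompact K) (h0 : ∀ θ ∉ K, u θ = 0) :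
    FiniteEnergyField μ u := by
  have h1 : Continuous fun θ => bwInner θ (u θ) (u θ) :=
    continuous_bwInner.comp (continuous_id.prodMk (hc.prodMk hc))
  obtain ⟨C, hC⟩ := exists_bound_of_eq_zero h1 hK (fun θ hθ => by simp [h0 θ hθ, bwInner])
  exact ⟨hu, hc.measurable.aemeasurable,
    Integrable.of_bound h1.aestronglyMeasurable C (ae_of_all _ hC)⟩

lemma IsTestFunction.finiteEnergyField [IsFiniteMeasure μ] {φ : Ambient d → ℝ}
    (hφ : IsTestFunction φ) : FiniteEnergyField μ (bwGrad φ) := by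
  obtain ⟨K, hK, hφK⟩ := hφ.2
  exact finiteEnergyField_of_continuous (isVectorField_bwGrad hφ) hφ.continuous_bwGrad hK
    fun θ hθ => IsTestFunction.bwGrad_eq_zero hφ.differentiable hK.isClosed hφK hθ

lemma IsTestFunction.add_smul {φ ψ : Ambient d → ℝ} (hφ : IsTestFunction φ)
    (hψ : IsTestFunction ψ) (s : ℝ) : IsTestFunction (fun η => φ η + s * ψ η) := by
  obtain ⟨K, hK, h0⟩ := hφ.2
  obtain ⟨L, hL, h1⟩ := hψ.2
  refine ⟨hφ.1.add (contDiff_const.mul hψ.1), K ∪ L, hK.union hL, fun θ hθ => ?_⟩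
  simp [h0 θ fun h => hθ (Or.inl h), h1 θ fun h => hθ (Or.inr h)]

lemma IsTestFunction.bwGrad_add_smul {φ ψ : Ambient d → ℝ} (hφ : IsTestFunction φ)
    (hψ : IsTestFunction ψ) (s : ℝ) (θ : BW d) :
    bwGrad (fun η => φ η + s * ψ η) θ = bwGrad φ θ + s • bwGrad ψ θ := by
  rw [bwGrad_eq_gradOf (hφ.add_smul hψ s).differentiable, bwGrad_eq_gradOf hφ.differentiable,
    bwGrad_eq_gradOf hψ.differentiable, fderiv_fun_add (hφ.differentiable _)
    ((hψ.differentiable _).const_mul s), fderiv_const_mul (hψ.differentiable _), map_add, map_smul]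

lemma isTestFunction_zero : IsTestFunction (fun _ : Ambient d => (0 : ℝ)) :=
  ⟨contDiff_const, ∅, isCompact_empty, fun _ _ => rfl⟩

end FiniteEnergy

section Projection

variable {μ : Measure (BW d)} {v : BW d → Ambient d}

/-- The squared `L²(μ)` distance of a vector field to the gradient of a test function. -/
def distToGradSq (μ : Measure (BW d)) (v : BW d → Ambient d) (ψ : Ambient d → ℝ) : ℝ :=
  ∫ θ, bwInner θ (v θ - bwGrad ψ θ) (v θ - bwGrad ψ θ) ∂μ

lemma integral_linear_combination {f g h : BW d → ℝ} (hf : Integrable f μ) (hg : Integrable g μ)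
    (hh : Integrable h μ) (a b c : ℝ) : ∫ θ, (a * f θ + b * g θ + c * h θ) ∂μ
      = a * ∫ θ, f θ ∂μ + b * ∫ θ, g θ ∂μ + c * ∫ θ, h θ ∂μ := by
  have h1 : Integrable (fun θ => a * f θ + b * g θ) μ := (hf.const_mul a).add (hg.const_mul b)
  rw [integral_add h1 (hh.const_mul c), integral_add (hf.const_mul a) (hg.const_mul b),
    integral_const_mul, integral_const_mul, integral_const_mul]

/-- Gradients of test functions `ψ n` whose squared distance to `v` is within `16⁻ⁿ` of the infimum.
They form a Cauchy sequence by the parallelogram identity, and `v - ∇ψ n` is asymptotically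
orthogonal to all gradients of test functions, by comparison with `ψ n + s φ`. -/
lemma exists_minimizing_seq [IsFiniteMeasure μ] (hv : FiniteEnergyField μ v) :
    ∃ ψ : ℕ → Ambient d → ℝ, (∀ n, IsTestFunction (ψ n)) ∧
      (∀ n k, n ≤ k → ∫ θ, bwInner θ (bwGrad (ψ k) θ - bwGrad (ψ n) θ)
        (bwGrad (ψ k) θ - bwGrad (ψ n) θ) ∂μ ≤ 4 * (1 / 16) ^ n) ∧
      ∀ φ, IsTestFunction φ → ∀ n (s : ℝ),
        2 * s * ∫ θ, bwInner θ (v θ - bwGrad (ψ n) θ) (bwGrad φ θ) ∂μ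
          ≤ (1 / 16) ^ n + s ^ 2 * ∫ θ, bwInner θ (bwGrad φ θ) (bwGrad φ θ) ∂μ := by
  set S : Set ℝ := {r | ∃ ψ, IsTestFunction ψ ∧ r = distToGradSq μ v ψ} with hS
  have hSne : S.Nonempty := ⟨_, _, isTestFunction_zero, rfl⟩
  have hfe : ∀ {ψ}, IsTestFunction ψ → FiniteEnergyField μ (fun θ => v θ - bwGrad ψ θ) :=
    fun hψ => hv.sub hψ.finiteEnergyField
  have hSbdd : BddBelow S := ⟨0, by
    rintro _ ⟨ψ, hψ, rfl⟩
    exact integral_nonneg fun θ => bwInner_self_nonneg θ ((hfe hψ).isVectorField θ)⟩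
  have hlow : ∀ {ψ}, IsTestFunction ψ → sInf S ≤ distToGradSq μ v ψ := fun hψ =>
    csInf_le hSbdd ⟨_, hψ, rfl⟩
  have hex : ∀ n : ℕ, ∃ ψ, IsTestFunction ψ ∧ distToGradSq μ v ψ < sInf S + (1 / 16) ^ n := by
    intro n
    obtain ⟨_, ⟨ψ, hψ, rfl⟩, h⟩ := exists_lt_of_csInf_lt hSne
      (lt_add_of_pos_right (sInf S) (by positivity : (0 : ℝ) < (1 / 16) ^ n))
    exact ⟨ψ, hψ, h⟩
  choose ψ hψ hψlt using hex
  refine ⟨ψ, hψ, fun n k hnk => ?_, fun φ hφ n s => ?_⟩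
  · -- compare with the midpoint
    have hmid1 := isTestFunction_zero.add_smul (hψ n) (1 / 2)
    have hmid := hmid1.add_smul (hψ k) (1 / 2)
    have h1 := hlow hmid
    set a := fun θ => v θ - bwGrad (ψ n) θ with ha
    set b := fun θ => v θ - bwGrad (ψ k) θ with hb
    have hfa : FiniteEnergyField μ a := hfe (hψ n)
    have hfb : FiniteEnergyField μ b := hfe (hψ k)
    have hz : ∀ θ : BW d, bwGrad (fun _ : Ambient d => (0 : ℝ)) θ = 0 := fun θ => by
      rw [bwGrad_eq_gradOf isTestFunction_zero.differentiable]; simp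
    have e1 : distToGradSq μ v (fun η => 0 + 1 / 2 * ψ n η + 1 / 2 * ψ k η)
        = ∫ θ, bwInner θ ((1 / 2 : ℝ) • a θ + (1 / 2 : ℝ) • b θ)
        ((1 / 2 : ℝ) • a θ + (1 / 2 : ℝ) • b θ) ∂μ := by
      refine integral_congr_ae (ae_of_all _ fun θ => ?_)
      have e2 : v θ - bwGrad (fun η => 0 + 1 / 2 * ψ n η + 1 / 2 * ψ k η) θ
          = (1 / 2 : ℝ) • a θ + (1 / 2 : ℝ) • b θ := by
        rw [IsTestFunction.bwGrad_add_smul hmid1 (hψ k),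
          IsTestFunction.bwGrad_add_smul isTestFunction_zero (hψ n), hz, ha, hb]
        module
      simp only [e2]
    rw [e1] at h1
    have e3 : ∀ θ, bwInner θ ((1 / 2 : ℝ) • a θ + (1 / 2 : ℝ) • b θ)
        ((1 / 2 : ℝ) • a θ + (1 / 2 : ℝ) • b θ)
        = (1 / 4) * bwInner θ (a θ) (a θ) + (1 / 2) * bwInner θ (a θ) (b θ)
          + (1 / 4) * bwInner θ (b θ) (b θ) := fun θ => by
      simp only [bwInner_add_left, bwInner_add_right, bwInner_smul_left, bwInner_smul_right,
        bwInner_comm θ (hfb.isVectorField θ) (hfa.isVectorField θ)]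
      ring
    have e4 : ∀ θ, bwInner θ (bwGrad (ψ k) θ - bwGrad (ψ n) θ) (bwGrad (ψ k) θ - bwGrad (ψ n) θ)
        = 1 * bwInner θ (a θ) (a θ) + (-2) * bwInner θ (a θ) (b θ)
          + 1 * bwInner θ (b θ) (b θ) := fun θ => by
      have e5 : bwGrad (ψ k) θ - bwGrad (ψ n) θ = a θ - b θ := by rw [ha, hb]; simp
      rw [e5]
      simp only [bwInner_sub_left, bwInner_sub_right,
        bwInner_comm θ (hfb.isVectorField θ) (hfa.isVectorField θ)]
      ring
    have iab := hfa.integrable_bwInner hfb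
    simp only [e3] at h1
    simp only [e4]
    rw [integral_linear_combination hfa.integrable iab hfb.integrable] at h1 ⊢
    have h2 : ∫ θ, bwInner θ (a θ) (a θ) ∂μ < sInf S + (1 / 16) ^ n := hψlt n
    have h3 : ∫ θ, bwInner θ (b θ) (b θ) ∂μ < sInf S + (1 / 16) ^ k := hψlt k
    have h4 : ((1 : ℝ) / 16) ^ k ≤ (1 / 16) ^ n :=
      pow_le_pow_of_le_one (by norm_num) (by norm_num) hnk
    linarith
  · have h1 := hlow ((hψ n).add_smul hφ s)
    set a := fun θ => v θ - bwGrad (ψ n) θ with ha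
    have hfa : FiniteEnergyField μ a := hfe (hψ n)
    have hfφ : FiniteEnergyField μ (bwGrad φ) := hφ.finiteEnergyField
    have e1 : ∀ θ, bwInner θ (v θ - bwGrad (fun η => ψ n η + s * φ η) θ)
        (v θ - bwGrad (fun η => ψ n η + s * φ η) θ) = 1 * bwInner θ (a θ) (a θ)
          + (-(2 * s)) * bwInner θ (a θ) (bwGrad φ θ)
          + s ^ 2 * bwInner θ (bwGrad φ θ) (bwGrad φ θ) := fun θ => by
      have e2 : v θ - bwGrad (fun η => ψ n η + s * φ η) θ = a θ - s • bwGrad φ θ := by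
        rw [IsTestFunction.bwGrad_add_smul (hψ n) hφ, ha]
        exact sub_add_eq_sub_sub _ _ _
      rw [e2]
      simp only [bwInner_sub_left, bwInner_sub_right, bwInner_smul_left, bwInner_smul_right,
        bwInner_comm θ (hfφ.isVectorField θ) (hfa.isVectorField θ)]
      ring
    have iab := hfa.integrable_bwInner hfφ
    unfold distToGradSq at h1
    simp only [e1] at h1
    rw [integral_linear_combination hfa.integrable iab hfφ.integrable] at h1
    have h2 : ∫ θ, bwInner θ (a θ) (a θ) ∂μ < sInf S + (1 / 16) ^ n := hψlt n
    linarith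

/-- A sequence of vector fields that is fast Cauchy in `L²(μ)` converges: with squared increments of
order `16⁻ⁿ` in the mean, the squared increments are almost everywhere of order `4⁻ⁿ`, so there
is a pointwise limit, to which Fatou's lemma applies. -/
lemma exists_limit_field {u : ℕ → BW d → Ambient d} (hu : ∀ n, FiniteEnergyField μ (u n))
    (hc : ∀ n k, n ≤ k → ∫ θ, bwInner θ (u k θ - u n θ) (u k θ - u n θ) ∂μ ≤ 4 * (1 / 16) ^ n) :
    ∃ G : BW d → Ambient d, IsVectorField G ∧ AEMeasurable G μ ∧
      ∀ n, ∫⁻ θ, ENNReal.ofReal (bwInner θ (G θ - u n θ) (G θ - u n θ)) ∂μ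
        ≤ ENNReal.ofReal (4 * (1 / 16) ^ n) := by
  set g : ℕ → BW d → ℝ := fun n θ => bwInner θ (u (n + 1) θ - u n θ) (u (n + 1) θ - u n θ) with hg
  have hgf : ∀ n, FiniteEnergyField μ fun θ => u (n + 1) θ - u n θ := fun n =>
    (hu (n + 1)).sub (hu n)
  have hg0 : ∀ n θ, 0 ≤ g n θ := fun n θ => bwInner_self_nonneg θ ((hgf n).isVectorField θ)
  have hsum : ∫⁻ θ, ∑' n, ENNReal.ofReal (4 ^ n * g n θ) ∂μ ≠ ⊤ := by
    rw [lintegral_tsum fun n => ((hgf n).integrable.aemeasurable.const_mul _).ennreal_ofReal]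
    have h1 : ∀ n, ∫⁻ θ, ENNReal.ofReal (4 ^ n * g n θ) ∂μ ≤ ENNReal.ofReal (4 * (1 / 4) ^ n) := by
      intro n
      rw [← ofReal_integral_eq_lintegral_ofReal ((hgf n).integrable.const_mul _)
        (ae_of_all _ fun θ => mul_nonneg (by positivity) (hg0 n θ)), integral_const_mul]
      refine ENNReal.ofReal_le_ofReal ?_
      have h2 := mul_le_mul_of_nonneg_left (hc n (n + 1) n.le_succ)
        (by positivity : (0 : ℝ) ≤ 4 ^ n)
      refine h2.trans (le_of_eq ?_)
      rw [mul_left_comm, ← mul_pow]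
      norm_num
    refine ne_top_of_le_ne_top ?_ (ENNReal.tsum_le_tsum h1)
    rw [← ENNReal.ofReal_tsum_of_nonneg (fun n => by positivity)
      ((summable_geometric_of_lt_one (by norm_num) (by norm_num)).mul_left _)]
    exact ENNReal.ofReal_ne_top
  have hae : ∀ᵐ θ ∂μ, ∃ l, Tendsto (fun n => u n θ) atTop (𝓝 l) := by
    have h1 := ae_lt_top' (AEMeasurable.tsum fun n =>
      ((hgf n).integrable.aemeasurable.const_mul (4 ^ n)).ennreal_ofReal) hsum
    filter_upwards [h1] with θ hθ
    set c := (∑' n, ENNReal.ofReal (4 ^ n * g n θ)).toReal with hcdef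
    have h2 : ∀ n, 4 ^ n * g n θ ≤ c := fun n => by
      have h3 := ENNReal.toReal_mono hθ.ne (ENNReal.le_tsum (f := fun n =>
        ENNReal.ofReal (4 ^ n * g n θ)) n)
      rwa [ENNReal.toReal_ofReal (mul_nonneg (by positivity) (hg0 n θ))] at h3
    obtain ⟨l, hl, hlow⟩ := exists_mul_norm_sq_le_bwInner θ
    have h4 : ∀ n, dist (u n θ) (u (n + 1) θ) ≤ √(c / l) * (1 / 2) ^ n := by
      intro n
      rw [dist_comm, dist_eq_norm]
      have h5 := hlow _ ((hgf n).isVectorField θ)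
      have h6 : ‖u (n + 1) θ - u n θ‖ ^ 2 ≤ c / l * ((1 / 2) ^ n) ^ 2 := by
        have h8 : (((1 : ℝ) / 2) ^ n) ^ 2 * 4 ^ n = 1 := by
          rw [← pow_mul, mul_comm n 2, pow_mul, ← mul_pow]; norm_num
        have h9 : (0 : ℝ) < (((1 : ℝ) / 2) ^ n) ^ 2 := by positivity
        rw [div_mul_eq_mul_div, le_div_iff₀ hl]
        calc ‖u (n + 1) θ - u n θ‖ ^ 2 * l ≤ g n θ := by linarith
          _ = (4 ^ n * g n θ) * (((1 : ℝ) / 2) ^ n) ^ 2 := by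
              linear_combination (-(g n θ)) * h8
          _ ≤ c * (((1 : ℝ) / 2) ^ n) ^ 2 := by gcongr; exact h2 n
      calc ‖u (n + 1) θ - u n θ‖ = √(‖u (n + 1) θ - u n θ‖ ^ 2) :=
            (Real.sqrt_sq (norm_nonneg _)).symm
        _ ≤ √(c / l * ((1 / 2) ^ n) ^ 2) := Real.sqrt_le_sqrt h6
        _ = √(c / l) * (1 / 2) ^ n := by
            rw [Real.sqrt_mul' _ (by positivity), Real.sqrt_sq (by positivity)]
    exact cauchySeq_tendsto_of_complete
      (cauchySeq_of_le_geometric (1 / 2) _ (by norm_num) h4)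
  obtain ⟨G₀, hG₀, hG₀l⟩ := measurable_limit_of_tendsto_metrizable_ae
    (fun n => (hu n).aemeasurable) hae
  refine ⟨fun θ => symmPart d (G₀ θ), fun θ => symmPart_isSymm _,
    ((symmPart d).continuous.measurable.comp hG₀).aemeasurable, fun n => ?_⟩
  have hlim : ∀ᵐ θ ∂μ, Tendsto (fun k => ENNReal.ofReal
      (bwInner θ (u k θ - u n θ) (u k θ - u n θ))) atTop
      (𝓝 (ENNReal.ofReal (bwInner θ (symmPart d (G₀ θ) - u n θ) (symmPart d (G₀ θ) - u n θ)))) := by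
    filter_upwards [hG₀l] with θ hθ
    have h1 : Tendsto (fun k => u k θ) atTop (𝓝 (symmPart d (G₀ θ))) := by
      have h2 := ((symmPart d).continuous.tendsto _).comp hθ
      refine h2.congr fun k => ?_
      exact symmPart_of_isSymm ((hu k).isVectorField θ)
    have h3 : Continuous fun x : Ambient d => bwInner θ (x - u n θ) (x - u n θ) :=
      continuous_bwInner.comp (by fun_prop : Continuous fun x : Ambient d =>
        (θ, x - u n θ, x - u n θ))
    exact (ENNReal.continuous_ofReal.tendsto _).comp ((h3.tendsto _).comp h1)
  calc ∫⁻ θ, ENNReal.ofReal (bwInner θ (symmPart d (G₀ θ) - u n θ) (symmPart d (G₀ θ) - u n θ)) ∂μ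
      = ∫⁻ θ, liminf (fun k => ENNReal.ofReal
          (bwInner θ (u k θ - u n θ) (u k θ - u n θ))) atTop ∂μ :=
        lintegral_congr_ae (hlim.mono fun θ hθ => hθ.liminf_eq.symm)
    _ ≤ liminf (fun k => ∫⁻ θ, ENNReal.ofReal
          (bwInner θ (u k θ - u n θ) (u k θ - u n θ)) ∂μ) atTop :=
        lintegral_liminf_le' fun k =>
          ((hu k).sub (hu n)).integrable.aemeasurable.ennreal_ofReal
    _ ≤ ENNReal.ofReal (4 * (1 / 16) ^ n) := by
        refine liminf_le_of_frequently_le' (Eventually.frequently ?_)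
        filter_upwards [eventually_ge_atTop n] with k hk
        rw [((hu k).sub (hu n)).lintegral_eq]
        exact ENNReal.ofReal_le_ofReal (hc n k hk)

/-- The orthogonal projection of a square-integrable field onto the tangent space. -/
theorem exists_projection [IsFiniteMeasure μ] (hv : FiniteEnergyField μ v) :
    ∃ G, InTangentSpace μ G ∧ FiniteEnergyField μ G ∧
      ∀ w, FiniteEnergyField μ w → InTangentSpace μ w →
        ∫ θ, bwInner θ (G θ) (w θ) ∂μ = ∫ θ, bwInner θ (v θ) (w θ) ∂μ := by
  obtain ⟨ψ, hψ, hcauchy, horth⟩ := exists_minimizing_seq hv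
  obtain ⟨G, hGs, hGm, hGl⟩ := exists_limit_field
    (fun n => (hψ n).finiteEnergyField (μ := μ)) hcauchy
  have hdiff : ∀ n, FiniteEnergyField μ fun θ => G θ - bwGrad (ψ n) θ := fun n =>
    finiteEnergyField_of_lintegral
      (fun θ => (hGs θ).sub (isVectorField_bwGrad (hψ n) θ))
      (hGm.sub ((hψ n).finiteEnergyField (μ := μ)).aemeasurable)
      ((hGl n).trans_lt ENNReal.ofReal_lt_top)
  have hG : FiniteEnergyField μ G := by
    simpa using (hdiff 0).add ((hψ 0).finiteEnergyField (μ := μ))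
  have hdl : ∀ n, ∫ θ, bwInner θ (G θ - bwGrad (ψ n) θ) (G θ - bwGrad (ψ n) θ) ∂μ
      ≤ 4 * (1 / 16) ^ n := fun n => by
    have h1 := hGl n
    rw [(hdiff n).lintegral_eq] at h1
    exact (ENNReal.ofReal_le_ofReal_iff (by positivity)).1 h1
  have htend : Tendsto (fun n : ℕ => ((1 : ℝ) / 4) ^ n) atTop (𝓝 0) :=
    tendsto_pow_atTop_nhds_zero_of_lt_one (by norm_num) (by norm_num)
  have htest : ∀ φ, IsTestFunction φ → ∫ θ, bwInner θ (v θ - G θ) (bwGrad φ θ) ∂μ = 0 := by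
    intro φ hφ
    have hfφ : FiniteEnergyField μ (bwGrad φ) := hφ.finiteEnergyField
    set b := ∫ θ, bwInner θ (bwGrad φ θ) (bwGrad φ θ) ∂μ with hb
    have hbound : ∀ n : ℕ, |∫ θ, bwInner θ (v θ - G θ) (bwGrad φ θ) ∂μ|
        ≤ (5 + 2 * b) * (1 / 4) ^ n := by
      intro n
      have hs : (0 : ℝ) < (1 / 4) ^ n := by positivity
      have hss : ((1 : ℝ) / 16) ^ n = (1 / 4) ^ n * (1 / 4) ^ n := by rw [← mul_pow]; norm_num
      -- The choice `s = ± 4⁻ⁿ` balances the two terms of the asymptotic orthogonality.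
      have h1 := horth φ hφ n ((1 / 4) ^ n)
      have h2 := horth φ hφ n (-(1 / 4) ^ n)
      have h3 := (hdiff n).two_mul_abs_integral_le hfφ (inv_pos.2 hs)
      rw [inv_inv] at h3
      have h4 := mul_le_mul_of_nonneg_left (hdl n) (inv_pos.2 hs).le
      have h5 : ((1 / 4 : ℝ) ^ n)⁻¹ * (4 * (1 / 16) ^ n) = 4 * (1 / 4) ^ n := by
        rw [hss]; field_simp
      have h6 : ∫ θ, bwInner θ (v θ - G θ) (bwGrad φ θ) ∂μ
          = ∫ θ, bwInner θ (v θ - bwGrad (ψ n) θ) (bwGrad φ θ) ∂μ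
            - ∫ θ, bwInner θ (G θ - bwGrad (ψ n) θ) (bwGrad φ θ) ∂μ := by
        rw [← integral_sub ((hv.sub (hψ n).finiteEnergyField).integrable_bwInner hfφ)
          ((hdiff n).integrable_bwInner hfφ)]
        refine integral_congr_ae (ae_of_all _ fun θ => ?_)
        simp only [bwInner_sub_left]
        ring
      set A := ∫ θ, bwInner θ (v θ - bwGrad (ψ n) θ) (bwGrad φ θ) ∂μ
      have h7 : 2 * |A| ≤ (1 / 4) ^ n * (1 + b) := by
        have h8 : (1 / 4 : ℝ) ^ n * (2 * A) ≤ (1 / 4) ^ n * ((1 / 4) ^ n * (1 + b)) := by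
          rw [hss] at h1; linarith
        have h9 : (1 / 4 : ℝ) ^ n * (-(2 * A)) ≤ (1 / 4) ^ n * ((1 / 4) ^ n * (1 + b)) := by
          rw [hss] at h2; linarith
        have h8' := le_of_mul_le_mul_left h8 hs
        have h9' := le_of_mul_le_mul_left h9 hs
        rcases abs_choice A with h | h <;> rw [h] <;> linarith
      rw [h6]
      have hb0 : 0 ≤ b := integral_nonneg fun θ => bwInner_self_nonneg θ (hfφ.isVectorField θ)
      have h10 := mul_nonneg hs.le hb0
      refine (abs_sub _ _).trans ?_
      linarith
    have h := ge_of_tendsto (htend.const_mul (5 + 2 * b)) (Eventually.of_forall hbound)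
    rw [mul_zero] at h
    exact abs_nonpos_iff.1 h
  refine ⟨G, ⟨hGs, hGm, fun ε hε => ?_⟩, hG, fun w hw hwt => ?_⟩
  · have h1 : Tendsto (fun n : ℕ => 4 * ((1 : ℝ) / 16) ^ n) atTop (𝓝 (4 * 0)) :=
      (tendsto_pow_atTop_nhds_zero_of_lt_one (by norm_num) (by norm_num)).const_mul 4
    rw [mul_zero] at h1
    obtain ⟨n, hn⟩ := (h1.eventually (gt_mem_nhds hε)).exists
    exact ⟨ψ n, hψ n, (hGl n).trans_lt ((ENNReal.ofReal_lt_ofReal_iff hε).2 hn)⟩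
  · have hvG := hv.sub hG
    set e := ∫ θ, bwInner θ (v θ - G θ) (v θ - G θ) ∂μ with he
    have hzero : ∫ θ, bwInner θ (v θ - G θ) (w θ) ∂μ = 0 := by
      have hbound : ∀ n : ℕ, |∫ θ, bwInner θ (v θ - G θ) (w θ) ∂μ| ≤ (1 + |e|) * (1 / 4) ^ n := by
        intro n
        have hs : (0 : ℝ) < (1 / 4) ^ n := by positivity
        obtain ⟨φ, hφ, hlt⟩ := hwt.2.2 ((1 / 4) ^ n * (1 / 4) ^ n) (by positivity)
        have hfφ : FiniteEnergyField μ (bwGrad φ) := hφ.finiteEnergyField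
        have hwφ := hw.sub hfφ
        rw [hwφ.lintegral_eq, ENNReal.ofReal_lt_ofReal_iff (by positivity)] at hlt
        have h1 := hvG.two_mul_abs_integral_le hwφ hs
        have h2 : ∫ θ, bwInner θ (v θ - G θ) (w θ) ∂μ
            = ∫ θ, bwInner θ (v θ - G θ) (w θ - bwGrad φ θ) ∂μ := by
          simp only [bwInner_sub_right _ _ (w _)]
          rw [integral_sub (hvG.integrable_bwInner hw) (hvG.integrable_bwInner hfφ),
            htest φ hφ, sub_zero]
        rw [h2]
        have h3 := mul_le_mul_of_nonneg_left hlt.le (inv_pos.2 hs).le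
        rw [inv_mul_cancel_left₀ hs.ne'] at h3
        have h4 := mul_le_mul_of_nonneg_left (le_abs_self e) hs.le
        have h5 := mul_nonneg hs.le (abs_nonneg e)
        linarith
      have h := ge_of_tendsto (htend.const_mul (1 + |e|)) (Eventually.of_forall hbound)
      rw [mul_zero] at h
      exact abs_nonpos_iff.1 h
    simp only [bwInner_sub_left] at hzero
    rw [integral_sub (hv.integrable_bwInner hw) (hG.integrable_bwInner hw)] at hzero
    linarith

end Projection

/-! ### Gradient flows and the continuity equation of the first variation -/

section GradientFlow

variable {V : EuclideanSpace ℝ (Fin d) → ℝ}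

lemma integrable_bwInner_velocity (hV : Continuous V)
    (hVint : ∀ θ : BW d, Integrable V (gaussian θ))
    (hexp : Integrable (fun x => Real.exp (-V x)) volume) (μ : Measure (BW d))
    [IsProbabilityMeasure μ] {φ : Ambient d → ℝ} (hφ : IsTestFunction φ) :
    Integrable (fun θ => bwInner θ (velocity V μ θ) (bwGrad φ θ)) μ := by
  obtain ⟨K, hK, hφK⟩ := hφ.2
  have hf := fun c hc => integrable_exp_mul_logRatio hV hVint hexp μ (c := c) hc
  have hT : Continuous fun θ : BW d => tangentMap θ.1 (bwGrad φ θ) :=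
    continuous_tangentMap.comp (continuous_subtype_val.prodMk hφ.continuous_bwGrad)
  have h := (integrable_kernelDeriv_mul hK hT (fun θ hθ => by
    rw [IsTestFunction.bwGrad_eq_zero hφ.differentiable hK.isClosed hφK hθ, tangentMap_zero]) μ
    (measurable_logRatio hV μ) hf).integral_prod_left
  refine h.congr (ae_of_all _ fun θ => ?_)
  simp only [velocity]
  rw [bwInner_gradOf θ _ (isVectorField_bwGrad hφ θ), firstVariationDeriv,
    ContinuousLinearMap.integral_apply (integrable_smul_kernelDeriv hf θ)]
  rfl

/-- A gradient flow of the divergence solves the continuity equation driven by the gradient of the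
first variation: the Wasserstein gradient and the gradient of the first variation have the same
pairing with all gradients of test functions, as these are velocities of regular curves. -/
theorem IsGradientFlow.continuityEquation (hV : Continuous V)
    (hVint : ∀ θ : BW d, Integrable V (gaussian θ))
    (hexp : Integrable (fun x => Real.exp (-V x)) volume) {μ : ℝ → Measure (BW d)}
    (h : IsGradientFlow (klFunctional V) μ) :
    ContinuityEquation (Ici 0) μ (fun t θ => -velocity V (μ t) θ) := by
  obtain ⟨hP2, G, hG, hCE⟩ := h
  intro φ hφ t ht
  have hprob := (hP2 t ht).1
  obtain ⟨hF, hGT, hGd⟩ := hG t ht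
  obtain ⟨ε, ν, hν⟩ := hφ.exists_isRegularCurve (hP2 t ht)
  have h1 := (hGd ε ν _ hν).2
  have h2 := (hν.hasDerivAt_klFunctional hV hVint hexp hF).2
  have h3 := h1.unique h2
  have hs := fun θ => isVectorField_bwGrad hφ θ
  have e1 : ∀ θ, bwInner θ (bwGrad φ θ) (-velocity V (μ t) θ)
      = -bwInner θ (velocity V (μ t) θ) (bwGrad φ θ) := fun θ => by
    rw [bwInner_neg_right, bwInner_comm θ (hs θ) (velocity_isSymm _ _)]
  have e2 : ∀ θ, bwInner θ (bwGrad φ θ) (-G t θ) = -bwInner θ (G t θ) (bwGrad φ θ) := fun θ => by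
    rw [bwInner_neg_right, bwInner_comm θ (hs θ) (hGT.1 θ)]
  have h4 := (hCE φ hφ t ht).2
  simp only [e2] at h4
  simp only [e1]
  rw [integral_neg, h3] at h4
  rw [integral_neg]
  exact ⟨(integrable_bwInner_velocity hV hVint hexp (μ t) hφ).neg, h4⟩

/-- Solutions of the continuity equation driven by a square-integrable gradient of the first
variation are gradient flows: the Wasserstein gradient is the orthogonal projection of the gradient
of the first variation onto the tangent space. -/
theorem isGradientFlow_of_continuityEquation (hV : Continuous V)
    (hVint : ∀ θ : BW d, Integrable V (gaussian θ))
    (hexp : Integrable (fun x => Real.exp (-V x)) volume) {μ : ℝ → Measure (BW d)}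
    (hP2 : ∀ t, 0 ≤ t → IsP2 (μ t)) (hF : ∀ t, 0 ≤ t → klFunctional V (μ t) ≠ ⊤)
    (hE : ∀ t, 0 ≤ t → FiniteEnergyField (μ t) (velocity V (μ t)))
    (hCE : ContinuityEquation (Ici 0) μ (fun t θ => -velocity V (μ t) θ)) :
    IsGradientFlow (klFunctional V) μ := by
  have hex : ∀ t, ∃ G, 0 ≤ t → InTangentSpace (μ t) G ∧ FiniteEnergyField (μ t) G ∧
      ∀ w, FiniteEnergyField (μ t) w → InTangentSpace (μ t) w →
        ∫ θ, bwInner θ (G θ) (w θ) ∂(μ t) = ∫ θ, bwInner θ (velocity V (μ t) θ) (w θ) ∂(μ t) := by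
    intro t
    by_cases ht : 0 ≤ t
    · have := (hP2 t ht).1
      obtain ⟨G, hG⟩ := exists_projection (hE t ht)
      exact ⟨G, fun _ => hG⟩
    · exact ⟨0, fun h => absurd h ht⟩
  choose G hG using hex
  refine ⟨hP2, G, fun t ht => ⟨hF t ht, (hG t ht).1, fun ε ν w hν => ?_⟩, fun φ hφ t ht => ?_⟩
  · have := (hP2 t ht).1
    have h0 : (0 : ℝ) ∈ Ioo (-ε) ε := ⟨by linarith [hν.pos], hν.pos⟩
    obtain ⟨K, hK, hw⟩ := hν.compactSupport
    have hw0 : Continuous (w 0) :=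
      hν.continuous.comp_continuous (f := fun θ : BW d => ((0 : ℝ), θ)) (by fun_prop)
        fun θ => ⟨h0, mem_univ _⟩
    have hfe : FiniteEnergyField (μ t) (w 0) :=
      finiteEnergyField_of_continuous (hν.vectorField 0 h0) hw0 hK (hw 0 h0)
    rw [(hG t ht).2.2 _ hfe hν.tangent]
    exact hν.hasDerivAt_klFunctional hV hVint hexp (hF t ht)
  · have := (hP2 t ht).1
    have hfe : FiniteEnergyField (μ t) (bwGrad φ) := hφ.finiteEnergyField
    have hT : InTangentSpace (μ t) (bwGrad φ) :=
      ⟨isVectorField_bwGrad hφ, hfe.aemeasurable, fun r hr => ⟨φ, hφ, by simp [bwInner, hr]⟩⟩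
    have hs := fun θ => isVectorField_bwGrad hφ θ
    have e1 : ∀ θ, bwInner θ (bwGrad φ θ) (-velocity V (μ t) θ)
        = -bwInner θ (velocity V (μ t) θ) (bwGrad φ θ) := fun θ => by
      rw [bwInner_neg_right, bwInner_comm θ (hs θ) (velocity_isSymm _ _)]
    have e2 : ∀ θ, bwInner θ (bwGrad φ θ) (-G t θ) = -bwInner θ (G t θ) (bwGrad φ θ) := fun θ => by
      rw [bwInner_neg_right, bwInner_comm θ (hs θ) ((hG t ht).1.1 θ)]
    have h4 := (hCE φ hφ t ht).2
    simp only [e1] at h4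
    simp only [e2]
    rw [integral_neg, ← (hG t ht).2.2 _ hfe hT] at h4
    rw [integral_neg]
    exact ⟨((hG t ht).2.1.integrable_bwInner hfe).neg, h4⟩

end GradientFlow

/-! ### Continuity in time of the log-ratio -/

lemma integrable_gaussianDensity (θ : BW d) : Integrable (gaussianDensity θ) := by
  refine ⟨(continuous_gaussianDensity θ).aestronglyMeasurable, ?_⟩
  rw [hasFiniteIntegral_iff_ofReal (ae_of_all _ fun x => (gaussianDensity_pos θ x).le),
    lintegral_gaussianDensity]
  exact ENNReal.one_lt_top

lemma integral_gaussianDensity (θ : BW d) : ∫ x, gaussianDensity θ x = 1 := by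
  rw [integral_eq_lintegral_of_nonneg_ae (ae_of_all _ fun x => (gaussianDensity_pos θ x).le)
    (continuous_gaussianDensity θ).aestronglyMeasurable, lintegral_gaussianDensity]
  rfl

lemma integrable_mul_gaussianDensity_prod (μ : Measure (BW d)) [IsFiniteMeasure μ] {g : BW d → ℝ}
    (hg : Continuous g) {C : ℝ} (hC : ∀ θ, |g θ| ≤ C) :
    Integrable (fun p : BW d × EuclideanSpace ℝ (Fin d) => g p.1 * gaussianDensity p.1 p.2)
      (μ.prod volume) := by
  have h1 : Integrable (fun p : BW d × EuclideanSpace ℝ (Fin d) => gaussianDensity p.1 p.2)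
      (μ.prod volume) := by
    rw [integrable_prod_iff measurable_gaussianDensity_uncurry.aestronglyMeasurable]
    refine ⟨ae_of_all _ fun θ => integrable_gaussianDensity θ, ?_⟩
    simp only [Real.norm_of_nonneg (gaussianDensity_pos _ _).le, integral_gaussianDensity]
    exact integrable_const _
  exact h1.bdd_mul (c := C) (hg.comp continuous_fst).aestronglyMeasurable
    (ae_of_all _ fun p => hC p.1)

lemma integral_integral_mul_gaussianDensity (μ : Measure (BW d)) [IsFiniteMeasure μ] {g : BW d → ℝ}
    (hg : Continuous g) {C : ℝ} (hC : ∀ θ, |g θ| ≤ C) :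
    Integrable (fun x => ∫ θ, g θ * gaussianDensity θ x ∂μ) ∧
      ∫ x, ∫ θ, g θ * gaussianDensity θ x ∂μ = ∫ θ, g θ ∂μ := by
  have h := integrable_mul_gaussianDensity_prod μ hg hC
  refine ⟨h.integral_prod_right, ?_⟩
  rw [← integral_integral_swap (f := fun θ x => g θ * gaussianDensity θ x) h]
  simp only [integral_const_mul, integral_gaussianDensity, mul_one]

/-- The integrals of all test functions are continuous in time on `I`. -/
def TestContinuousOn (I : Set ℝ) (μ : ℝ → Measure (BW d)) : Prop :=
  ∀ φ : Ambient d → ℝ, IsTestFunction φ → ContinuousOn (fun t => ∫ θ, φ θ.1 ∂(μ t)) I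

lemma ContinuityEquation.testContinuousOn {I : Set ℝ} {μ : ℝ → Measure (BW d)}
    {v : ℝ → BW d → Ambient d} (h : ContinuityEquation I μ v) : TestContinuousOn I μ :=
  fun φ hφ t ht => (h φ hφ t ht).2.continuousWithinAt

section TimeContinuity

variable {I : Set ℝ} {μ : ℝ → Measure (BW d)}

/-- No mass escapes to infinity, or to the boundary of the manifold, under test continuity: a cutoff
that captures almost all of the mass at one time does so at nearby times. -/
lemma TestContinuousOn.exists_cutoff (h : TestContinuousOn I μ)
    (hp : ∀ t ∈ I, IsProbabilityMeasure (μ t)) {s : ℝ} (hs : s ∈ I) {ε : ℝ} (hε : 0 < ε) :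
    ∃ χ : Ambient d → ℝ, ContDiff ℝ ∞ χ ∧ HasCompactSupport χ ∧ tsupport χ ⊆ detPos d ∧
      (∀ x, χ x ∈ Icc (0 : ℝ) 1) ∧ ∀ᶠ t in 𝓝[I] s, 1 - ε < ∫ θ, χ θ.1 ∂(μ t) := by
  have := hp s hs
  obtain ⟨K, hK, hlt⟩ := exists_isCompact_lt_real (μ s) (a := 1 - ε) (by simp; linarith)
  obtain ⟨χ, h1, h2, h3, ⟨W, hW, hKW, hW1⟩, h4⟩ := exists_test_cutoff hK
  have hχ := isTestFunction_of_hasCompactSupport h1 h2 h3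
  refine ⟨χ, h1, h2, h3, h4, (h χ hχ s hs).eventually (lt_mem_nhds (hlt.trans_le ?_))⟩
  rw [← integral_indicator_one hK.measurableSet]
  refine integral_mono ((integrable_const 1).indicator hK.measurableSet) (hχ.integrable _)
    fun θ => ?_
  by_cases hθ : θ ∈ K
  · simp [hθ, hW1 _ (hKW θ hθ)]
  · simpa [hθ] using (h4 θ.1).1

lemma abs_cutoff_le {χ : Ambient d → ℝ} (h : ∀ x, χ x ∈ Icc (0 : ℝ) 1) (θ : BW d) :
    |χ θ.1| ≤ 1 := abs_le.2 ⟨by linarith [(h θ.1).1], (h θ.1).2⟩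

/-- The mixture densities are continuous in time with values in `L¹`. Since the total mass is
preserved, the parts of the densities outside of a cutoff have small `L¹` norm. -/
lemma TestContinuousOn.tendsto_mixtureDensity (h : TestContinuousOn I μ)
    (hp : ∀ t ∈ I, IsProbabilityMeasure (μ t)) {s : ℝ} (hs : s ∈ I) :
    Tendsto (fun t => ∫ x, |mixtureDensity (μ t) x - mixtureDensity (μ s) x|) (𝓝[I] s) (𝓝 0) := by
  have hI : ∀ᶠ t in 𝓝[I] s, t ∈ I := self_mem_nhdsWithin
  rw [tendsto_order]
  refine ⟨fun a ha => Eventually.of_forall fun t =>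
    ha.trans_le (integral_nonneg fun x => abs_nonneg _), fun ε hε => ?_⟩
  have hps := hp s hs
  obtain ⟨χ, h1, h2, h3, h4, hev⟩ := h.exists_cutoff hp hs (by linarith : 0 < ε / 4)
  have hχc : Continuous fun θ : BW d => χ θ.1 := h1.continuous.comp continuous_subtype_val
  set a : ℝ → EuclideanSpace ℝ (Fin d) → ℝ := fun t x => ∫ θ, χ θ.1 * gaussianDensity θ x ∂(μ t)
    with ha
  have hai : ∀ t ∈ I, Integrable (a t) ∧ ∫ x, a t x = ∫ θ, χ θ.1 ∂(μ t) := fun t ht => by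
    have := hp t ht
    exact integral_integral_mul_gaussianDensity (μ t) hχc (abs_cutoff_le h4)
  -- the part inside the cutoff converges by dominated convergence
  have hlim : Tendsto (fun t => ∫ x, |a t x - a s x|) (𝓝[I] s) (𝓝 0) := by
    obtain ⟨c, hc, C, hC, hb⟩ := exists_kernel_bounds (isCompact_val_preimage h2 h3)
    have hab : ∀ t ∈ I, ∀ x, |a t x| ≤ C * Real.exp (-(c * ‖x‖ ^ 2)) := fun t ht x => by
      have := hp t ht
      have h5 := norm_integral_le_of_norm_le_const (μ := μ t)
        (f := fun θ : BW d => χ θ.1 * gaussianDensity θ x)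
        (C := C * Real.exp (-(c * ‖x‖ ^ 2))) (ae_of_all _ fun θ => ?_)
      · simpa using h5
      · rw [norm_mul, Real.norm_of_nonneg (gaussianDensity_pos θ x).le, Real.norm_eq_abs]
        by_cases hθ : θ.1 ∈ tsupport χ
        · exact (mul_le_of_le_one_left (gaussianDensity_pos θ x).le (abs_cutoff_le h4 θ)).trans
            (hb θ hθ x).1
        · rw [image_eq_zero_of_notMem_tsupport hθ, abs_zero, zero_mul]
          positivity
    have hzero : ∫ x : EuclideanSpace ℝ (Fin d), (0 : ℝ) = 0 := integral_zero _ _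
    rw [← hzero]
    refine tendsto_integral_filter_of_dominated_convergence
      (fun x => 2 * (C * Real.exp (-(c * ‖x‖ ^ 2)))) ?_ ?_
      (((integrable_exp_neg_mul_sq hc).const_mul C).const_mul 2) (ae_of_all _ fun x => ?_)
    · filter_upwards [hI] with t ht
      exact ((hai t ht).1.sub (hai s hs).1).abs.aestronglyMeasurable
    · filter_upwards [hI] with t ht
      refine ae_of_all _ fun x => ?_
      rw [Real.norm_eq_abs, abs_abs]
      have := abs_sub (a t x) (a s x)
      linarith [hab t ht x, hab s hs x]
    · have hφ : IsTestFunction (fun θ => χ θ • gaussKernel θ x) :=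
        isTestFunction_of_hasCompactSupport
          (contDiff_cutoff_mul h1 isOpen_detPos h3 (contDiffOn_gaussKernel x)) h2.smul_right
          ((tsupport_smul_subset_left _ _).trans h3)
      have h5 : Tendsto (fun t => a t x) (𝓝[I] s) (𝓝 (a s x)) := h _ hφ s hs
      have h6 := (h5.sub_const (a s x)).abs
      simpa using h6
  have hmass : 1 - ε / 4 < ∫ θ, χ θ.1 ∂(μ s) := hev.self_of_nhdsWithin hs
  filter_upwards [hI, hev, hlim.eventually (gt_mem_nhds (by linarith : 0 < ε / 2))] with t ht h5 h6
  have hpt := hp t ht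
  have hp1 : ∀ r ∈ I, ∫ x, mixtureDensity (μ r) x = 1 := fun r hr => by
    have := hp r hr
    have := (integral_integral_mul_gaussianDensity (μ r) (g := fun _ => 1) continuous_const
      (C := 1) (by simp)).2
    simpa [mixtureDensity] using this
  have hple : ∀ r ∈ I, ∀ᵐ x, a r x ≤ mixtureDensity (μ r) x := fun r hr => by
    have := hp r hr
    filter_upwards [ae_integrable_gaussianDensity (μ r)] with x hx
    refine integral_mono_of_nonneg (ae_of_all _ fun θ =>
      mul_nonneg (h4 θ.1).1 (gaussianDensity_pos θ x).le) hx (ae_of_all _ fun θ =>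
      mul_le_of_le_one_left (gaussianDensity_pos θ x).le (h4 θ.1).2)
  have hit := integrable_mixtureDensity (μ t)
  have his := integrable_mixtureDensity (μ s)
  calc ∫ x, |mixtureDensity (μ t) x - mixtureDensity (μ s) x|
      ≤ ∫ x, (|a t x - a s x| + ((mixtureDensity (μ t) x - a t x)
          + (mixtureDensity (μ s) x - a s x))) := by
        refine integral_mono_ae (hit.sub his).abs (((hai t ht).1.sub (hai s hs).1).abs.add
          ((hit.sub (hai t ht).1).add (his.sub (hai s hs).1))) ?_
        filter_upwards [hple t ht, hple s hs] with x hx1 hx2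
        refine abs_le.2 ⟨?_, ?_⟩
        · linarith [neg_abs_le (a t x - a s x)]
        · linarith [le_abs_self (a t x - a s x)]
    _ = (∫ x, |a t x - a s x|) + ((1 - ∫ θ, χ θ.1 ∂(μ t)) + (1 - ∫ θ, χ θ.1 ∂(μ s))) := by
        have i1 : Integrable (fun x => mixtureDensity (μ t) x - a t x) := hit.sub (hai t ht).1
        have i2 : Integrable (fun x => mixtureDensity (μ s) x - a s x) := his.sub (hai s hs).1
        have i3 : Integrable (fun x => |a t x - a s x|) := ((hai t ht).1.sub (hai s hs).1).abs
        have i12 : Integrable (fun x => (mixtureDensity (μ t) x - a t x)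
            + (mixtureDensity (μ s) x - a s x)) := i1.add i2
        rw [integral_add i3 i12, integral_add i1 i2,
          integral_sub hit (hai t ht).1, integral_sub his (hai s hs).1, hp1 t ht, hp1 s hs,
          (hai t ht).2, (hai s hs).2]
    _ < ε := by linarith

lemma abs_log_sub_log_le {a b l : ℝ} (hl : 0 < l) (ha : l ≤ a) (hb : l ≤ b) :
    |Real.log a - Real.log b| ≤ |a - b| / l := by
  have key : ∀ {a b : ℝ}, l ≤ a → l ≤ b → Real.log a - Real.log b ≤ |a - b| / l := by
    intro a b ha hb
    have ha0 := hl.trans_le ha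
    have hb0 := hl.trans_le hb
    rw [← Real.log_div ha0.ne' hb0.ne']
    calc Real.log (a / b) ≤ a / b - 1 := Real.log_le_sub_one_of_pos (div_pos ha0 hb0)
      _ = (a - b) / b := by field_simp
      _ ≤ |a - b| / b := by gcongr; exact le_abs_self _
      _ ≤ |a - b| / l := by gcongr
  refine abs_le.2 ⟨?_, key ha hb⟩
  have := key hb ha
  rw [abs_sub_comm] at this
  linarith

/-- The log-ratios are continuous in time with values in all Gaussian weighted `L¹` spaces. For
`‖x‖² ≤ ρ` the densities are bounded below, so the logarithm is Lipschitz; for `‖x‖² ≥ ρ` the weight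
beats the quadratic growth of the logarithms, uniformly in time. -/
lemma TestContinuousOn.tendsto_logRatio {V : EuclideanSpace ℝ (Fin d) → ℝ}
    (hexp : Integrable (fun x => Real.exp (-V x)) volume) (h : TestContinuousOn I μ)
    (hp : ∀ t ∈ I, IsProbabilityMeasure (μ t)) {s : ℝ} (hs : s ∈ I) {c : ℝ} (hc : 0 < c) :
    Tendsto (fun t => ∫ x, Real.exp (-(c * ‖x‖ ^ 2)) * |logRatio V (μ t) x - logRatio V (μ s) x|)
      (𝓝[I] s) (𝓝 0) := by
  have hI : ∀ᶠ t in 𝓝[I] s, t ∈ I := self_mem_nhdsWithin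
  have hps := hp s hs
  obtain ⟨χ, h1, h2, h3, h4, hev⟩ := h.exists_cutoff hp hs (by norm_num : (0 : ℝ) < 1 / 2)
  set K : Set (BW d) := Subtype.val ⁻¹' (tsupport χ) with hKdef
  have hK : IsCompact K := isCompact_val_preimage h2 h3
  have hmass : ∀ t ∈ I, 1 - 1 / 2 < ∫ θ, χ θ.1 ∂(μ t) → 1 / 2 ≤ (μ t).real K := by
    intro t ht hlt
    have := hp t ht
    have h5 : ∫ θ, χ θ.1 ∂(μ t) ≤ (μ t).real K := by
      rw [← integral_indicator_one hK.measurableSet]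
      refine integral_mono
        ((isTestFunction_of_hasCompactSupport h1 h2 h3).integrable _)
        ((integrable_const 1).indicator hK.measurableSet) fun θ => ?_
      by_cases hθ : θ ∈ K
      · simpa [hθ] using (h4 θ.1).2
      · simp [hθ, image_eq_zero_of_notMem_tsupport fun h => hθ h]
    linarith
  obtain ⟨C, hC, hlow⟩ := exists_mixtureDensity_lower_bound hK
  have hsK := hmass s hs (hev.self_of_nhdsWithin hs)
  set A := ∫ x : EuclideanSpace ℝ (Fin d), (1 + ‖x‖ ^ 2) * Real.exp (-(c / 2 * ‖x‖ ^ 2)) with hA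
  have hA0 : 0 ≤ A := integral_nonneg fun x => by positivity
  have hp1 : ∀ r ∈ I, ∫ x, mixtureDensity (μ r) x = 1 := fun r hr => by
    have := hp r hr
    have := (integral_integral_mul_gaussianDensity (μ r) (g := fun _ => 1) continuous_const
      (C := 1) (by simp)).2
    simpa [mixtureDensity] using this
  -- the estimate with a free truncation parameter `ρ`
  have key : ∀ ρ : ℝ, 0 ≤ ρ → ∀ t ∈ I, 1 / 2 ≤ (μ t).real K →
      ∫ x, Real.exp (-(c * ‖x‖ ^ 2)) * |logRatio V (μ t) x - logRatio V (μ s) x|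
        ≤ Real.exp (C * (1 + ρ)) * (∫ x, |mixtureDensity (μ t) x - mixtureDensity (μ s) x|)
          + Real.exp (-(c / 2 * ρ)) * (2 + 2 * C * A) := by
    intro ρ hρ t ht htK
    have hpt := hp t ht
    have hit := integrable_mixtureDensity (μ t)
    have his := integrable_mixtureDensity (μ s)
    have i1 : Integrable fun x => |mixtureDensity (μ t) x - mixtureDensity (μ s) x| :=
      (hit.sub his).abs
    have i2 : Integrable fun x : EuclideanSpace ℝ (Fin d) => 2 * C *
        ((1 + ‖x‖ ^ 2) * Real.exp (-(c / 2 * ‖x‖ ^ 2))) :=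
      (integrable_one_add_sq_mul_exp (half_pos hc)).const_mul (2 * C)
    have i3 : Integrable fun x => mixtureDensity (μ t) x + mixtureDensity (μ s) x := hit.add his
    have e1 : ∫ x, (Real.exp (C * (1 + ρ)) * |mixtureDensity (μ t) x - mixtureDensity (μ s) x|
        + Real.exp (-(c / 2 * ρ)) * ((mixtureDensity (μ t) x + mixtureDensity (μ s) x)
          + 2 * C * ((1 + ‖x‖ ^ 2) * Real.exp (-(c / 2 * ‖x‖ ^ 2)))))
        = Real.exp (C * (1 + ρ)) * (∫ x, |mixtureDensity (μ t) x - mixtureDensity (μ s) x|)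
          + Real.exp (-(c / 2 * ρ)) * (2 + 2 * C * A) := by
      have i32 : Integrable (fun x => (mixtureDensity (μ t) x + mixtureDensity (μ s) x)
          + 2 * C * ((1 + ‖x‖ ^ 2) * Real.exp (-(c / 2 * ‖x‖ ^ 2)))) := i3.add i2
      rw [integral_add (i1.const_mul _) (i32.const_mul _), integral_const_mul,
        integral_const_mul, integral_add i3 i2, integral_add hit his, hp1 t ht, hp1 s hs,
        integral_const_mul, ← hA]
      norm_num
    rw [← e1]
    refine integral_mono_of_nonneg (ae_of_all _ fun x => by positivity)
      ((i1.const_mul _).add ((i3.add i2).const_mul _)) ?_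
    filter_upwards [ae_integrable_gaussianDensity (μ t), ae_integrable_gaussianDensity (μ s)]
      with x hxt hxs
    have lt := hlow (μ t) htK x hxt
    have ls := hlow (μ s) hsK x hxs
    have pt := (Real.exp_pos _).trans_le lt
    have ps := (Real.exp_pos _).trans_le ls
    have e2 : logRatio V (μ t) x - logRatio V (μ s) x
        = Real.log (mixtureDensity (μ t) x) - Real.log (mixtureDensity (μ s) x) := by
      rw [logRatio_eq hexp pt, logRatio_eq hexp ps]; ring
    rw [e2]
    set a := mixtureDensity (μ t) x
    set b := mixtureDensity (μ s) x
    rcases le_total (‖x‖ ^ 2) ρ with hx | hx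
    · have h5 : Real.exp (-(C * (1 + ρ))) ≤ Real.exp (-(C * (1 + ‖x‖ ^ 2))) :=
        Real.exp_le_exp.2 (by nlinarith)
      have h6 := abs_log_sub_log_le (Real.exp_pos _) (h5.trans lt) (h5.trans ls)
      rw [div_eq_mul_inv, ← Real.exp_neg, neg_neg, mul_comm] at h6
      have h7 : Real.exp (-(c * ‖x‖ ^ 2)) * |Real.log a - Real.log b|
          ≤ |Real.log a - Real.log b| :=
        mul_le_of_le_one_left (abs_nonneg _) (exp_neg_mul_sq_le_one hc x)
      have h8 : 0 ≤ Real.exp (-(c / 2 * ρ)) * ((a + b)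
          + 2 * C * ((1 + ‖x‖ ^ 2) * Real.exp (-(c / 2 * ‖x‖ ^ 2)))) := by positivity
      linarith
    · have hlog : ∀ {r : ℝ}, Real.exp (-(C * (1 + ‖x‖ ^ 2))) ≤ r →
          |Real.log r| ≤ r + C * (1 + ‖x‖ ^ 2) := by
        intro r hr
        have hr0 := (Real.exp_pos _).trans_le hr
        have h5 := Real.log_le_log (Real.exp_pos _) hr
        rw [Real.log_exp] at h5
        have h6 := Real.log_le_sub_one_of_pos hr0
        have h7 : 0 ≤ C * (1 + ‖x‖ ^ 2) := by positivity
        exact abs_le.2 ⟨by linarith, by linarith⟩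
      have h5 : |Real.log a - Real.log b| ≤ a + b + 2 * C * (1 + ‖x‖ ^ 2) := by
        have := abs_sub (Real.log a) (Real.log b)
        linarith [hlog lt, hlog ls]
      have h6 : Real.exp (-(c * ‖x‖ ^ 2))
          ≤ Real.exp (-(c / 2 * ρ)) * Real.exp (-(c / 2 * ‖x‖ ^ 2)) := by
        rw [← Real.exp_add]
        refine Real.exp_le_exp.2 ?_
        nlinarith
      have h7 : Real.exp (-(c / 2 * ‖x‖ ^ 2)) ≤ 1 := exp_neg_mul_sq_le_one (half_pos hc) x
      calc Real.exp (-(c * ‖x‖ ^ 2)) * |Real.log a - Real.log b|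
          ≤ (Real.exp (-(c / 2 * ρ)) * Real.exp (-(c / 2 * ‖x‖ ^ 2)))
            * (a + b + 2 * C * (1 + ‖x‖ ^ 2)) := by gcongr
        _ = Real.exp (-(c / 2 * ρ)) * (Real.exp (-(c / 2 * ‖x‖ ^ 2)) * (a + b)
            + 2 * C * ((1 + ‖x‖ ^ 2) * Real.exp (-(c / 2 * ‖x‖ ^ 2)))) := by ring
        _ ≤ Real.exp (-(c / 2 * ρ)) * ((a + b)
            + 2 * C * ((1 + ‖x‖ ^ 2) * Real.exp (-(c / 2 * ‖x‖ ^ 2)))) := by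
            gcongr
            exact mul_le_of_le_one_left (by positivity) h7
        _ ≤ _ := le_add_of_nonneg_left (by positivity)
  rw [tendsto_order]
  refine ⟨fun a ha => Eventually.of_forall fun t =>
    ha.trans_le (integral_nonneg fun x => by positivity), fun ε hε => ?_⟩
  obtain ⟨ρ, hρ0, hρ⟩ : ∃ ρ : ℝ, 0 ≤ ρ ∧ Real.exp (-(c / 2 * ρ)) * (2 + 2 * C * A) < ε / 2 := by
    have h5 : Tendsto (fun ρ : ℝ => Real.exp (-(c / 2 * ρ)) * (2 + 2 * C * A)) atTop
        (𝓝 (0 * (2 + 2 * C * A))) :=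
      (Real.tendsto_exp_neg_atTop_nhds_zero.comp
        (tendsto_id.const_mul_atTop (half_pos hc))).mul_const _
    rw [zero_mul] at h5
    obtain ⟨ρ, h6, h7⟩ := ((h5.eventually (gt_mem_nhds (half_pos hε))).and
      (eventually_ge_atTop 0)).exists
    exact ⟨ρ, h7, h6⟩
  have h5 := (h.tendsto_mixtureDensity hp hs).const_mul (Real.exp (C * (1 + ρ)))
  rw [mul_zero] at h5
  filter_upwards [hI, hev, h5.eventually (gt_mem_nhds (half_pos hε))] with t ht h6 h7
  linarith [key ρ hρ0 t ht (hmass t ht h6)]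

end TimeContinuity

/-! ### The velocity as a smooth field driven by a curve of functionals -/

open scoped BoundedContinuousFunction

open scoped Classical in
/-- The functional `u ↦ ∫ exp (-c‖x‖²) f x u x dx` on bounded continuous functions, with the value
zero when `exp (-c‖x‖²) f` is not integrable. -/
def gaussianPairing (c : ℝ) (f : EuclideanSpace ℝ (Fin d) → ℝ) :
    StrongDual ℝ (EuclideanSpace ℝ (Fin d) →ᵇ ℝ) :=
  if h : Integrable (fun x => Real.exp (-(c * ‖x‖ ^ 2)) * f x) then
    LinearMap.mkContinuous
      { toFun := fun u => ∫ x, Real.exp (-(c * ‖x‖ ^ 2)) * f x * u x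
        map_add' := fun u v => by
          have hi : ∀ u : EuclideanSpace ℝ (Fin d) →ᵇ ℝ,
              Integrable (fun x => Real.exp (-(c * ‖x‖ ^ 2)) * f x * u x) := fun u =>
            h.mul_bdd (c := ‖u‖) u.continuous.aestronglyMeasurable
              (ae_of_all _ fun x => u.norm_coe_le_norm x)
          simp only [BoundedContinuousFunction.coe_add, Pi.add_apply, mul_add]
          exact integral_add (hi u) (hi v)
        map_smul' := fun r u => by
          simp only [BoundedContinuousFunction.coe_smul, smul_eq_mul, RingHom.id_apply]
          rw [← integral_const_mul]
          congr 1; ext x; ring }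
      (∫ x, ‖Real.exp (-(c * ‖x‖ ^ 2)) * f x‖) (fun u => by
        rw [← integral_mul_const]
        refine norm_integral_le_of_norm_le (h.norm.mul_const _) (ae_of_all _ fun x => ?_)
        rw [norm_mul]
        gcongr
        exact u.norm_coe_le_norm x)
  else 0

lemma gaussianPairing_apply {c : ℝ} {f : EuclideanSpace ℝ (Fin d) → ℝ}
    (h : Integrable (fun x => Real.exp (-(c * ‖x‖ ^ 2)) * f x))
    (u : EuclideanSpace ℝ (Fin d) →ᵇ ℝ) :
    gaussianPairing c f u = ∫ x, Real.exp (-(c * ‖x‖ ^ 2)) * f x * u x := by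
  rw [gaussianPairing, dif_pos h]
  rfl

lemma norm_gaussianPairing_sub_le {c : ℝ} {f g : EuclideanSpace ℝ (Fin d) → ℝ}
    (hf : Integrable (fun x => Real.exp (-(c * ‖x‖ ^ 2)) * f x))
    (hg : Integrable (fun x => Real.exp (-(c * ‖x‖ ^ 2)) * g x)) :
    ‖gaussianPairing c f - gaussianPairing c g‖
      ≤ ∫ x, Real.exp (-(c * ‖x‖ ^ 2)) * |f x - g x| := by
  have hi : Integrable (fun x => Real.exp (-(c * ‖x‖ ^ 2)) * |f x - g x|) := by
    refine (hf.sub hg).abs.congr (ae_of_all _ fun x => ?_)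
    simp only [Pi.sub_apply]
    rw [← mul_sub, abs_mul, abs_of_pos (Real.exp_pos _)]
  refine ContinuousLinearMap.opNorm_le_bound _ (integral_nonneg fun x => by positivity)
    fun u => ?_
  have hb : ∀ {f : EuclideanSpace ℝ (Fin d) → ℝ},
      Integrable (fun x => Real.exp (-(c * ‖x‖ ^ 2)) * f x) →
      Integrable (fun x => Real.exp (-(c * ‖x‖ ^ 2)) * f x * u x) := fun h =>
    h.mul_bdd (c := ‖u‖) u.continuous.aestronglyMeasurable
      (ae_of_all _ fun x => u.norm_coe_le_norm x)
  rw [_root_.sub_apply, gaussianPairing_apply hf, gaussianPairing_apply hg,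
    ← integral_sub (hb hf) (hb hg), ← integral_mul_const]
  refine norm_integral_le_of_norm_le (hi.mul_const _) (ae_of_all _ fun x => ?_)
  rw [← sub_mul, ← mul_sub, norm_mul, norm_mul, Real.norm_eq_abs, abs_of_pos (Real.exp_pos _),
    Real.norm_eq_abs (f x - g x)]
  gcongr
  exact u.norm_coe_le_norm x

/-- `tangentMap θ` as a continuous linear map. -/
def tangentMapL (θ : Ambient d) : Ambient d →L[ℝ] Ambient d :=
  LinearMap.toContinuousLinearMap
    { toFun := fun u => tangentMap θ u
      map_add' := fun u v => by
        simp only [tangentMap, Prod.fst_add, Prod.snd_add, add_mul, mul_add, Prod.mk_add_mk]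
        congr 1; abel
      map_smul' := fun r u => by
        simp [tangentMap] }

@[simp]
lemma contDiff_tangentMapL : ContDiff ℝ ∞ (tangentMapL (d := d)) := by
  refine contDiff_clm_apply_iff.2 fun u => ?_
  exact contDiff_tangentMap.comp (contDiff_id.prodMk contDiff_const)

lemma isOpen_interior_posDef_of_isSymm {K : Set (BW d)} :
    IsOpen (interior {η : Ambient d | η.2.IsSymm → η.2.PosDef}) ∧
      ∀ θ ∈ K, θ.1 ∈ interior {η : Ambient d | η.2.IsSymm → η.2.PosDef} :=
  ⟨isOpen_interior, fun θ _ => mem_interior_iff_mem_nhds.2 (eventually_posDef θ)⟩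

/-- The family of linear maps `Λ ↦ -χ • T (∇ (Λ ∘ D))`, where `T` turns tangent vectors into
ambient velocities and everything is evaluated at the symmetrization of the base point. -/
def cutoffField {G : Type*} [NormedAddCommGroup G] [NormedSpace ℝ G] (χ : Ambient d → ℝ)
    (D : Ambient d → Ambient d →L[ℝ] G) (η : Ambient d) : StrongDual ℝ G →L[ℝ] Ambient d :=
  -(χ η • (tangentMapL (symmPart d η)).comp (gradOf.comp
      ((ContinuousLinearMap.compL ℝ (Ambient d) G ℝ).flip (D (symmPart d η)))))

section CutoffField

variable {G : Type*} [NormedAddCommGroup G] [NormedSpace ℝ G] {χ : Ambient d → ℝ}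
  {D : Ambient d → Ambient d →L[ℝ] G}

lemma cutoffField_apply (η : Ambient d) (Λ : StrongDual ℝ G) : cutoffField χ D η Λ
    = -(χ η • tangentMap (symmPart d η) (gradOf (Λ.comp (D (symmPart d η))))) := rfl

lemma contDiff_cutoffField {N U : Set (Ambient d)} (h1 : ContDiff ℝ ∞ χ) (hU : IsOpen U)
    (h3 : tsupport χ ⊆ U) (hUN : U ⊆ symmPart d ⁻¹' N) (hD : ContDiffOn ℝ ∞ D N) :
    ContDiff ℝ ∞ (cutoffField χ D) := by
  have hA : ContDiffOn ℝ ∞ (fun η => (tangentMapL (symmPart d η)).comp (gradOf.comp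
      ((ContinuousLinearMap.compL ℝ (Ambient d) G ℝ).flip (D (symmPart d η))))) U := by
    refine (contDiff_tangentMapL.comp (symmPart d).contDiff).contDiffOn.clm_comp ?_
    refine contDiffOn_const.clm_comp ?_
    exact (ContinuousLinearMap.contDiff _).comp_contDiffOn
      (hD.comp (symmPart d).contDiff.contDiffOn hUN)
  exact (contDiff_cutoff_mul h1 hU h3 hA).neg

lemma hasCompactSupport_cutoffField (h2 : HasCompactSupport χ) :
    HasCompactSupport (cutoffField χ D) := by
  refine h2.mono fun η hη h => hη ?_
  refine ContinuousLinearMap.ext fun Λ => ?_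
  rw [cutoffField_apply, h, zero_smul, neg_zero]
  rfl

lemma cutoffField_isSymm (η : Ambient d) (Λ : StrongDual ℝ G) :
    (cutoffField χ D η Λ).2.IsSymm := by
  rw [cutoffField_apply, Prod.snd_neg, Prod.smul_snd]
  exact ((tangentMap_isSymm (symmPart_isSymm η) (gradOf_isSymm _)).smul _).neg

end CutoffField

/-- Near a compact set of parameters, the velocity of any mixing measure is the value of one smooth
compactly supported family `B` of linear maps at a vector that depends on the mixing measure in a
Lipschitz way, with respect to a Gaussian weighted `L¹` norm of the log-ratio. -/
lemma exists_velocity_field {K : Set (BW d)} (hK : IsCompact K) :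
    ∃ c > 0, ∃ (F : Type) (_ : NormedAddCommGroup F) (_ : NormedSpace ℝ F)
      (pair : (EuclideanSpace ℝ (Fin d) → ℝ) → F) (B : Ambient d → F →L[ℝ] Ambient d)
      (W : Set (Ambient d)), IsOpen W ∧ (∀ θ ∈ K, θ.1 ∈ W) ∧ W ⊆ detPos d ∧
        (∀ η ∈ W, η.2.IsSymm → η.2.PosDef) ∧ ContDiff ℝ ∞ B ∧ HasCompactSupport B ∧
        (∀ η Λ, (B η Λ).2.IsSymm) ∧
        (∀ {f g : EuclideanSpace ℝ (Fin d) → ℝ},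
          Integrable (fun x => Real.exp (-(c * ‖x‖ ^ 2)) * f x) →
          Integrable (fun x => Real.exp (-(c * ‖x‖ ^ 2)) * g x) →
          ‖pair f - pair g‖ ≤ ∫ x, Real.exp (-(c * ‖x‖ ^ 2)) * |f x - g x|) ∧
        ∀ {V : EuclideanSpace ℝ (Fin d) → ℝ} {μ : Measure (BW d)},
          (∀ c : ℝ, 0 < c → Integrable (fun x => Real.exp (-(c * ‖x‖ ^ 2)) * logRatio V μ x)) →
          ∀ θ : BW d, θ.1 ∈ W → B θ.1 (pair (logRatio V μ))
            = -tangentMap θ.1 (velocity V μ θ) := by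
  obtain ⟨c, hc, N, hN, hKN, hs, hv⟩ := exists_contDiffOn_weightedKernel hK
  set U := symmPart d ⁻¹' N ∩ detPos d with hUdef
  have hU : IsOpen U := (hN.preimage (symmPart d).continuous).inter isOpen_detPos
  have hKU : Subtype.val '' K ⊆ U := by
    rintro _ ⟨θ, hθ, rfl⟩
    exact ⟨by simpa [symmPart_val] using hKN θ hθ, val_mem_detPos θ⟩
  obtain ⟨χ, h1, h2, h3, ⟨W, hW, hKW, hW1⟩, h4⟩ :=
    exists_smooth_cutoff (hK.image continuous_subtype_val) hU hKU
  set P := interior {η : Ambient d | η.2.IsSymm → η.2.PosDef}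
  have hP := isOpen_interior_posDef_of_isSymm (K := K)
  have hD : ContDiffOn ℝ ∞ (fderiv ℝ (weightedKernel (d := d) c)) N :=
    hs.fderiv_of_isOpen hN (by norm_cast)
  refine ⟨c, hc, StrongDual ℝ (EuclideanSpace ℝ (Fin d) →ᵇ ℝ), inferInstance, inferInstance,
    gaussianPairing c, cutoffField χ (fderiv ℝ (weightedKernel (d := d) c)),
    W ∩ U ∩ P, (hW.inter hU).inter hP.1, fun θ hθ =>
    ⟨⟨hKW ⟨θ, hθ, rfl⟩, hKU ⟨θ, hθ, rfl⟩⟩, hP.2 θ hθ⟩, fun η hη => hη.1.2.2, fun η hη =>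
    interior_subset hη.2, contDiff_cutoffField h1 hU h3 inter_subset_left hD,
    hasCompactSupport_cutoffField h2, cutoffField_isSymm, norm_gaussianPairing_sub_le,
    fun {V μ} hint θ hθ => ?_⟩
  have hθN : θ.1 ∈ N := by simpa [symmPart_val] using hθ.1.2.1
  rw [cutoffField_apply, hW1 _ hθ.1.1, one_smul, velocity, symmPart_val]
  have e : (gaussianPairing c (logRatio V μ)).comp (fderiv ℝ (weightedKernel c) θ.1)
      = firstVariationDeriv V μ θ.1 := by
    refine ContinuousLinearMap.ext fun u => ?_
    have h5 := integrable_smul_kernelDeriv (hint) θ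
    rw [firstVariationDeriv, ContinuousLinearMap.integral_apply h5,
      ContinuousLinearMap.comp_apply, gaussianPairing_apply (hint c hc)]
    refine integral_congr_ae (ae_of_all _ fun x => ?_)
    simp only [_root_.smul_apply, smul_eq_mul]
    rw [fderiv_weightedKernel_apply hN hs hv hθN]
    ring
  rw [e]

section DrivingCurve

variable {V : EuclideanSpace ℝ (Fin d) → ℝ} {I : Set ℝ} {μ : ℝ → Measure (BW d)}

/-- Near a compact set of parameters, the velocity along a curve of mixing measures is a smooth
compactly supported family of linear maps applied to a continuous curve. -/
lemma TestContinuousOn.exists_velocity_field (hV : Continuous V)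
    (hVint : ∀ θ : BW d, Integrable V (gaussian θ))
    (hexp : Integrable (fun x => Real.exp (-V x)) volume) (h : TestContinuousOn I μ)
    (hp : ∀ t ∈ I, IsProbabilityMeasure (μ t)) {K : Set (BW d)} (hK : IsCompact K) :
    ∃ (F : Type) (_ : NormedAddCommGroup F) (_ : NormedSpace ℝ F)
      (B : Ambient d → F →L[ℝ] Ambient d) (Λ : ℝ → F)
      (W : Set (Ambient d)), IsOpen W ∧ (∀ θ ∈ K, θ.1 ∈ W) ∧ W ⊆ detPos d ∧
        (∀ η ∈ W, η.2.IsSymm → η.2.PosDef) ∧ ContDiff ℝ ∞ B ∧ HasCompactSupport B ∧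
        (∀ η Λ, (B η Λ).2.IsSymm) ∧ ContinuousOn Λ I ∧
        ∀ t ∈ I, ∀ θ : BW d, θ.1 ∈ W → B θ.1 (Λ t) = -tangentMap θ.1 (velocity V (μ t) θ) := by
  obtain ⟨c, hc, F, _, _, pair, B, W, hW, hKW, hWd, hWp, hB, hBc, hBs, hpair, hBv⟩ :=
    GaussianMixtureFlow.exists_velocity_field hK
  have hint : ∀ t ∈ I, ∀ c : ℝ, 0 < c →
      Integrable (fun x => Real.exp (-(c * ‖x‖ ^ 2)) * logRatio V (μ t) x) :=
    fun t ht c hc => by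
      have := hp t ht
      exact integrable_exp_mul_logRatio hV hVint hexp (μ t) hc
  refine ⟨F, _, _, B, fun t => pair (logRatio V (μ t)), W, hW, hKW, hWd, hWp, hB, hBc, hBs, ?_,
    fun t ht θ hθ => hBv (hint t ht) θ hθ⟩
  intro s hs
  refine tendsto_iff_norm_sub_tendsto_zero.2 (squeeze_zero' (Eventually.of_forall fun t =>
    norm_nonneg _) ?_ (h.tendsto_logRatio hexp hp hs hc))
  filter_upwards [self_mem_nhdsWithin] with t ht
  exact hpair (hint t ht c hc) (hint s hs c hc)

/-- The displacement velocity is bounded on compact sets, locally uniformly in time. -/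
lemma TestContinuousOn.exists_velocity_bound (hV : Continuous V)
    (hVint : ∀ θ : BW d, Integrable V (gaussian θ))
    (hexp : Integrable (fun x => Real.exp (-V x)) volume) (h : TestContinuousOn I μ)
    (hp : ∀ t ∈ I, IsProbabilityMeasure (μ t)) (hI : IsCompact I) {K : Set (BW d)}
    (hK : IsCompact K) :
    ∃ C, ∀ t ∈ I, ∀ θ ∈ K, ‖tangentMap θ.1 (velocity V (μ t) θ)‖ ≤ C := by
  obtain ⟨F, _, _, B, Λ, W, hW, hKW, -, -, hB, hBc, -, hΛ, hBv⟩ :=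
    h.exists_velocity_field hV hVint hexp hp hK
  obtain ⟨C₁, hC₁⟩ := hI.exists_bound_of_continuousOn hΛ
  obtain ⟨C₂, hC₂⟩ := hBc.exists_bound_of_continuous hB.continuous
  refine ⟨C₂ * C₁, fun t ht θ hθ => ?_⟩
  rw [← norm_neg, ← hBv t ht θ (hKW θ hθ)]
  exact (ContinuousLinearMap.le_opNorm _ _).trans (mul_le_mul (hC₂ _) (hC₁ t ht) (norm_nonneg _)
    ((norm_nonneg _).trans (hC₂ θ.1)))

/-- The displacement velocity is continuous in the parameter. -/
lemma continuous_tangentMap_velocity {μ : Measure (BW d)}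
    (hint : ∀ c : ℝ, 0 < c → Integrable (fun x => Real.exp (-(c * ‖x‖ ^ 2)) * logRatio V μ x)) :
    Continuous fun θ : BW d => tangentMap θ.1 (velocity V μ θ) := by
  refine continuous_iff_continuousAt.2 fun θ₀ => ?_
  obtain ⟨c, hc, F, _, _, pair, B, W, hW, hKW, -, -, hB, -, -, -, hBv⟩ :=
    exists_velocity_field (isCompact_singleton (x := θ₀))
  have h5 : ContinuousAt (fun θ : BW d => -B θ.1 (pair (logRatio V μ))) θ₀ :=
    ((hB.continuous.comp continuous_subtype_val).clm_apply continuous_const).neg.continuousAt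
  refine h5.congr ?_
  filter_upwards [(hW.preimage continuous_subtype_val).mem_nhds (hKW θ₀ rfl)] with θ hθ
  rw [hBv hint θ hθ, neg_neg]

end DrivingCurve

/-! ### Local uniqueness for the linear continuity equation -/

lemma abs_integral_le_of_real_univ_le_one {X : Type*} [MeasurableSpace X] {γ : Measure X}
    [IsFiniteMeasure γ] (hγ : γ.real univ ≤ 1) {f : X → ℝ} {C : ℝ} (hC : 0 ≤ C)
    (hf : ∀ y, |f y| ≤ C) :
    |∫ y, f y ∂γ| ≤ C :=
  (norm_integral_le_of_norm_le_const (f := f) (C := C) (ae_of_all _ hf)).trans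
    (mul_le_of_le_one_right hC hγ)

section LocalUniqueness

variable {E : Type*} [NormedAddCommGroup E] [NormedSpace ℝ E]

/-- Smooth functions supported in the closed ball of radius `r` around `p`, whose derivative is
bounded by `a` and `a`-Lipschitz. -/
structure IsLocalTest (a r : ℝ) (p : E) (φ : E → ℝ) : Prop where
  contDiff : ContDiff ℝ ∞ φ
  support : ∀ y, φ y ≠ 0 → ‖y - p‖ ≤ r
  norm_fderiv_le : ∀ y, ‖fderiv ℝ φ y‖ ≤ a
  norm_fderiv_sub_le : ∀ y z, ‖fderiv ℝ φ y - fderiv ℝ φ z‖ ≤ a * ‖y - z‖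

namespace IsLocalTest

variable {a r : ℝ} {p : E} {φ : E → ℝ}

lemma nonneg (hφ : IsLocalTest a r p φ) : 0 ≤ a := (norm_nonneg _).trans (hφ.norm_fderiv_le p)

lemma differentiable (hφ : IsLocalTest a r p φ) : Differentiable ℝ φ :=
  hφ.contDiff.differentiable (by norm_num)

lemma tsupport_subset (hφ : IsLocalTest a r p φ) : tsupport φ ⊆ Metric.closedBall p r :=
  closure_minimal (fun y hy => by
    rw [Metric.mem_closedBall, dist_eq_norm]; exact hφ.support y hy) Metric.isClosed_closedBall

lemma hasCompactSupport [FiniteDimensional ℝ E] (hφ : IsLocalTest a r p φ) :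
    HasCompactSupport φ := by
  have := FiniteDimensional.proper_real E
  exact (isCompact_closedBall p r).of_isClosed_subset (isClosed_tsupport _) hφ.tsupport_subset

/-- Second-order Taylor estimate. -/
lemma abs_taylor_le (hφ : IsLocalTest a r p φ) (y v : E) :
    |φ (y + v) - φ y - fderiv ℝ φ y v| ≤ a * ‖v‖ ^ 2 := by
  have h := Convex.norm_image_sub_le_of_norm_fderiv_le' (f := φ) (φ := fderiv ℝ φ y)
    (C := a * ‖v‖) (s := Metric.closedBall y ‖v‖) (x := y) (y := y + v)
    (fun x _ => hφ.differentiable x) (fun x hx => ?_) (convex_closedBall y ‖v‖)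
    (Metric.mem_closedBall_self (norm_nonneg v)) (by simp)
  · rw [add_sub_cancel_left, Real.norm_eq_abs] at h
    linarith [h]
  · refine (hφ.norm_fderiv_sub_le x y).trans ?_
    rw [Metric.mem_closedBall, dist_eq_norm] at hx
    exact mul_le_mul_of_nonneg_left hx hφ.nonneg

/-- One Euler step backwards: composition with the near-identity map `y ↦ y + h X y` turns a test
function localized near `p` into one localized near any `q` with `p ≈ q + h X q`, at the cost of
factors `1 + O(h)`. -/
lemma comp_euler (hφ : IsLocalTest a r p φ) {X : E → E} (hX : ContDiff ℝ ∞ X) {L h δ : ℝ}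
    (hL : ∀ y z, ‖X y - X z‖ ≤ L * ‖y - z‖) (hL' : ∀ y, ‖fderiv ℝ X y‖ ≤ L)
    (hL'' : ∀ y z, ‖fderiv ℝ X y - fderiv ℝ X z‖ ≤ L * ‖y - z‖) (hh : 0 ≤ h)
    (hhL : h * L ≤ 1 / 2) {q : E} (hq : ‖p - q - h • X q‖ ≤ δ) :
    IsLocalTest (a * (1 + 4 * L * h)) ((r + δ) * (1 + 4 * L * h)) q (fun y => φ (y + h • X y)) := by
  have ha := hφ.nonneg
  have hL0 : 0 ≤ L := (norm_nonneg _).trans (hL' p)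
  have hhL0 : 0 ≤ h * L := mul_nonneg hh hL0
  have hXd : Differentiable ℝ X := hX.differentiable (by norm_num)
  have hg : ContDiff ℝ ∞ fun y => y + h • X y := contDiff_id.add (contDiff_const.smul hX)
  set G : E → E →L[ℝ] E := fun y => ContinuousLinearMap.id ℝ E + h • fderiv ℝ X y with hG
  have hgd : ∀ y, HasFDerivAt (fun y => y + h • X y) (G y) y := fun y =>
    (hasFDerivAt_id y).add ((hXd y).hasFDerivAt.const_smul h)
  have hfd : ∀ y, fderiv ℝ (fun y => φ (y + h • X y)) y
      = (fderiv ℝ φ (y + h • X y)).comp (G y) := fun y =>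
    ((hφ.differentiable (y + h • X y)).hasFDerivAt.comp y (hgd y)).fderiv
  have hGn : ∀ y, ‖G y‖ ≤ 1 + h * L := fun y => by
    refine (norm_add_le _ _).trans (add_le_add ContinuousLinearMap.norm_id_le ?_)
    rw [norm_smul, Real.norm_of_nonneg hh]
    exact mul_le_mul_of_nonneg_left (hL' y) hh
  have hGs : ∀ y z, ‖G y - G z‖ ≤ h * L * ‖y - z‖ := fun y z => by
    have e : G y - G z = h • (fderiv ℝ X y - fderiv ℝ X z) := by
      simp only [hG, smul_sub]; abel
    rw [e, norm_smul, Real.norm_of_nonneg hh, mul_assoc]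
    exact mul_le_mul_of_nonneg_left (hL'' y z) hh
  have hgs : ∀ y z, ‖(y + h • X y) - (z + h • X z)‖ ≤ (1 + h * L) * ‖y - z‖ := fun y z => by
    have e : (y + h • X y) - (z + h • X z) = (y - z) + h • (X y - X z) := by
      rw [smul_sub]; abel
    rw [e]
    refine (norm_add_le _ _).trans ?_
    rw [norm_smul, Real.norm_of_nonneg hh]
    have := mul_le_mul_of_nonneg_left (hL y z) hh
    linarith
  refine ⟨hφ.contDiff.comp hg, fun y hy => ?_, fun y => ?_, fun y z => ?_⟩
  · have h1 := hφ.support _ hy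
    have h2 : ‖y - q‖ ≤ (r + δ) + h * L * ‖y - q‖ := by
      have e : y - q = (y + h • X y - p) - h • (X y - X q) + (p - q - h • X q) := by
        rw [smul_sub]; abel
      calc ‖y - q‖ = ‖(y + h • X y - p) - h • (X y - X q) + (p - q - h • X q)‖ := by rw [← e]
        _ ≤ ‖y + h • X y - p‖ + ‖h • (X y - X q)‖ + ‖p - q - h • X q‖ :=
          (norm_add_le _ _).trans (add_le_add_left (norm_sub_le _ _) _)
        _ ≤ r + h * (L * ‖y - q‖) + δ := by
          rw [norm_smul, Real.norm_of_nonneg hh]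
          have := mul_le_mul_of_nonneg_left (hL y q) hh
          linarith
        _ = _ := by ring
    have h3 := norm_nonneg (y - q)
    have h4 : ‖y - q‖ * (1 - h * L) ≤ r + δ := by linarith
    calc ‖y - q‖ ≤ ‖y - q‖ * (1 - h * L) * (1 + 4 * L * h) := by
          have : 1 ≤ (1 - h * L) * (1 + 4 * L * h) := by nlinarith
          rw [mul_assoc]
          exact le_mul_of_one_le_right h3 this
      _ ≤ (r + δ) * (1 + 4 * L * h) := mul_le_mul_of_nonneg_right h4 (by nlinarith)
  · rw [hfd]
    refine (ContinuousLinearMap.opNorm_comp_le _ _).trans ?_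
    refine (mul_le_mul (hφ.norm_fderiv_le _) (hGn y) (norm_nonneg _) ha).trans ?_
    exact mul_le_mul_of_nonneg_left (by linarith) ha
  · rw [hfd, hfd]
    have e : (fderiv ℝ φ (y + h • X y)).comp (G y) - (fderiv ℝ φ (z + h • X z)).comp (G z)
        = (fderiv ℝ φ (y + h • X y) - fderiv ℝ φ (z + h • X z)).comp (G y)
          + (fderiv ℝ φ (z + h • X z)).comp (G y - G z) := by
      rw [ContinuousLinearMap.sub_comp, ContinuousLinearMap.comp_sub]; abel
    rw [e]
    have h1 := norm_nonneg (y - z)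
    calc _ ≤ ‖fderiv ℝ φ (y + h • X y) - fderiv ℝ φ (z + h • X z)‖ * ‖G y‖
          + ‖fderiv ℝ φ (z + h • X z)‖ * ‖G y - G z‖ :=
        (norm_add_le _ _).trans (add_le_add (ContinuousLinearMap.opNorm_comp_le _ _)
          (ContinuousLinearMap.opNorm_comp_le _ _))
      _ ≤ (a * ((1 + h * L) * ‖y - z‖)) * (1 + h * L) + a * (h * L * ‖y - z‖) := by
        gcongr
        · exact (hφ.norm_fderiv_sub_le _ _).trans (mul_le_mul_of_nonneg_left (hgs y z) ha)
        · exact hGn y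
        · exact hφ.norm_fderiv_le _
        · exact hGs y z
      _ = a * ‖y - z‖ * ((1 + h * L) ^ 2 + h * L) := by ring
      _ ≤ a * ‖y - z‖ * (1 + 4 * L * h) :=
        mul_le_mul_of_nonneg_left (by nlinarith) (mul_nonneg ha h1)
      _ = _ := by ring

end IsLocalTest

lemma exists_smooth_bounds {G : Type*} [NormedAddCommGroup G] [NormedSpace ℝ G] {f : E → G}
    (hf : ContDiff ℝ ∞ f) (hc : HasCompactSupport f) :
    ∃ C : ℝ, 0 ≤ C ∧ (∀ y, ‖f y‖ ≤ C) ∧ (∀ y z, ‖f y - f z‖ ≤ C * ‖y - z‖) ∧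
      ∀ y z, ‖fderiv ℝ f y - fderiv ℝ f z‖ ≤ C * ‖y - z‖ := by
  obtain ⟨C₀, hC₀⟩ := hc.exists_bound_of_continuous hf.continuous
  obtain ⟨C₁, hC₁⟩ := (hf.of_le (by norm_cast) : ContDiff ℝ 1 f).lipschitzWith_of_hasCompactSupport
    hc one_ne_zero
  obtain ⟨C₂, hC₂⟩ := (hf.fderiv_right (m := 1) (by norm_cast)).lipschitzWith_of_hasCompactSupport
    (hc.fderiv (𝕜 := ℝ)) one_ne_zero
  refine ⟨max C₀ (max C₁ C₂), le_max_of_le_right (le_max_of_le_left C₁.2),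
    fun y => (hC₀ y).trans (le_max_left _ _), fun y z => ?_, fun y z => ?_⟩
  · have h1 := hC₁.dist_le_mul y z
    rw [dist_eq_norm, dist_eq_norm] at h1
    exact h1.trans (mul_le_mul_of_nonneg_right (le_max_of_le_right (le_max_left _ _))
      (norm_nonneg _))
  · have h1 := hC₂.dist_le_mul y z
    rw [dist_eq_norm, dist_eq_norm] at h1
    exact h1.trans (mul_le_mul_of_nonneg_right (le_max_of_le_right (le_max_right _ _))
      (norm_nonneg _))

/-- Every smooth function with compact support is a local test function for some constant. -/
lemma exists_isLocalTest {φ : E → ℝ} (hφ : ContDiff ℝ ∞ φ)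
    (hc : HasCompactSupport φ) {p : E} {r : ℝ} (hr : tsupport φ ⊆ Metric.closedBall p r) :
    ∃ a, IsLocalTest a r p φ := by
  obtain ⟨C, -, -, h1, h2⟩ := exists_smooth_bounds hφ hc
  have hlip : LipschitzWith (Real.toNNReal C) φ := LipschitzWith.of_dist_le' fun y z => by
    rw [dist_eq_norm, dist_eq_norm]; exact h1 y z
  have hC : ∀ y, ‖fderiv ℝ φ y‖ ≤ max C 0 := fun y => by
    simpa using norm_fderiv_le_of_lipschitz ℝ hlip (x₀ := y)
  refine ⟨max C 0, hφ, fun y hy => ?_, hC, fun y z =>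
    (h2 y z).trans (mul_le_mul_of_nonneg_right (le_max_left _ _) (norm_nonneg _))⟩
  have := hr (subset_tsupport _ hy)
  rwa [Metric.mem_closedBall, dist_eq_norm] at this

/-- Bounds on a time-dependent field: smooth, bounded by `M`, Lipschitz with constant `L`, with
`L`-Lipschitz derivative. -/
structure IsBoundedField (T M L : ℝ) (X : ℝ → E → E) : Prop where
  contDiff : ∀ t ∈ Icc 0 T, ContDiff ℝ ∞ (X t)
  norm_le : ∀ t ∈ Icc 0 T, ∀ y, ‖X t y‖ ≤ M
  norm_sub_le : ∀ t ∈ Icc 0 T, ∀ y z, ‖X t y - X t z‖ ≤ L * ‖y - z‖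
  norm_fderiv_le : ∀ t ∈ Icc 0 T, ∀ y, ‖fderiv ℝ (X t) y‖ ≤ L
  norm_fderiv_sub_le : ∀ t ∈ Icc 0 T, ∀ y z,
    ‖fderiv ℝ (X t) y - fderiv ℝ (X t) z‖ ≤ L * ‖y - z‖

lemma exists_isBoundedField {F : Type*} [NormedAddCommGroup F] [NormedSpace ℝ F]
    {B : E → F →L[ℝ] E} (hB : ContDiff ℝ ∞ B) (hBc : HasCompactSupport B) {Λ : ℝ → F} {T : ℝ}
    (hΛ : ContinuousOn Λ (Icc 0 T)) :
    ∃ M L : ℝ, 0 ≤ M ∧ 0 ≤ L ∧ IsBoundedField T M L (fun t y => B y (Λ t)) := by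
  obtain ⟨D, hD⟩ := isCompact_Icc.exists_bound_of_continuousOn hΛ
  have hD' : ∀ t ∈ Icc 0 T, ‖Λ t‖ ≤ max D 0 := fun t ht => (hD t ht).trans (le_max_left _ _)
  have hD0 : 0 ≤ max D 0 := le_max_right _ _
  obtain ⟨C, hC, h0, h1, h2⟩ := exists_smooth_bounds hB hBc
  have hLip : ∀ t ∈ Icc 0 T, ∀ y z, ‖B y (Λ t) - B z (Λ t)‖ ≤ C * max D 0 * ‖y - z‖ := by
    intro t ht y z
    rw [← _root_.sub_apply]
    calc ‖(B y - B z) (Λ t)‖ ≤ (C * ‖y - z‖) * max D 0 := ((B y - B z).le_opNorm _).trans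
          (mul_le_mul (h1 y z) (hD' t ht) (norm_nonneg _) (by positivity))
      _ = _ := by ring
  refine ⟨C * max D 0, C * max D 0, by positivity, by positivity,
    fun t _ => hB.clm_apply contDiff_const, fun t ht y => ?_, hLip, fun t ht y => ?_,
    fun t ht y z => ?_⟩
  · exact ((B y).le_opNorm _).trans (mul_le_mul (h0 y) (hD' t ht) (norm_nonneg _) hC)
  · have hlip : LipschitzWith (Real.toNNReal (C * max D 0)) (fun y => B y (Λ t)) :=
      LipschitzWith.of_dist_le_mul fun y z => by
        rw [Real.coe_toNNReal _ (by positivity), dist_eq_norm, dist_eq_norm]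
        exact hLip t ht y z
    exact (norm_fderiv_le_of_lipschitz ℝ hlip).trans_eq (Real.coe_toNNReal _ (by positivity))
  · have hfd : ∀ y, fderiv ℝ (fun y => B y (Λ t)) y
        = (ContinuousLinearMap.apply ℝ E (Λ t)).comp (fderiv ℝ B y) := fun y =>
      ((ContinuousLinearMap.apply ℝ E (Λ t)).hasFDerivAt.comp y
        ((hB.differentiable (by norm_num)) y).hasFDerivAt).fderiv
    rw [hfd, hfd, ← ContinuousLinearMap.comp_sub]
    refine ContinuousLinearMap.opNorm_le_bound _ (by positivity) fun u => ?_
    calc ‖((fderiv ℝ B y - fderiv ℝ B z) u) (Λ t)‖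
        ≤ ‖fderiv ℝ B y - fderiv ℝ B z‖ * ‖u‖ * ‖Λ t‖ :=
          (ContinuousLinearMap.le_opNorm _ _).trans (mul_le_mul_of_nonneg_right
            (ContinuousLinearMap.le_opNorm _ _) (norm_nonneg _))
      _ ≤ (C * ‖y - z‖) * ‖u‖ * max D 0 := by
          gcongr
          · exact h2 y z
          · exact hD' t ht
      _ = _ := by ring

variable [MeasurableSpace E] [BorelSpace E] [FiniteDimensional ℝ E]

/-- A curve of measures of mass at most one solves on `[0, T]` the continuity equation with field
`X`, tested against smooth functions with compact support in `W`. -/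
structure SolvesOn (W : Set E) (T : ℝ) (X : ℝ → E → E) (γ : ℝ → Measure E) : Prop where
  isFiniteMeasure : ∀ t ∈ Icc 0 T, IsFiniteMeasure (γ t)
  mass_le : ∀ t ∈ Icc 0 T, (γ t).real univ ≤ 1
  hasDerivWithinAt : ∀ φ : E → ℝ, ContDiff ℝ ∞ φ → HasCompactSupport φ → tsupport φ ⊆ W →
    ∀ t ∈ Icc 0 T, HasDerivWithinAt (fun s => ∫ y, φ y ∂(γ s))
      (∫ y, fderiv ℝ φ y (X t y) ∂(γ t)) (Icc 0 T) t

/-- Consistency of one Euler step with the continuity equation: replacing the exact evolution over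
a time step `h ≤ ε` by the push-forward under `y ↦ y + h X y` costs `O(h ε)`, if `X` varies by at
most `ε` during the step. -/
lemma SolvesOn.abs_euler_step_le {W : Set E} {T : ℝ} {X : ℝ → E → E} {γ : ℝ → Measure E}
    (hγ : SolvesOn W T X γ) {M L ε : ℝ} (hXs : ∀ t ∈ Icc 0 T, ContDiff ℝ ∞ (X t))
    (hM : ∀ t ∈ Icc 0 T, ∀ y, ‖X t y‖ ≤ M)
    (hL : ∀ t ∈ Icc 0 T, ∀ y z, ‖X t y - X t z‖ ≤ L * ‖y - z‖) (hM0 : 0 ≤ M) (hL0 : 0 ≤ L)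
    (hε : 0 ≤ ε) {s h : ℝ} (hs : 0 ≤ s) (hh : 0 ≤ h) (hsT : s + h ≤ T) (hhε : h ≤ ε)
    (hXε : ∀ t ∈ Icc s (s + h), ∀ y, ‖X t y - X s y‖ ≤ ε)
    {a r : ℝ} {p : E} {φ : E → ℝ} (hφ : IsLocalTest a r p φ) (hφW : tsupport φ ⊆ W) :
    |∫ y, φ y ∂(γ (s + h)) - ∫ y, φ (y + h • X s y) ∂(γ s)|
      ≤ h * ε * a * (1 + (M + L) * M + M ^ 2) := by
  have ha := hφ.nonneg
  have hsub : Icc s (s + h) ⊆ Icc 0 T := Icc_subset_Icc hs hsT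
  have hs' : s ∈ Icc s (s + h) := left_mem_Icc.2 (by linarith)
  have hsh : s + h ∈ Icc s (s + h) := right_mem_Icc.2 (by linarith)
  have hsI := hsub hs'
  have hc := hφ.hasCompactSupport
  have hXc : ∀ t ∈ Icc 0 T, Continuous (X t) := fun t ht => (hXs t ht).continuous
  set ψ : ℝ → E → ℝ := fun t y => fderiv ℝ φ y (X t y) with hψ
  have hψs : ∀ t ∈ Icc 0 T, ContDiff ℝ ∞ (ψ t) := fun t ht =>
    (hφ.contDiff.fderiv_right (m := ∞) (by norm_cast)).clm_apply (hXs t ht)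
  have hψ0 : ∀ t, tsupport (ψ t) ⊆ tsupport φ := fun t => by
    refine closure_minimal (fun y hy => ?_) (isClosed_tsupport φ)
    by_contra hy'
    exact hy (by simp [hψ, image_eq_zero_of_notMem_tsupport
      (fun h => hy' (tsupport_fderiv_subset ℝ h))])
  have hψc : ∀ t, HasCompactSupport (ψ t) := fun t =>
    hc.of_isClosed_subset (isClosed_tsupport _) (hψ0 t)
  have hint : ∀ t ∈ Icc 0 T, ∀ {f : E → ℝ}, Continuous f → HasCompactSupport f →
      Integrable f (γ t) := fun t ht f hf hf' => by
    have := hγ.isFiniteMeasure t ht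
    exact integrable_of_hasCompactSupport hf hf' _
  have hab : ∀ t ∈ Icc 0 T, ∀ {f : E → ℝ} {C : ℝ}, 0 ≤ C → (∀ y, |f y| ≤ C) →
      |∫ y, f y ∂(γ t)| ≤ C := fun t ht f C hC hf => by
    have := hγ.isFiniteMeasure t ht
    exact abs_integral_le_of_real_univ_le_one (hγ.mass_le t ht) hC hf
  -- The velocity term `∫ ψ s dγ` is Lipschitz in time, by the continuity equation tested with
  -- `ψ s`.
  have hψL : ∀ y, ‖fderiv ℝ (ψ s) y‖ ≤ a * (M + L) := fun y => by
    have hlip : LipschitzWith (Real.toNNReal (a * (M + L))) (ψ s) := by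
      refine LipschitzWith.of_dist_le_mul fun y z => ?_
      rw [Real.coe_toNNReal _ (mul_nonneg ha (add_nonneg hM0 hL0)), dist_eq_norm, dist_eq_norm]
      have e : ψ s y - ψ s z = (fderiv ℝ φ y - fderiv ℝ φ z) (X s y)
          + fderiv ℝ φ z (X s y - X s z) := by
        simp only [hψ, _root_.sub_apply, map_sub]; ring
      rw [e]
      calc _ ≤ ‖fderiv ℝ φ y - fderiv ℝ φ z‖ * ‖X s y‖ + ‖fderiv ℝ φ z‖ * ‖X s y - X s z‖ :=
            (norm_add_le _ _).trans (add_le_add (ContinuousLinearMap.le_opNorm _ _)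
              (ContinuousLinearMap.le_opNorm _ _))
        _ ≤ (a * ‖y - z‖) * M + a * (L * ‖y - z‖) := by
            gcongr
            · exact hφ.norm_fderiv_sub_le y z
            · exact hM s hsI y
            · exact hφ.norm_fderiv_le z
            · exact hL s hsI y z
        _ = _ := by ring
    have := norm_fderiv_le_of_lipschitz ℝ hlip (x₀ := y)
    rwa [Real.coe_toNNReal _ (mul_nonneg ha (add_nonneg hM0 hL0))] at this
  have h1 : ∀ t ∈ Icc s (s + h), |∫ y, ψ s y ∂(γ t) - ∫ y, ψ s y ∂(γ s)|
      ≤ a * (M + L) * M * h := fun t ht => by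
    have h2 := (convex_Icc s (s + h)).norm_image_sub_le_of_norm_hasDerivWithin_le
      (f := fun t => ∫ y, ψ s y ∂(γ t)) (f' := fun t => ∫ y, fderiv ℝ (ψ s) y (X t y) ∂(γ t))
      (C := a * (M + L) * M) (x := s) (y := t)
      (fun τ hτ => (hγ.hasDerivWithinAt (ψ s) (hψs s hsI) (hψc s) ((hψ0 s).trans hφW) τ
        (hsub hτ)).mono hsub)
      (fun τ hτ => hab τ (hsub hτ) (by positivity) fun y =>
        ((fderiv ℝ (ψ s) y).le_opNorm _).trans
          (mul_le_mul (hψL y) (hM τ (hsub hτ) y) (norm_nonneg _) (by positivity))) hs' ht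
    refine h2.trans (mul_le_mul_of_nonneg_left ?_ (by positivity))
    rw [Real.norm_of_nonneg (by linarith [ht.1])]
    linarith [ht.2]
  have h2 : ∀ t ∈ Icc s (s + h), |∫ y, ψ t y ∂(γ t) - ∫ y, ψ s y ∂(γ s)|
      ≤ a * ε + a * (M + L) * M * h := fun t ht => by
    have htI := hsub ht
    have h3 : |∫ y, ψ t y ∂(γ t) - ∫ y, ψ s y ∂(γ t)| ≤ a * ε := by
      rw [← integral_sub (hint t htI (hψs t htI).continuous (hψc t))
        (hint t htI (hψs s hsI).continuous (hψc s))]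
      refine hab t htI (by positivity) fun y => ?_
      simp only [hψ]
      rw [← map_sub]
      exact ((fderiv ℝ φ y).le_opNorm _).trans
        (mul_le_mul (hφ.norm_fderiv_le y) (hXε t ht y) (norm_nonneg _) ha)
    calc _ ≤ |∫ y, ψ t y ∂(γ t) - ∫ y, ψ s y ∂(γ t)|
          + |∫ y, ψ s y ∂(γ t) - ∫ y, ψ s y ∂(γ s)| := abs_sub_le _ _ _
      _ ≤ _ := add_le_add h3 (h1 t ht)
  have h3 : |∫ y, φ y ∂(γ (s + h)) - ∫ y, φ y ∂(γ s) - h * ∫ y, ψ s y ∂(γ s)|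
      ≤ (a * ε + a * (M + L) * M * h) * h := by
    have h4 := (convex_Icc s (s + h)).norm_image_sub_le_of_norm_hasDerivWithin_le
      (f := fun t => ∫ y, φ y ∂(γ t) - t * ∫ y, ψ s y ∂(γ s))
      (f' := fun t => ∫ y, ψ t y ∂(γ t) - 1 * ∫ y, ψ s y ∂(γ s))
      (C := a * ε + a * (M + L) * M * h) (x := s) (y := s + h)
      (fun τ hτ => ((hγ.hasDerivWithinAt φ hφ.contDiff hc hφW τ (hsub hτ)).mono hsub).sub
        ((hasDerivWithinAt_id τ _).mul_const _))
      (fun τ hτ => by rw [one_mul]; exact h2 τ hτ) hs' hsh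
    rw [add_sub_cancel_left, Real.norm_of_nonneg hh, Real.norm_eq_abs] at h4
    convert h4 using 2
    ring
  have h4 : |∫ y, φ (y + h • X s y) ∂(γ s) - ∫ y, φ y ∂(γ s) - h * ∫ y, ψ s y ∂(γ s)|
      ≤ a * (h * M) ^ 2 := by
    have hfin := hγ.isFiniteMeasure s hsI
    have hbd : Integrable (fun y => φ (y + h • X s y)) (γ s) := by
      obtain ⟨C, hC⟩ := hc.exists_bound_of_continuous hφ.contDiff.continuous
      exact Integrable.of_bound (hφ.contDiff.continuous.comp
        (continuous_id.add ((hXc s hsI).const_smul h))).aestronglyMeasurable C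
        (ae_of_all _ fun y => hC _)
    have i1 := hint s hsI hφ.contDiff.continuous hc
    have i2 := hint s hsI (hψs s hsI).continuous (hψc s)
    have i3 : Integrable (fun y => φ (y + h • X s y) - φ y) (γ s) := hbd.sub i1
    rw [← integral_sub hbd i1, ← integral_const_mul, ← integral_sub i3 (i2.const_mul h)]
    refine hab s hsI (by positivity) fun y => ?_
    have h5 := hφ.abs_taylor_le y (h • X s y)
    rw [map_smul, smul_eq_mul, norm_smul, Real.norm_of_nonneg hh] at h5
    refine h5.trans (mul_le_mul_of_nonneg_left ?_ ha)
    have := hM s hsI y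
    gcongr
  have h5 := abs_sub_le (∫ y, φ y ∂(γ (s + h))) (∫ y, φ y ∂(γ s) + h * ∫ y, ψ s y ∂(γ s))
    (∫ y, φ (y + h • X s y) ∂(γ s))
  rw [abs_sub_comm (∫ y, φ y ∂(γ s) + h * ∫ y, ψ s y ∂(γ s)), ← sub_sub, ← sub_sub] at h5
  have h6 : a * (M + L) * M * (h * h) ≤ a * (M + L) * M * (h * ε) := by gcongr
  have h7 : a * M ^ 2 * (h * h) ≤ a * M ^ 2 * (h * ε) := by gcongr
  calc _ ≤ (a * ε + a * (M + L) * M * h) * h + a * (h * M) ^ 2 := h5.trans (add_le_add h3 h4)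
    _ = a * ε * h + a * (M + L) * M * (h * h) + a * M ^ 2 * (h * h) := by ring
    _ ≤ a * ε * h + a * (M + L) * M * (h * ε) + a * M ^ 2 * (h * ε) := by linarith
    _ = _ := by ring

/-- The difference of two solutions of the continuity equation, tested near a characteristic at the
`j`-th time of a grid of width `h`, is at most the sum of `j` consistency errors. -/
lemma abs_integral_sub_le_of_euler {W : Set E} {T : ℝ} {X : ℝ → E → E} {α β : ℝ → Measure E}
    (hα : SolvesOn W T X α) (hβ : SolvesOn W T X β) {M L : ℝ} (hX : IsBoundedField T M L X)
    (hM0 : 0 ≤ M) (hL0 : 0 ≤ L) {x : ℝ → E}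
    (hx : ∀ t ∈ Icc 0 T, HasDerivWithinAt x (X t (x t)) (Icc 0 T) t) {r₀ : ℝ}
    (htube : ∀ t ∈ Icc 0 T, Metric.closedBall (x t) r₀ ⊆ W)
    (h0 : ∀ φ : E → ℝ, ContDiff ℝ ∞ φ → HasCompactSupport φ →
      tsupport φ ⊆ Metric.closedBall (x 0) r₀ → ∫ y, φ y ∂(α 0) = ∫ y, φ y ∂(β 0))
    {ε h : ℝ} (hε : 0 < ε) (hh0 : 0 ≤ h) (hhε : h ≤ ε) (hhL : h * L ≤ 1 / 2)
    (hXε : ∀ s ∈ Icc 0 T, ∀ t ∈ Icc 0 T, |t - s| ≤ h → ∀ y, ‖X t y - X s y‖ ≤ ε)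
    {n : ℕ} (hnh : n * h = T) :
    ∀ j : ℕ, j ≤ n → ∀ (a r : ℝ) (φ : E → ℝ), 0 ≤ r → IsLocalTest a r (x (j * h)) φ →
      (r + j * (h * (ε * (1 + L * M)))) * (1 + 4 * L * h) ^ j ≤ r₀ →
      |∫ y, φ y ∂(α (j * h)) - ∫ y, φ y ∂(β (j * h))|
        ≤ j * (2 * (h * ε * a * (1 + (M + L) * M + M ^ 2))) * (1 + 4 * L * h) ^ j := by
  have hxM : ∀ s ∈ Icc 0 T, ∀ t ∈ Icc 0 T, ‖x t - x s‖ ≤ M * ‖t - s‖ := fun s hs t ht =>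
    (convex_Icc 0 T).norm_image_sub_le_of_norm_hasDerivWithin_le hx
      (fun τ hτ => hX.norm_le τ hτ (x τ)) hs ht
  set κ := 1 + (M + L) * M + M ^ 2 with hκ
  have hκ0 : 0 ≤ κ := by positivity
  set q := 4 * L * h with hq
  have hq0 : 0 ≤ q := by positivity
  set δ := h * (ε * (1 + L * M)) with hδ
  have hδ0 : 0 ≤ δ := by positivity
  have hgrid : ∀ j : ℕ, j ≤ n → (j : ℝ) * h ∈ Icc 0 T := fun j hj => by
    refine ⟨by positivity, ?_⟩
    rw [← hnh]
    have : (j : ℝ) ≤ n := by exact_mod_cast hj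
    gcongr
  intro j
  induction j with
  | zero =>
    intro _ a r φ hr hφ hrr
    simp only [Nat.cast_zero, zero_mul, add_zero, pow_zero, mul_one] at hφ hrr ⊢
    have h1 := h0 φ hφ.contDiff hφ.hasCompactSupport
      (hφ.tsupport_subset.trans (Metric.closedBall_subset_closedBall hrr))
    simp [h1]
  | succ j ih =>
    intro hj a r φ hr hφ hrr
    have ha := hφ.nonneg
    have hjn : j ≤ n := Nat.le_of_succ_le hj
    have hs := hgrid j hjn
    have hs' := hgrid (j + 1) hj
    set s := (j : ℝ) * h with hsdef
    have hsucc : ((j + 1 : ℕ) : ℝ) * h = s + h := by push_cast; ring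
    rw [hsucc] at hφ hs' ⊢
    have hsub : Icc s (s + h) ⊆ Icc 0 T := Icc_subset_Icc hs.1 hs'.2
    have hs₀ : s ∈ Icc s (s + h) := left_mem_Icc.2 (by linarith)
    have hXt : ∀ t ∈ Icc s (s + h), ∀ y, ‖X t y - X s y‖ ≤ ε := fun t ht y =>
      hXε s hs t (hsub ht) (by rw [abs_of_nonneg (by linarith [ht.1])]; linarith [ht.2]) y
    have hstep : ‖x (s + h) - x s - h • X s (x s)‖ ≤ δ := by
      have h1 := (convex_Icc s (s + h)).norm_image_sub_le_of_norm_hasDerivWithin_le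
        (f := fun t => x t - t • X s (x s)) (f' := fun t => X t (x t) - (1 : ℝ) • X s (x s))
        (C := ε * (1 + L * M)) (x := s) (y := s + h)
        (fun t ht => ((hx t (hsub ht)).mono hsub).sub
          ((hasDerivWithinAt_id t _).smul_const _)) (fun t ht => ?_) hs₀
          (right_mem_Icc.2 (by linarith))
      · rw [add_sub_cancel_left, Real.norm_of_nonneg hh0] at h1
        refine le_trans (le_of_eq ?_) (h1.trans (le_of_eq (by rw [hδ]; ring)))
        congr 1
        rw [add_smul]; abel
      · rw [one_smul]
        have h2 : ‖x t - x s‖ ≤ M * h := (hxM s hs t (hsub ht)).trans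
          (mul_le_mul_of_nonneg_left (by
            rw [Real.norm_of_nonneg (by linarith [ht.1])]; linarith [ht.2]) hM0)
        calc ‖X t (x t) - X s (x s)‖ ≤ ‖X t (x t) - X s (x t)‖ + ‖X s (x t) - X s (x s)‖ :=
              norm_sub_le_norm_sub_add_norm_sub _ _ _
          _ ≤ ε + L * (M * ε) := by
              refine add_le_add (hXt t ht _) ((hX.norm_sub_le s hs _ _).trans ?_)
              refine mul_le_mul_of_nonneg_left (h2.trans ?_) hL0
              exact mul_le_mul_of_nonneg_left hhε hM0
          _ = _ := by ring
    have hφ' := hφ.comp_euler (hX.contDiff s hs) (hX.norm_sub_le s hs)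
      (hX.norm_fderiv_le s hs) (hX.norm_fderiv_sub_le s hs) hh0 hhL hstep
    have hpow : 1 ≤ (1 + q) ^ (j + 1) := one_le_pow₀ (by linarith)
    have hrr₀ : r ≤ r₀ := by
      refine le_trans ?_ hrr
      calc r ≤ r + ((j + 1 : ℕ) : ℝ) * δ := le_add_of_nonneg_right (by positivity)
        _ ≤ _ := le_mul_of_one_le_right (by positivity) hpow
    have h1 := ih hjn _ _ _ (by positivity) hφ' (by
      refine le_trans ?_ hrr
      have hp : (0 : ℝ) ≤ (1 + q) ^ j := by positivity
      calc ((r + δ) * (1 + q) + j * δ) * (1 + q) ^ j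
          ≤ ((r + δ) * (1 + q) + j * δ * (1 + q)) * (1 + q) ^ j := by
            refine mul_le_mul_of_nonneg_right (add_le_add le_rfl ?_) hp
            exact le_mul_of_one_le_right (by positivity) (by linarith)
        _ = _ := by push_cast; ring)
    have hφW : tsupport φ ⊆ W := hφ.tsupport_subset.trans
      ((Metric.closedBall_subset_closedBall hrr₀).trans (htube _ hs'))
    have h2 : ∀ {γ : ℝ → Measure E}, SolvesOn W T X γ →
        |∫ y, φ y ∂(γ (s + h)) - ∫ y, φ (y + h • X s y) ∂(γ s)| ≤ h * ε * a * κ := fun hγ =>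
      hγ.abs_euler_step_le hX.contDiff hX.norm_le hX.norm_sub_le hM0 hL0 hε.le hs.1 hh0 hs'.2
        hhε hXt hφ hφW
    have hA := abs_le.1 (h2 hα)
    have hA' := abs_le.1 (h2 hβ)
    have hI := abs_le.1 h1
    have h3 : 2 * (h * ε * a * κ) ≤ 2 * (h * ε * a * κ) * (1 + q) ^ (j + 1) :=
      le_mul_of_one_le_right (by positivity) hpow
    have h4 : (j : ℝ) * (2 * (h * ε * (a * (1 + q)) * κ)) * (1 + q) ^ j
        = j * (2 * (h * ε * a * κ)) * (1 + q) ^ (j + 1) := by ring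
    have h5 : ((j + 1 : ℕ) : ℝ) * (2 * (h * ε * a * κ)) * (1 + q) ^ (j + 1)
        = j * (2 * (h * ε * a * κ)) * (1 + q) ^ (j + 1)
          + 2 * (h * ε * a * κ) * (1 + q) ^ (j + 1) := by push_cast; ring
    rw [h4] at hI
    rw [h5]
    exact abs_le.2 ⟨by linarith [hI.1, hA.1, hA'.2], by linarith [hI.2, hA.2, hA'.1]⟩

/-- Two solutions of the continuity equation with a smooth driven field that agree near the initial
point of a characteristic agree near its final point. The difference of the two solutions is
transported backwards along explicit Euler steps, which keep local test functions near the
characteristic and under control, and whose consistency error vanishes with the step size. -/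
theorem exists_local_uniqueness {F : Type*} [NormedAddCommGroup F] [NormedSpace ℝ F]
    {B : E → F →L[ℝ] E} (hB : ContDiff ℝ ∞ B) (hBc : HasCompactSupport B) {Λ : ℝ → F} {T : ℝ}
    (hT : 0 ≤ T) (hΛ : ContinuousOn Λ (Icc 0 T)) {W : Set E} (hW : IsOpen W)
    {α β : ℝ → Measure E} (hα : SolvesOn W T (fun t y => B y (Λ t)) α)
    (hβ : SolvesOn W T (fun t y => B y (Λ t)) β) {x : ℝ → E}
    (hx : ∀ t ∈ Icc 0 T, HasDerivWithinAt x (B (x t) (Λ t)) (Icc 0 T) t)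
    (hxW : ∀ t ∈ Icc 0 T, x t ∈ W) {r₁ : ℝ} (hr₁ : 0 < r₁)
    (h0 : ∀ φ : E → ℝ, ContDiff ℝ ∞ φ → HasCompactSupport φ →
      tsupport φ ⊆ Metric.closedBall (x 0) r₁ → ∫ y, φ y ∂(α 0) = ∫ y, φ y ∂(β 0)) :
    ∃ r > 0, ∀ φ : E → ℝ, ContDiff ℝ ∞ φ → HasCompactSupport φ →
      tsupport φ ⊆ Metric.closedBall (x T) r → ∫ y, φ y ∂(α T) = ∫ y, φ y ∂(β T) := by
  have h0T : (0 : ℝ) ∈ Icc 0 T := left_mem_Icc.2 hT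
  have hTT : T ∈ Icc 0 T := right_mem_Icc.2 hT
  -- a tube around the characteristic inside `W`
  obtain ⟨r₀, hr₀, hr₀₁, htube⟩ : ∃ r₀ > 0, r₀ ≤ r₁ ∧
      ∀ t ∈ Icc 0 T, Metric.closedBall (x t) r₀ ⊆ W := by
    have hcomp : IsCompact (x '' Icc 0 T) :=
      isCompact_Icc.image_of_continuousOn fun t ht => (hx t ht).continuousWithinAt
    obtain ⟨δ, hδ, h1⟩ := hcomp.exists_cthickening_subset_open hW
      (by rintro _ ⟨t, ht, rfl⟩; exact hxW t ht)
    exact ⟨min δ r₁, lt_min hδ hr₁, min_le_right _ _, fun t ht =>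
      (Metric.closedBall_subset_closedBall (min_le_left _ _)).trans
      ((Metric.closedBall_subset_cthickening (mem_image_of_mem x ht) δ).trans h1)⟩
  obtain ⟨M, L, hM0, hL0, hXb⟩ := exists_isBoundedField hB hBc hΛ
  obtain ⟨C₀, hC₀⟩ := hBc.exists_bound_of_continuous hB.continuous
  have hC₀0 : 0 ≤ C₀ := (norm_nonneg _).trans (hC₀ (x 0))
  set X : ℝ → E → E := fun t y => B y (Λ t) with hX
  set ℓ : ℝ → (E → ℝ) → ℝ := fun t φ => ∫ y, φ y ∂(α t) - ∫ y, φ y ∂(β t) with hℓ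
  set κ := 1 + (M + L) * M + M ^ 2 with hκ
  have hκ0 : 0 ≤ κ := by positivity
  set e := Real.exp (4 * L * T) with he
  have he0 : 0 < e := Real.exp_pos _
  -- The iterated estimate for a given accuracy `ε`, with a step size chosen by uniform continuity
  -- of `Λ`.
  have key : ∀ ε > 0, ∀ a r : ℝ, 0 ≤ r → (r + T * (ε * (1 + L * M))) * e ≤ r₀ →
      ∀ φ : E → ℝ, IsLocalTest a r (x T) φ → |ℓ T φ| ≤ T * ε * (2 * κ * a * e) := by
    intro ε hε a r hr hre φ hφ
    obtain ⟨η, hη, hΛη⟩ := Metric.uniformContinuousOn_iff_le.1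
      (isCompact_Icc.uniformContinuousOn_of_continuous hΛ) (ε / (C₀ + 1)) (by positivity)
    obtain ⟨n, hn⟩ := exists_nat_gt (T / min (min η ε) (1 / (2 * (L + 1))))
    have hmin : 0 < min (min η ε) (1 / (2 * (L + 1))) :=
      lt_min (lt_min hη hε) (by positivity)
    have hn0 : (0 : ℝ) < n := (div_nonneg hT hmin.le).trans_lt hn
    set h := T / n with hh
    have hh0 : 0 ≤ h := by positivity
    have hnh : n * h = T := by rw [hh]; field_simp
    have hhmin : h ≤ min (min η ε) (1 / (2 * (L + 1))) := by
      rw [hh, div_le_iff₀ hn0]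
      rw [div_lt_iff₀ hmin] at hn
      linarith
    have hhη : h ≤ η := hhmin.trans ((min_le_left _ _).trans (min_le_left _ _))
    have hhε : h ≤ ε := hhmin.trans ((min_le_left _ _).trans (min_le_right _ _))
    have hhL : h * L ≤ 1 / 2 := by
      have h1 : h ≤ 1 / (2 * (L + 1)) := hhmin.trans (min_le_right _ _)
      rw [le_div_iff₀ (by positivity)] at h1
      linarith
    have hXε : ∀ s ∈ Icc 0 T, ∀ t ∈ Icc 0 T, |t - s| ≤ h → ∀ y, ‖X t y - X s y‖ ≤ ε := by
      intro s hs t ht hts y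
      have h1 := hΛη t ht s hs (by rw [Real.dist_eq]; exact hts.trans hhη)
      rw [dist_eq_norm] at h1
      calc ‖X t y - X s y‖ = ‖B y (Λ t - Λ s)‖ := by simp only [hX, map_sub]
        _ ≤ C₀ * (ε / (C₀ + 1)) := ((B y).le_opNorm _).trans
            (mul_le_mul (hC₀ y) h1 (norm_nonneg _) hC₀0)
        _ ≤ (C₀ + 1) * (ε / (C₀ + 1)) := by gcongr; linarith
        _ = ε := by field_simp
    have hexpn : (1 + 4 * L * h) ^ n ≤ e := by
      calc (1 + 4 * L * h) ^ n ≤ Real.exp (4 * L * h) ^ n := by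
            gcongr
            linarith [Real.add_one_le_exp (4 * L * h)]
        _ = e := by
            rw [← Real.exp_nat_mul, he, ← hnh]
            congr 1; ring
    have hnT : (n : ℝ) * (h * (ε * (1 + L * M))) = T * (ε * (1 + L * M)) := by
      rw [← hnh]; ring
    have h1 := abs_integral_sub_le_of_euler hα hβ hXb hM0 hL0 hx htube (fun φ h1 h2 h3 =>
      h0 φ h1 h2 (h3.trans (Metric.closedBall_subset_closedBall hr₀₁))) hε hh0 hhε hhL hXε hnh
      n le_rfl a r φ hr (by rw [hnh]; exact hφ) (by
      rw [hnT]
      exact le_trans (mul_le_mul_of_nonneg_left hexpn (by positivity)) hre)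
    have ha := hφ.nonneg
    rw [hnh] at h1
    refine h1.trans ?_
    calc (n : ℝ) * (2 * (h * ε * a * κ)) * (1 + 4 * L * h) ^ n
        = (n * h) * ε * (2 * κ * a * (1 + 4 * L * h) ^ n) := by ring
      _ ≤ T * ε * (2 * κ * a * e) := by rw [hnh]; gcongr
  refine ⟨r₀ / (2 * e), by positivity, fun φ hφ hφc hφr => ?_⟩
  obtain ⟨a, ha⟩ := exists_isLocalTest hφ hφc hφr
  have ha0 := ha.nonneg
  have hlim : |ℓ T φ| ≤ 0 := by
    have h1 : Tendsto (fun ε : ℝ => T * ε * (2 * κ * a * e)) (𝓝[>] 0)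
        (𝓝 (T * 0 * (2 * κ * a * e))) :=
      ((continuous_const.mul continuous_id).mul continuous_const).continuousAt.mono_left
        nhdsWithin_le_nhds
    rw [mul_zero, zero_mul] at h1
    have h2 : Tendsto (fun ε : ℝ => (r₀ / (2 * e) + T * (ε * (1 + L * M))) * e) (𝓝[>] 0)
        (𝓝 ((r₀ / (2 * e) + T * (0 * (1 + L * M))) * e)) := by
      refine Tendsto.mono_left (Continuous.tendsto ?_ 0) nhdsWithin_le_nhds
      fun_prop
    have h3 : (r₀ / (2 * e) + T * (0 * (1 + L * M))) * e < r₀ := by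
      have : (r₀ / (2 * e) + T * (0 * (1 + L * M))) * e = r₀ / 2 := by field_simp; ring
      rw [this]; linarith
    refine ge_of_tendsto h1 ?_
    filter_upwards [h2.eventually (gt_mem_nhds h3), self_mem_nhdsWithin] with ε h4 h5
    exact key ε h5 a _ (by positivity) h4.le φ ha
  exact sub_eq_zero.1 (abs_eq_zero.1 (le_antisymm hlim (abs_nonneg _)))

end LocalUniqueness

/-! ### Laws of particles and uniqueness -/

/-- Differentiation under the integral sign, within a convex set of parameters. -/
lemma hasDerivWithinAt_integral_of_bound {Ω : Type*} [MeasurableSpace Ω] {P : Measure Ω}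
    [IsFiniteMeasure P] {f f' : ℝ → Ω → ℝ} {s : Set ℝ} (hs : Convex ℝ s) {C : ℝ}
    (hf : ∀ t ∈ s, Integrable (f t) P)
    (h : ∀ᵐ z ∂P, ∀ t ∈ s, HasDerivWithinAt (fun r => f r z) (f' t z) s t ∧ |f' t z| ≤ C)
    {t₀ : ℝ} (ht₀ : t₀ ∈ s) :
    HasDerivWithinAt (fun t => ∫ z, f t z ∂P) (∫ z, f' t₀ z ∂P) s t₀ := by
  rw [hasDerivWithinAt_iff_tendsto_slope]
  have hsl : ∀ t ∈ s, slope (fun t => ∫ z, f t z ∂P) t₀ t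
      = ∫ z, slope (fun r => f r z) t₀ t ∂P := fun t ht => by
    simp only [slope_def_module]
    rw [integral_smul, integral_sub (hf t ht) (hf t₀ ht₀)]
  have hmem : ∀ᶠ t in 𝓝[s \ {t₀}] t₀, t ∈ s \ {t₀} := self_mem_nhdsWithin
  refine Tendsto.congr' (f₁ := fun t => ∫ z, slope (fun r => f r z) t₀ t ∂P) ?_ ?_
  · filter_upwards [hmem] with t ht
    exact (hsl t ht.1).symm
  refine tendsto_integral_filter_of_dominated_convergence (fun _ => C) ?_ ?_ (integrable_const C) ?_
  · filter_upwards [hmem] with t ht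
    simp only [slope_def_module]
    exact (((hf t ht.1).sub (hf t₀ ht₀)).smul (t - t₀)⁻¹).aestronglyMeasurable
  · filter_upwards [hmem] with t ht
    filter_upwards [h] with z hz
    have h1 := hs.norm_image_sub_le_of_norm_hasDerivWithin_le (fun r hr => (hz r hr).1)
      (fun r hr => (hz r hr).2) ht₀ ht.1
    have h2 : 0 < ‖t - t₀‖ := norm_pos_iff.2 (sub_ne_zero.2 fun h => ht.2 h)
    rw [slope_def_module, norm_smul, norm_inv, inv_mul_le_iff₀ h2, mul_comm]
    exact h1
  · filter_upwards [h] with z hz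
    exact hasDerivWithinAt_iff_tendsto_slope.1 (hz t₀ ht₀).1

/-- Probability measures that agree locally at almost every point are equal. -/
lemma measure_eq_of_locally_eq {X : Type*} [TopologicalSpace X] [SecondCountableTopology X]
    [MeasurableSpace X] [OpensMeasurableSpace X] {μ ν : Measure X} [IsProbabilityMeasure μ]
    [IsProbabilityMeasure ν]
    (h : ∀ᵐ x ∂ν, ∃ O : Set X, IsOpen O ∧ x ∈ O ∧ μ.restrict O = ν.restrict O) : μ = ν := by
  obtain ⟨S, hS, hSU⟩ := TopologicalSpace.isOpen_iUnion_countable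
    (fun O : {O : Set X // IsOpen O ∧ μ.restrict O = ν.restrict O} => O.1) fun O => O.2.1
  set U : Set X := ⋃ O : {O : Set X // IsOpen O ∧ μ.restrict O = ν.restrict O}, O.1 with hU
  have hUo : IsOpen U := isOpen_iUnion fun O => O.2.1
  have hr : μ.restrict U = ν.restrict U := by
    rw [← hSU]
    exact (Measure.restrict_biUnion_congr hS).2 fun O _ => O.2.2
  have hν : ∀ᵐ x ∂ν, x ∈ U := h.mono fun x ⟨O, h1, h2, h3⟩ => mem_iUnion.2 ⟨⟨O, h1, h3⟩, h2⟩
  have hμ : ∀ᵐ x ∂μ, x ∈ U := by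
    have h1 : μ U = ν U := by
      rw [← Measure.restrict_apply_self, hr, Measure.restrict_apply_self]
    have h2 : ν U = 1 := (prob_compl_eq_zero_iff hUo.measurableSet).1 hν
    exact (prob_compl_eq_zero_iff hUo.measurableSet).2 (h1.trans h2)
  rw [← Measure.restrict_eq_self_of_ae_mem hμ, hr, Measure.restrict_eq_self_of_ae_mem hν]

/-- `γ` is a path of parameters that solves on the time set `I` the particle equations driven by the
curve `μ` of mixing measures, in terms of the velocity field. -/
def IsCharacteristic (V : EuclideanSpace ℝ (Fin d) → ℝ) (μ : ℝ → Measure (BW d)) (I : Set ℝ)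
    (γ : ℝ → BW d) : Prop :=
  ∀ t ∈ I, HasDerivWithinAt (fun s => (γ s).1)
    (-tangentMap (γ t).1 (velocity V (μ t) (γ t))) I t

section Laws

variable {V : EuclideanSpace ℝ (Fin d) → ℝ}

lemma IsCharacteristic.mono {μ : ℝ → Measure (BW d)} {I J : Set ℝ} {γ : ℝ → BW d}
    (h : IsCharacteristic V μ I γ) (hJ : J ⊆ I) : IsCharacteristic V μ J γ :=
  fun t ht => (h t (hJ ht)).mono hJ

lemma IsCharacteristic.continuousOn {μ : ℝ → Measure (BW d)} {I : Set ℝ} {γ : ℝ → BW d}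
    (h : IsCharacteristic V μ I γ) : ContinuousOn γ I :=
  Topology.IsInducing.subtypeVal.continuousOn_iff.2 fun t ht => (h t ht).continuousWithinAt

lemma tangentMap_neg (θ u : Ambient d) : tangentMap θ (-u) = -tangentMap θ u :=
  map_neg (tangentMapL θ) u

lemma bwInner_bwGrad_neg_velocity {φ : Ambient d → ℝ} (hφ : Differentiable ℝ φ)
    (μ : Measure (BW d)) (θ : BW d) :
    bwInner θ (bwGrad φ θ) (-velocity V μ θ)
      = fderiv ℝ φ θ.1 (-tangentMap θ.1 (velocity V μ θ)) := by
  rw [bwInner_bwGrad hφ θ (u := -velocity V μ θ) (velocity_isSymm μ θ).neg, tangentMap_neg]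

lemma IsTestFunction.continuous_bwInner_velocity {φ : Ambient d → ℝ} (hφ : IsTestFunction φ)
    {μ : Measure (BW d)}
    (hint : ∀ c : ℝ, 0 < c → Integrable (fun x => Real.exp (-(c * ‖x‖ ^ 2)) * logRatio V μ x)) :
    Continuous fun θ : BW d => bwInner θ (bwGrad φ θ) (-velocity V μ θ) := by
  simp only [bwInner_bwGrad_neg_velocity hφ.differentiable]
  exact ((hφ.1.continuous_fderiv (by norm_num)).comp continuous_subtype_val).clm_apply
    (continuous_tangentMap_velocity hint).neg

lemma TestContinuousOn.exists_bound_bwInner_velocity (hV : Continuous V)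
    (hVint : ∀ θ : BW d, Integrable V (gaussian θ))
    (hexp : Integrable (fun x => Real.exp (-V x)) volume) {I : Set ℝ} {μ : ℝ → Measure (BW d)}
    (h : TestContinuousOn I μ) (hp : ∀ t ∈ I, IsProbabilityMeasure (μ t)) (hI : IsCompact I)
    {φ : Ambient d → ℝ} (hφ : IsTestFunction φ) :
    ∃ C, ∀ t ∈ I, ∀ θ : BW d, |bwInner θ (bwGrad φ θ) (-velocity V (μ t) θ)| ≤ C := by
  obtain ⟨K, hK, h0⟩ := hφ.2
  obtain ⟨C₁, hC₁⟩ := h.exists_velocity_bound hV hVint hexp hp hI hK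
  obtain ⟨C₂, hC₂⟩ := hK.exists_bound_of_continuousOn
    ((hφ.1.continuous_fderiv (by norm_num)).comp continuous_subtype_val).continuousOn
  refine ⟨max (C₂ * C₁) 0, fun t ht θ => ?_⟩
  by_cases hθ : θ ∈ K
  · refine le_max_of_le_left ?_
    rw [bwInner_bwGrad_neg_velocity hφ.differentiable]
    refine ((fderiv ℝ φ θ.1).le_opNorm _).trans ?_
    rw [norm_neg]
    exact mul_le_mul (hC₂ θ hθ) (hC₁ t ht θ hθ) (norm_nonneg _) ((norm_nonneg _).trans (hC₂ θ hθ))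
  · rw [IsTestFunction.bwGrad_eq_zero hφ.differentiable hK.isClosed h0 hθ]
    simp [bwInner]

/-- The laws of random characteristics solve the continuity equation. -/
lemma continuityEquation_map (hV : Continuous V)
    (hVint : ∀ θ : BW d, Integrable V (gaussian θ))
    (hexp : Integrable (fun x => Real.exp (-V x)) volume) {μ : ℝ → Measure (BW d)}
    (h : TestContinuousOn (Ici 0) μ) (hp : ∀ t ∈ Ici (0 : ℝ), IsProbabilityMeasure (μ t))
    {Ω : Type*} [MeasurableSpace Ω] {P : Measure Ω} [IsFiniteMeasure P] {θ : ℝ → Ω → BW d}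
    (hθ : ∀ t, 0 ≤ t → AEMeasurable (θ t) P)
    (hc : ∀ᵐ z ∂P, IsCharacteristic V μ (Ici 0) fun t => θ t z) :
    ContinuityEquation (Ici 0) (fun t => P.map (θ t)) (fun t θ => -velocity V (μ t) θ) := by
  intro φ hφ t ht
  have ht0 : (0 : ℝ) ≤ t := ht
  have hsub : Icc 0 (t + 1) ⊆ Ici (0 : ℝ) := Icc_subset_Ici_self
  have hint : ∀ t ∈ Ici (0 : ℝ), ∀ c : ℝ, 0 < c →
      Integrable (fun x => Real.exp (-(c * ‖x‖ ^ 2)) * logRatio V (μ t) x) := fun t ht c hc => by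
    have := hp t ht
    exact integrable_exp_mul_logRatio hV hVint hexp (μ t) hc
  obtain ⟨C, hC⟩ := TestContinuousOn.exists_bound_bwInner_velocity hV hVint hexp
    (μ := μ) (I := Icc 0 (t + 1)) (fun φ hφ => (h φ hφ).mono hsub)
    (fun s hs => hp s (hsub hs)) isCompact_Icc hφ
  have htI : t ∈ Icc 0 (t + 1) := ⟨ht0, by linarith⟩
  have hcont := hφ.continuous_bwInner_velocity (hint t ht)
  refine ⟨Integrable.of_bound hcont.aestronglyMeasurable C (ae_of_all _ (hC t htI)), ?_⟩
  obtain ⟨C', hC'⟩ := hφ.exists_bound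
  have hφc : Continuous fun θ : BW d => φ θ.1 := hφ.continuous.comp continuous_subtype_val
  have h1 := hasDerivWithinAt_integral_of_bound (P := P) (f := fun s z => φ (θ s z).1)
    (f' := fun s z => bwInner (θ s z) (bwGrad φ (θ s z)) (-velocity V (μ s) (θ s z)))
    (convex_Icc 0 (t + 1)) (C := C)
    (fun s hs => Integrable.of_bound
      (hφc.measurable.comp_aemeasurable (hθ s (hsub hs))).aestronglyMeasurable C'
      (ae_of_all _ fun z => hC' _)) (by
        filter_upwards [hc] with z hz s hs
        refine ⟨?_, hC s hs _⟩
        rw [bwInner_bwGrad_neg_velocity hφ.differentiable]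
        exact ((hφ.differentiable _).hasFDerivAt.comp_hasDerivWithinAt s (hz s (hsub hs))).mono
          hsub) htI
  have hnhds : Icc 0 (t + 1) ∈ 𝓝[Ici 0] t := by
    rw [← Ici_inter_Iic]
    exact inter_mem self_mem_nhdsWithin (mem_nhdsWithin_of_mem_nhds (Iic_mem_nhds (by linarith)))
  have h2 := h1.mono_of_mem_nhdsWithin hnhds
  have e1 : ∀ s, 0 ≤ s → ∫ η, φ η.1 ∂(P.map (θ s)) = ∫ z, φ (θ s z).1 ∂P := fun s hs =>
    integral_map (hθ s hs) hφc.aestronglyMeasurable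
  have e2 : ∫ η, bwInner η (bwGrad φ η) (-velocity V (μ t) η) ∂(P.map (θ t))
      = ∫ z, bwInner (θ t z) (bwGrad φ (θ t z)) (-velocity V (μ t) (θ t z)) ∂P :=
    integral_map (hθ t ht) hcont.aestronglyMeasurable
  rw [← e2] at h2
  exact h2.congr (fun s hs => e1 s hs) (e1 t ht0)

/-- A solution of the continuity equation in the parameter space, pushed to the ambient space. -/
lemma solvesOn_map {μ ν : ℝ → Measure (BW d)} {T : ℝ} {F : Type*} [NormedAddCommGroup F]
    [NormedSpace ℝ F] {B : Ambient d → F →L[ℝ] Ambient d} {Λ : ℝ → F} {W : Set (Ambient d)}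
    (hWd : W ⊆ detPos d)
    (hB : ContDiff ℝ ∞ B) (hν : ∀ t ∈ Icc 0 T, IsFiniteMeasure (ν t) ∧ (ν t).real univ ≤ 1)
    (hCE : ContinuityEquation (Icc 0 T) ν (fun t θ => -velocity V (μ t) θ))
    (hBv : ∀ t ∈ Icc 0 T, ∀ θ : BW d, θ.1 ∈ W →
      B θ.1 (Λ t) = -tangentMap θ.1 (velocity V (μ t) θ)) :
    SolvesOn W T (fun t y => B y (Λ t)) (fun t => (ν t).map Subtype.val) := by
  have hval : Measurable (Subtype.val : BW d → Ambient d) := measurable_subtype_coe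
  refine ⟨fun t ht => ?_, fun t ht => ?_, fun φ hφ hφc hφW t ht => ?_⟩
  · have := (hν t ht).1
    infer_instance
  · rw [measureReal_def, Measure.map_apply hval MeasurableSet.univ, preimage_univ]
    exact (hν t ht).2
  · have hφt := isTestFunction_of_hasCompactSupport hφ hφc (hφW.trans hWd)
    have h1 := (hCE φ hφt t ht).2
    have e1 : ∀ s, ∫ y, φ y ∂((ν s).map Subtype.val) = ∫ θ : BW d, φ θ.1 ∂(ν s) := fun s =>
      integral_map hval.aemeasurable hφ.continuous.aestronglyMeasurable
    have hc : Continuous fun y => fderiv ℝ φ y (B y (Λ t)) :=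
      (hφ.continuous_fderiv (by norm_num)).clm_apply (hB.continuous.clm_apply continuous_const)
    have e2 : ∫ y, fderiv ℝ φ y (B y (Λ t)) ∂((ν t).map Subtype.val)
        = ∫ θ : BW d, bwInner θ (bwGrad φ θ) (-velocity V (μ t) θ) ∂(ν t) := by
      rw [integral_map hval.aemeasurable hc.aestronglyMeasurable]
      congr 1
      ext θ
      rw [bwInner_bwGrad_neg_velocity hφt.differentiable]
      by_cases hθ : θ.1 ∈ W
      · rw [hBv t ht θ hθ]
      · have : fderiv ℝ φ θ.1 = 0 := image_eq_zero_of_notMem_tsupport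
          fun h => hθ (hφW (tsupport_fderiv_subset ℝ h))
        simp [this]
    simp only [e1, e2]
    exact h1

/-- Along a characteristic, local agreement of two solutions of the continuity equation is
propagated in time. -/
lemma exists_restrict_eq_of_isCharacteristic (hV : Continuous V)
    (hVint : ∀ θ : BW d, Integrable V (gaussian θ))
    (hexp : Integrable (fun x => Real.exp (-V x)) volume) {μ ν : ℝ → Measure (BW d)} {T : ℝ}
    (hT : 0 ≤ T) (hp : ∀ t ∈ Icc 0 T, IsProbabilityMeasure (μ t))
    (hμ : ContinuityEquation (Icc 0 T) μ (fun t θ => -velocity V (μ t) θ))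
    (hν1 : ∀ t ∈ Icc 0 T, IsFiniteMeasure (ν t) ∧ (ν t).real univ ≤ 1)
    (hν : ContinuityEquation (Icc 0 T) ν (fun t θ => -velocity V (μ t) θ))
    {γ : ℝ → BW d} (hγ : IsCharacteristic V μ (Icc 0 T) γ) {O : Set (BW d)} (hO : IsOpen O)
    (hγO : γ 0 ∈ O) (h0 : (μ 0).restrict O = (ν 0).restrict O) :
    ∃ O' : Set (BW d), IsOpen O' ∧ γ T ∈ O' ∧ (μ T).restrict O' = (ν T).restrict O' := by
  have hTT : T ∈ Icc 0 T := right_mem_Icc.2 hT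
  obtain ⟨F, _, _, B, Λ, W, hW, hKW, hWd, -, hB, hBc, -, hΛ, hBv⟩ :=
    hμ.testContinuousOn.exists_velocity_field hV hVint hexp hp
      (isCompact_Icc.image_of_continuousOn hγ.continuousOn)
  have hγW : ∀ t ∈ Icc 0 T, (γ t).1 ∈ W := fun t ht => hKW _ (mem_image_of_mem γ ht)
  have hval : Measurable (Subtype.val : BW d → Ambient d) := measurable_subtype_coe
  have hα := solvesOn_map hWd hB (fun t ht => by
    have := hp t ht
    exact ⟨inferInstance, by simp⟩) hμ hBv
  have hβ := solvesOn_map hWd hB hν1 hν hBv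
  obtain ⟨O₁, hO₁, rfl⟩ := isOpen_induced_iff.1 hO
  obtain ⟨r₁, hr₁, hball⟩ := Metric.nhds_basis_closedBall.mem_iff.1 (hO₁.mem_nhds hγO)
  have hmap : ∀ {ρ : Measure (BW d)} {φ : Ambient d → ℝ}, Continuous φ →
      ∫ y, φ y ∂(ρ.map Subtype.val) = ∫ θ : BW d, φ θ.1 ∂ρ := fun hφ =>
    integral_map hval.aemeasurable hφ.aestronglyMeasurable
  obtain ⟨r, hr, hloc⟩ := exists_local_uniqueness hB hBc hT hΛ hW hα hβ (x := fun t => (γ t).1)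
    (fun t ht => by
      rw [hBv t ht (γ t) (hγW t ht)]
      exact hγ t ht) hγW hr₁ (fun φ hφ hφc hφr => by
      rw [hmap hφ.continuous, hmap hφ.continuous]
      have hz : ∀ θ : BW d, θ ∉ Subtype.val ⁻¹' O₁ → φ θ.1 = 0 := fun θ hθ =>
        image_eq_zero_of_notMem_tsupport fun h => hθ (hball (hφr h))
      rw [← setIntegral_eq_integral_of_forall_compl_eq_zero hz, h0,
        setIntegral_eq_integral_of_forall_compl_eq_zero hz])
  have hfin := (hν1 T hTT).1
  have hprob := hp T hTT
  refine ⟨Subtype.val ⁻¹' Metric.ball (γ T).1 r, Metric.isOpen_ball.preimage continuous_subtype_val,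
    Metric.mem_ball_self hr, Measure.ext fun s hs => ?_⟩
  have hOm : MeasurableSet (Subtype.val ⁻¹' Metric.ball (γ T).1 r : Set (BW d)) :=
    hval Metric.isOpen_ball.measurableSet
  rw [Measure.restrict_apply hs, Measure.restrict_apply hs]
  refine measure_eq_of_forall_test (Metric.isOpen_ball (x := (γ T).1) (ε := r))
    (fun φ hφ hφc hφr => ?_) (hs.inter hOm) fun θ hθ => hθ.2
  have := hloc φ hφ hφc (hφr.trans (inter_subset_left.trans Metric.ball_subset_closedBall))
  rwa [hmap hφ.continuous, hmap hφ.continuous] at this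

/-- Random characteristics with the right initial law have the right law at all times: both curves
of measures solve the continuity equation, hence agree near the final points of characteristics. -/
theorem map_eq_of_isCharacteristic (hV : Continuous V)
    (hVint : ∀ θ : BW d, Integrable V (gaussian θ))
    (hexp : Integrable (fun x => Real.exp (-V x)) volume) {μ : ℝ → Measure (BW d)}
    (hp : ∀ t ∈ Ici (0 : ℝ), IsProbabilityMeasure (μ t))
    (hμ : ContinuityEquation (Ici 0) μ (fun t θ => -velocity V (μ t) θ))
    {Ω : Type*} [MeasurableSpace Ω] {P : Measure Ω} [IsProbabilityMeasure P] {θ : ℝ → Ω → BW d}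
    (hθ : ∀ t, 0 ≤ t → AEMeasurable (θ t) P) (h0 : P.map (θ 0) = μ 0)
    (hc : ∀ᵐ z ∂P, IsCharacteristic V μ (Ici 0) fun t => θ t z) {T : ℝ} (hT : 0 ≤ T) :
    P.map (θ T) = μ T := by
  have hsub : Icc 0 T ⊆ Ici (0 : ℝ) := Icc_subset_Ici_self
  have hν := continuityEquation_map hV hVint hexp hμ.testContinuousOn hp hθ hc
  have hmono : ∀ {ρ : ℝ → Measure (BW d)} {v : ℝ → BW d → Ambient d},
      ContinuityEquation (Ici 0) ρ v → ContinuityEquation (Icc 0 T) ρ v := fun h φ hφ t ht =>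
    ⟨(h φ hφ t (hsub ht)).1, (h φ hφ t (hsub ht)).2.mono hsub⟩
  have hPprob : ∀ t ∈ Icc 0 T, IsProbabilityMeasure (P.map (θ t)) := fun t ht =>
    Measure.isProbabilityMeasure_map (hθ t ht.1)
  have := hPprob T (right_mem_Icc.2 hT)
  have := hp T hT
  refine (measure_eq_of_locally_eq (μ := μ T) (ν := P.map (θ T)) ?_).symm
  -- the set of points with local agreement is open, hence measurable
  have hopen : IsOpen {x : BW d | ∃ O : Set (BW d), IsOpen O ∧ x ∈ O ∧
      (μ T).restrict O = (P.map (θ T)).restrict O} := by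
    refine isOpen_iff_mem_nhds.2 fun x ⟨O, h1, h2, h3⟩ => ?_
    filter_upwards [h1.mem_nhds h2] with y hy
    exact ⟨O, h1, hy, h3⟩
  refine (ae_map_iff (hθ T hT) hopen.measurableSet).2 ?_
  filter_upwards [hc] with z hz
  exact exists_restrict_eq_of_isCharacteristic hV hVint hexp hT (fun t ht => hp t (hsub ht))
    (hmono hμ) (fun t ht => by
      have := hPprob t ht
      exact ⟨inferInstance, by simp⟩) (hmono hν) (hz.mono hsub) isOpen_univ (mem_univ _)
    (by rw [h0])

end Laws

/-! ### Characteristics that carry atoms -/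

section Characteristics

variable {V : EuclideanSpace ℝ (Fin d) → ℝ} {μ : ℝ → Measure (BW d)}

/-- A curve of probability measures that is continuous against test functions is tight on compact
time sets. -/
lemma TestContinuousOn.exists_isCompact_lt_real {I : Set ℝ} (h : TestContinuousOn I μ)
    (hp : ∀ t ∈ I, IsProbabilityMeasure (μ t)) (hI : IsCompact I) {ε : ℝ} (hε : 0 < ε) :
    ∃ K : Set (BW d), IsCompact K ∧ ∀ t ∈ I, 1 - ε < (μ t).real K := by
  refine hI.induction_on (p := fun S => ∃ K : Set (BW d), IsCompact K ∧
    ∀ t ∈ S ∩ I, 1 - ε < (μ t).real K) ?_ ?_ ?_ ?_ |>.imp fun K hK => ⟨hK.1, fun t ht =>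
      hK.2 t ⟨ht, ht⟩⟩
  · exact ⟨∅, isCompact_empty, by simp⟩
  · rintro S S' hS ⟨K, hK, h1⟩
    exact ⟨K, hK, fun t ht => h1 t ⟨hS ht.1, ht.2⟩⟩
  · rintro S S' ⟨K, hK, h1⟩ ⟨K', hK', h1'⟩
    refine ⟨K ∪ K', hK.union hK', fun t ht => ?_⟩
    have := hp t ht.2
    rcases ht.1 with h2 | h2
    · exact (h1 t ⟨h2, ht.2⟩).trans_le (measureReal_mono subset_union_left)
    · exact (h1' t ⟨h2, ht.2⟩).trans_le (measureReal_mono subset_union_right)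
  · intro s hs
    obtain ⟨χ, h1, h2, h3, h4, hev⟩ := h.exists_cutoff hp hs hε
    have hK := isCompact_val_preimage h2 h3
    refine ⟨{t | 1 - ε < ∫ θ, χ θ.1 ∂(μ t)}, hev, _, hK, fun t ht => lt_of_lt_of_le ht.1 ?_⟩
    have := hp t ht.2
    rw [← integral_indicator_one hK.measurableSet]
    refine integral_mono ((isTestFunction_of_hasCompactSupport h1 h2 h3).integrable _)
      ((integrable_const 1).indicator hK.measurableSet) fun θ => ?_
    by_cases hθ : θ ∈ (Subtype.val ⁻¹' (tsupport χ) : Set (BW d))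
    · simpa [hθ] using (h4 θ.1).2
    · simp [hθ, image_eq_zero_of_notMem_tsupport fun h => hθ h]

/-- A weighted Dirac mass that moves along a characteristic solves the continuity equation. -/
lemma continuityEquation_dirac {I : Set ℝ} {γ : ℝ → BW d} (hγ : IsCharacteristic V μ I γ)
    (c : ℝ≥0) : ContinuityEquation I (fun t => c • Measure.dirac (γ t))
      (fun t θ => -velocity V (μ t) θ) := by
  intro φ hφ t ht
  refine ⟨(integrable_dirac (by simp)).smul_measure_nnreal, ?_⟩
  simp only [integral_smul_nnreal_measure, integral_dirac]
  rw [bwInner_bwGrad_neg_velocity hφ.differentiable]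
  exact ((hφ.differentiable _).hasFDerivAt.comp_hasDerivWithinAt t (hγ t ht)).const_smul c

/-- An atom that is isolated at time zero is transported along the characteristic. -/
lemma measure_singleton_of_isCharacteristic (hV : Continuous V)
    (hVint : ∀ θ : BW d, Integrable V (gaussian θ))
    (hexp : Integrable (fun x => Real.exp (-V x)) volume) {T : ℝ}
    (hT : 0 ≤ T) (hp : ∀ t ∈ Icc 0 T, IsProbabilityMeasure (μ t))
    (hμ : ContinuityEquation (Icc 0 T) μ (fun t θ => -velocity V (μ t) θ))
    {γ : ℝ → BW d} (hγ : IsCharacteristic V μ (Icc 0 T) γ) {c : ℝ≥0} (hc : c ≤ 1)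
    {O : Set (BW d)} (hO : IsOpen O) (hγO : γ 0 ∈ O)
    (h0 : (μ 0).restrict O = (c • Measure.dirac (γ 0)).restrict O) :
    μ T {γ T} = c := by
  obtain ⟨O', hO', hγO', heq⟩ := exists_restrict_eq_of_isCharacteristic hV hVint hexp hT hp hμ
    (ν := fun t => c • Measure.dirac (γ t))
    (fun t _ => ⟨inferInstance, by simpa [measureReal_nnreal_smul_apply] using hc⟩)
    (continuityEquation_dirac hγ c) hγ hO hγO h0
  have h1 := congrArg (fun ρ : Measure (BW d) => ρ {γ T}) heq
  simp only [Measure.restrict_apply (measurableSet_singleton _)] at h1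
  rw [inter_eq_self_of_subset_left (singleton_subset_iff.2 hγO')] at h1
  rw [h1]
  simp

/-- Existence of the characteristic that starts at an isolated atom. It cannot leave the region
where almost all the mass is, since it carries the mass of the atom. -/
lemma exists_isCharacteristic_Icc (hV : Continuous V)
    (hVint : ∀ θ : BW d, Integrable V (gaussian θ))
    (hexp : Integrable (fun x => Real.exp (-V x)) volume) {T : ℝ}
    (hT : 0 ≤ T) (hp : ∀ t ∈ Icc 0 T, IsProbabilityMeasure (μ t))
    (hμ : ContinuityEquation (Icc 0 T) μ (fun t θ => -velocity V (μ t) θ))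
    {x₀ : BW d} {c : ℝ≥0} (hc0 : 0 < c) (hc : c ≤ 1)
    {O : Set (BW d)} (hO : IsOpen O) (hxO : x₀ ∈ O)
    (h0 : (μ 0).restrict O = (c • Measure.dirac x₀).restrict O) :
    ∃ γ : ℝ → BW d, γ 0 = x₀ ∧ IsCharacteristic V μ (Icc 0 T) γ := by
  classical
  have hTC := hμ.testContinuousOn
  have h0T : (0 : ℝ) ∈ Icc 0 T := left_mem_Icc.2 hT
  obtain ⟨K, hK, hmass⟩ := hTC.exists_isCompact_lt_real hp isCompact_Icc
    (NNReal.coe_pos.2 hc0)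
  obtain ⟨F, _, _, B, Λ, W, hW, hKW, hWd, hWp, hB, hBc, hBs, hΛ, hBv⟩ :=
    hTC.exists_velocity_field hV hVint hexp hp (hK.union (isCompact_singleton (x := x₀)))
  obtain ⟨M, L, hM, hL, hX⟩ := exists_isBoundedField hB hBc hΛ
  have hpl : IsPicardLindelof (fun t y => B y (Λ t)) (tmin := 0) (tmax := T) ⟨0, h0T⟩ x₀.1
      (M.toNNReal * T.toNNReal) 0 M.toNNReal L.toNNReal :=
    { lipschitzOnWith := fun t ht => (LipschitzWith.of_dist_le_mul fun y z => by
        rw [Real.coe_toNNReal _ hL, dist_eq_norm, dist_eq_norm]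
        exact hX.norm_sub_le t ht y z).lipschitzOnWith
      continuousOn := fun x _ => continuousOn_const.clm_apply hΛ
      norm_le := fun t ht y _ => by
        rw [Real.coe_toNNReal _ hM]; exact hX.norm_le t ht y
      mul_max_le := by
        simp [Real.coe_toNNReal _ hM, Real.coe_toNNReal _ hT, hT] }
  obtain ⟨x, hx0, hx⟩ := hpl.exists_eq_forall_mem_Icc_hasDerivWithinAt₀
  simp only at hx0
  have hxc : ContinuousOn x (Icc 0 T) := fun t ht => (hx t ht).continuousWithinAt
  have hsymm : ∀ t ∈ Icc 0 T, (x t).2.IsSymm := fun t ht =>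
    isSymm_of_hasDerivWithinAt (convex_Icc 0 T) hx (fun s _ => hBs _ _) h0T ht
      (by rw [hx0]; exact cov_isSymm x₀)
  have hpos : ∀ t ∈ Icc 0 T, x t ∈ W → (x t).2.PosDef := fun t ht h => hWp _ h (hsymm t ht)
  set γ : ℝ → BW d := fun t => if h : (x t).2.PosDef then ⟨x t, h⟩ else x₀ with hγdef
  have hγx : ∀ t ∈ Icc 0 T, x t ∈ W → (γ t).1 = x t := fun t ht h => by
    simp only [hγdef, dif_pos (hpos t ht h)]
  have hx0W : x 0 ∈ W := by rw [hx0]; exact hKW x₀ (Or.inr rfl)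
  have hγ0 : γ 0 = x₀ := Subtype.ext ((hγx 0 h0T hx0W).trans hx0)
  have hchar : ∀ τ ∈ Icc 0 T, (∀ t ∈ Icc 0 τ, x t ∈ W) →
      IsCharacteristic V μ (Icc 0 τ) γ := by
    intro τ hτ hτW t ht
    have hsub : Icc 0 τ ⊆ Icc 0 T := Icc_subset_Icc_right hτ.2
    have h1 := hγx t (hsub ht) (hτW t ht)
    rw [← hBv t (hsub ht) (γ t) (by rw [h1]; exact hτW t ht), h1]
    exact ((hx t (hsub ht)).mono hsub).congr (fun s hs => hγx s (hsub hs) (hτW s hs)) h1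
  -- the path stays in the set `C`, as long as it stays in `W`
  set C : Set (Ambient d) := Subtype.val '' K with hCdef
  have hCc : IsClosed C := (hK.image continuous_subtype_val).isClosed
  have hCW : C ⊆ W := by
    rintro _ ⟨θ, hθ, rfl⟩
    exact hKW θ (Or.inl hθ)
  have hstay : ∀ τ ∈ Icc 0 T, (∀ t ∈ Icc 0 τ, x t ∈ W) → x τ ∈ C := by
    intro τ hτ hτW
    have hsub : Icc 0 τ ⊆ Icc 0 T := Icc_subset_Icc_right hτ.2
    have h1 := measure_singleton_of_isCharacteristic hV hVint hexp hτ.1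
      (fun t ht => hp t (hsub ht))
      (fun φ hφ t ht => ⟨(hμ φ hφ t (hsub ht)).1, (hμ φ hφ t (hsub ht)).2.mono hsub⟩)
      (hchar τ hτ hτW) hc hO (by rwa [hγ0]) (by rwa [hγ0])
    have := hp τ hτ
    have hmem : γ τ ∈ K := by
      -- otherwise `K` and the atom at `γ τ` together have mass greater than one
      by_contra hn
      have h2 : (μ τ).real ({γ τ} ∪ K) = c + (μ τ).real K := by
        rw [measureReal_union (disjoint_singleton_left.2 hn) hK.measurableSet, measureReal_def, h1]
        simp
      have h3 := measureReal_le_one (μ := μ τ) (s := {γ τ} ∪ K)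
      linarith [hmass τ hτ]
    exact ⟨γ τ, hmem, hγx τ hτ (hτW τ (right_mem_Icc.2 hτ.1))⟩
  have hall : ∀ t ∈ Icc 0 T, x t ∈ W := by
    by_contra hcon
    push Not at hcon
    obtain ⟨t₁, ht₁, ht₁W⟩ := hcon
    -- the first exit time from `W`
    have hbad : IsCompact (Icc 0 T ∩ x ⁻¹' Wᶜ) := isCompact_Icc.of_isClosed_subset
      (hxc.preimage_isClosed_of_isClosed isClosed_Icc hW.isClosed_compl) inter_subset_left
    obtain ⟨τ, ⟨hτ, hτW⟩, hmin⟩ := hbad.exists_isLeast ⟨t₁, ht₁, ht₁W⟩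
    have hτ0 : 0 < τ := lt_of_le_of_ne hτ.1 fun h => hτW (by rwa [← h])
    have hbefore : ∀ u ∈ Ico 0 τ, x u ∈ W := fun u hu => by
      by_contra hn
      exact absurd (hmin ⟨⟨hu.1, hu.2.le.trans hτ.2⟩, hn⟩) (not_le.2 hu.2)
    have hC' : ∀ u ∈ Ico 0 τ, x u ∈ C := fun u hu =>
      hstay u ⟨hu.1, hu.2.le.trans hτ.2⟩ fun t ht => hbefore t ⟨ht.1, ht.2.trans_lt hu.2⟩
    have hne : (𝓝[Ico 0 τ] τ).NeBot := by
      rw [← mem_closure_iff_nhdsWithin_neBot, closure_Ico hτ0.ne]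
      exact right_mem_Icc.2 hτ0.le
    have hlim : Tendsto x (𝓝[Ico 0 τ] τ) (𝓝 (x τ)) :=
      (hxc τ hτ).mono fun u hu => ⟨hu.1, hu.2.le.trans hτ.2⟩
    exact hτW (hCW (hCc.mem_of_tendsto hlim (eventually_mem_nhdsWithin.mono hC')))
  exact ⟨γ, hγ0, hchar T (right_mem_Icc.2 hT) hall⟩

/-- Characteristics are determined by their initial point. -/
lemma IsCharacteristic.eqOn (hV : Continuous V)
    (hVint : ∀ θ : BW d, Integrable V (gaussian θ))
    (hexp : Integrable (fun x => Real.exp (-V x)) volume) {T : ℝ}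
    (hp : ∀ t ∈ Icc 0 T, IsProbabilityMeasure (μ t)) (hTC : TestContinuousOn (Icc 0 T) μ)
    {γ γ' : ℝ → BW d} (hγ : IsCharacteristic V μ (Icc 0 T) γ)
    (hγ' : IsCharacteristic V μ (Icc 0 T) γ') (h0 : γ 0 = γ' 0) : EqOn γ γ' (Icc 0 T) := by
  obtain ⟨F, _, _, B, Λ, W, hW, hKW, hWd, hWp, hB, hBc, hBs, hΛ, hBv⟩ :=
    hTC.exists_velocity_field hV hVint hexp hp
      ((isCompact_Icc.image_of_continuousOn hγ.continuousOn).union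
        (isCompact_Icc.image_of_continuousOn hγ'.continuousOn))
  obtain ⟨M, L, hM, hL, hX⟩ := exists_isBoundedField hB hBc hΛ
  have hode : ∀ {γ : ℝ → BW d}, IsCharacteristic V μ (Icc 0 T) γ →
      (∀ t ∈ Icc 0 T, (γ t).1 ∈ W) → ContinuousOn (fun t => (γ t).1) (Icc 0 T) ∧
      ∀ t ∈ Ico 0 T, HasDerivWithinAt (fun t => (γ t).1) (B (γ t).1 (Λ t)) (Ici t) t := by
    intro γ hγ hγW
    refine ⟨fun t ht => (hγ t ht).continuousWithinAt, fun t ht => ?_⟩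
    have ht' := Ico_subset_Icc_self ht
    rw [hBv t ht' (γ t) (hγW t ht')]
    refine (hγ t ht').mono_of_mem_nhdsWithin ?_
    filter_upwards [Icc_mem_nhdsGE ht.2] with s hs
    exact ⟨ht.1.trans hs.1, hs.2⟩
  obtain ⟨c1, d1⟩ := hode hγ fun t ht => hKW _ (Or.inl (mem_image_of_mem γ ht))
  obtain ⟨c2, d2⟩ := hode hγ' fun t ht => hKW _ (Or.inr (mem_image_of_mem γ' ht))
  have h1 := ODE_solution_unique_of_mem_Icc_right (v := fun t y => B y (Λ t)) (s := fun _ => univ)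
    (K := L.toNNReal) (fun t ht => (LipschitzWith.of_dist_le_mul fun y z => by
        rw [Real.coe_toNNReal _ hL, dist_eq_norm, dist_eq_norm]
        exact hX.norm_sub_le t (Ico_subset_Icc_self ht) y z).lipschitzOnWith)
    c1 d1 (fun _ _ => mem_univ _) c2 d2 (fun _ _ => mem_univ _) (congrArg Subtype.val h0)
  exact fun t ht => Subtype.ext (h1 ht)

/-- Global existence of the characteristic that starts at an isolated atom. -/
lemma exists_isCharacteristic (hV : Continuous V)
    (hVint : ∀ θ : BW d, Integrable V (gaussian θ))
    (hexp : Integrable (fun x => Real.exp (-V x)) volume)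
    (hp : ∀ t ∈ Ici (0 : ℝ), IsProbabilityMeasure (μ t))
    (hμ : ContinuityEquation (Ici 0) μ (fun t θ => -velocity V (μ t) θ))
    {x₀ : BW d} {c : ℝ≥0} (hc0 : 0 < c) (hc : c ≤ 1)
    {O : Set (BW d)} (hO : IsOpen O) (hxO : x₀ ∈ O)
    (h0 : (μ 0).restrict O = (c • Measure.dirac x₀).restrict O) :
    ∃ γ : ℝ → BW d, γ 0 = x₀ ∧ IsCharacteristic V μ (Ici 0) γ := by
  have hsub : ∀ T, Icc 0 T ⊆ Ici (0 : ℝ) := fun T => Icc_subset_Ici_self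
  have hCE : ∀ T, ContinuityEquation (Icc 0 T) μ (fun t θ => -velocity V (μ t) θ) :=
    fun T φ hφ t ht =>
      ⟨(hμ φ hφ t (hsub T ht)).1, (hμ φ hφ t (hsub T ht)).2.mono (hsub T)⟩
  have hpT : ∀ T, ∀ t ∈ Icc 0 T, IsProbabilityMeasure (μ t) := fun T t ht => hp t (hsub T ht)
  have hex : ∀ n : ℕ, ∃ γ : ℝ → BW d, γ 0 = x₀ ∧ IsCharacteristic V μ (Icc 0 (n : ℝ)) γ :=
    fun n => exists_isCharacteristic_Icc hV hVint hexp (Nat.cast_nonneg n) (hpT n) (hCE n) hc0 hc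
      hO hxO h0
  choose γ hγ0 hγ using hex
  have hagree : ∀ m n : ℕ, m ≤ n → EqOn (γ m) (γ n) (Icc 0 (m : ℝ)) := fun m n hmn =>
    (hγ m).eqOn hV hVint hexp (hpT m) (hCE m).testContinuousOn
      ((hγ n).mono (Icc_subset_Icc_right (by exact_mod_cast hmn))) ((hγ0 m).trans (hγ0 n).symm)
  have heq : ∀ n : ℕ, EqOn (fun t => γ ⌈t⌉₊ t) (γ n) (Icc 0 (n : ℝ)) := fun n t ht =>
    hagree ⌈t⌉₊ n (Nat.ceil_le.2 ht.2) ⟨ht.1, Nat.le_ceil t⟩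
  refine ⟨fun t => γ ⌈t⌉₊ t, ?_, fun t ht => ?_⟩
  · simpa using hγ0 0
  · have ht0 : (0 : ℝ) ≤ t := ht
    set n := ⌈t⌉₊ + 1 with hn
    have htn : t < n := by rw [hn]; push_cast; linarith [Nat.le_ceil t]
    have htI : t ∈ Icc 0 (n : ℝ) := ⟨ht0, htn.le⟩
    have e := heq n htI
    simp only at e ⊢
    rw [e]
    have h1 : HasDerivWithinAt (fun s => (γ n s).1)
        (-tangentMap (γ n t).1 (velocity V (μ t) (γ n t))) (Ici 0) t := by
      refine (hγ n t htI).mono_of_mem_nhdsWithin ?_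
      rw [← Ici_inter_Iic]
      exact inter_mem self_mem_nhdsWithin (mem_nhdsWithin_of_mem_nhds (Iic_mem_nhds htn))
    refine h1.congr_of_eventuallyEq ?_ (congrArg Subtype.val e)
    filter_upwards [self_mem_nhdsWithin, mem_nhdsWithin_of_mem_nhds (Iic_mem_nhds htn)] with s h2 h3
    exact congrArg Subtype.val (heq n ⟨h2, h3⟩)

end Characteristics

/-! ### Finite mixtures -/

section FiniteMixtures

lemma integrable_exp_neg_mul_one {c : ℝ} (hc : 0 < c) :
    Integrable fun x : EuclideanSpace ℝ (Fin d) => Real.exp (-(c * ‖x‖ ^ 2)) * 1 := by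
  simpa using integrable_exp_neg_mul_sq hc

/-- Quadratic growth of the first and second derivatives makes them integrable with respect to all
Gaussians. -/
lemma hasGaussianDerivatives_of_bound {f : EuclideanSpace ℝ (Fin d) → ℝ} (hf : ContDiff ℝ 2 f)
    {C : ℝ} (h1 : ∀ x i, |fderiv ℝ f x (EuclideanSpace.single i 1)| ≤ C * (1 + ‖x‖ ^ 2))
    (h2 : ∀ x i j, |hessian f x i j| ≤ C * (1 + ‖x‖ ^ 2)) : HasGaussianDerivatives f := by
  have key : ∀ (θ : BW d) {g : EuclideanSpace ℝ (Fin d) → ℝ}, Continuous g →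
      (∀ x, |g x| ≤ C * (1 + ‖x‖ ^ 2)) → Integrable g (gaussian θ) := fun θ g hg hb => by
    rw [integrable_gaussian_iff]
    refine (integrable_mul_quadratic_mul_gaussianDensity (f := fun _ => 1)
      (fun c hc => integrable_exp_neg_mul_one hc) θ hg hb).congr (ae_of_all _ fun x => ?_)
    simp only [smul_eq_mul, one_mul]
    exact mul_comm _ _
  have hd : ContDiff ℝ 1 (fderiv ℝ f) := hf.fderiv_right (by norm_num)
  refine ⟨hf, fun θ => ?_, fun θ i j => ?_⟩
  · refine Integrable.of_eval_piLp fun i => ?_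
    simp only [gradient_apply]
    exact key θ (hd.continuous.clm_apply continuous_const) fun x => h1 x i
  · refine key θ ?_ fun x => h2 x i j
    simp only [hessian_apply]
    exact ((hd.continuous_fderiv (by norm_num)).clm_apply continuous_const).clm_apply
      continuous_const

lemma contDiff_gaussianDensity (θ : BW d) : ContDiff ℝ ∞ (gaussianDensity θ) := by
  have e : gaussianDensity θ = fun x => (√((2 * Real.pi) ^ d * (cov θ).det))⁻¹ *
      Real.exp (-(1 / 2) * ∑ i, (x i - mean θ i) * ∑ j, (cov θ)⁻¹ i j * (x j - mean θ j)) := rfl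
  rw [e]
  fun_prop

variable {N : ℕ} {w : Fin N → ℝ≥0} {θ : Fin N → BW d}

lemma isProbabilityMeasure_finiteMixing (hw1 : ∑ i, w i = 1) (θ : Fin N → BW d) :
    IsProbabilityMeasure (finiteMixing w θ) := by
  refine ⟨?_⟩
  simp only [finiteMixing, Measure.coe_finsetSum, Finset.sum_apply, Measure.smul_apply,
    measure_univ, ENNReal.smul_def, smul_eq_mul, mul_one]
  exact_mod_cast hw1

lemma integrable_finiteMixing {F : Type*} [NormedAddCommGroup F] (f : BW d → F) :
    Integrable f (finiteMixing w θ) :=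
  integrable_finsetSum_measure.2 fun _ _ => (integrable_dirac (by simp)).smul_measure_nnreal

lemma integral_finiteMixing (f : BW d → ℝ) :
    ∫ η, f η ∂(finiteMixing w θ) = ∑ i, (w i : ℝ) * f (θ i) := by
  rw [finiteMixing, integral_finsetSum_measure
    fun _ _ => (integrable_dirac (by simp)).smul_measure_nnreal]
  simp only [integral_smul_nnreal_measure, integral_dirac]
  rfl

lemma mixtureDensity_finiteMixing (x : EuclideanSpace ℝ (Fin d)) :
    mixtureDensity (finiteMixing w θ) x = ∑ i, (w i : ℝ) * gaussianDensity (θ i) x :=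
  integral_finiteMixing _

lemma isP2_finiteMixing (hw1 : ∑ i, w i = 1) (θ : Fin N → BW d) : IsP2 (finiteMixing w θ) := by
  refine ⟨isProbabilityMeasure_finiteMixing hw1 θ, ⟨(0, 1), Matrix.PosDef.one⟩, ?_⟩
  rw [finiteMixing, lintegral_finsetSum_measure]
  refine ENNReal.sum_lt_top.2 fun i _ => ?_
  rw [lintegral_smul_measure, lintegral_dirac]
  exact ENNReal.mul_lt_top ENNReal.coe_lt_top ENNReal.ofReal_lt_top

/-- The log-density of a finite Gaussian mixture is smooth, and its first and second derivatives
have at most quadratic growth: they are averages over the components of polynomials in the scores,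
weighted by the posterior probabilities of the components. -/
lemma isRegularMixing_finiteMixing (hw1 : ∑ i, w i = 1) (θ : Fin N → BW d) :
    IsRegularMixing (finiteMixing w θ) := by
  have hprob := isProbabilityMeasure_finiteMixing hw1 θ
  refine ⟨fun x => integrable_finiteMixing _, ?_⟩
  set p : EuclideanSpace ℝ (Fin d) → ℝ := mixtureDensity (finiteMixing w θ) with hp
  have hpe : p = fun x => ∑ k, (w k : ℝ) * gaussianDensity (θ k) x :=
    funext fun x => mixtureDensity_finiteMixing x
  have hpos : ∀ x, 0 < p x := fun x => mixtureDensity_pos (integrable_finiteMixing _)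
  have hps : ContDiff ℝ ∞ p := by
    rw [hpe]
    exact ContDiff.sum fun k _ => contDiff_const.mul (contDiff_gaussianDensity (θ k))
  set f : EuclideanSpace ℝ (Fin d) → ℝ := fun x => Real.log (p x) with hf
  have hfs : ContDiff ℝ ∞ f := hps.log fun x => (hpos x).ne'
  set e : Fin d → EuclideanSpace ℝ (Fin d) := fun i => EuclideanSpace.single i 1 with he
  set S : Fin d → EuclideanSpace ℝ (Fin d) → ℝ := fun i x =>
    ∑ k, (w k : ℝ) * (score (θ k) x i * gaussianDensity (θ k) x) with hS
  set Q : Fin d → Fin d → EuclideanSpace ℝ (Fin d) → ℝ := fun i j x =>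
    ∑ k, (w k : ℝ) * (((cov (θ k))⁻¹ i j - score (θ k) x i * score (θ k) x j)
      * gaussianDensity (θ k) x) with hQ
  have dk : ∀ k i x, HasLineDerivAt ℝ (gaussianDensity (θ k))
      (-(score (θ k) x i * gaussianDensity (θ k) x)) x (e i) := fun k i x => by
    have := hasLineDerivAt_gaussianDensity (θ k) x (e i)
    rwa [he, inner_single] at this
  have dp : ∀ i x, HasLineDerivAt ℝ p (-S i x) x (e i) := fun i x => by
    have h : HasDerivAt (fun t : ℝ => ∑ k, (w k : ℝ) * gaussianDensity (θ k) (x + t • e i))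
        (∑ k, (w k : ℝ) * -(score (θ k) x i * gaussianDensity (θ k) x)) 0 :=
      HasDerivAt.fun_sum fun k _ => HasDerivAt.const_mul _ (dk k i x)
    rw [hpe]
    refine h.congr_deriv ?_
    simp [hS]
  have dS : ∀ i j x, HasLineDerivAt ℝ (S i) (Q i j x) x (e j) := fun i j x => by
    refine HasDerivAt.fun_sum fun k _ => HasDerivAt.const_mul _ ?_
    have h3 := HasDerivAt.mul (hasLineDerivAt_score (θ k) x i j) (dk k j x)
    refine h3.congr_deriv ?_
    simp only [zero_smul, add_zero]
    ring
  have e1 : ∀ i x, fderiv ℝ f x (e i) = -S i x / p x := fun i x => by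
    have h1 : HasDerivAt (fun t : ℝ => Real.log (p (x + t • e i))) (-S i x / p (x + (0 : ℝ) • e i))
      0 := HasDerivAt.log (dp i x) (hpos _).ne'
    have h2 : HasDerivAt (fun t : ℝ => Real.log (p (x + t • e i))) (fderiv ℝ f x (e i)) 0 :=
      ((hfs.differentiable (by norm_num)) x).hasFDerivAt.hasLineDerivAt (e i)
    rw [h2.unique h1, zero_smul, add_zero]
  have e2 : ∀ i j x, hessian f x i j = -(Q j i x * p x + S j x * S i x) / p x ^ 2 :=
    fun i j x => by
    have h1 : HasDerivAt (fun t : ℝ => fderiv ℝ f (x + t • e i) (e j)) (hessian f x i j) 0 := by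
      have h3 := (((hfs.fderiv_right (m := 1) (by norm_cast)).differentiable
        (by norm_num) x).hasFDerivAt.clm_apply (hasFDerivAt_const (e j) x)).hasLineDerivAt (e i)
      rw [hessian_apply]
      simpa [HasLineDerivAt] using h3
    simp only [e1] at h1
    have h2 : HasDerivAt (fun t : ℝ => -S j (x + t • e i) / p (x + t • e i))
        ((-Q j i x * p (x + (0 : ℝ) • e i) - -S j (x + (0 : ℝ) • e i) * -S i x)
          / p (x + (0 : ℝ) • e i) ^ 2) 0 :=
      HasDerivAt.div (HasDerivAt.neg (dS j i x)) (dp i x) (hpos _).ne'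
    rw [h1.unique h2]
    simp only [zero_smul, add_zero]
    ring
  -- The scores grow at most linearly, uniformly in the components, so weighted averages of the
  -- scores and of their products grow at most linearly and quadratically.
  choose B hB0 hB using fun k => exists_abs_score_le (θ k)
  set b := ∑ k, B k with hb
  have hb0 : 0 ≤ b := Finset.sum_nonneg fun k _ => hB0 k
  have hsb : ∀ k x i, |score (θ k) x i| ≤ b * (1 + ‖x‖) := fun k x i =>
    (hB k x i).trans (mul_le_mul_of_nonneg_right
      (Finset.single_le_sum (fun k _ => hB0 k) (Finset.mem_univ k)) (by positivity))
  set a := ∑ k, ∑ i, ∑ j, |(cov (θ k))⁻¹ i j| with ha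
  have ha0 : 0 ≤ a := by positivity
  have hab : ∀ k i j, |(cov (θ k))⁻¹ i j| ≤ a := fun k i j => by
    refine (Finset.single_le_sum (f := fun j => |(cov (θ k))⁻¹ i j|) (fun j _ => abs_nonneg _)
      (Finset.mem_univ j)).trans ?_
    refine (Finset.single_le_sum (f := fun i => ∑ j, |(cov (θ k))⁻¹ i j|)
      (fun i _ => by positivity) (Finset.mem_univ i)).trans ?_
    exact Finset.single_le_sum (f := fun k => ∑ i, ∑ j, |(cov (θ k))⁻¹ i j|)
      (fun k _ => by positivity) (Finset.mem_univ k)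
  have hsum : ∀ (g : Fin N → EuclideanSpace ℝ (Fin d) → ℝ) (x : EuclideanSpace ℝ (Fin d)) (D : ℝ),
      (∀ k, |g k x| ≤ D) → |∑ k, (w k : ℝ) * (g k x * gaussianDensity (θ k) x)| ≤ D * p x := by
    intro g x D hg
    rw [hpe, Finset.mul_sum]
    refine (Finset.abs_sum_le_sum_abs _ _).trans (Finset.sum_le_sum fun k _ => ?_)
    rw [abs_mul, abs_mul, abs_of_pos (gaussianDensity_pos (θ k) x), NNReal.abs_eq]
    calc (w k : ℝ) * (|g k x| * gaussianDensity (θ k) x)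
        ≤ (w k : ℝ) * (D * gaussianDensity (θ k) x) := by
          gcongr
          · exact (gaussianDensity_pos (θ k) x).le
          · exact hg k
      _ = _ := by ring
  have hSb : ∀ i x, |S i x| ≤ b * (1 + ‖x‖) * p x := fun i x =>
    hsum (fun k x => score (θ k) x i) x _ fun k => hsb k x i
  have quad : ∀ x : EuclideanSpace ℝ (Fin d), (1 + ‖x‖) ^ 2 ≤ 2 * (1 + ‖x‖ ^ 2) := fun x => by
    nlinarith [sq_nonneg (1 - ‖x‖)]
  have hQb : ∀ i j x, |Q i j x| ≤ (a + b ^ 2 * (2 * (1 + ‖x‖ ^ 2))) * p x := fun i j x =>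
    hsum (fun k x => (cov (θ k))⁻¹ i j - score (θ k) x i * score (θ k) x j) x _ fun k => by
      refine (abs_sub _ _).trans (add_le_add (hab k i j) ?_)
      rw [abs_mul]
      calc |score (θ k) x i| * |score (θ k) x j| ≤ (b * (1 + ‖x‖)) * (b * (1 + ‖x‖)) :=
            mul_le_mul (hsb k x i) (hsb k x j) (abs_nonneg _) (by positivity)
        _ = b ^ 2 * (1 + ‖x‖) ^ 2 := by ring
        _ ≤ _ := mul_le_mul_of_nonneg_left (quad x) (by positivity)
  have hone : ∀ x : EuclideanSpace ℝ (Fin d), 1 ≤ 1 + ‖x‖ ^ 2 := fun x => by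
    nlinarith [sq_nonneg ‖x‖]
  refine hasGaussianDerivatives_of_bound (C := 2 * b + a + 4 * b ^ 2)
    (hfs.of_le (by norm_cast)) (fun x i => ?_) fun x i j => ?_
  · change |fderiv ℝ f x (e i)| ≤ _
    rw [e1, abs_div, abs_neg, abs_of_pos (hpos x), div_le_iff₀ (hpos x)]
    refine (hSb i x).trans (mul_le_mul_of_nonneg_right ?_ (hpos x).le)
    have h5 : 1 + ‖x‖ ≤ 2 * (1 + ‖x‖ ^ 2) := by nlinarith [sq_nonneg (1 - ‖x‖)]
    have h6 := mul_le_mul_of_nonneg_left h5 hb0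
    have h7 : 0 ≤ (a + 4 * b ^ 2) * (1 + ‖x‖ ^ 2) := by positivity
    linarith
  · rw [e2, abs_div, abs_neg, abs_of_pos (pow_pos (hpos x) 2), div_le_iff₀ (pow_pos (hpos x) 2)]
    have h5 : |Q j i x * p x| ≤ (a + b ^ 2 * (2 * (1 + ‖x‖ ^ 2))) * p x * p x := by
      rw [abs_mul, abs_of_pos (hpos x)]
      exact mul_le_mul_of_nonneg_right (hQb j i x) (hpos x).le
    have h6 : |S j x * S i x| ≤ b ^ 2 * (2 * (1 + ‖x‖ ^ 2)) * p x ^ 2 := by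
      rw [abs_mul]
      calc |S j x| * |S i x| ≤ (b * (1 + ‖x‖) * p x) * (b * (1 + ‖x‖) * p x) :=
            mul_le_mul (hSb j x) (hSb i x) (abs_nonneg _) (by have := hpos x; positivity)
        _ = b ^ 2 * (1 + ‖x‖) ^ 2 * p x ^ 2 := by ring
        _ ≤ _ := by gcongr; exact quad x
    have h7 : a ≤ a * (1 + ‖x‖ ^ 2) := le_mul_of_one_le_right ha0 (hone x)
    calc |Q j i x * p x + S j x * S i x|
        ≤ (a + b ^ 2 * (2 * (1 + ‖x‖ ^ 2))) * p x * p x + b ^ 2 * (2 * (1 + ‖x‖ ^ 2)) * p x ^ 2 :=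
          (abs_add_le _ _).trans (add_le_add h5 h6)
      _ = (a + 4 * b ^ 2 * (1 + ‖x‖ ^ 2)) * p x ^ 2 := by ring
      _ ≤ _ := by
          refine mul_le_mul_of_nonneg_right ?_ (sq_nonneg _)
          have h8 : 0 ≤ b * (1 + ‖x‖ ^ 2) := by positivity
          linarith

variable {V : EuclideanSpace ℝ (Fin d) → ℝ}

lemma klFunctional_finiteMixing_ne_top (hV : Continuous V)
    (hVint : ∀ θ : BW d, Integrable V (gaussian θ))
    (hexp : Integrable (fun x => Real.exp (-V x)) volume) (hw1 : ∑ i, w i = 1)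
    (θ : Fin N → BW d) : klFunctional V (finiteMixing w θ) ≠ ⊤ := by
  have hprob := isProbabilityMeasure_finiteMixing hw1 θ
  rw [klFunctional_ne_top_iff hV hexp]
  have h1 : Integrable fun x => mixtureDensity (finiteMixing w θ) x
      * logRatio V (finiteMixing w θ) x := by
    simp only [mixtureDensity_finiteMixing, Finset.sum_mul]
    refine integrable_finsetSum _ fun k _ => ?_
    refine ((integrable_mul_quadratic_mul_gaussianDensity (f := logRatio V (finiteMixing w θ))
      (fun c hc => integrable_exp_mul_logRatio hV hVint hexp _ hc) (θ k) (g := fun _ => 1)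
      (B := 1) continuous_const fun x => ?_).const_mul (w k : ℝ)).congr (ae_of_all _ fun x => ?_)
    · rw [abs_one]; nlinarith [sq_nonneg ‖x‖]
    · simp only [one_mul]; ring
  refine ((h1.add (integrable_targetDensity hexp)).sub
    (integrable_mixtureDensity (finiteMixing w θ))).congr
    (ae_of_all _ fun x => ?_)
  rw [klIntegrand_eq hexp]
  rfl

lemma finiteEnergyField_finiteMixing {u : BW d → Ambient d} (hu : IsVectorField u)
    (hum : AEMeasurable u (finiteMixing w θ)) : FiniteEnergyField (finiteMixing w θ) u :=
  ⟨hu, hum, integrable_finiteMixing _⟩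

lemma aemeasurable_finiteMixing {F : Type*} [MeasurableSpace F] (u : BW d → F) :
    AEMeasurable u (finiteMixing w θ) := by
  rw [finiteMixing, ← Measure.sum_fintype, aemeasurable_sum_measure_iff]
  exact fun i => aemeasurable_dirac.mono_ac
    (Measure.smul_absolutelyContinuous (c := w i))

end FiniteMixtures

/-! ### Particles and the gradient flow -/

section Particles

variable {V : EuclideanSpace ℝ (Fin d) → ℝ} {μ : ℝ → Measure (BW d)}

lemma measurable_velocity (hV : Continuous V) (ν : Measure (BW d)) [SFinite ν] :
    Measurable (velocity V ν) := by
  have h : Continuous fun p : BW d × EuclideanSpace ℝ (Fin d) => kernelDeriv p.1.1 p.2 :=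
    continuousOn_kernelDeriv.comp_continuous
      (f := fun p : BW d × EuclideanSpace ℝ (Fin d) => (p.1.1, p.2)) (by fun_prop)
      fun p => p.1.2.det_pos
  have h1 : StronglyMeasurable fun p : BW d × EuclideanSpace ℝ (Fin d) =>
      logRatio V ν p.2 • kernelDeriv p.1.1 p.2 :=
    ((measurable_logRatio hV ν).comp measurable_snd).stronglyMeasurable.smul h.stronglyMeasurable
  have h2 : StronglyMeasurable fun θ : BW d => firstVariationDeriv V ν θ.1 :=
    h1.integral_prod_right' (ν := volume)
  exact (gradOf.continuous.comp_stronglyMeasurable h2).measurable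

/-- With the velocity identified with the Gaussian expectations of the gradient and the Hessian of
the log-ratio, the particle equations are the characteristic equations. -/
lemma solvesParticleODE_iff
    (hv : ∀ t, 0 ≤ t → ∀ θ, velocity V (μ t) θ = (expectedGrad V (μ t) θ, expectedHess V (μ t) θ))
    {γ : ℝ → BW d} : SolvesParticleODE V μ γ ↔ IsCharacteristic V μ (Ici 0) γ := by
  have e : ∀ t, 0 ≤ t → -tangentMap (γ t).1 (velocity V (μ t) (γ t))
      = (-expectedGrad V (μ t) (γ t),
        -(expectedHess V (μ t) (γ t) * cov (γ t)) - cov (γ t) * expectedHess V (μ t) (γ t)) :=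
    fun t ht => by
      rw [hv t ht, tangentMap]
      exact Prod.ext rfl (neg_add' _ _)
  constructor
  · intro h t ht
    rw [e t ht]
    exact (h t ht).1.prodMk (h t ht).2
  · intro h t ht
    have h1 := h t ht
    rw [e t ht] at h1
    exact ⟨(ContinuousLinearMap.fst ℝ (EuclideanSpace ℝ (Fin d))
        (Matrix (Fin d) (Fin d) ℝ)).hasFDerivAt.comp_hasDerivWithinAt t h1,
      (ContinuousLinearMap.snd ℝ (EuclideanSpace ℝ (Fin d))
        (Matrix (Fin d) (Fin d) ℝ)).hasFDerivAt.comp_hasDerivWithinAt t h1⟩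

/-- The laws of random characteristics depend continuously on time when tested against smooth
compactly supported functions. -/
lemma testContinuousOn_of_isCharacteristic {Ω : Type*} [MeasurableSpace Ω] {P : Measure Ω}
    [IsFiniteMeasure P] {θ : ℝ → Ω → BW d} (hθ : ∀ t, 0 ≤ t → AEMeasurable (θ t) P)
    (hlaw : ∀ t, 0 ≤ t → P.map (θ t) = μ t)
    (hc : ∀ᵐ z ∂P, IsCharacteristic V μ (Ici 0) fun t => θ t z) :
    TestContinuousOn (Ici 0) μ := by
  intro φ hφ t ht
  have hφc : Continuous fun θ : BW d => φ θ.1 := hφ.continuous.comp continuous_subtype_val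
  have e : ∀ s ∈ Ici (0 : ℝ), ∫ η, φ η.1 ∂(μ s) = ∫ z, φ (θ s z).1 ∂P := fun s hs => by
    rw [← hlaw s hs]
    exact integral_map (hθ s hs) hφc.aestronglyMeasurable
  obtain ⟨C, hC⟩ := hφ.exists_bound
  have h1 : ContinuousWithinAt (fun s => ∫ z, φ (θ s z).1 ∂P) (Ici 0) t := by
    refine tendsto_integral_filter_of_dominated_convergence (fun _ => C) ?_ ?_
      (integrable_const C) ?_
    · filter_upwards [self_mem_nhdsWithin] with s hs
      exact (hφc.measurable.comp_aemeasurable (hθ s hs)).aestronglyMeasurable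
    · exact Eventually.of_forall fun s => ae_of_all _ fun z => hC _
    · filter_upwards [hc] with z hz
      exact (hφc.tendsto _).comp (hz.continuousOn t ht)
  exact h1.congr e (e t ht)

theorem isGradientFlow_of_isCharacteristic (hV : Continuous V)
    (hVint : ∀ θ : BW d, Integrable V (gaussian θ))
    (hexp : Integrable (fun x => Real.exp (-V x)) volume)
    (hP2 : ∀ t, 0 ≤ t → IsP2 (μ t)) (hF : ∀ t, 0 ≤ t → klFunctional V (μ t) ≠ ⊤)
    (hE : ∀ t, 0 ≤ t → FiniteEnergyField (μ t) (velocity V (μ t)))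
    {Ω : Type*} [MeasurableSpace Ω] {P : Measure Ω} [IsFiniteMeasure P] {θ : ℝ → Ω → BW d}
    (hθ : ∀ t, 0 ≤ t → AEMeasurable (θ t) P) (hlaw : ∀ t, 0 ≤ t → P.map (θ t) = μ t)
    (hc : ∀ᵐ z ∂P, IsCharacteristic V μ (Ici 0) fun t => θ t z) :
    IsGradientFlow (klFunctional V) μ := by
  refine isGradientFlow_of_continuityEquation hV hVint hexp hP2 hF hE fun φ hφ t ht => ?_
  have h := continuityEquation_map hV hVint hexp (testContinuousOn_of_isCharacteristic hθ hlaw hc)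
    (fun t ht => (hP2 t ht).1) hθ hc φ hφ t ht
  have e : ∀ s ∈ Ici (0 : ℝ), ∫ η, φ η.1 ∂(μ s) = ∫ η, φ η.1 ∂(P.map (θ s)) := fun s hs => by
    rw [hlaw s hs]
  have h2 := h.2.congr e (e t ht)
  have h1 := h.1
  simp only [hlaw t ht] at h1 h2
  exact ⟨h1, h2⟩

end Particles

section FiniteParticles

variable {V : EuclideanSpace ℝ (Fin d) → ℝ} {μ : ℝ → Measure (BW d)} {N : ℕ} {w : Fin N → ℝ≥0}

/-- The random index that selects the component `i` with probability `wᵢ`. -/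
def weightMeasure (w : Fin N → ℝ≥0) : Measure (Fin N) := ∑ i, w i • Measure.dirac i

lemma isProbabilityMeasure_weightMeasure (hw1 : ∑ i, w i = 1) :
    IsProbabilityMeasure (weightMeasure w) := by
  refine ⟨?_⟩
  rw [weightMeasure, Measure.finsetSum_apply]
  simp only [Measure.smul_apply, Measure.dirac_apply_of_mem (mem_univ _)]
  simp only [ENNReal.smul_def, smul_eq_mul, mul_one]
  exact_mod_cast congrArg ((↑) : ℝ≥0 → ℝ≥0∞) hw1

lemma map_weightMeasure (γ : Fin N → BW d) : (weightMeasure w).map γ = finiteMixing w γ := by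
  refine Measure.ext fun s hs => ?_
  rw [Measure.map_apply (measurable_of_finite γ) hs, weightMeasure, finiteMixing,
    Measure.finsetSum_apply, Measure.finsetSum_apply]
  refine Finset.sum_congr rfl fun i _ => ?_
  rw [Measure.smul_apply, Measure.smul_apply,
    Measure.dirac_apply' _ (measurable_of_finite γ hs), Measure.dirac_apply' _ hs]
  rfl

/-- Near one of its atoms, a finitely supported measure is a multiple of a Dirac measure. The points
`θ j` may coincide, and then their weights add up. -/
lemma exists_restrict_finiteMixing (hw : ∀ i, 0 < w i) (hw1 : ∑ i, w i = 1) (θ : Fin N → BW d)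
    (i : Fin N) : ∃ (c : ℝ≥0) (O : Set (BW d)), 0 < c ∧ c ≤ 1 ∧ IsOpen O ∧ θ i ∈ O ∧
      (finiteMixing w θ).restrict O = (c • Measure.dirac (θ i)).restrict O := by
  classical
  set J : Finset (Fin N) := Finset.univ.filter fun j => θ j = θ i with hJ
  refine ⟨∑ j ∈ J, w j, (θ '' {j | θ j ≠ θ i})ᶜ, ?_, ?_, ?_, ?_, ?_⟩
  · exact Finset.sum_pos (fun j _ => hw j) ⟨i, by simp [hJ]⟩
  · rw [← hw1]
    exact Finset.sum_le_sum_of_subset (Finset.subset_univ J)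
  · exact ((toFinite _).image θ).isClosed.isOpen_compl
  · rintro ⟨j, hj, hji⟩
    exact hj hji
  · set O : Set (BW d) := (θ '' {j | θ j ≠ θ i})ᶜ with hO
    have hOm : MeasurableSet O := ((toFinite _).image θ).isClosed.isOpen_compl.measurableSet
    refine Measure.ext fun s hs => ?_
    rw [Measure.restrict_apply hs, Measure.restrict_apply hs, finiteMixing,
      Measure.finsetSum_apply, Measure.smul_apply, Finset.sum_smul, hJ, Finset.sum_filter]
    refine Finset.sum_congr rfl fun j _ => ?_
    rw [Measure.smul_apply]
    split_ifs with h
    · rw [h]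
    · have : θ j ∉ s ∩ O := fun h' => h'.2 ⟨j, h, rfl⟩
      rw [Measure.dirac_apply' _ (hs.inter hOm), indicator_of_notMem this, smul_zero]

/-- A gradient flow that starts at a finitely supported measure is carried by finitely many
particles: the characteristics through the atoms exist for all times, and they transport the initial
measure. -/
lemma exists_particles_of_isGradientFlow (hV : HasGaussianDerivatives V)
    (hVint : ∀ θ : BW d, Integrable V (gaussian θ))
    (hexp : Integrable (fun x => Real.exp (-V x)) volume) (hw : ∀ i, 0 < w i)
    (hw1 : ∑ i, w i = 1) {θ₀ : Fin N → BW d} (h0 : μ 0 = finiteMixing w θ₀)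
    (h : IsGradientFlow (klFunctional V) μ) :
    ∃ θ : Fin N → ℝ → BW d, (∀ i, θ i 0 = θ₀ i) ∧
      (∀ t, 0 ≤ t → μ t = finiteMixing w fun i => θ i t) ∧ ∀ i, SolvesParticleODE V μ (θ i) := by
  have hVc := hV.contDiff.continuous
  have hp : ∀ t ∈ Ici (0 : ℝ), IsProbabilityMeasure (μ t) := fun t ht => (h.1 t ht).1
  have hCE := h.continuityEquation hVc hVint hexp
  have hex : ∀ i, ∃ γ : ℝ → BW d, γ 0 = θ₀ i ∧ IsCharacteristic V μ (Ici 0) γ := fun i => by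
    obtain ⟨c, O, hc0, hc1, hO, hiO, hr⟩ := exists_restrict_finiteMixing hw hw1 θ₀ i
    rw [← h0] at hr
    exact exists_isCharacteristic hVc hVint hexp hp hCE hc0 hc1 hO hiO hr
  choose θ hθ0 hθ using hex
  have hP := isProbabilityMeasure_weightMeasure hw1
  have hμ : ∀ t, 0 ≤ t → μ t = finiteMixing w fun i => θ i t := fun t ht => by
    rw [← map_weightMeasure]
    refine (map_eq_of_isCharacteristic hVc hVint hexp hp hCE (θ := fun t i => θ i t)
      (fun t _ => (measurable_of_finite _).aemeasurable) ?_ (ae_of_all _ hθ) ht).symm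
    rw [map_weightMeasure, h0]
    simp only [hθ0]
  refine ⟨θ, hθ0, hμ, fun i => (solvesParticleODE_iff fun t ht η => ?_).2 (hθ i)⟩
  have := hp t ht
  refine velocity_eq hV hVint hexp ?_ η
  rw [hμ t ht]
  exact isRegularMixing_finiteMixing hw1 _

/-- The empirical measures of interacting particles form a gradient flow; finite mixtures satisfy
all of the regularity and finiteness conditions. -/
lemma isGradientFlow_of_particles (hV : HasGaussianDerivatives V)
    (hVint : ∀ θ : BW d, Integrable V (gaussian θ))
    (hexp : Integrable (fun x => Real.exp (-V x)) volume) (hw1 : ∑ i, w i = 1)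
    {θ : Fin N → ℝ → BW d} (hμ : ∀ t, 0 ≤ t → μ t = finiteMixing w fun i => θ i t)
    (hθ : ∀ i, SolvesParticleODE V μ (θ i)) : IsGradientFlow (klFunctional V) μ := by
  have hVc := hV.contDiff.continuous
  have hP := isProbabilityMeasure_weightMeasure hw1
  have hP2 : ∀ t, 0 ≤ t → IsP2 (μ t) := fun t ht => by
    rw [hμ t ht]
    exact isP2_finiteMixing hw1 _
  have hv : ∀ t, 0 ≤ t → ∀ η, velocity V (μ t) η
      = (expectedGrad V (μ t) η, expectedHess V (μ t) η) := fun t ht η => by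
    have := (hP2 t ht).1
    refine velocity_eq hV hVint hexp ?_ η
    rw [hμ t ht]
    exact isRegularMixing_finiteMixing hw1 _
  refine isGradientFlow_of_isCharacteristic (P := weightMeasure w) (θ := fun t i => θ i t) hVc hVint
    hexp hP2 (fun t ht => ?_) (fun t ht => ?_)
    (fun t _ => (measurable_of_finite _).aemeasurable)
    (fun t ht => by rw [map_weightMeasure, hμ t ht])
    (ae_of_all _ fun i => (solvesParticleODE_iff hv).1 (hθ i))
  · rw [hμ t ht]
    exact klFunctional_finiteMixing_ne_top hVc hVint hexp hw1 _
  · rw [hμ t ht]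
    exact finiteEnergyField_finiteMixing (velocity_isSymm _) (aemeasurable_finiteMixing _)

end FiniteParticles

end GaussianMixtureFlow

end

theorem theorem3 (d : ℕ) (V : EuclideanSpace ℝ (Fin d) → ℝ)
    (hV : HasGaussianDerivatives V)
    (hVint : ∀ θ : BW d, Integrable V (gaussian θ))
    (hexp : Integrable (fun x => Real.exp (-V x)) volume) :
    -- the gradient flow is carried by Gaussian particles
    (∀ (μ : ℝ → Measure (BW d)),
      IsGradientFlow (klFunctional V) μ →
      (∀ t, 0 ≤ t → IsRegularMixing (μ t)) →
      ∀ (Ω : Type*) (_ : MeasurableSpace Ω) (P : Measure Ω) (_ : IsProbabilityMeasure P)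
        (θ : ℝ → Ω → BW d),
        (∀ t, 0 ≤ t → AEMeasurable (θ t) P) →
        HasLaw (θ 0) (μ 0) P →
        (∀ᵐ z ∂P, SolvesParticleODE V μ (fun t => θ t z)) →
        ∀ t, 0 ≤ t → HasLaw (θ t) (μ t) P) ∧
    -- conversely, the laws of such Gaussian particles form a gradient flow
    (∀ (μ : ℝ → Measure (BW d)),
      (∀ t, 0 ≤ t → IsP2 (μ t) ∧ IsRegularMixing (μ t) ∧
        klFunctional V (μ t) ≠ ⊤ ∧
        HasFiniteEnergy V (μ t)) →
      ∀ (Ω : Type*) (_ : MeasurableSpace Ω) (P : Measure Ω) (_ : IsProbabilityMeasure P)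
        (θ : ℝ → Ω → BW d),
        (∀ t, 0 ≤ t → HasLaw (θ t) (μ t) P) →
        (∀ᵐ z ∂P, SolvesParticleODE V μ (fun t => θ t z)) →
        IsGradientFlow (klFunctional V) μ) ∧
    -- finitely supported initial data: the interacting particle system
    (∀ (N : ℕ) (w : Fin N → ℝ≥0), (∀ i, 0 < w i) → ∑ i, w i = 1 →
      ∀ (θ₀ : Fin N → BW d) (μ : ℝ → Measure (BW d)),
        μ 0 = finiteMixing w θ₀ →
        (IsGradientFlow (klFunctional V) μ ↔
          ∃ θ : Fin N → ℝ → BW d,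
            (∀ i, θ i 0 = θ₀ i) ∧
            (∀ t, 0 ≤ t → μ t = finiteMixing w (fun i => θ i t)) ∧
            ∀ i, SolvesParticleODE V μ (θ i))) := by
  have hVc := hV.contDiff.continuous
  refine ⟨?_, ?_, ?_⟩
  · intro μ hμ hreg Ω _ P _ θ hθ h0 hode t ht
    have hp : ∀ t ∈ Ici (0 : ℝ), IsProbabilityMeasure (μ t) := fun t ht => (hμ.1 t ht).1
    refine ⟨hθ t ht, map_eq_of_isCharacteristic hVc hVint hexp hp
      (hμ.continuityEquation hVc hVint hexp) hθ h0.map_eq ?_ ht⟩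
    filter_upwards [hode] with z hz
    refine (solvesParticleODE_iff fun t ht η => ?_).1 hz
    have := hp t ht
    exact velocity_eq hV hVint hexp (hreg t ht) η
  · intro μ hμ Ω _ P _ θ hθ hode
    have hv : ∀ t, 0 ≤ t → ∀ η, velocity V (μ t) η
        = (expectedGrad V (μ t) η, expectedHess V (μ t) η) := fun t ht η => by
      have := (hμ t ht).1.1
      exact velocity_eq hV hVint hexp (hμ t ht).2.1 η
    refine isGradientFlow_of_isCharacteristic hVc hVint hexp (fun t ht => (hμ t ht).1)
      (fun t ht => (hμ t ht).2.2.1) (fun t ht => ?_) (fun t ht => (hθ t ht).aemeasurable)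
      (fun t ht => (hθ t ht).map_eq) ?_
    · have := (hμ t ht).1.1
      refine finiteEnergyField_of_lintegral (velocity_isSymm _)
        (measurable_velocity hVc (μ t)).aemeasurable ?_
      simp only [hv t ht]
      exact (hμ t ht).2.2.2
    · filter_upwards [hode] with z hz
      exact (solvesParticleODE_iff hv).1 hz
  · intro N w hw hw1 θ₀ μ h0
    refine ⟨exists_particles_of_isGradientFlow hV hVint hexp hw hw1 h0, ?_⟩
    rintro ⟨θ, -, hμ, hθ⟩
    exact isGradientFlow_of_particles hV hVint hexp hw1 hμ hθ
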